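/- **Setting.** Let $d\ge 1$, let $(\Omega,\mathcal F,P)$ be a separable probability space with expectation $\langle\cdot\rangle$, and let $(T_x)_{x\in\mathbb Z^d}$ be measurable, measure preserving maps of $\Omega$ with $T_0=\mathrm{Id}$, $T_{x+y}=T_xT_y$, which are ergodic (if $A\in\mathcal F$ and $T_xA=A$ for all $x$, then $P(A)\in\{0,1\}$). Let $b_1,\dots,b_k\in\mathbb Z^d\setminus\{0\}$ contain the standard basis $e_1,\dots,e_d$, and assume the discrete Korn inequality: there is $C>0$ with $\sum_{x\in\mathbb Z^d}|\nabla u(x)|^2\le C\sum_{x\in\mathbb Z^d}|\nabla_s u(x)|^2$ for all finitely supported $u:\mathbb Z^d\to\mathbb R^d$. Here, for $u:\varepsilon\mathbb Z^d\to\mathbb R^d$, $\nabla^\varepsilon_j u(x)=\frac{u(x+\varepsilon e_j)-u(x)}{\varepsilon}$ are the columns of $\nabla^\varepsilon u$, $(\nabla^\varepsilon_s u)_i(x)=\frac{b_i}{|b_i|}\cdot\frac{u(x+\varepsilon b_i)-u(x)}{\varepsilon|b_i|}$, and $\nabla=\nabla^1$, $\nabla_s=\nabla^1_s$. Let $B_i:\mathbb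 Z^d\to\mathbb R^d$ ($i=1,\dots,k$) be finitely supported with $\frac{u(x+b_i)-u(x)}{|b_i|}=\sum_{y}\nabla u(x-y)\cdot B_i(y)$ for all $u:\mathbb Z^d\to\mathbb R$ (such $B_i$ exist). For $F\in\mathbb R^{d\times d}$ set $(F_s)_i=\frac{b_i}{|b_i|}\cdot F\frac{b_i}{|b_i|}$, and for a random matrix field $\chi$ set $(\chi_s)_i(\omega,x)=\frac{b_i}{|b_i|}\cdot\sum_y\chi(T_{-y}\omega,x)B_i(y)$; write $\nabla_sU=(\nabla U)_s$. Let $O\subset\mathbb R^d$ be a bounded domain with Lipschitz boundary and $O^{+\varepsilon}=O\cup\{x:(x,x+\varepsilon b_i)\cap O\ne\emptyset\text{ for some }i\}$, where $(x,x+\varepsilon b_i)$ is the open segment. Let $A\in L^\infty(\Omega;\mathbb R^{2k\times 2k}_{\rm sym})$ satisfy, for some $C>0$, $A(\omega)F\cdot F\ge C|F|^2$ for a.e. $\omega$ and all $F$. Let $\rho:\Omega\times\mathbb R^k\to[0,\infty)$ be jointly measurable and, for a.e. $\omega$, convex with $\rho(\omega,\alpha F)=\alpha\rho(\omega,F)$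 for all $\alpha\ge0$ and all $F$. Let $T>0$ and $l\in C^1([0,T],L^2(O)^d)$. *Discrete system.* Let $m_\varepsilon=\varepsilon^d\sum_{x\in\varepsilon\mathbb Z^d}\delta_x$, let $\square=[-\frac12,\frac12)^d$, and let $\pi_\varepsilon f(x)$ be the mean over $x+\varepsilon\square$ of the extension of $f$ by $0$. The space $Y_\varepsilon$ consists of the $y=(u,z)$ with $u\in L^2(\Omega\times\varepsilon\mathbb Z^d)^d$ vanishing outside $O$ and $z\in L^2(\Omega\times\varepsilon\mathbb Z^d)^k$ vanishing outside $O^{+\varepsilon}$, with scalar product $\langle\int u_1\cdot u_2+\nabla^\varepsilon u_1:\nabla^\varepsilon u_2+z_1\cdot z_2\,dm_\varepsilon\rangle$. Set $$\mathcal E_\varepsilon(t,y)=\tfrac12\Big\langle\int_{O^{+\varepsilon}\cap\varepsilon\mathbb Z^d}A(T_{x/\varepsilon}\omega)\tbinom{\nabla^\varepsilon_su}{z}\cdot\tbinom{\nabla^\varepsilon_su}{z}\,dm_\varepsilon\Big\rangle-\Big\langle\int_{O\cap\varepsilon\mathbb Z^d}\pi_\varepsilon l(t)\cdot u\,dm_\varepsilon\Big\rangle,$$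 $$\Psi_\varepsilon(y)=\Big\langle\int_{O^{+\varepsilon}\cap\varepsilon\mathbb Z^d}\rho(T_{x/\varepsilon}\omega,z)\,dm_\varepsilon\Big\rangle\in[0,\infty].$$ *Continuum system.* Let $\mathbf L^2_{\rm pot}(\Omega)$ be the closure in $L^2(\Omega)^d$ of $\{D\varphi:\varphi\in L^2(\Omega)\}$, $D_j\varphi(\omega)=\varphi(T_{e_j}\omega)-\varphi(\omega)$, and let $\mathbf L^2_{\rm pot}(\Omega)\otimes L^2(O)$ be the closure in $L^2(\Omega\times O)^d$ of the linear span of the products $\psi(\omega)\eta(x)$, $\psi\in\mathbf L^2_{\rm pot}(\Omega)$, $\eta\in L^2(O)$. Let $Y=H^1_0(O)^d\times L^2(\Omega\times O)^k\times(\mathbf L^2_{\rm pot}(\Omega)\otimes L^2(O))^d$ with elements $y=(U,Z,\chi)$, and $$\mathcal E_0(t,y)=\tfrac12\int_O\Big\langle A\tbinom{\nabla_sU+\chi_s}{Z}\cdot\tbinom{\nabla_sU+\chi_s}{Z}\Big\rangle dx-\int_Ol(t)\cdot U\,dx,\qquad \Psi_0(y)=\int_O\langle\rho(\omega,Z(\omega,x))\rangle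 dx\in[0,\infty].$$ *Energetic solutions.* For either system, $y$ is stable at time $t$ if $\mathcal E(t,y)\le\mathcal E(t,\tilde y)+\Psi(\tilde y-y)$ for all states $\tilde y$; let $S_\varepsilon(t)$, $S(t)$ be the sets of stable states. An absolutely continuous curve $y$ on $[0,T]$ is an energetic solution if for all $t\in[0,T]$ the state $y(t)$ is stable at time $t$ and $$\mathcal E(t,y(t))+\int_0^t\Psi(\dot y(s))\,ds=\mathcal E(0,y(0))-\int_0^t\langle\dot l(s),y(s)\rangle\,ds,$$ where $\langle\dot l(s),y\rangle$ is the load term of the energy with $l(t)$ replaced by $\dot l(s)$. *Cross convergence.* For $u\in L^2(\Omega\times\varepsilon\mathbb Z^d)$ let $\mathcal T_\varepsilon u(\omega,x)=u(T_{-\lfloor x\rfloor_\varepsilon/\varepsilon}\,\omega,\lfloor x\rfloor_\varepsilon)$, where $\lfloor x\rfloor_\varepsilon\in\varepsilon\mathbb Z^d$ and $x-\lfloor x\rfloor_\varepsilon\in\varepsilon\square$. We write $y_\varepsilon\overset{c2}{\to}y$ if $\mathcal T_\varepsilon u_\varepsilon\to U$, $\mathcal T_\varepsilon\nabla^\varepsilon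 u_\varepsilon\to\nabla U+\chi$ and $\mathcal T_\varepsilon z_\varepsilon\to Z$ strongly in $L^2(\Omega\times\mathbb R^d)$ componentwise, the limits being extended by $0$ outside $O$. **Theorem.** Let $\varepsilon$ run through a sequence of positive numbers tending to $0$, and let $y^0_\varepsilon\in S_\varepsilon(0)$ satisfy $y^0_\varepsilon\overset{c2}{\to}y^0$ for some $y^0\in Y$. Then: 1. $y^0\in S(0)$. 2. For each $\varepsilon$ there is a Lipschitz curve $y_\varepsilon:[0,T]\to Y_\varepsilon$ which is the unique energetic solution associated with $(\mathcal E_\varepsilon,\Psi_\varepsilon)$ with $y_\varepsilon(0)=y_\varepsilon^0$, and there is a Lipschitz curve $y=(U,Z,\chi):[0,T]\to Y$ which is the unique energetic solution associated with $(\mathcal E_0,\Psi_0)$ with $y(0)=y^0$. 3. $y_\varepsilon(t)\overset{c2}{\to}y(t)$ for every $t\in[0,T]$. -/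

import Mathlib

open MeasureTheory Filter Set
open scoped Topology NNReal ENNReal

noncomputable section

namespace SpringNetwork

/-! ### Physical space and lattice

The lattice `ε ℤ^d` is indexed by `n : ℤ^d`, the node with index `n` being the point `ε n`. -/

/-- The physical space `ℝ^d` with its Euclidean norm. -/
abbrev Space (d : ℕ) : Type := EuclideanSpace ℝ (Fin d)

/-- The index set `ℤ^d` of the lattice `ε ℤ^d`. -/
abbrev IntLattice (d : ℕ) : Type := Fin d → ℤ

/-- The node `ε n` of the lattice `ε ℤ^d`. -/
def node {d : ℕ} (ε : ℝ) (n : IntLattice d) : Space d := WithLp.toLp 2 (fun i => ε * (n i : ℝ))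

/-- The Euclidean length `|b|` of an integer vector. -/
def len {d : ℕ} (b : IntLattice d) : ℝ := ‖node 1 b‖

/-- The standard basis vector `e_j` of `ℤ^d`. -/
def unitVec {d : ℕ} (j : Fin d) : IntLattice d := Pi.single j 1

/-- The rescaled counting measure `m_ε = ε^d ∑_x δ_x` on `ε ℤ^d`. -/
def latticeMeasure (d : ℕ) (ε : ℝ) : Measure (IntLattice d) :=
  ENNReal.ofReal (ε ^ d) • Measure.count

/-- The index of the node `⌊x⌋_ε` with `x - ⌊x⌋_ε ∈ ε □`, where `□ = [-1/2, 1/2)^d`. -/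
def nearestNode {d : ℕ} (ε : ℝ) (x : Space d) : IntLattice d := fun i => ⌊x i / ε + 1 / 2⌋

/-- The cell `x + ε □`. -/
def cell {d : ℕ} (ε : ℝ) (x : Space d) : Set (Space d) :=
  {y | ∀ i, y i - x i ∈ Ico (-(ε / 2)) (ε / 2)}

/-- The boundary of `O` is Lipschitz: near each of its points, `O` is, in suitable orthonormal
coordinates with last axis `ν`, the strict epigraph of a Lipschitz function of the coordinates
orthogonal to `ν`. -/
def HasLipschitzBoundary {d : ℕ} (O : Set (Space d)) : Prop :=
  ∀ x₀ ∈ frontier O, ∃ r : ℝ, 0 < r ∧ ∃ ν : Space d, ‖ν‖ = 1 ∧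
    ∃ (L : ℝ≥0) (γ : Space d → ℝ), LipschitzWith L γ ∧
      ∀ x ∈ Metric.ball x₀ r, (x ∈ O ↔ γ (x - inner ℝ x ν • ν) < inner ℝ x ν)

/-- The set `O^{+ε} = O ∪ {x : (x, x + ε b_i) ∩ O ≠ ∅ for some i}`. -/
def enlarged {d k : ℕ} (b : Fin k → IntLattice d) (ε : ℝ) (O : Set (Space d)) : Set (Space d) :=
  O ∪ {x | ∃ i, (openSegment ℝ x (x + node ε (b i)) ∩ O).Nonempty}

/-! ### The random medium -/

/-- `τ` is a measure preserving action of `ℤ^d` on the probability space. -/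
structure IsDynamicalSystem {d : ℕ} {Ω : Type*} [MeasurableSpace Ω] (P : Measure Ω)
    (τ : IntLattice d → Ω → Ω) : Prop where
  measurePreserving : ∀ x, MeasurePreserving (τ x) P P
  zero : τ 0 = id
  add : ∀ x y, τ (x + y) = τ x ∘ τ y

/-- Ergodicity: every measurable set that is invariant under all shifts has measure `0` or `1`. -/
def IsErgodicSystem {d : ℕ} {Ω : Type*} [MeasurableSpace Ω] (P : Measure Ω)
    (τ : IntLattice d → Ω → Ω) : Prop :=
  ∀ S : Set Ω, MeasurableSet S → (∀ x, τ x '' S = S) → P S = 0 ∨ P S = 1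

/-! ### Difference quotients and edge kernels -/

/-- The discrete Korn inequality (exponent `2`) for the lattice graph generated by `b_1, …, b_k`:
`∫ |∇u|² ≤ C ∫ |∇_s u|²` for all finitely supported `u : ℤ^d → ℝ^d`. -/
def DiscreteKorn {d k : ℕ} (b : Fin k → IntLattice d) : Prop :=
  ∃ C : ℝ, 0 < C ∧ ∀ u : IntLattice d → Fin d → ℝ, (Function.support u).Finite →
    ∑' n, ∑ l, ∑ j, (u (n + unitVec j) l - u n l) ^ 2 ≤
      C * ∑' n, ∑ i, (∑ l, (b i l : ℝ) / len (b i) * ((u (n + b i) l - u n l) / len (b i))) ^ 2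

/-- `B : ℤ^d → ℝ^d`, finitely supported, represents the difference quotient along `b` through the
discrete gradient: `(u(n+b) - u(n)) / |b| = ∑_y ∇u(n - y) · B(y)` for all `u : ℤ^d → ℝ`. -/
def IsEdgeKernel {d : ℕ} (b : IntLattice d) (B : IntLattice d →₀ (Fin d → ℝ)) : Prop :=
  ∀ (u : IntLattice d → ℝ) (n : IntLattice d),
    (u (n + b) - u n) / len b =
      B.sum fun y v => ∑ j, (u (n - y + unitVec j) - u (n - y)) * v j

/-- Every integer vector has an edge kernel. -/
theorem exists_isEdgeKernel {d : ℕ} (b : IntLattice d) : ∃ B, IsEdgeKernel b B := by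
  let G : AddSubgroup (IntLattice d) :=
    { carrier := {b | ∃ B : IntLattice d →₀ (Fin d → ℝ), ∀ (u : IntLattice d → ℝ) (n : IntLattice d),
        u (n + b) - u n = B.sum fun y v => ∑ j, (u (n - y + unitVec j) - u (n - y)) * v j}
      zero_mem' := ⟨0, by simp⟩
      add_mem' := by
        rintro b c ⟨B, hB⟩ ⟨C, hC⟩
        refine ⟨B + C.mapDomain (fun y => y - b), fun u n => ?_⟩
        rw [Finsupp.sum_add_index', Finsupp.sum_mapDomain_index, ← hB u n]
        · have := hC u (n + b)
          simp only [← add_assoc, sub_sub_eq_add_sub]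
          linarith
        · simp
        · simp [mul_add, Finset.sum_add_distrib]
        · simp
        · simp [mul_add, Finset.sum_add_distrib]
      neg_mem' := by
        rintro b ⟨B, hB⟩
        refine ⟨(-B).mapDomain (fun y => y + b), fun u n => ?_⟩
        rw [Finsupp.sum_mapDomain_index, Finsupp.sum_neg_index]
        · have := hB u (n - b)
          simp only [sub_add_cancel] at this
          simp only [Pi.neg_apply, mul_neg, Finset.sum_neg_distrib, Finsupp.sum,
            ← sub_sub, sub_right_comm _ _ b, ← sub_eq_add_neg] at this ⊢
          linarith
        · simp
        · simp
        · simp [mul_add, Finset.sum_add_distrib] }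
  have hunit : ∀ j : Fin d, unitVec j ∈ G := fun j =>
    ⟨Finsupp.single 0 (Pi.single j 1), fun u n => by
      rw [Finsupp.sum_single_index (by simp)]
      rw [Finset.sum_eq_single j]
      · simp
      · intro i _ hi
        simp [hi]
      · simp⟩
  have hb : b ∈ G := by
    have h : b = ∑ j, b j • (unitVec j : IntLattice d) := by
      ext i
      simp [unitVec, Finset.sum_apply, Pi.single_apply]
    rw [h]
    exact G.sum_mem fun j _ => G.zsmul_mem (hunit j) _
  obtain ⟨B, hB⟩ := hb
  refine ⟨B.mapRange (fun v => (len b)⁻¹ • v) (by simp), fun u n => ?_⟩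
  rw [hB u n, Finsupp.sum_mapRange_index (by simp)]
  simp only [Finsupp.sum, Finset.sum_div, Pi.smul_apply, smul_eq_mul]
  refine Finset.sum_congr rfl fun y _ => Finset.sum_congr rfl fun j _ => ?_
  ring

section Fields

variable {d k : ℕ} {Ω : Type*} [MeasurableSpace Ω]

/-! ### Discrete random fields -/

/-- The space `L²(Ω × ε ℤ^d)`. -/
abbrev DiscreteL2 (P : Measure Ω) (d : ℕ) (ε : ℝ) : Type _ :=
  Lp ℝ 2 (P.prod (latticeMeasure d ε))

theorem measurePreserving_translate (P : Measure Ω) [SFinite P] (ε : ℝ) (b : IntLattice d) :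
    MeasurePreserving (fun p : Ω × IntLattice d => (p.1, p.2 + b))
      (P.prod (latticeMeasure d ε)) (P.prod (latticeMeasure d ε)) := by
  have h : MeasurePreserving (fun n : IntLattice d => n + b)
      (latticeMeasure d ε) (latticeMeasure d ε) :=
    (measurePreserving_add_right (Measure.count : Measure (IntLattice d)) b).smul_measure _
  have : SFinite (latticeMeasure d ε) := by unfold latticeMeasure; infer_instance
  exact (MeasurePreserving.id P).prod h

/-- The translation `u ↦ u(ω, · + ε b)` on `L²(Ω × ε ℤ^d)`. -/
def translate (P : Measure Ω) [SFinite P] (ε : ℝ) (b : IntLattice d) :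
    DiscreteL2 P d ε →ₗᵢ[ℝ] DiscreteL2 P d ε :=
  Lp.compMeasurePreservingₗᵢ ℝ _ (measurePreserving_translate P ε b)

/-- The component `∇^ε_j u(x) = (u(x + ε e_j) - u(x)) / ε` of the discrete gradient. -/
def discreteGrad (P : Measure Ω) [SFinite P] (ε : ℝ) (j : Fin d) :
    DiscreteL2 P d ε →ₗ[ℝ] DiscreteL2 P d ε :=
  ε⁻¹ • ((translate P ε (unitVec j)).toLinearMap - LinearMap.id)

/-- The difference quotient `(u(x + ε b) - u(x)) / (ε |b|)` along an edge. -/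
def edgeDiff (P : Measure Ω) [SFinite P] (ε : ℝ) (b : IntLattice d) :
    DiscreteL2 P d ε →ₗ[ℝ] DiscreteL2 P d ε :=
  (ε * len b)⁻¹ • ((translate P ε b).toLinearMap - LinearMap.id)

/-- The `i`-th component `b_i/|b_i| · ∂^ε_i u` of the discrete symmetrized gradient `∇^ε_s u`. -/
def discreteSymGrad (P : Measure Ω) [SFinite P] (ε : ℝ) (b : Fin k → IntLattice d)
    (u : Fin d → DiscreteL2 P d ε) (i : Fin k) : DiscreteL2 P d ε :=
  ∑ l, ((b i l : ℝ) / len (b i)) • edgeDiff P ε (b i) (u l)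

/-- The space `L²(Ω) ⊗ L²_0(S ∩ ε ℤ^d)` of square integrable random fields that vanish at the nodes
outside `S`. -/
def supportedOn (P : Measure Ω) (ε : ℝ) (S : Set (Space d)) : Submodule ℝ (DiscreteL2 P d ε) where
  carrier := {u | ∀ᵐ p ∂P.prod (latticeMeasure d ε), node ε p.2 ∉ S → u p = 0}
  zero_mem' := by
    filter_upwards [Lp.coeFn_zero ℝ 2 (P.prod (latticeMeasure d ε))] with p hp _
    simpa using hp
  add_mem' := by
    intro u v hu hv
    filter_upwards [hu, hv, Lp.coeFn_add u v] with p h1 h2 h3 hp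
    rw [h3, Pi.add_apply, h1 hp, h2 hp, add_zero]
  smul_mem' := by
    intro c u hu
    filter_upwards [hu, Lp.coeFn_smul c u] with p h1 h2 hp
    rw [h2, Pi.smul_apply, h1 hp, smul_zero]

/-- The space `L²(Ω) ⊗ L²_0(O ∩ ε ℤ^d)` with the discrete `H¹` scalar product
`⟨∫ u₁ u₂ + ∇^ε u₁ · ∇^ε u₂ dm_ε⟩`; the element `u` is stored as the pair `(u, ∇^ε u)`. -/
def DiscreteH10 (P : Measure Ω) [SFinite P] (ε : ℝ) (O : Set (Space d)) :
    Submodule ℝ (WithLp 2 (DiscreteL2 P d ε × PiLp 2 (fun _ : Fin d => DiscreteL2 P d ε))) where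
  carrier := {v | v.fst ∈ supportedOn P ε O ∧ ∀ j, v.snd j = discreteGrad P ε j v.fst}
  zero_mem' := by simp
  add_mem' := by
    rintro u v ⟨hu, hu'⟩ ⟨hv, hv'⟩
    exact ⟨by simpa using add_mem hu hv, fun j => by simp [hu' j, hv' j]⟩
  smul_mem' := by
    rintro c u ⟨hu, hu'⟩
    exact ⟨by simpa using Submodule.smul_mem _ c hu, fun j => by simp [hu' j]⟩

/-- The discrete state space `Y_ε`; a state `(u, z)` has `d` displacement components supported in
`O` and `k` internal variables supported in `O^{+ε}`. -/
abbrev DiscreteState (P : Measure Ω) [SFinite P] (b : Fin k → IntLattice d) (O : Set (Space d))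
    (ε : ℝ) : Type _ :=
  WithLp 2 (PiLp 2 (fun _ : Fin d => DiscreteH10 P ε O) ×
    PiLp 2 (fun _ : Fin k => supportedOn P ε (enlarged b ε O)))

namespace DiscreteState

variable {P : Measure Ω} [SFinite P] {b : Fin k → IntLattice d} {O : Set (Space d)} {ε : ℝ}

/-- The displacement component `u_l`. -/
def u (y : DiscreteState P b O ε) (l : Fin d) : DiscreteL2 P d ε := (y.fst l).1.fst

/-- The component `∇^ε_j u_l` of the discrete gradient of the displacement. -/
def gradU (y : DiscreteState P b O ε) (l j : Fin d) : DiscreteL2 P d ε := (y.fst l).1.snd j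

/-- The internal variable `z_i`. -/
def z (y : DiscreteState P b O ε) (i : Fin k) : DiscreteL2 P d ε := (y.snd i).1

end DiscreteState

/-! ### Continuum fields -/

/-- The space `L²(O)`. -/
abbrev DomainL2 (O : Set (Space d)) : Type := Lp ℝ 2 (volume.restrict O)

/-- The space `L²(Ω × O)`. -/
abbrev TwoScaleL2 (P : Measure Ω) (O : Set (Space d)) : Type _ :=
  Lp ℝ 2 (P.prod (volume.restrict O))

/-- The space `H¹_0(O)`, the closure of `C_c^∞(O)` in `H¹(O)`; the element `U` is stored as the pair
`(U, ∇U)`. -/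
def H10 (O : Set (Space d)) :
    Submodule ℝ (WithLp 2 (DomainL2 O × PiLp 2 (fun _ : Fin d => DomainL2 O))) :=
  (Submodule.span ℝ {v | ∃ φ : Space d → ℝ, ContDiff ℝ (⊤ : ℕ∞) φ ∧ HasCompactSupport φ ∧
      tsupport φ ⊆ O ∧ v.fst =ᵐ[volume.restrict O] φ ∧
      ∀ j, v.snd j =ᵐ[volume.restrict O]
        fun x => fderiv ℝ φ x (EuclideanSpace.single j 1)}).topologicalClosure

/-- The space `L²_pot(Ω)`, the closure in `L²(Ω)^d` of the horizontal derivatives `Dφ`,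
`D_j φ(ω) = φ(T_{e_j} ω) - φ(ω)`, of the functions `φ ∈ L²(Ω)`. -/
def L2Pot (P : Measure Ω) (τ : IntLattice d → Ω → Ω) :
    Submodule ℝ (PiLp 2 (fun _ : Fin d => Lp ℝ 2 P)) :=
  (Submodule.span ℝ {ψ | ∃ φ : Lp ℝ 2 P,
      ∀ j, ψ j =ᵐ[P] fun ω => φ (τ (unitVec j) ω) - φ ω}).topologicalClosure

/-- The space `L²_pot(Ω) ⊗ L²(O)`, the closure in `L²(Ω × O)^d` of the linear span of the products
`ψ(ω) η(x)` with `ψ ∈ L²_pot(Ω)` and `η ∈ L²(O)`. -/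
def L2PotTensor (P : Measure Ω) (τ : IntLattice d → Ω → Ω) (O : Set (Space d)) :
    Submodule ℝ (PiLp 2 (fun _ : Fin d => TwoScaleL2 P O)) :=
  (Submodule.span ℝ {f | ∃ ψ ∈ L2Pot P τ, ∃ η : DomainL2 O,
      ∀ j, f j =ᵐ[P.prod (volume.restrict O)] fun p => ψ j p.1 * η p.2}).topologicalClosure

/-- The continuum state space `Y = H¹_0(O)^d × L²(Ω × O)^k × (L²_pot(Ω) ⊗ L²(O))^d`. -/
abbrev ContState (k : ℕ) (P : Measure Ω) (τ : IntLattice d → Ω → Ω) (O : Set (Space d)) : Type _ :=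
  WithLp 2 (PiLp 2 (fun _ : Fin d => H10 O) ×
    WithLp 2 (PiLp 2 (fun _ : Fin k => TwoScaleL2 P O) ×
      PiLp 2 (fun _ : Fin d => L2PotTensor P τ O)))

namespace ContState

variable {P : Measure Ω} {τ : IntLattice d → Ω → Ω} {O : Set (Space d)}

/-- The displacement component `U_l`. -/
def U (y : ContState k P τ O) (l : Fin d) : DomainL2 O := (y.fst l).1.fst

/-- The partial derivative `∂_j U_l`. -/
def gradU (y : ContState k P τ O) (l j : Fin d) : DomainL2 O := (y.fst l).1.snd j

/-- The internal variable `Z_i`. -/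
def Z (y : ContState k P τ O) (i : Fin k) : TwoScaleL2 P O := y.snd.fst i

/-- The entry `χ_{lj}`; the row `χ_l` belongs to `L²_pot(Ω) ⊗ L²(O)`. -/
def χ (y : ContState k P τ O) (l j : Fin d) : TwoScaleL2 P O := (y.snd.snd l).1 j

/-- The component `(∇_s U)_i = b_i/|b_i| · ∇U b_i/|b_i|` at `x ∈ O`. -/
def symGradU (b : Fin k → IntLattice d) (y : ContState k P τ O) (i : Fin k) (x : Space d) : ℝ :=
  ∑ l, ∑ j, (b i l : ℝ) / len (b i) * y.gradU l j x * ((b i j : ℝ) / len (b i))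

/-- The component `(χ_s)_i = b_i/|b_i| · ∑_y χ(T_{-y} ω, x) B_i(y)` at `(ω, x) ∈ Ω × O`. -/
def symχ (b : Fin k → IntLattice d) (B : Fin k → IntLattice d →₀ (Fin d → ℝ))
    (y : ContState k P τ O) (i : Fin k) (p : Ω × Space d) : ℝ :=
  ∑ l, (b i l : ℝ) / len (b i) *
    (B i).sum fun n v => ∑ j, y.χ l j (τ (-n) p.1, p.2) * v j

end ContState

/-! ### Unfolding and two-scale convergence -/

/-- The stochastic unfolding `(𝒯_ε u)(ω, x) = u(T_{-n} ω, n)`, where `ε n = ⌊x⌋_ε`. -/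
def unfold {P : Measure Ω} (τ : IntLattice d → Ω → Ω) {ε : ℝ} (u : DiscreteL2 P d ε)
    (p : Ω × Space d) : ℝ :=
  u (τ (-nearestNode ε p.2) p.1, nearestNode ε p.2)

/-- Strong stochastic two-scale convergence in the mean along `ε_n`: `𝒯_{ε_n} u_n → U` strongly in
`L²(Ω × ℝ^d)`. -/
def StrongTwoScale {P : Measure Ω} (τ : IntLattice d → Ω → Ω) (ε : ℕ → ℝ)
    (u : ∀ n, DiscreteL2 P d (ε n)) (U : Ω × Space d → ℝ) : Prop :=
  Tendsto (fun n => eLpNorm (fun p => unfold τ (u n) p - U p) 2 (P.prod volume)) atTop (𝓝 0)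

/-- The extension by zero, from `Ω × O` to `Ω × ℝ^d`. -/
def zeroExt (O : Set (Space d)) (f : Ω × Space d → ℝ) : Ω × Space d → ℝ :=
  (Prod.snd ⁻¹' O).indicator f

/-- Strong cross convergence `y_n → y`: strong two-scale convergence of `u_n` to `U`, of
`∇^{ε_n} u_n` to `∇U + χ` and of `z_n` to `Z`, componentwise. -/
def StrongCross {P : Measure Ω} [SFinite P] {τ : IntLattice d → Ω → Ω} {b : Fin k → IntLattice d}
    {O : Set (Space d)} (ε : ℕ → ℝ) (yseq : ∀ n, DiscreteState P b O (ε n))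
    (y : ContState k P τ O) : Prop :=
  (∀ l, StrongTwoScale τ ε (fun n => (yseq n).u l) (zeroExt O fun p => y.U l p.2)) ∧
  (∀ l j, StrongTwoScale τ ε (fun n => (yseq n).gradU l j)
    (zeroExt O fun p => y.gradU l j p.2 + y.χ l j p)) ∧
  (∀ i, StrongTwoScale τ ε (fun n => (yseq n).z i) (zeroExt O fun p => y.Z i p))

/-! ### Rate-independent systems -/

section ERIS

variable {Y : Type*} [NormedAddCommGroup Y] [NormedSpace ℝ Y]

/-- The set of stable states at time `t`:
`{y : ℰ(t, y) ≤ ℰ(t, ỹ) + Ψ(ỹ - y) for all ỹ}`. -/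
def stableSet (E : ℝ → Y → ℝ) (Ψ : Y → ℝ≥0∞) (t : ℝ) : Set Y :=
  {y | ∀ y' : Y, (E t y : EReal) ≤ (E t y' : EReal) + (Ψ (y' - y) : EReal)}

/-- Energetic solutions on `[0, T]` in the class of absolutely continuous curves. Here `power s y`
stands for `⟨l̇(s), y⟩`, and the energy balance reads
`ℰ(t, y(t)) + ∫₀ᵗ Ψ(ẏ(s)) ds = ℰ(0, y(0)) - ∫₀ᵗ ⟨l̇(s), y(s)⟩ ds`. -/
structure IsEnergeticSolution (T : ℝ) (E : ℝ → Y → ℝ) (Ψ : Y → ℝ≥0∞) (power : ℝ → Y → ℝ)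
    (y : ℝ → Y) : Prop where
  ac : AbsolutelyContinuousOnInterval y 0 T
  stable : ∀ t ∈ Icc 0 T, y t ∈ stableSet E Ψ t
  balance : ∀ t ∈ Icc 0 T,
    (E t (y t) : EReal) + ((∫⁻ s in Ioc 0 t, Ψ (deriv y s) : ℝ≥0∞) : EReal) =
      ((E 0 (y 0) - ∫ s in (0 : ℝ)..t, power s (y s) : ℝ) : EReal)

/-- `y ∈ C^Lip([0, T], Y)` is the unique energetic solution with `y(0) = y₀`. -/
structure IsUniqueEnergeticSolution (T : ℝ) (E : ℝ → Y → ℝ) (Ψ : Y → ℝ≥0∞) (power : ℝ → Y → ℝ)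
    (y₀ : Y) (y : ℝ → Y) : Prop where
  lipschitz : ∃ L : ℝ≥0, LipschitzOnWith L y (Icc 0 T)
  initial : y 0 = y₀
  solution : IsEnergeticSolution T E Ψ power y
  unique : ∀ y' : ℝ → Y, IsEnergeticSolution T E Ψ power y' → y' 0 = y₀ → EqOn y' y (Icc 0 T)

end ERIS

/-! ### Energies and dissipation potentials of the spring network -/

/-- The space `L²(O)^d` of loads. -/
abbrev Load (O : Set (Space d)) : Type := PiLp 2 (fun _ : Fin d => DomainL2 O)

/-- The bilinear form `A F · G` on `ℝ^{2k}`, vectors being written in two blocks of length `k`. -/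
def pairing (M : Matrix (Fin k ⊕ Fin k) (Fin k ⊕ Fin k) ℝ) (F G : Fin k ⊕ Fin k → ℝ) : ℝ :=
  ∑ a, ∑ c, M a c * F c * G a

/-- The discretization `(π_ε f)(ε n)`: the mean over the cell around `ε n` of the extension of `f`
by zero. -/
def discretize {O : Set (Space d)} (ε : ℝ) (f : DomainL2 O) (n : IntLattice d) : ℝ :=
  ⨍ x in cell ε (node ε n), O.indicator f x

section Discrete

variable (P : Measure Ω) [SFinite P] (τ : IntLattice d → Ω → Ω) (b : Fin k → IntLattice d)
  (O : Set (Space d)) (ε : ℝ)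

/-- The discrete quadratic form `⟨𝔸_ε y, y⟩`. -/
def discreteQuad (A : Ω → Matrix (Fin k ⊕ Fin k) (Fin k ⊕ Fin k) ℝ)
    (y : DiscreteState P b O ε) : ℝ :=
  ∫ p in {p : Ω × IntLattice d | node ε p.2 ∈ enlarged b ε O},
    pairing (A (τ p.2 p.1))
      (Sum.elim (fun i => discreteSymGrad P ε b y.u i p) (fun i => y.z i p))
      (Sum.elim (fun i => discreteSymGrad P ε b y.u i p) (fun i => y.z i p))
    ∂P.prod (latticeMeasure d ε)

/-- The discrete load term `⟨∫_{O ∩ ε ℤ^d} π_ε f · u dm_ε⟩`. -/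
def discreteLoad (f : Load O) (y : DiscreteState P b O ε) : ℝ :=
  ∫ p in {p : Ω × IntLattice d | node ε p.2 ∈ O},
    ∑ l, discretize ε (f l) p.2 * y.u l p ∂P.prod (latticeMeasure d ε)

/-- The discrete energy `ℰ_ε(t, y)` with loading `l`. -/
def discreteEnergy (A : Ω → Matrix (Fin k ⊕ Fin k) (Fin k ⊕ Fin k) ℝ) (l : ℝ → Load O) (t : ℝ)
    (y : DiscreteState P b O ε) : ℝ :=
  1 / 2 * discreteQuad P τ b O ε A y - discreteLoad P b O ε (l t) y

/-- The discrete dissipation potential `Ψ_ε(y) = ⟨∫_{O^{+ε} ∩ ε ℤ^d} ρ(T_{x/ε} ω, z) dm_ε⟩`. -/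
def discreteDissipation (ρ : Ω → (Fin k → ℝ) → ℝ) (y : DiscreteState P b O ε) : ℝ≥0∞ :=
  ∫⁻ p in {p : Ω × IntLattice d | node ε p.2 ∈ enlarged b ε O},
    ENNReal.ofReal (ρ (τ p.2 p.1) (fun i => y.z i p)) ∂P.prod (latticeMeasure d ε)

end Discrete

section Continuum

variable (P : Measure Ω) (τ : IntLattice d → Ω → Ω) (b : Fin k → IntLattice d)
  (B : Fin k → IntLattice d →₀ (Fin d → ℝ)) (O : Set (Space d))

/-- The two-scale quadratic form `⟨𝔸 y, y⟩`. -/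
def contQuad (A : Ω → Matrix (Fin k ⊕ Fin k) (Fin k ⊕ Fin k) ℝ) (y : ContState k P τ O) : ℝ :=
  ∫ p : Ω × Space d,
    pairing (A p.1)
      (Sum.elim (fun i => y.symGradU b i p.2 + y.symχ b B i p) (fun i => y.Z i p))
      (Sum.elim (fun i => y.symGradU b i p.2 + y.symχ b B i p) (fun i => y.Z i p))
    ∂P.prod (volume.restrict O)

/-- The load term `∫_O f · U dx`. -/
def contLoad (f : Load O) (y : ContState k P τ O) : ℝ := ∫ x in O, ∑ l, f l x * y.U l x

/-- The two-scale energy `ℰ_0(t, y)` with loading `l`. -/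
def contEnergy (A : Ω → Matrix (Fin k ⊕ Fin k) (Fin k ⊕ Fin k) ℝ) (l : ℝ → Load O) (t : ℝ)
    (y : ContState k P τ O) : ℝ :=
  1 / 2 * contQuad P τ b B O A y - contLoad P τ O (l t) y

/-- The two-scale dissipation potential `Ψ_0(y) = ∫_O ⟨ρ(ω, Z(ω, x))⟩ dx`. -/
def contDissipation (ρ : Ω → (Fin k → ℝ) → ℝ) (y : ContState k P τ O) : ℝ≥0∞ :=
  ∫⁻ p : Ω × Space d, ENNReal.ofReal (ρ p.1 (fun i => y.Z i p)) ∂P.prod (volume.restrict O)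

end Continuum

/-- `A ∈ L^∞(Ω; ℝ^{2k × 2k}_sym)` is uniformly positive definite. -/
structure IsAdmissibleCoefficient (P : Measure Ω)
    (A : Ω → Matrix (Fin k ⊕ Fin k) (Fin k ⊕ Fin k) ℝ) : Prop where
  essBounded : ∀ a c, MemLp (fun ω => A ω a c) ∞ P
  symmetric : ∀ᵐ ω ∂P, (A ω).IsSymm
  coercive : ∃ C : ℝ, 0 < C ∧ ∀ᵐ ω ∂P, ∀ F : Fin k ⊕ Fin k → ℝ,
    C * ∑ a, F a ^ 2 ≤ pairing (A ω) F F

/-- `ρ : Ω × ℝ^k → [0, ∞)` is jointly measurable and, for almost every `ω`, convex and positively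
homogeneous of order one in its second argument. -/
structure IsAdmissibleDissipation (P : Measure Ω) (ρ : Ω → (Fin k → ℝ) → ℝ) : Prop where
  nonneg : ∀ ω F, 0 ≤ ρ ω F
  measurable : Measurable (Function.uncurry ρ)
  convex : ∀ᵐ ω ∂P, ConvexOn ℝ univ (ρ ω)
  homogeneous : ∀ᵐ ω ∂P, ∀ (α : ℝ) (F : Fin k → ℝ), 0 ≤ α → ρ ω (α • F) = α * ρ ω F

end Fields

end SpringNetwork

end

open SpringNetwork

set_option linter.unusedSectionVars false

/-! Both systems have a quadratic energy ½ a(y, y) - ℓ(t)(y) on a Hilbert space and a dissipation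
potential Ψ that is subadditive, positively one-homogeneous and lower semicontinuous. For such
systems, stability at time t means exactly that the force f = ℓ(t) - a y satisfies f(v) ≤ Ψ(v) for
all v (`mem_stableSet_iff`), and the energetic solution is a limit of implicit time-incremental
minimizations. Comparing one coarse step with two fine ones (`refinement_bound`) shows that the
dyadic scheme of level j stays within a constant times 2^(-j/2) of the solution. The constant
depends only on the coercivity constant, the Lipschitz constant of the load and T. Uniqueness holds
because a(y - z, y - z) does not increase along two solutions; its derivative can be computed
because absolutely continuous curves in a Hilbert space are differentiable almost everywhere.

Since the error of the scheme is uniform in ε, convergence of solutions reduces to convergence of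
finitely many incremental minimizers at a fixed level (`IsMoscoLimit.tendsto_energeticSolution`). To
compare minimizers, all state spaces are mapped isometrically into one space of L² fields on Ω ×
ℝ^d: discrete states by stochastic unfolding, continuum states by (U, ∇U + χ, Z). The second map is
isometric because ∇U is deterministic and χ has mean zero. In the common space cross convergence is
norm convergence, all dissipations are restrictions of one functional, and all energies come from
`energyForm`. Unfolding removes the oscillation of the coefficients, so ε survives only as a spatial
translation in the strain, and ε = 0 gives the homogenized form.

Four facts then force strong convergence of minimizers (`exists_isMoscoLimit`). Coercivity is
uniform in ε, by the discrete Korn and Poincaré inequalities (`exists_discrete_coercive`). The forms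
converge along pairs of a strongly and a weakly convergent sequence (`tendsto_energyForm`). Each
continuum state is a strong limit of discrete states with no larger dissipation (`exists_recovery`):
samples of test functions produce U, the fields ε φ(εn) ψ(τ_n ω) produce χ, and cell averages
produce Z, with Jensen's inequality bounding the dissipation. Finally, weak limits of bounded
discrete states are continuum states (`exists_contEmbedding_eq`): the limit displacement is shift
invariant, hence deterministic by ergodicity; discrete integration by parts against solenoidal
fields shows that the limit gradient is ∇U + χ; and the Lipschitz boundary places U in H¹_0. -/

namespace SpringNetwork

/-! ### Weak limits and almost everywhere differentiability in Hilbert spaces. -/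

section Hilbert


variable {Y : Type*} [NormedAddCommGroup Y] [InnerProductSpace ℝ Y] [CompleteSpace Y]

/-- Bounded families in a Hilbert space converge weakly along every ultrafilter. -/
theorem exists_weak_limit {ι : Type*} (F : Ultrafilter ι) (f : ι → Y) (C : ℝ)
    (hf : ∀ᶠ i in F, ‖f i‖ ≤ C) :
    ∃ w : Y, ∀ g, Tendsto (fun i => inner ℝ (f i) g) F (𝓝 (inner ℝ w g)) := by
  -- Each scalar product stays in a compact interval, so the ultrafilter itself selects a limit. No
  -- subsequence is extracted and no separability is needed.
  have key : ∀ g : Y, ∃ x : ℝ, |x| ≤ C * ‖g‖ ∧ Tendsto (fun i => inner ℝ (f i) g) F (𝓝 x) := by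
    intro g
    have hmem : ∀ᶠ i in F, inner ℝ (f i) g ∈ Icc (-(C * ‖g‖)) (C * ‖g‖) := by
      filter_upwards [hf] with i hi
      rw [mem_Icc, ← abs_le]
      exact (abs_real_inner_le_norm _ _).trans (mul_le_mul_of_nonneg_right hi (norm_nonneg _))
    obtain ⟨x, hx, hxF⟩ := isCompact_Icc.ultrafilter_le_nhds
      (F.map fun i => inner ℝ (f i) g) (le_principal_iff.2 hmem)
    exact ⟨x, abs_le.2 hx, hxF⟩
  choose L hL hLt using key
  let Φ : Y →ₗ[ℝ] ℝ :=
    { toFun := L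
      map_add' := fun g h => tendsto_nhds_unique (hLt (g + h)) (by
        simpa only [inner_add_right] using (hLt g).add (hLt h))
      map_smul' := fun c g => tendsto_nhds_unique (hLt (c • g)) (by
        simpa only [inner_smul_right, smul_eq_mul, RingHom.id_apply] using
          (hLt g).const_mul c) }
  refine ⟨(InnerProductSpace.toDual ℝ Y).symm (Φ.mkContinuous C fun g => hL g), fun g => ?_⟩
  rw [InnerProductSpace.toDual_symm_apply]
  exact hLt g

/-- In a Hilbert space, weak convergence together with an upper bound of the norms by the norm of
the limit is strong convergence. -/
theorem tendsto_of_weak_of_norm {ι : Type*} {l : Filter ι} {f : ι → Y} {w : Y} {r : ℝ} {N : ι → ℝ}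
    (hw : Tendsto (fun i => inner ℝ (f i) w) l (𝓝 (inner ℝ w w)))
    (hN : ∀ᶠ i in l, ‖f i‖ ≤ N i) (hr : Tendsto N l (𝓝 r)) (hr0 : 0 ≤ r) (hrw : r ≤ ‖w‖) :
    Tendsto f l (𝓝 w) := by
  rw [tendsto_iff_norm_sub_tendsto_zero]
  -- This expression dominates ‖f i - w‖², and its limit r² - ‖w‖² is nonpositive because r ≤ ‖w‖.
  have h1 : Tendsto (fun i => (N i) ^ 2 - 2 * inner ℝ (f i) w + ‖w‖ ^ 2) l
      (𝓝 (r ^ 2 - 2 * inner ℝ w w + ‖w‖ ^ 2)) :=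
    ((hr.pow 2).sub (hw.const_mul 2)).add_const _
  rw [real_inner_self_eq_norm_sq] at h1
  have h3 : Tendsto (fun i => ‖f i - w‖ ^ 2) l (𝓝 0) := by
    have h2 : r ^ 2 - 2 * ‖w‖ ^ 2 + ‖w‖ ^ 2 ≤ 0 := by nlinarith
    rw [tendsto_order]
    refine ⟨fun a ha => Eventually.of_forall fun i => ha.trans_le (by positivity), fun a ha => ?_⟩
    filter_upwards [(tendsto_order.1 h1).2 a (h2.trans_lt ha), hN] with i hi hi'
    rw [norm_sub_sq_real]
    have := norm_nonneg (f i)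
    nlinarith
  simpa using h3.sqrt

theorem AbsolutelyContinuousOnInterval.comp_lipschitz {X Z : Type*} [PseudoMetricSpace X]
    [PseudoMetricSpace Z] {f : ℝ → X} {g : X → Z} {K : ℝ≥0} {a b : ℝ} (hg : LipschitzWith K g)
    (hf : AbsolutelyContinuousOnInterval f a b) :
    AbsolutelyContinuousOnInterval (fun t => g (f t)) a b := by
  rw [absolutelyContinuousOnInterval_iff] at hf ⊢
  intro r hr
  -- K + 1 in place of K keeps the tolerance meaningful when the Lipschitz constant vanishes.
  obtain ⟨δ, hδ, h⟩ := hf (r / (K + 1)) (by positivity)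
  refine ⟨δ, hδ, fun E hE hEδ => ?_⟩
  have h1 := h E hE hEδ
  rw [lt_div_iff₀ (by positivity)] at h1
  refine lt_of_le_of_lt ?_ h1
  rw [Finset.sum_mul]
  refine Finset.sum_le_sum fun i _ => (hg.dist_le_mul _ _).trans ?_
  rw [mul_comm]
  exact mul_le_mul_of_nonneg_left (by simp) dist_nonneg

/-- V is the variation of the curve from a. Being monotone, it is differentiable almost everywhere,
which bounds the difference quotients of f at almost every time. -/
theorem AbsolutelyContinuousOnInterval.exists_monotoneOn_dist_le {X : Type*}
    [SeminormedAddCommGroup X] {f : ℝ → X} {a b : ℝ} (hab : a ≤ b) (hf : AbsolutelyContinuousOnInterval f a b) :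
    ∃ V : ℝ → ℝ, MonotoneOn V (Icc a b) ∧
      ∀ s ∈ Icc a b, ∀ t ∈ Icc a b, dist (f s) (f t) ≤ |V s - V t| := by
  have hbv := hf.boundedVariationOn
  rw [uIcc_of_le hab] at hbv
  have hl := hbv.locallyBoundedVariationOn
  refine ⟨variationOnFromTo f (Icc a b) a, variationOnFromTo.monotoneOn hl (left_mem_Icc.2 hab), ?_⟩
  have key : ∀ s ∈ Icc a b, ∀ t ∈ Icc a b, s ≤ t → dist (f s) (f t) ≤
      |variationOnFromTo f (Icc a b) a s - variationOnFromTo f (Icc a b) a t| := by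
    intro s hs t ht hst
    rw [abs_sub_comm, variationOnFromTo.sub_right hl (left_mem_Icc.2 hab) ht hs,
      variationOnFromTo.eq_of_le _ _ hst, abs_of_nonneg ENNReal.toReal_nonneg]
    have h := eVariationOn.edist_le f (s := Icc a b ∩ Icc s t) (x := s) (y := t)
      ⟨hs, left_mem_Icc.2 hst⟩ ⟨ht, right_mem_Icc.2 hst⟩
    rw [edist_dist] at h
    exact (ENNReal.ofReal_le_iff_le_toReal (hl s t hs ht)).1 h
  intro s hs t ht
  rcases le_total s t with h | h
  · exact key s hs t ht h
  · rw [dist_comm, abs_sub_comm]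
    exact key t ht s hs h

/-- Absolutely continuous curves in a Hilbert space are differentiable almost everywhere. -/
theorem AbsolutelyContinuousOnInterval.ae_differentiableAt_hilbert {y : ℝ → Y} {a b : ℝ}
    (hab : a ≤ b) (hy : AbsolutelyContinuousOnInterval y a b) :
    ∀ᵐ t : ℝ, t ∈ Ioo a b → DifferentiableAt ℝ y t := by
  obtain ⟨V, hVm, hV⟩ := AbsolutelyContinuousOnInterval.exists_monotoneOn_dist_le hab hy
  -- Only countably many directions are tested, the normalized increments between rational times, so
  -- a single null set serves for all of them. By continuity the closed span of these increments
  -- contains every increment of the curve.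
  let J := {p : ℚ × ℚ // (p.1 : ℝ) ∈ Icc a b ∧ (p.2 : ℝ) ∈ Icc a b}
  let v : J → Y := fun p => y p.1.2 - y p.1.1
  let e : J → Y := fun p => ‖v p‖⁻¹ • v p
  let G : J → ℝ → ℝ := fun p t => inner ℝ (e p) (y t)
  have he : ∀ p, ‖e p‖ ≤ 1 := fun p => by
    simp only [e, norm_smul, norm_inv, norm_norm]
    exact inv_mul_le_one
  have hGac : ∀ p, AbsolutelyContinuousOnInterval (G p) a b := fun p =>
    AbsolutelyContinuousOnInterval.comp_lipschitz (innerSL ℝ (e p)).lipschitz hy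
  have hyc : ContinuousOn y (Icc a b) := by simpa [uIcc_of_le hab] using hy.continuousOn
  -- pointwise information at almost every time
  have hae : ∀ᵐ t : ℝ, t ∈ Ioo a b → (DifferentiableAt ℝ V t ∧
      ∀ p, DifferentiableAt ℝ (G p) t) := by
    have h1 : ∀ᵐ t : ℝ, t ∈ Icc a b → DifferentiableWithinAt ℝ V (Icc a b) t :=
      hVm.ae_differentiableWithinAt_of_mem
    have h2 : ∀ᵐ t : ℝ, ∀ p, t ∈ uIcc a b → DifferentiableAt ℝ (G p) t :=
      ae_all_iff.2 fun p => (hGac p).ae_differentiableAt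
    filter_upwards [h1, h2] with t ht1 ht2 ht
    exact ⟨(ht1 (Ioo_subset_Icc_self ht)).differentiableAt (Icc_mem_nhds ht.1 ht.2),
      fun p => ht2 p (by rw [uIcc_of_le hab]; exact Ioo_subset_Icc_self ht)⟩
  have hnear : ∀ t ∈ Ioo a b, ∀ᶠ s in 𝓝[≠] t, s ∈ Icc a b := fun t ht =>
    nhdsWithin_le_nhds (Icc_mem_nhds ht.1 ht.2)
  have hslopeV : ∀ t ∈ Ioo a b, ∀ᶠ s in 𝓝[≠] t, ‖slope y t s‖ ≤ |slope V t s| := by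
    intro t ht
    filter_upwards [hnear t ht] with s hs
    rw [slope, slope, norm_smul, vsub_eq_sub, vsub_eq_sub, smul_eq_mul, abs_mul, Real.norm_eq_abs,
      ← dist_eq_norm]
    exact mul_le_mul_of_nonneg_left (hV s hs t (Ioo_subset_Icc_self ht)) (abs_nonneg _)
  have hGslope : ∀ p t s, slope (G p) t s = inner ℝ (e p) (slope y t s) := by
    intro p t s
    simp only [slope, vsub_eq_sub, G, inner_smul_right, inner_sub_right, smul_eq_mul]
  have hbound : ∀ t ∈ Ioo a b, DifferentiableAt ℝ V t → (∀ p, DifferentiableAt ℝ (G p) t) →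
      ∀ p, |deriv (G p) t| ≤ |deriv V t| := by
    intro t ht htV htG p
    have h1 := (hasDerivAt_iff_tendsto_slope.1 (htG p).hasDerivAt).abs
    have h2 := (hasDerivAt_iff_tendsto_slope.1 htV.hasDerivAt).abs
    refine le_of_tendsto_of_tendsto h1 h2 ?_
    filter_upwards [hslopeV t ht] with s hs
    rw [hGslope]
    refine (abs_real_inner_le_norm _ _).trans (le_trans ?_ hs)
    exact mul_le_of_le_one_left (norm_nonneg _) (he p)
  -- φ plays the role of the metric derivative. It is measurable as a countable supremum and
  -- dominated by |V'|, which is integrable.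
  let φ : ℝ → ℝ := fun t => ⨆ p, |deriv (G p) t|
  have hφm : Measurable φ := Measurable.iSup fun p => continuous_abs.measurable.comp (measurable_deriv _)
  have hae' : ∀ᵐ t : ℝ, t ∈ Ioo a b → (∀ p, |deriv (G p) t| ≤ φ t) ∧ 0 ≤ φ t ∧
      φ t ≤ |deriv V t| := by
    filter_upwards [hae] with t ht h
    obtain ⟨h1, h2⟩ := ht h
    have hb := hbound t h h1 h2
    refine ⟨fun p => le_ciSup (f := fun p => |deriv (G p) t|) ⟨_, forall_mem_range.2 hb⟩ p,
      Real.iSup_nonneg fun p => abs_nonneg _, Real.iSup_le hb (abs_nonneg _)⟩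
  have hae'' : ∀ᵐ t ∂volume.restrict (uIoc a b), (∀ p, |deriv (G p) t| ≤ φ t) ∧ 0 ≤ φ t ∧
      φ t ≤ |deriv V t| := by
    rw [uIoc_of_le hab, ← restrict_Ioo_eq_restrict_Ioc, ae_restrict_iff' measurableSet_Ioo]
    exact hae'
  have hφi : IntervalIntegrable φ volume a b := by
    have hVi : IntervalIntegrable (deriv V) volume a b :=
      MonotoneOn.intervalIntegrable_deriv (by rwa [uIcc_of_le hab])
    refine hVi.norm.mono_fun hφm.aestronglyMeasurable ?_
    filter_upwards [hae''] with t ht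
    rw [Real.norm_eq_abs, abs_of_nonneg ht.2.1]
    simpa using ht.2.2
  have hsub : ∀ s ∈ Icc a b, ∀ t ∈ Icc a b, IntervalIntegrable φ volume s t := fun s hs t ht =>
    hφi.mono_set (by rw [uIcc_of_le hab]; exact uIcc_subset_Icc hs ht)
  -- the arc length bound, first between rational times
  have hrat : ∀ p : J, (p.1.1 : ℝ) ≤ p.1.2 → ‖y p.1.2 - y p.1.1‖ ≤ ∫ r in (p.1.1 : ℝ)..p.1.2, φ r := by
    intro p hp
    have hss : uIcc (p.1.1 : ℝ) p.1.2 ⊆ uIcc a b := by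
      rw [uIcc_of_le hab]; exact uIcc_subset_Icc p.2.1 p.2.2
    have hG' := (hGac p).mono hss
    have h1 : ‖y p.1.2 - y p.1.1‖ = G p p.1.2 - G p p.1.1 := by
      have h2 : G p p.1.2 - G p p.1.1 = ‖v p‖⁻¹ * ‖v p‖ ^ 2 := by
        simp only [G, e]
        rw [← inner_sub_right, real_inner_smul_left, real_inner_self_eq_norm_sq]
      rw [h2]
      simp only [v]
      rcases eq_or_ne ‖y p.1.2 - y p.1.1‖ 0 with h | h
      · simp [h]
      · field_simp
    rw [h1, ← hG'.integral_deriv_eq_sub]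
    refine intervalIntegral.integral_mono_ae_restrict hp hG'.intervalIntegrable_deriv
      (hsub _ p.2.1 _ p.2.2) ?_
    rw [EventuallyLE, ← restrict_Ioo_eq_restrict_Icc, ae_restrict_iff' measurableSet_Ioo]
    filter_upwards [hae'] with t ht htp
    exact (le_abs_self _).trans ((ht ⟨p.2.1.1.trans_lt htp.1, htp.2.trans_le p.2.2.2⟩).1 p)
  let Φ : ℝ → ℝ := fun t => ∫ r in a..t, φ r
  have hΦc : ContinuousOn Φ (Icc a b) := by
    have := intervalIntegral.continuousOn_primitive_interval' hφi (left_mem_uIcc)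
    rwa [uIcc_of_le hab] at this
  have hΦ : ∀ s ∈ Icc a b, ∀ t ∈ Icc a b, ∫ r in s..t, φ r = Φ t - Φ s := by
    intro s hs t ht
    rw [intervalIntegral.integral_interval_sub_left (hsub _ (left_mem_Icc.2 hab) _ ht)
      (hsub _ (left_mem_Icc.2 hab) _ hs)]
  have harc : ∀ s ∈ Ioo a b, ∀ t ∈ Ioo a b, s < t → ‖y t - y s‖ ≤ Φ t - Φ s := by
    intro s hs t ht hst
    obtain ⟨p, hp1, hp2⟩ : ∃ p : ℕ → ℚ, (∀ n, s < (p n : ℝ) ∧ (p n : ℝ) < t) ∧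
        Tendsto (fun n => (p n : ℝ)) atTop (𝓝 s) := by
      have : ∀ n : ℕ, ∃ q : ℚ, s < (q : ℝ) ∧ (q : ℝ) < min t (s + 1 / ((n : ℝ) + 1)) := fun n =>
        exists_rat_btwn (lt_min hst (by have : (0 : ℝ) < 1 / ((n : ℝ) + 1) := by positivity
                                        linarith))
      choose p hp using this
      refine ⟨p, fun n => ⟨(hp n).1, (hp n).2.trans_le (min_le_left _ _)⟩, ?_⟩
      refine tendsto_of_tendsto_of_tendsto_of_le_of_le tendsto_const_nhds
        (by simpa using tendsto_const_nhds.add (tendsto_one_div_add_atTop_nhds_zero_nat (𝕜 := ℝ)))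
        (fun n => (hp n).1.le) (fun n => ((hp n).2.trans_le (min_le_right _ _)).le)
    obtain ⟨q, hq1, hq2⟩ : ∃ q : ℕ → ℚ, (∀ n, t < (q n : ℝ) ∧ (q n : ℝ) < b) ∧
        Tendsto (fun n => (q n : ℝ)) atTop (𝓝 t) := by
      have : ∀ n : ℕ, ∃ q : ℚ, t < (q : ℝ) ∧ (q : ℝ) < min b (t + 1 / ((n : ℝ) + 1)) := fun n =>
        exists_rat_btwn (lt_min ht.2 (by have : (0 : ℝ) < 1 / ((n : ℝ) + 1) := by positivity
                                         linarith))
      choose q hq using this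
      refine ⟨q, fun n => ⟨(hq n).1, (hq n).2.trans_le (min_le_left _ _)⟩, ?_⟩
      refine tendsto_of_tendsto_of_tendsto_of_le_of_le tendsto_const_nhds
        (by simpa using tendsto_const_nhds.add (tendsto_one_div_add_atTop_nhds_zero_nat (𝕜 := ℝ)))
        (fun n => (hq n).1.le) (fun n => ((hq n).2.trans_le (min_le_right _ _)).le)
    have hpm : ∀ n, (p n : ℝ) ∈ Icc a b := fun n =>
      ⟨(hs.1.trans (hp1 n).1).le, ((hp1 n).2.trans ht.2).le⟩
    have hqm : ∀ n, (q n : ℝ) ∈ Icc a b := fun n => ⟨(ht.1.trans (hq1 n).1).le, (hq1 n).2.le⟩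
    have lim : ∀ (f : ℝ → Y) {x : ℝ} {u : ℕ → ℝ},
        ContinuousOn f (Icc a b) → x ∈ Icc a b → (∀ n, u n ∈ Icc a b) →
        Tendsto u atTop (𝓝 x) → Tendsto (fun n => f (u n)) atTop (𝓝 (f x)) :=
      fun f _ _ hf hx hu hux => (hf _ hx).tendsto.comp
        (tendsto_nhdsWithin_iff.2 ⟨hux, Eventually.of_forall hu⟩)
    have lim' : ∀ (f : ℝ → ℝ) {x : ℝ} {u : ℕ → ℝ},
        ContinuousOn f (Icc a b) → x ∈ Icc a b → (∀ n, u n ∈ Icc a b) →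
        Tendsto u atTop (𝓝 x) → Tendsto (fun n => f (u n)) atTop (𝓝 (f x)) :=
      fun f _ _ hf hx hu hux => (hf _ hx).tendsto.comp
        (tendsto_nhdsWithin_iff.2 ⟨hux, Eventually.of_forall hu⟩)
    have hs' := Ioo_subset_Icc_self hs
    have ht' := Ioo_subset_Icc_self ht
    refine le_of_tendsto_of_tendsto' (((lim y hyc ht' hqm hq2).sub (lim y hyc hs' hpm hp2)).norm)
      ((lim' Φ hΦc ht' hqm hq2).sub (lim' Φ hΦc hs' hpm hp2)) fun n => ?_
    rw [← hΦ _ (hpm n) _ (hqm n)]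
    exact hrat ⟨(p n, q n), hpm n, hqm n⟩ ((hp1 n).2.trans (hq1 n).1).le
  have harc' : ∀ s ∈ Ioo a b, ∀ t ∈ Ioo a b, ‖slope y t s‖ ≤ |slope Φ t s| := by
    intro s hs t ht
    rw [slope, slope, norm_smul, vsub_eq_sub, vsub_eq_sub, smul_eq_mul, abs_mul, Real.norm_eq_abs]
    refine mul_le_mul_of_nonneg_left ?_ (abs_nonneg _)
    rcases lt_trichotomy s t with h | h | h
    · rw [norm_sub_rev, abs_sub_comm]
      exact (harc s hs t ht h).trans (le_abs_self _)
    · simp [h]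
    · exact (harc t ht s hs h).trans (le_abs_self _)
  -- At a point t where the primitive of φ has derivative φ t, the arc length bound makes the norms
  -- of the difference quotients asymptotically at most φ t.
  have hLeb := hφi.ae_hasDerivAt_integral
  filter_upwards [hae, hae', hLeb] with t h1 h2 h3 ht
  obtain ⟨hdV, hdG⟩ := h1 ht
  obtain ⟨hGφ, hφ0, -⟩ := h2 ht
  have hΦ' : HasDerivAt Φ (φ t) t :=
    h3 (by rw [uIcc_of_le hab]; exact Ioo_subset_Icc_self ht) a left_mem_uIcc
  have hΦs := (hasDerivAt_iff_tendsto_slope.1 hΦ').abs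
  rw [abs_of_nonneg hφ0] at hΦs
  have hle : ∀ᶠ s in 𝓝[≠] t, ‖slope y t s‖ ≤ |slope Φ t s| := by
    filter_upwards [nhdsWithin_le_nhds (Ioo_mem_nhds ht.1 ht.2)] with s hs using harc' s hs t ht
  have hbd : ∀ᶠ s in 𝓝[≠] t, ‖slope y t s‖ ≤ φ t + 1 := by
    filter_upwards [hle, (tendsto_order.1 hΦs).2 (φ t + 1) (by linarith)] with s h4 h5
    exact h4.trans h5.le
  -- The difference quotients lie in S, and a vector of S is determined by its products with the e
  -- p. This forces the limits along different ultrafilters to agree.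
  let S : Submodule ℝ Y := (Submodule.span ℝ (range v)).topologicalClosure
  have hvS : ∀ p, v p ∈ S := fun p =>
    Submodule.le_topologicalClosure _ (Submodule.subset_span ⟨p, rfl⟩)
  have hslS : ∀ᶠ s in 𝓝[≠] t, slope y t s ∈ S := by
    filter_upwards [hnear t ht] with s hs
    refine S.smul_mem _ ?_
    rw [vsub_eq_sub]
    -- rational times are dense
    have hcl : ∀ x ∈ Icc a b, ∃ u : ℕ → ℝ, (∀ n, ∃ q : ℚ, (q : ℝ) = u n ∧ (q : ℝ) ∈ Icc a b) ∧
        Tendsto u atTop (𝓝 x) := by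
      intro x hx
      have hd : x ∈ closure (Ioo a b ∩ range ((↑) : ℚ → ℝ)) := by
        rw [← closure_Ioo (ht.1.trans ht.2).ne] at hx
        exact closure_minimal ((Rat.denseRange_cast (𝕜 := ℝ)).open_subset_closure_inter isOpen_Ioo)
          isClosed_closure hx
      obtain ⟨u, hu, hux⟩ := mem_closure_iff_seq_limit.1 hd
      refine ⟨u, fun n => ?_, hux⟩
      obtain ⟨hn, q, hq⟩ := hu n
      exact ⟨q, hq, by rw [hq]; exact Ioo_subset_Icc_self hn⟩
    obtain ⟨us, hus, hust⟩ := hcl s hs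
    obtain ⟨ut, hut, hutt⟩ := hcl t (Ioo_subset_Icc_self ht)
    choose qs hqs hqsI using hus
    choose qt hqt hqtI using hut
    have e1 : Tendsto (fun n => y (us n) - y (ut n)) atTop (𝓝 (y s - y t)) :=
      ((hyc s hs).tendsto.comp (tendsto_nhdsWithin_iff.2
        ⟨hust, Eventually.of_forall fun n => hqs n ▸ hqsI n⟩)).sub
      ((hyc t (Ioo_subset_Icc_self ht)).tendsto.comp (tendsto_nhdsWithin_iff.2
        ⟨hutt, Eventually.of_forall fun n => hqt n ▸ hqtI n⟩))
    refine (Submodule.isClosed_topologicalClosure _).mem_of_tendsto e1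
      (Eventually.of_forall fun n => ?_)
    rw [← hqs n, ← hqt n]
    exact hvS ⟨(qt n, qs n), hqtI n, hqsI n⟩
  -- every ultrafilter gives a strong limit of the difference quotients
  have hlim : ∀ F : Ultrafilter ℝ, (F : Filter ℝ) ≤ 𝓝[≠] t → ∃ w ∈ S,
      Tendsto (slope y t) F (𝓝 w) ∧ ∀ p, inner ℝ (e p) w = deriv (G p) t := by
    intro F hF
    obtain ⟨w, hw⟩ := exists_weak_limit F (slope y t) (φ t + 1) (hF hbd)
    have hwe : ∀ p, inner ℝ (e p) w = deriv (G p) t := by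
      intro p
      refine tendsto_nhds_unique (f := fun s => inner ℝ (e p) (slope y t s)) (l := (F : Filter ℝ))
        ?_ ?_
      · simpa only [real_inner_comm] using hw (e p)
      · simp only [← hGslope]
        exact (hasDerivAt_iff_tendsto_slope.1 (hdG p).hasDerivAt).mono_left hF
    -- No norm is lost in the weak limit: the e p have norm at most one and recover every derivative
    -- of the G p, hence their supremum φ t. Weak convergence is therefore strong.
    have hφw : φ t ≤ ‖w‖ := by
      refine Real.iSup_le (fun p => ?_) (norm_nonneg _)
      rw [← hwe]
      exact (abs_real_inner_le_norm _ _).trans (mul_le_of_le_one_left (norm_nonneg _) (he p))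
    have hst := tendsto_of_weak_of_norm (hw w) (hF hle) (hΦs.mono_left hF) hφ0 hφw
    exact ⟨w, (Submodule.isClosed_topologicalClosure _).mem_of_tendsto hst (hF hslS), hst, hwe⟩
  obtain ⟨F₀, hF₀⟩ := Ultrafilter.exists_le (𝓝[≠] t)
  obtain ⟨w₀, hw₀S, -, hw₀⟩ := hlim F₀ hF₀
  refine HasDerivAt.differentiableAt (f' := w₀) (hasDerivAt_iff_tendsto_slope.2 ?_)
  rw [tendsto_iff_ultrafilter]
  intro F hF
  obtain ⟨w, hwS, hwt, hw⟩ := hlim F hF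
  suffices hww : w = w₀ by rw [← hww]; exact hwt
  have horth : w - w₀ ∈ Sᗮ := by
    rw [Submodule.orthogonal_closure, Submodule.mem_orthogonal]
    intro u hu
    induction hu using Submodule.span_induction with
    | mem x hx =>
      obtain ⟨p, rfl⟩ := hx
      have h0 : v p = ‖v p‖ • e p := by
        rcases eq_or_ne ‖v p‖ 0 with h | h
        · rw [h, zero_smul]; exact norm_eq_zero.1 h
        · simp only [e, smul_smul, mul_inv_cancel₀ h, one_smul]
      rw [h0, real_inner_smul_left, inner_sub_right, hw, hw₀, sub_self, mul_zero]
    | zero => simp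
    | add x y _ _ hx hy => rw [inner_add_left, hx, hy, add_zero]
    | smul c x _ hx => rw [real_inner_smul_left, hx, mul_zero]
  have := (Submodule.mem_orthogonal _ _).1 horth (w - w₀) (S.sub_mem hwS hw₀S)
  exact sub_eq_zero.1 (inner_self_eq_zero.1 this)

end Hilbert

end SpringNetwork

namespace SpringNetwork

/-! ### The incremental minimization problem. -/

section RateIndependent


variable {Y : Type*} [NormedAddCommGroup Y] [InnerProductSpace ℝ Y] [CompleteSpace Y]

/-- A quadratic form with coercivity constant `c` and a positively one-homogeneous dissipation
potential. -/
structure IsQuadraticRIS (c : ℝ) (a : Y →L[ℝ] Y →L[ℝ] ℝ) (Ψ : Y → ℝ≥0∞) : Prop where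
  pos : 0 < c
  symm : ∀ u v, a u v = a v u
  coercive : ∀ v, c * ‖v‖ ^ 2 ≤ a v v
  subadd : ∀ u v, Ψ (u + v) ≤ Ψ u + Ψ v
  homog : ∀ (s : ℝ) (v : Y), 0 ≤ s → Ψ (s • v) = ENNReal.ofReal s * Ψ v
  lsc : LowerSemicontinuous Ψ

/-- `f` is a subgradient of `Ψ` at `0`. -/
def IsAdmissibleForce (Ψ : Y → ℝ≥0∞) (f : Y →L[ℝ] ℝ) : Prop :=
  ∀ v, ENNReal.ofReal (f v) ≤ Ψ v

/-- The Euler equation of the minimization of `½ a(v, v) - f(v) + Ψ(v)`. -/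
structure IsIncrement (a : Y →L[ℝ] Y →L[ℝ] ℝ) (Ψ : Y → ℝ≥0∞) (f : Y →L[ℝ] ℝ) (δ : Y) : Prop where
  admissible : IsAdmissibleForce Ψ (f - a δ)
  nonneg : 0 ≤ (f - a δ) δ
  eq : Ψ δ = ENNReal.ofReal ((f - a δ) δ)

/-- Lower semicontinuity in the form in which limits of dissipation bounds are taken. Since
`ENNReal.ofReal` is continuous, the real bounds need no sign. -/
theorem le_ofReal_of_tendsto_of_lsc {Y : Type*} [TopologicalSpace Y] {Ψ : Y → ℝ≥0∞}
    (hΨ : LowerSemicontinuous Ψ) {ι : Type*} {l : Filter ι} [l.NeBot] {u : ι → Y} {v : Y}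
    {r : ι → ℝ} {s : ℝ} (hu : Tendsto u l (𝓝 v)) (hr : Tendsto r l (𝓝 s))
    (h : ∀ᶠ i in l, Ψ (u i) ≤ ENNReal.ofReal (r i)) : Ψ v ≤ ENNReal.ofReal s := by
  by_contra! hlt
  obtain ⟨x, hx1, hx2⟩ := exists_between hlt
  have h1 := hu.eventually (hΨ v x hx2)
  have h2 := (tendsto_order.1 ((ENNReal.continuous_ofReal.tendsto s).comp hr)).2 x hx1
  obtain ⟨i, ⟨hi1, hi2⟩, hi3⟩ := ((h1.and h2).and h).exists
  exact absurd (hi3.trans_lt hi2) (not_lt.2 hi1.le)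

/-- Dividing by s and letting s tend to zero turns a minimality inequality into its first-order
condition. A single small s suffices. -/
theorem nonneg_of_forall_pos_mul_add {A B : ℝ}
    (h : ∀ s : ℝ, 0 < s → s ≤ 1 → 0 ≤ s * A + s ^ 2 * B) : 0 ≤ A := by
  by_contra! hA
  have hB : 0 < B := by
    have := h 1 one_pos le_rfl
    linarith
  -- For this s one has s B ≤ -A / 2, so that s A + s² B ≤ s A / 2 < 0.
  have h1 := h (min 1 (-A / (2 * B))) (lt_min one_pos (by apply div_pos <;> linarith))
    (min_le_left _ _)
  have h2 : min 1 (-A / (2 * B)) * B ≤ -A / 2 := by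
    calc min 1 (-A / (2 * B)) * B ≤ -A / (2 * B) * B :=
          mul_le_mul_of_nonneg_right (min_le_right _ _) hB.le
      _ = -A / 2 := by field_simp
  have h3 : 0 < min 1 (-A / (2 * B)) := lt_min one_pos (by apply div_pos <;> linarith)
  nlinarith

namespace IsQuadraticRIS

variable {c : ℝ} {a : Y →L[ℝ] Y →L[ℝ] ℝ} {Ψ : Y → ℝ≥0∞} (h : IsQuadraticRIS c a Ψ)
include h

theorem zero : Ψ 0 = 0 := by
  have := h.homog 0 0 le_rfl
  simpa using this

theorem form_nonneg (v : Y) : 0 ≤ a v v :=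
  (mul_nonneg h.pos.le (sq_nonneg _)).trans (h.coercive v)

/-- The direct method needs no weak compactness: coercivity makes the functional strongly convex, so
minimizing sequences are Cauchy, and lower semicontinuity of Ψ makes their limit a minimizer. The
Euler equation then results from two kinds of variations. -/
theorem exists_isIncrement (f : Y →L[ℝ] ℝ) : ∃ δ, IsIncrement a Ψ f δ := by
  let J : Y → ℝ := fun v => 1 / 2 * a v v - f v + (Ψ v).toReal
  let D : Set Y := {v | Ψ v ≠ ∞}
  have h0 : (0 : Y) ∈ D := by simp [D, h.zero]
  have hbelow : ∀ v, -(‖f‖ ^ 2 / (2 * c)) ≤ J v := by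
    intro v
    have h1 := h.coercive v
    have h2 := (le_abs_self _).trans (f.le_opNorm v)
    have h3 : 0 ≤ (Ψ v).toReal := ENNReal.toReal_nonneg
    have h4 : ‖f‖ ^ 2 / (2 * c) + c / 2 * ‖v‖ ^ 2 - ‖f‖ * ‖v‖ =
        (‖f‖ - c * ‖v‖) ^ 2 / (2 * c) := by
      have := h.pos.ne'
      field_simp
      ring
    have h5 : 0 ≤ (‖f‖ - c * ‖v‖) ^ 2 / (2 * c) := by
      have := h.pos
      positivity
    simp only [J]
    linarith
  have hbdd : BddBelow (J '' D) := ⟨_, forall_mem_image.2 fun v _ => hbelow v⟩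
  have hne : (J '' D).Nonempty := ⟨_, mem_image_of_mem J h0⟩
  set m := sInf (J '' D) with hm
  have hmin : ∀ v ∈ D, m ≤ J v := fun v hv => csInf_le hbdd (mem_image_of_mem J hv)
  obtain ⟨r, -, hr, hrD⟩ := exists_seq_tendsto_sInf hne hbdd
  choose v hvD hvr using hrD
  have hvJ : Tendsto (fun n => J (v n)) atTop (𝓝 m) := by simpa only [hvr] using hr
  -- strong convexity
  have hconv : ∀ x ∈ D, ∀ y ∈ D, c / 4 * ‖x - y‖ ^ 2 ≤ J x + J y - 2 * m := by
    intro x hx y hy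
    have hΨ : Ψ ((1 / 2 : ℝ) • (x + y)) ≤ ENNReal.ofReal (1 / 2) * (Ψ x + Ψ y) := by
      rw [h.homog _ _ (by norm_num)]
      gcongr
      exact h.subadd x y
    have hfin : ENNReal.ofReal (1 / 2) * (Ψ x + Ψ y) ≠ ∞ :=
      ENNReal.mul_ne_top ENNReal.ofReal_ne_top (ENNReal.add_ne_top.2 ⟨hx, hy⟩)
    have hD : (1 / 2 : ℝ) • (x + y) ∈ D := ne_top_of_le_ne_top hfin hΨ
    have h1 := hmin _ hD
    have h2 := ENNReal.toReal_mono hfin hΨ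
    rw [ENNReal.toReal_mul, ENNReal.toReal_ofReal (by norm_num), ENNReal.toReal_add hx hy] at h2
    have h3 := h.coercive (x - y)
    have h4 := h.symm x y
    simp only [J, map_smul, map_add, map_sub, smul_apply,
      add_apply, sub_apply, smul_eq_mul] at h1 h3 ⊢
    linarith
  have hcauchy : CauchySeq v := by
    rw [Metric.cauchySeq_iff']
    intro e he
    have hpos : 0 < c / 8 * e ^ 2 := by have := h.pos; positivity
    obtain ⟨N, hN⟩ := eventually_atTop.1 ((tendsto_order.1 hvJ).2 (m + c / 8 * e ^ 2) (by linarith))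
    refine ⟨N, fun n hn => ?_⟩
    have h1 := hconv _ (hvD n) _ (hvD N)
    have h2 := hN n hn
    have h3 := hN N le_rfl
    rw [dist_eq_norm]
    have h4 : c / 4 * ‖v n - v N‖ ^ 2 < c / 4 * e ^ 2 := by linarith
    have h5 := lt_of_mul_lt_mul_left h4 (by have := h.pos; positivity)
    exact lt_of_pow_lt_pow_left₀ 2 he.le h5
  obtain ⟨δ, hδ⟩ := cauchySeq_tendsto_of_complete hcauchy
  have hform : Continuous fun v => 1 / 2 * a v v - f v := by fun_prop
  have hΨδ : Ψ δ ≤ ENNReal.ofReal (m - (1 / 2 * a δ δ - f δ)) := by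
    refine le_ofReal_of_tendsto_of_lsc h.lsc hδ (hvJ.sub ((hform.tendsto δ).comp hδ))
      (Eventually.of_forall fun n => ?_)
    have : J (v n) - ((fun v => 1 / 2 * a v v - f v) ∘ v) n = (Ψ (v n)).toReal := by
      simp [J]
    rw [this, ENNReal.ofReal_toReal (hvD n)]
  have hδD : δ ∈ D := ne_top_of_le_ne_top ENNReal.ofReal_ne_top hΨδ
  have hδJ : ∀ w ∈ D, J δ ≤ J w := by
    intro w hw
    have h2 : (Ψ δ).toReal ≤ max (m - (1 / 2 * a δ δ - f δ)) 0 := by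
      have := ENNReal.toReal_mono ENNReal.ofReal_ne_top hΨδ
      rwa [ENNReal.toReal_ofReal'] at this
    have h3 : 0 ≤ m - (1 / 2 * a δ δ - f δ) := by
      refine ge_of_tendsto' (hvJ.sub ((hform.tendsto δ).comp hδ)) fun n => ?_
      simp [J]
    rw [max_eq_left h3] at h2
    refine le_trans ?_ (hmin w hw)
    simp only [J]
    linarith
  -- The variations δ + s w cost at most s Ψ(w) more dissipation, by subadditivity and homogeneity;
  -- this yields the inequality for every direction w.
  have hadm : IsAdmissibleForce Ψ (f - a δ) := by
    intro w
    rcases eq_or_ne (Ψ w) ∞ with hw | hw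
    · simp [hw]
    refine ENNReal.ofReal_le_of_le_toReal ?_
    have : 0 ≤ a δ w - f w + (Ψ w).toReal := by
      refine nonneg_of_forall_pos_mul_add (B := 1 / 2 * a w w) fun s hs _ => ?_
      have hΨ : Ψ (δ + s • w) ≤ Ψ δ + ENNReal.ofReal s * Ψ w := by
        rw [← h.homog s w hs.le]; exact h.subadd _ _
      have hfin : Ψ δ + ENNReal.ofReal s * Ψ w ≠ ∞ :=
        ENNReal.add_ne_top.2 ⟨hδD, ENNReal.mul_ne_top ENNReal.ofReal_ne_top hw⟩
      have h1 := hδJ (δ + s • w) (ne_top_of_le_ne_top hfin hΨ)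
      have h2 := ENNReal.toReal_mono hfin hΨ
      rw [ENNReal.toReal_add hδD (ENNReal.mul_ne_top ENNReal.ofReal_ne_top hw),
        ENNReal.toReal_mul, ENNReal.toReal_ofReal hs.le] at h2
      have h3 := h.symm w δ
      simp only [J, map_smul, map_add, smul_apply,
        add_apply, smul_eq_mul] at h1
      nlinarith
    simp only [sub_apply]
    linarith
  -- Shrinking δ to (1 - s) δ releases exactly s Ψ(δ), which bounds Ψ(δ) by the force on δ. The
  -- reverse bound is admissibility.
  have hle : (Ψ δ).toReal ≤ (f - a δ) δ := by
    have : 0 ≤ -a δ δ + f δ - (Ψ δ).toReal := by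
      refine nonneg_of_forall_pos_mul_add (B := 1 / 2 * a δ δ) fun s hs hs1 => ?_
      have hΨ : Ψ ((1 - s) • δ) = ENNReal.ofReal (1 - s) * Ψ δ := h.homog _ _ (by linarith)
      have h1 := hδJ ((1 - s) • δ) (by
        simp only [D, mem_ofPred_eq, hΨ]; exact ENNReal.mul_ne_top ENNReal.ofReal_ne_top hδD)
      simp only [J, hΨ, map_smul, smul_apply, smul_eq_mul,
        ENNReal.toReal_mul, ENNReal.toReal_ofReal (show (0 : ℝ) ≤ 1 - s by linarith)] at h1
      nlinarith
    simp only [sub_apply]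
    linarith
  exact ⟨δ, hadm, ENNReal.toReal_nonneg.trans hle, le_antisymm
    (by rw [← ENNReal.ofReal_toReal hδD]; exact ENNReal.ofReal_le_ofReal hle) (hadm δ)⟩

omit h in
/-- Admissible forces are bounded by the increment's force on the increment. -/
theorem _root_.SpringNetwork.IsIncrement.le {f g : Y →L[ℝ] ℝ} {δ : Y} (hδ : IsIncrement a Ψ f δ)
    (hg : IsAdmissibleForce Ψ g) : g δ ≤ (f - a δ) δ := by
  have := hg δ
  rw [hδ.eq] at this
  exact (ENNReal.ofReal_le_ofReal_iff hδ.nonneg).1 this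

/-- The old force is still admissible, so it acts on δ no more strongly than the new one. This
leaves a(δ, δ) ≤ (l' - l)(δ): a step is controlled by the change of the load alone. -/
theorem increment_bound {l l' : Y →L[ℝ] ℝ} {y δ : Y} {Λ : ℝ} (hl : ‖l' - l‖ ≤ Λ)
    (hy : IsAdmissibleForce Ψ (l - a y)) (hδ : IsIncrement a Ψ (l' - a y) δ) :
    ‖δ‖ ≤ Λ / c ∧ a δ δ ≤ Λ ^ 2 / c := by
  have h1 := hδ.le hy
  have h2 : a δ δ ≤ Λ * ‖δ‖ := by
    have := (le_abs_self _).trans ((l' - l).le_opNorm δ)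
    have h3 : ‖l' - l‖ * ‖δ‖ ≤ Λ * ‖δ‖ := mul_le_mul_of_nonneg_right hl (norm_nonneg _)
    simp only [sub_apply] at h1 this
    linarith
  have h3 := h.coercive δ
  have hc := h.pos
  have hΛ : 0 ≤ Λ := (norm_nonneg _).trans hl
  have h4 : ‖δ‖ ≤ Λ / c := by
    rw [le_div_iff₀ hc]
    rcases eq_or_lt_of_le (norm_nonneg δ) with h0 | h0
    · rw [← h0, zero_mul]; exact hΛ
    · have : ‖δ‖ * (‖δ‖ * c) ≤ ‖δ‖ * Λ := by nlinarith
      exact le_of_mul_le_mul_left this h0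
  refine ⟨h4, h2.trans ?_⟩
  calc Λ * ‖δ‖ ≤ Λ * (Λ / c) := mul_le_mul_of_nonneg_left h4 hΛ
    _ = Λ ^ 2 / c := by ring

/-- Comparison of one coarse step with two fine steps. -/
theorem refinement_bound {l₀ l₁ l₂ : Y →L[ℝ] ℝ} {y y' δ δ₁ δ₂ : Y} {Λ : ℝ}
    (h01 : ‖l₁ - l₀‖ ≤ Λ) (h12 : ‖l₂ - l₁‖ ≤ Λ) (hy' : IsAdmissibleForce Ψ (l₀ - a y'))
    (hδ : IsIncrement a Ψ (l₂ - a y) δ) (hδ₁ : IsIncrement a Ψ (l₁ - a y') δ₁)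
    (hδ₂ : IsIncrement a Ψ (l₂ - a (y' + δ₁)) δ₂) :
    a (y + δ - (y' + δ₁ + δ₂)) (y + δ - (y' + δ₁ + δ₂)) ≤
      a (y - y') (y - y') + 4 * (Λ ^ 2 / c) := by
  have hadm₁ : IsAdmissibleForce Ψ (l₁ - a (y' + δ₁)) := by
    have := hδ₁.admissible
    rwa [sub_sub, ← map_add] at this
  obtain ⟨b1, c1⟩ := h.increment_bound h01 hy' hδ₁
  obtain ⟨b2, c2⟩ := h.increment_bound h12 hadm₁ hδ₂
  -- Let X be the new difference of the two states and D = δ - δ₁ - δ₂. Then a(X, X) = a(y - y', y -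
  -- y') + 2 a(X, D) - a(D, D), and adding e1, e2, e3 gives a(X, D) ≤ (l₁ - l₂)(δ₁) + a(δ₁, δ₂),
  -- which is at most 2Λ²/c.
  have e1 := hδ.le hδ₂.admissible
  have e2 := hδ₂.le hδ.admissible
  have e3 := hδ₁.le hδ.admissible
  have hD := h.form_nonneg (δ - δ₁ - δ₂)
  have hd := h.form_nonneg (δ₁ - δ₂)
  have hl : (l₁ - l₂) δ₁ ≤ Λ ^ 2 / c := by
    have t1 := (le_abs_self _).trans ((l₁ - l₂).le_opNorm δ₁)
    have hΛ : 0 ≤ Λ := (norm_nonneg _).trans h01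
    rw [norm_sub_rev] at h12
    calc (l₁ - l₂) δ₁ ≤ ‖l₁ - l₂‖ * ‖δ₁‖ := t1
      _ ≤ Λ * (Λ / c) := mul_le_mul h12 b1 (norm_nonneg _) hΛ
      _ = Λ ^ 2 / c := by ring
  have s1 := h.symm y y'
  have s2 := h.symm y δ
  have s3 := h.symm y δ₁
  have s4 := h.symm y δ₂
  have s5 := h.symm y' δ
  have s6 := h.symm y' δ₁
  have s7 := h.symm y' δ₂
  have s8 := h.symm δ δ₁
  have s9 := h.symm δ δ₂
  have s10 := h.symm δ₁ δ₂
  simp only [map_add, map_sub, add_apply, sub_apply] at *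
  linarith

end IsQuadraticRIS

end RateIndependent

end SpringNetwork

namespace SpringNetwork

/-! ### The time-incremental scheme and its dyadic refinement. -/

section Scheme


variable {Y : Type*} [NormedAddCommGroup Y] [InnerProductSpace ℝ Y] [CompleteSpace Y]
  {c : ℝ} {a : Y →L[ℝ] Y →L[ℝ] ℝ} {Ψ : Y → ℝ≥0∞} (h : IsQuadraticRIS c a Ψ)

/-- The time-incremental minimization scheme for the loads `ℓ`. -/
noncomputable def scheme (ℓ : ℕ → Y →L[ℝ] ℝ) (y₀ : Y) : ℕ → Y
  | 0 => y₀
  | k + 1 => scheme ℓ y₀ k + (h.exists_isIncrement (ℓ (k + 1) - a (scheme ℓ y₀ k))).choose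

section

variable {ℓ : ℕ → Y →L[ℝ] ℝ} {y₀ : Y}

theorem scheme_isIncrement (k : ℕ) : IsIncrement a Ψ (ℓ (k + 1) - a (scheme h ℓ y₀ k))
    (scheme h ℓ y₀ (k + 1) - scheme h ℓ y₀ k) := by
  rw [scheme, add_sub_cancel_left]
  exact (h.exists_isIncrement _).choose_spec

/-- Stability propagates: the Euler equation of each step states that the force after the step is
admissible. -/
theorem scheme_admissible (h₀ : IsAdmissibleForce Ψ (ℓ 0 - a y₀)) (k : ℕ) :
    IsAdmissibleForce Ψ (ℓ k - a (scheme h ℓ y₀ k)) := by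
  cases k with
  | zero => exact h₀
  | succ k =>
    have := (scheme_isIncrement h (ℓ := ℓ) (y₀ := y₀) k).admissible
    rwa [sub_sub, ← map_add, add_sub_cancel] at this

theorem scheme_step_le (h₀ : IsAdmissibleForce Ψ (ℓ 0 - a y₀)) {Λ : ℝ}
    (hΛ : ∀ k, ‖ℓ (k + 1) - ℓ k‖ ≤ Λ) (k : ℕ) :
    ‖scheme h ℓ y₀ (k + 1) - scheme h ℓ y₀ k‖ ≤ Λ / c :=
  (h.increment_bound (hΛ k) (scheme_admissible h h₀ k) (scheme_isIncrement h k)).1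

theorem scheme_dist_le (h₀ : IsAdmissibleForce Ψ (ℓ 0 - a y₀)) {Λ : ℝ}
    (hΛ : ∀ k, ‖ℓ (k + 1) - ℓ k‖ ≤ Λ) {m n : ℕ} (hmn : m ≤ n) :
    ‖scheme h ℓ y₀ n - scheme h ℓ y₀ m‖ ≤ Λ / c * ((n : ℝ) - m) := by
  induction n, hmn using Nat.le_induction with
  | base => simp
  | succ n hn ih =>
    have h1 := scheme_step_le h h₀ hΛ n
    have h2 := norm_sub_le_norm_sub_add_norm_sub (scheme h ℓ y₀ (n + 1)) (scheme h ℓ y₀ n)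
      (scheme h ℓ y₀ m)
    push_cast
    linarith

/-- Each coarse step adds at most 4Λ²/c to the squared energy distance. With Λ proportional to the
time step, the sum over all steps is of the order of a single time step. -/
theorem scheme_refine {ℓ' : ℕ → Y →L[ℝ] ℝ} (hℓ : ∀ k, ℓ' (2 * k) = ℓ k)
    (h₀ : IsAdmissibleForce Ψ (ℓ 0 - a y₀)) {Λ : ℝ}
    (hΛ : ∀ k, ‖ℓ' (k + 1) - ℓ' k‖ ≤ Λ) (k : ℕ) :
    c * ‖scheme h ℓ y₀ k - scheme h ℓ' y₀ (2 * k)‖ ^ 2 ≤ k * (4 * (Λ ^ 2 / c)) := by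
  refine (h.coercive _).trans ?_
  induction k with
  | zero => simp [scheme]
  | succ k ih =>
    have h₀' : IsAdmissibleForce Ψ (ℓ' 0 - a y₀) := by have := hℓ 0; rw [mul_zero] at this; rwa [this]
    have i1 := scheme_isIncrement h (ℓ := ℓ) (y₀ := y₀) k
    have i2 := scheme_isIncrement h (ℓ := ℓ') (y₀ := y₀) (2 * k)
    have i3 := scheme_isIncrement h (ℓ := ℓ') (y₀ := y₀) (2 * k + 1)
    rw [← hℓ (k + 1), show 2 * (k + 1) = 2 * k + 1 + 1 by ring] at i1
    have ha : scheme h ℓ' y₀ (2 * k) + (scheme h ℓ' y₀ (2 * k + 1) - scheme h ℓ' y₀ (2 * k)) =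
      scheme h ℓ' y₀ (2 * k + 1) := add_sub_cancel _ _
    have := h.refinement_bound (hΛ (2 * k)) (hΛ (2 * k + 1)) (scheme_admissible h h₀' (2 * k)) i1 i2
      (by rw [ha]; exact i3)
    rw [ha, add_sub_cancel, add_sub_cancel] at this
    rw [show 2 * (k + 1) = 2 * k + 1 + 1 by ring]
    push_cast
    linarith

/-- The dissipated energy along the scheme. -/
theorem scheme_dissipation_le (h₀ : IsAdmissibleForce Ψ (ℓ 0 - a y₀)) {Λ : ℝ}
    (hΛ : ∀ k, ‖ℓ (k + 1) - ℓ k‖ ≤ Λ) {m n : ℕ} (hmn : m ≤ n) :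
    ∃ S : ℝ, 0 ≤ S ∧
      Ψ (scheme h ℓ y₀ n - scheme h ℓ y₀ m) ≤ ENNReal.ofReal S ∧
      S ≤ (ℓ m - a (scheme h ℓ y₀ m)) (scheme h ℓ y₀ n - scheme h ℓ y₀ m) +
        (Λ + ‖a‖ * (Λ / c)) * (Λ / c) * ((n : ℝ) - m) ^ 2 := by
  have hΛ0 : 0 ≤ Λ := (norm_nonneg _).trans (hΛ 0)
  have hc := h.pos
  induction n, hmn using Nat.le_induction with
  | base => exact ⟨0, le_rfl, by simp [h.zero], by simp⟩
  | succ n hn ih =>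
    obtain ⟨S, hS0, hS1, hS2⟩ := ih
    set y := scheme h ℓ y₀ with hy
    have i1 := scheme_isIncrement h (ℓ := ℓ) (y₀ := y₀) n
    rw [← hy] at i1
    refine ⟨S + (ℓ (n + 1) - a (y n) - a (y (n + 1) - y n)) (y (n + 1) - y n),
      add_nonneg hS0 i1.nonneg, ?_, ?_⟩
    · rw [ENNReal.ofReal_add hS0 i1.nonneg, ← i1.eq]
      refine le_trans ?_ (add_le_add_left hS1 _)
      have : y (n + 1) - y m = (y n - y m) + (y (n + 1) - y n) := by abel
      rw [this]
      exact h.subadd _ _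
    · have hl : ‖ℓ (n + 1) - ℓ m‖ ≤ Λ * ((n + 1 : ℝ) - m) := by
        clear hS2 hS1 i1
        clear hy y
        induction n, hn using Nat.le_induction with
        | base => simpa using hΛ m
        | succ k _ ihk =>
          have := norm_sub_le_norm_sub_add_norm_sub (ℓ (k + 1 + 1)) (ℓ (k + 1)) (ℓ m)
          have := hΛ (k + 1)
          push_cast
          linarith
      have hd1 : ‖y (n + 1) - y n‖ ≤ Λ / c := scheme_step_le h h₀ hΛ n
      have hd2 : ‖y (n + 1) - y m‖ ≤ Λ / c * ((n + 1 : ℝ) - m) := by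
        have := scheme_dist_le h h₀ hΛ (show m ≤ n + 1 by omega)
        push_cast at this
        exact this
      have hmn' : (m : ℝ) ≤ n := by exact_mod_cast hn
      have hΛc : 0 ≤ Λ / c := div_nonneg hΛ0 hc.le
      have t1 : (ℓ (n + 1) - ℓ m) (y (n + 1) - y n) ≤ Λ * ((n + 1 : ℝ) - m) * (Λ / c) :=
        ((le_abs_self _).trans ((ℓ (n + 1) - ℓ m).le_opNorm _)).trans
          (mul_le_mul hl hd1 (norm_nonneg _) (mul_nonneg hΛ0 (by linarith)))
      have t2 : -(a (y (n + 1) - y m) (y (n + 1) - y n)) ≤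
          ‖a‖ * (Λ / c * ((n + 1 : ℝ) - m)) * (Λ / c) := by
        have hn1 : 0 ≤ (n + 1 : ℝ) - m := by linarith
        refine ((neg_le_abs _).trans (a.le_opNorm₂ _ _)).trans ?_
        gcongr
      -- The force dissipated in the last step is replaced by the force at index m. Both corrections
      -- are of order n + 1 - m times a step length, so they add up to an error quadratic in n - m.
      have e1 : (ℓ (n + 1) - a (y n) - a (y (n + 1) - y n)) (y (n + 1) - y n) =
          (ℓ m - a (y m)) (y (n + 1) - y n) + (ℓ (n + 1) - ℓ m) (y (n + 1) - y n) -
            a (y (n + 1) - y m) (y (n + 1) - y n) := by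
        simp only [sub_apply, map_sub]
        ring
      have e2 : (ℓ m - a (y m)) (y (n + 1) - y m) =
          (ℓ m - a (y m)) (y n - y m) + (ℓ m - a (y m)) (y (n + 1) - y n) := by
        rw [← map_add]; congr 1; abel
      have hK : 0 ≤ (Λ + ‖a‖ * (Λ / c)) * (Λ / c) := by positivity
      rw [e1, e2]
      simp only [Nat.cast_add, Nat.cast_one]
      have e3 : (Λ + ‖a‖ * (Λ / c)) * (Λ / c) * ((n + 1 : ℝ) - m) ^ 2 =
          (Λ + ‖a‖ * (Λ / c)) * (Λ / c) * ((n : ℝ) - m) ^ 2 +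
          (Λ * ((n + 1 : ℝ) - m) * (Λ / c) + ‖a‖ * (Λ / c * ((n + 1 : ℝ) - m)) * (Λ / c)) +
          (Λ + ‖a‖ * (Λ / c)) * (Λ / c) * ((n : ℝ) - m) := by ring
      have e4 : 0 ≤ (Λ + ‖a‖ * (Λ / c)) * (Λ / c) * ((n : ℝ) - m) :=
        mul_nonneg hK (by linarith)
      linarith
end

/-! ### Refinement limit -/

variable (ℓ : ℝ → Y →L[ℝ] ℝ) (y₀ : Y) (T : ℝ)

/-- The loads at the nodes of the dyadic partition of `[0, T]` of level `j`. -/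
noncomputable def dyadicLoad (j k : ℕ) : Y →L[ℝ] ℝ := ℓ (T * k / 2 ^ j)

/-- The index of the dyadic interval of level `j` that contains `t`. -/
noncomputable def dyadicIndex (j : ℕ) (t : ℝ) : ℕ := ⌊t / T * 2 ^ j⌋₊

/-- The piecewise constant interpolation of the scheme on the dyadic partition of level `j`. -/
noncomputable def dyadicApprox (j : ℕ) (t : ℝ) : Y :=
  scheme h (dyadicLoad ℓ T j) y₀ (dyadicIndex T j t)

variable {ℓ y₀ T} {L : ℝ} (hT : 0 < T) (hℓ : ∀ s t, ‖ℓ s - ℓ t‖ ≤ L * |s - t|)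
  (h₀ : IsAdmissibleForce Ψ (ℓ 0 - a y₀))

include hT in
theorem dyadicIndex_time {t : ℝ} (ht : 0 ≤ t) (j : ℕ) :
    T * dyadicIndex T j t / 2 ^ j ≤ t ∧ t < T * (dyadicIndex T j t + 1) / 2 ^ j := by
  have h2 : (0 : ℝ) < 2 ^ j := by positivity
  have hx : 0 ≤ t / T * 2 ^ j := by positivity
  constructor
  · rw [div_le_iff₀ h2]
    have := mul_le_mul_of_nonneg_left (Nat.floor_le hx) hT.le
    refine this.trans (le_of_eq ?_)
    field_simp
  · rw [lt_div_iff₀ h2]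
    have := mul_lt_mul_of_pos_left (Nat.lt_floor_add_one (t / T * 2 ^ j)) hT
    refine lt_of_eq_of_lt ?_ this
    field_simp

include hT in
theorem tendsto_dyadicIndex_time {t : ℝ} (ht : 0 ≤ t) :
    Tendsto (fun j => T * dyadicIndex T j t / 2 ^ j) atTop (𝓝 t) := by
  have h1 : Tendsto (fun j : ℕ => t - T * (1 / 2) ^ j) atTop (𝓝 t) := by
    have := (tendsto_pow_atTop_nhds_zero_of_lt_one (r := (1 / 2 : ℝ)) (by norm_num)
      (by norm_num)).const_mul T
    simpa using tendsto_const_nhds.sub this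
  refine tendsto_of_tendsto_of_tendsto_of_le_of_le h1 tendsto_const_nhds (fun j => ?_)
    (fun j => (dyadicIndex_time hT ht j).1)
  have := (dyadicIndex_time hT ht j).2
  rw [mul_add, add_div, mul_one] at this
  simp only [one_div, inv_pow]
  rw [← div_eq_mul_inv]
  linarith

theorem dyadicIndex_mono (hT : 0 < T) (j : ℕ) {s t : ℝ} (hst : s ≤ t) :
    dyadicIndex T j s ≤ dyadicIndex T j t :=
  Nat.floor_le_floor (by gcongr)

include hT hℓ in
theorem dyadicLoad_step (j k : ℕ) :
    ‖dyadicLoad ℓ T j (k + 1) - dyadicLoad ℓ T j k‖ ≤ L * (T / 2 ^ j) := by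
  refine (hℓ _ _).trans (le_of_eq ?_)
  have : T * ((k + 1 : ℕ) : ℝ) / 2 ^ j - T * k / 2 ^ j = T / 2 ^ j := by push_cast; ring
  rw [this, abs_of_pos (by positivity)]

include h₀ in
theorem dyadicLoad_zero (j : ℕ) : IsAdmissibleForce Ψ (dyadicLoad ℓ T j 0 - a y₀) := by
  simpa [dyadicLoad] using h₀

include hℓ in
theorem lipschitz_const_nonneg : 0 ≤ L := by
  have := (norm_nonneg _).trans (hℓ 1 0)
  simpa using this

/-- The rate constant `1 / √2` of the dyadic approximation. -/
noncomputable def dyadicRate : ℝ := Real.sqrt (1 / 2)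

theorem dyadicRate_sq : dyadicRate ^ 2 = 1 / 2 := Real.sq_sqrt (by norm_num)
theorem dyadicRate_nonneg : 0 ≤ dyadicRate := Real.sqrt_nonneg _
theorem dyadicRate_lt_one : dyadicRate < 1 := by
  have := dyadicRate_sq
  nlinarith [dyadicRate_nonneg]

theorem half_pow_le_dyadicRate_pow (j : ℕ) : (1 / 2 : ℝ) ^ j ≤ dyadicRate ^ j := by
  refine pow_le_pow_left₀ (by norm_num) ?_ j
  have := dyadicRate_sq
  nlinarith [dyadicRate_nonneg, dyadicRate_lt_one]

include hT hℓ h₀ in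
-- A time with index k at level j has index 2k or 2k + 1 at level j + 1. The states k and 2k are
-- compared by `scheme_refine` with k ≤ 2^j and Λ = L T / 2^(j+1), so the squared distance is of
-- order 2^(-j); a possible odd step adds one step length. The two contributions explain the factor
-- 2.
theorem dyadicApprox_succ {t : ℝ} (ht : t ∈ Icc 0 T) (j : ℕ) :
    dist (dyadicApprox h ℓ y₀ T j t) (dyadicApprox h ℓ y₀ T (j + 1) t) ≤
      2 * (L * T / c) * dyadicRate ^ j := by
  have hc := h.pos
  have hL := lipschitz_const_nonneg hℓ
  set k := dyadicIndex T j t with hk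
  have hx : 0 ≤ t / T * 2 ^ j := by have := ht.1; positivity
  have hkj : (k : ℝ) ≤ 2 ^ j := by
    refine (Nat.floor_le hx).trans ?_
    have : t / T ≤ 1 := (div_le_one hT).2 ht.2
    calc t / T * 2 ^ j ≤ 1 * 2 ^ j := by gcongr
      _ = 2 ^ j := one_mul _
  have hk' : dyadicIndex T (j + 1) t = 2 * k ∨ dyadicIndex T (j + 1) t = 2 * k + 1 := by
    have h1 : 2 * k ≤ dyadicIndex T (j + 1) t := by
      refine Nat.le_floor ?_
      have := Nat.floor_le hx
      rw [pow_succ]; push_cast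
      simp only [hk, dyadicIndex]
      linarith
    have h2 : dyadicIndex T (j + 1) t < 2 * k + 2 := by
      refine (Nat.floor_lt' (by omega)).2 ?_
      have := Nat.lt_floor_add_one (t / T * 2 ^ j)
      rw [pow_succ]; push_cast
      simp only [hk, dyadicIndex]
      linarith
    omega
  have hstep := dyadicLoad_step hT hℓ (j + 1)
  have h1 := scheme_refine h (ℓ := dyadicLoad ℓ T j) (ℓ' := dyadicLoad ℓ T (j + 1)) (y₀ := y₀)
    (fun k => by simp only [dyadicLoad]; congr 1; rw [pow_succ]; push_cast; field_simp)
    (dyadicLoad_zero h₀ j) hstep k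
  have h2 := scheme_step_le h (dyadicLoad_zero h₀ (j + 1)) hstep (2 * k)
  have hr := dyadicRate_nonneg
  have hr2 : (dyadicRate ^ j) ^ 2 = (1 / 2) ^ j := by rw [← pow_mul, mul_comm, pow_mul, dyadicRate_sq]
  have hpow : (1 / 2 : ℝ) ^ j * 2 ^ j = 1 := by rw [← mul_pow]; norm_num
  have h3 : ‖scheme h (dyadicLoad ℓ T j) y₀ k - scheme h (dyadicLoad ℓ T (j + 1)) y₀ (2 * k)‖ ≤
      L * T / c * dyadicRate ^ j := by
    refine (sq_le_sq₀ (norm_nonneg _) (by positivity)).1 ?_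
    refine le_of_mul_le_mul_left ?_ hc
    refine h1.trans ?_
    calc (k : ℝ) * (4 * ((L * (T / 2 ^ (j + 1))) ^ 2 / c))
        ≤ 2 ^ j * (4 * ((L * (T / 2 ^ (j + 1))) ^ 2 / c)) := by gcongr
      _ = c * (L * T / c * dyadicRate ^ j) ^ 2 := by
        rw [mul_pow (L * T / c), hr2, one_div, inv_pow]
        field_simp
        ring
  have h4 : L * (T / 2 ^ (j + 1)) / c ≤ L * T / c * dyadicRate ^ j := by
    have := half_pow_le_dyadicRate_pow j
    calc L * (T / 2 ^ (j + 1)) / c = L * T / c * ((1 / 2) ^ j * (1 / 2)) := by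
          rw [pow_succ, one_div, inv_pow]; field_simp
      _ ≤ L * T / c * (dyadicRate ^ j * 1) := by gcongr; norm_num
      _ = _ := by rw [mul_one]
  have h5 : 0 ≤ L * T / c * dyadicRate ^ j := by positivity
  rw [dyadicApprox, dyadicApprox, ← hk]
  rcases hk' with hk' | hk'
  · rw [hk', dist_eq_norm]; linarith
  · rw [hk']
    refine (dist_triangle _ (scheme h (dyadicLoad ℓ T (j + 1)) y₀ (2 * k)) _).trans ?_
    rw [dist_eq_norm, dist_eq_norm, norm_sub_rev (scheme h (dyadicLoad ℓ T (j + 1)) y₀ (2 * k))]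
    linarith

include hT hℓ h₀ in
theorem exists_dyadicLimit : ∃ y : ℝ → Y, ∀ t ∈ Icc 0 T,
    Tendsto (fun j => dyadicApprox h ℓ y₀ T j t) atTop (𝓝 (y t)) ∧
    ∀ j, dist (dyadicApprox h ℓ y₀ T j t) (y t) ≤
      2 * (L * T / c) * dyadicRate ^ j / (1 - dyadicRate) := by
  have : ∀ t, ∃ z, t ∈ Icc 0 T → Tendsto (fun j => dyadicApprox h ℓ y₀ T j t) atTop (𝓝 z) := by
    intro t
    by_cases ht : t ∈ Icc 0 T
    · obtain ⟨z, hz⟩ := cauchySeq_tendsto_of_complete (cauchySeq_of_le_geometric dyadicRate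
        (2 * (L * T / c)) dyadicRate_lt_one (dyadicApprox_succ h hT hℓ h₀ ht))
      exact ⟨z, fun _ => hz⟩
    · exact ⟨0, fun h => absurd h ht⟩
  choose y hy using this
  exact ⟨y, fun t ht => ⟨hy t ht, dist_le_of_le_geometric_of_tendsto dyadicRate
    (2 * (L * T / c)) dyadicRate_lt_one (dyadicApprox_succ h hT hℓ h₀ ht) (hy t ht)⟩⟩

/-- The limit of the scheme is Lipschitz, starts at `y₀`, is stable, and satisfies a local
dissipation estimate. -/
theorem dyadicLimit_properties (hT : 0 < T) (hℓ : ∀ s t, ‖ℓ s - ℓ t‖ ≤ L * |s - t|)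
    (h₀ : IsAdmissibleForce Ψ (ℓ 0 - a y₀)) {y : ℝ → Y}
    (hy : ∀ t ∈ Icc 0 T, Tendsto (fun j => dyadicApprox h ℓ y₀ T j t) atTop (𝓝 (y t))) :
    y 0 = y₀ ∧ (∀ t ∈ Icc 0 T, IsAdmissibleForce Ψ (ℓ t - a (y t))) ∧
    (∀ s ∈ Icc 0 T, ∀ t ∈ Icc 0 T, s ≤ t → ‖y t - y s‖ ≤ L / c * (t - s)) ∧
    ∃ K : ℝ, ∀ s ∈ Icc 0 T, ∀ t ∈ Icc 0 T, s ≤ t →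
      0 ≤ (ℓ s - a (y s)) (y t - y s) + K * (t - s) ^ 2 ∧
      Ψ (y t - y s) ≤ ENNReal.ofReal ((ℓ s - a (y s)) (y t - y s) + K * (t - s) ^ 2) := by
  have hc := h.pos
  have hL := lipschitz_const_nonneg hℓ
  have hℓc : Continuous ℓ := by
    refine (LipschitzWith.of_dist_le_mul (K := ⟨L, hL⟩) fun s t => ?_).continuous
    rw [dist_eq_norm, Real.dist_eq]
    exact hℓ s t
  have hload : ∀ t ∈ Icc 0 T, Tendsto (fun j => dyadicLoad ℓ T j (dyadicIndex T j t)) atTop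
      (𝓝 (ℓ t)) := fun t ht => (hℓc.tendsto t).comp (tendsto_dyadicIndex_time hT ht.1)
  have hforce : ∀ t ∈ Icc 0 T, Tendsto (fun j => dyadicLoad ℓ T j (dyadicIndex T j t) -
      a (dyadicApprox h ℓ y₀ T j t)) atTop (𝓝 (ℓ t - a (y t))) := fun t ht =>
    (hload t ht).sub ((a.continuous.tendsto _).comp (hy t ht))
  have hidx : ∀ (s t : ℝ) (j : ℕ), L * (T / 2 ^ j) / c * ((dyadicIndex T j t : ℝ) - dyadicIndex T j s) =
      L / c * (T * dyadicIndex T j t / 2 ^ j - T * dyadicIndex T j s / 2 ^ j) := by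
    intro s t j
    field_simp
  -- The constant K is that of `scheme_dissipation_le` with Λ replaced by L: at level j the load
  -- changes by L times the step length, so differences of indices become differences of times.
  refine ⟨?_, fun t ht v => ?_, fun s hs t ht hst => ?_,
    (L + ‖a‖ * (L / c)) * (L / c), fun s hs t ht hst => ?_⟩
  · have := hy 0 ⟨le_rfl, hT.le⟩
    refine tendsto_nhds_unique this ?_
    simp [dyadicApprox, dyadicIndex, scheme]
  · have h1 : Tendsto (fun j => (dyadicLoad ℓ T j (dyadicIndex T j t) -
        a (dyadicApprox h ℓ y₀ T j t)) v) atTop (𝓝 ((ℓ t - a (y t)) v)) :=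
      ((ContinuousLinearMap.apply ℝ ℝ v).continuous.tendsto _).comp (hforce t ht)
    refine le_of_tendsto' ((ENNReal.continuous_ofReal.tendsto _).comp h1) fun j => ?_
    exact scheme_admissible h (dyadicLoad_zero h₀ j) _ v
  · refine le_of_tendsto_of_tendsto' ((hy t ht).sub (hy s hs)).norm
      (((tendsto_dyadicIndex_time hT ht.1).sub (tendsto_dyadicIndex_time hT hs.1)).const_mul _)
      fun j => ?_
    rw [← hidx]
    exact scheme_dist_le h (dyadicLoad_zero h₀ j) (dyadicLoad_step hT hℓ j)
      (dyadicIndex_mono hT j hst)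
  · have hdiff := (hy t ht).sub (hy s hs)
    have h1 : Tendsto (fun j => (dyadicLoad ℓ T j (dyadicIndex T j s) -
        a (dyadicApprox h ℓ y₀ T j s)) (dyadicApprox h ℓ y₀ T j t - dyadicApprox h ℓ y₀ T j s) +
        (L + ‖a‖ * (L / c)) * (L / c) *
          (T * dyadicIndex T j t / 2 ^ j - T * dyadicIndex T j s / 2 ^ j) ^ 2) atTop
        (𝓝 ((ℓ s - a (y s)) (y t - y s) + (L + ‖a‖ * (L / c)) * (L / c) * (t - s) ^ 2)) := by
      refine Tendsto.add ?_ ((((tendsto_dyadicIndex_time hT ht.1).sub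
        (tendsto_dyadicIndex_time hT hs.1)).pow 2).const_mul _)
      have hcont : Continuous fun p : (Y →L[ℝ] ℝ) × Y => p.1 p.2 := by fun_prop
      exact (hcont.tendsto _).comp ((hforce s hs).prodMk_nhds hdiff)
    have h2 : ∀ j, ∃ S : ℝ, 0 ≤ S ∧
        Ψ (dyadicApprox h ℓ y₀ T j t - dyadicApprox h ℓ y₀ T j s) ≤ ENNReal.ofReal S ∧
        S ≤ (dyadicLoad ℓ T j (dyadicIndex T j s) -
        a (dyadicApprox h ℓ y₀ T j s)) (dyadicApprox h ℓ y₀ T j t - dyadicApprox h ℓ y₀ T j s) +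
        (L + ‖a‖ * (L / c)) * (L / c) *
          (T * dyadicIndex T j t / 2 ^ j - T * dyadicIndex T j s / 2 ^ j) ^ 2 := by
      intro j
      obtain ⟨S, hS0, hS1, hS2⟩ := scheme_dissipation_le h (dyadicLoad_zero h₀ j)
        (dyadicLoad_step hT hℓ j) (dyadicIndex_mono hT j hst)
      refine ⟨S, hS0, hS1, hS2.trans (le_of_eq ?_)⟩
      congr 1
      field_simp
    refine ⟨ge_of_tendsto' h1 fun j => ?_, le_ofReal_of_tendsto_of_lsc h.lsc hdiff h1
      (Eventually.of_forall fun j => ?_)⟩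
    · obtain ⟨S, hS0, -, hS2⟩ := h2 j
      exact hS0.trans hS2
    · obtain ⟨S, -, hS1, hS2⟩ := h2 j
      exact hS1.trans (ENNReal.ofReal_le_ofReal hS2)

end Scheme

end SpringNetwork

/-! ### Energetic solutions: stability, chain rule, uniqueness, existence. -/

namespace SpringNetwork

/-- Transfers stability from extended reals to inequalities between nonnegative quantities, with
infinite dissipation included. -/
theorem ereal_coe_le_add_iff {x x' : ℝ} {p : ℝ≥0∞} :
    (x : EReal) ≤ (x' : EReal) + (p : EReal) ↔ ENNReal.ofReal (x - x') ≤ p := by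
  induction p using ENNReal.recTopCoe with
  | top => simp
  | coe p =>
    rw [EReal.coe_nnreal_eq_coe_real, ← EReal.coe_add, EReal.coe_le_coe_iff,
      ENNReal.ofReal_le_iff_le_toReal (by simp), ENNReal.coe_toReal]
    constructor <;> intro h <;> linarith

/-- The sign condition on the right is essential: `ENNReal.ofReal` would send a negative energy gain
to zero. -/
theorem ereal_coe_add_eq_iff {x z : ℝ} {p : ℝ≥0∞} :
    (x : EReal) + (p : EReal) = (z : EReal) ↔ 0 ≤ z - x ∧ p = ENNReal.ofReal (z - x) := by
  induction p using ENNReal.recTopCoe with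
  | top => simp
  | coe p =>
    rw [EReal.coe_nnreal_eq_coe_real, ← EReal.coe_add, EReal.coe_eq_coe_iff]
    constructor
    · intro h
      have : z - x = p := by linarith
      rw [this]
      exact ⟨p.2, by simp⟩
    · rintro ⟨h1, h2⟩
      have := congrArg ENNReal.toReal h2
      rw [ENNReal.toReal_ofReal h1, ENNReal.coe_toReal] at this
      linarith

section Energetic


variable {Y : Type*} [NormedAddCommGroup Y] [InnerProductSpace ℝ Y] [CompleteSpace Y]

theorem AbsolutelyContinuousOnInterval.bilinear {F G : Type*} [NormedAddCommGroup F]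
    [NormedSpace ℝ F] [NormedAddCommGroup G] [NormedSpace ℝ G] (B : F →L[ℝ] G →L[ℝ] ℝ)
    {f : ℝ → F} {g : ℝ → G} {a b : ℝ} (hf : AbsolutelyContinuousOnInterval f a b)
    (hg : AbsolutelyContinuousOnInterval g a b) :
    AbsolutelyContinuousOnInterval (fun t => B (f t) (g t)) a b := by
  obtain ⟨C, hC⟩ := hf.exists_bound
  obtain ⟨D, hD⟩ := hg.exists_bound
  have hC0 : 0 ≤ C := (norm_nonneg _).trans (hC a left_mem_uIcc)
  have hD0 : 0 ≤ D := (norm_nonneg _).trans (hD a left_mem_uIcc)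
  rw [absolutelyContinuousOnInterval_iff] at hf hg ⊢
  intro r hr
  set K := ‖B‖ * C + ‖B‖ * D + 1 with hK
  have hK0 : 0 < K := by positivity
  obtain ⟨δ₁, hδ₁, h₁⟩ := hf (r / (2 * K)) (by positivity)
  obtain ⟨δ₂, hδ₂, h₂⟩ := hg (r / (2 * K)) (by positivity)
  refine ⟨min δ₁ δ₂, lt_min hδ₁ hδ₂, fun E hE hEδ => ?_⟩
  have e1 := h₁ E hE (hEδ.trans_le (min_le_left _ _))
  have e2 := h₂ E hE (hEδ.trans_le (min_le_right _ _))
  have hle : ∀ i ∈ Finset.range E.1, dist (B (f (E.2 i).1) (g (E.2 i).1)) (B (f (E.2 i).2) (g (E.2 i).2))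
      ≤ K * (dist (f (E.2 i).1) (f (E.2 i).2) + dist (g (E.2 i).1) (g (E.2 i).2)) := by
    intro i hi
    obtain ⟨hi1, hi2⟩ := hE.1 i hi
    set x := (E.2 i).1
    set z := (E.2 i).2
    rw [dist_eq_norm, dist_eq_norm, dist_eq_norm]
    have e : B (f x) (g x) - B (f z) (g z) = B (f x - f z) (g x) + B (f z) (g x - g z) := by
      simp only [map_sub, sub_apply]; ring
    rw [e]
    refine (norm_add_le _ _).trans ?_
    have t1 : ‖B (f x - f z) (g x)‖ ≤ ‖B‖ * ‖f x - f z‖ * D :=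
      (B.le_opNorm₂ _ _).trans (by gcongr; exact hD x hi1)
    have t2 : ‖B (f z) (g x - g z)‖ ≤ ‖B‖ * C * ‖g x - g z‖ :=
      (B.le_opNorm₂ _ _).trans (by gcongr; exact hC z hi2)
    have n1 := norm_nonneg (f x - f z)
    have n2 := norm_nonneg (g x - g z)
    have n3 : 0 ≤ ‖B‖ * C * ‖f x - f z‖ := by positivity
    have n4 : 0 ≤ ‖B‖ * D * ‖g x - g z‖ := by positivity
    rw [hK]
    nlinarith
  refine (Finset.sum_le_sum hle).trans_lt ?_
  rw [← Finset.mul_sum, Finset.sum_add_distrib]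
  have := mul_lt_mul_of_pos_left (add_lt_add e1 e2) hK0
  refine this.trans_le (le_of_eq ?_)
  field_simp
  ring

variable {c T L : ℝ} {a : Y →L[ℝ] Y →L[ℝ] ℝ} {Ψ : Y → ℝ≥0∞} {ℓ ℓ' : ℝ → Y →L[ℝ] ℝ}
  {E : ℝ → Y → ℝ} {power : ℝ → Y → ℝ}

/-- Testing stability with y + s v and dividing by s gives the first-order condition. Conversely,
the energy is convex, so the quadratic remainder discarded in the first-order condition has the
favourable sign. -/
theorem mem_stableSet_iff (h : IsQuadraticRIS c a Ψ) {t : ℝ} {f : Y →L[ℝ] ℝ}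
    (hE : ∀ y, E t y = 1 / 2 * a y y - f y) {y : Y} :
    y ∈ stableSet E Ψ t ↔ IsAdmissibleForce Ψ (f - a y) := by
  simp only [stableSet, mem_ofPred_eq, ereal_coe_le_add_iff, hE]
  constructor
  · intro hy v
    rcases eq_or_ne (Ψ v) ∞ with hv | hv
    · simp [hv]
    refine ENNReal.ofReal_le_of_le_toReal ?_
    have : 0 ≤ a y v - f v + (Ψ v).toReal := by
      refine nonneg_of_forall_pos_mul_add (B := 1 / 2 * a v v) fun s hs _ => ?_
      have h1 := hy (y + s • v)
      rw [add_sub_cancel_left, h.homog s v hs.le] at h1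
      have h2 := (ENNReal.ofReal_le_iff_le_toReal
        (ENNReal.mul_ne_top ENNReal.ofReal_ne_top hv)).1 h1
      rw [ENNReal.toReal_mul, ENNReal.toReal_ofReal hs.le] at h2
      have h3 := h.symm v y
      simp only [map_smul, map_add, smul_apply, add_apply, smul_eq_mul] at h2
      nlinarith
    simp only [sub_apply]
    linarith
  · intro hy y'
    refine le_trans (ENNReal.ofReal_le_ofReal ?_) (hy (y' - y))
    have h1 := h.form_nonneg (y' - y)
    have h2 := h.symm y y'
    simp only [map_sub, sub_apply] at h1 ⊢
    linarith

/-- The chain rule for the energy along an absolutely continuous curve. -/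
theorem energy_chain_rule (h : IsQuadraticRIS c a Ψ) (hT : 0 < T)
    (hℓ : ∀ s t, ‖ℓ s - ℓ t‖ ≤ L * |s - t|) (hℓd : ∀ s ∈ Ioo 0 T, HasDerivAt ℓ (ℓ' s) s)
    (hℓ'c : ContinuousOn ℓ' (Icc 0 T)) {y : ℝ → Y} (hy : AbsolutelyContinuousOnInterval y 0 T) :
    IntervalIntegrable (fun s => (ℓ s - a (y s)) (deriv y s)) volume 0 T ∧
    ∀ t ∈ Icc 0 T, (1 / 2 * a (y t) (y t) - ℓ t (y t)) +
      ∫ s in (0 : ℝ)..t, (ℓ s - a (y s)) (deriv y s) =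
      (1 / 2 * a (y 0) (y 0) - ℓ 0 (y 0)) - ∫ s in (0 : ℝ)..t, ℓ' s (y s) := by
  have hL := lipschitz_const_nonneg hℓ
  have hℓL : LipschitzWith ⟨L, hL⟩ ℓ := LipschitzWith.of_dist_le_mul fun s t => by
    rw [dist_eq_norm, Real.dist_eq]; exact hℓ s t
  have hℓac : AbsolutelyContinuousOnInterval ℓ 0 T :=
    (hℓL.lipschitzOnWith).absolutelyContinuousOnInterval
  let e : ℝ → ℝ := fun t => 1 / 2 * a (y t) (y t) - ℓ t (y t)
  have he : AbsolutelyContinuousOnInterval e 0 T :=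
    ((AbsolutelyContinuousOnInterval.bilinear a hy hy).const_mul (1 / 2)).sub
      (AbsolutelyContinuousOnInterval.bilinear (ContinuousLinearMap.id ℝ (Y →L[ℝ] ℝ)) hℓac hy)
  have hyd := AbsolutelyContinuousOnInterval.ae_differentiableAt_hilbert hT.le hy
  -- The product rule at points of differentiability of y. Symmetry of a merges the two derivatives
  -- of ½ a(y, y), and the derivative of the load produces the power term.
  have hder : ∀ᵐ s : ℝ, s ∈ Ioo 0 T →
      -deriv e s - ℓ' s (y s) = (ℓ s - a (y s)) (deriv y s) := by
    filter_upwards [hyd] with s hs hs'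
    have hys := (hs hs').hasDerivAt
    have h1 : HasDerivAt (fun t => a (y t) (y t)) (a (deriv y s) (y s) + a (y s) (deriv y s)) s :=
      (a.hasFDerivAt.comp_hasDerivAt s hys).clm_apply hys
    have h2 : HasDerivAt (fun t => ℓ t (y t)) (ℓ' s (y s) + ℓ s (deriv y s)) s :=
      (hℓd s hs').clm_apply hys
    have h3 := ((h1.const_mul (1 / 2)).sub h2).deriv
    change deriv e s = _ at h3
    rw [h3, h.symm (deriv y s)]
    simp only [sub_apply]
    ring
  have hyc : ContinuousOn y (Icc 0 T) := by simpa [uIcc_of_le hT.le] using hy.continuousOn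
  have hpi : IntervalIntegrable (fun s => ℓ' s (y s)) volume 0 T := by
    refine ContinuousOn.intervalIntegrable ?_
    rw [uIcc_of_le hT.le]
    exact hℓ'c.clm_apply hyc
  have hei := he.intervalIntegrable_deriv
  have hder' : ∀ t ∈ Icc 0 T, (fun s => -deriv e s - ℓ' s (y s)) =ᵐ[volume.restrict (uIoc 0 t)]
      fun s => (ℓ s - a (y s)) (deriv y s) := by
    intro t ht
    rw [uIoc_of_le ht.1, EventuallyEq, ← restrict_Ioo_eq_restrict_Ioc,
      ae_restrict_iff' measurableSet_Ioo]
    filter_upwards [hder] with s hs hs' using hs ⟨hs'.1, hs'.2.trans_le ht.2⟩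
  refine ⟨(hei.neg.sub hpi).congr_ae (hder' T ⟨hT.le, le_rfl⟩), fun t ht => ?_⟩
  have hsub : uIcc 0 t ⊆ uIcc 0 T := by
    rw [uIcc_of_le ht.1, uIcc_of_le hT.le]; exact Icc_subset_Icc_right ht.2
  have hneg : IntervalIntegrable (fun s => -deriv e s) volume 0 T := hei.neg
  rw [← intervalIntegral.integral_congr_ae_restrict (hder' t ht),
    intervalIntegral.integral_sub (hneg.mono_set hsub) (hpi.mono_set hsub),
    intervalIntegral.integral_neg, (he.mono hsub).integral_deriv_eq_sub]
  simp only [e]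
  ring

theorem setLIntegral_ofReal_eq {g : ℝ → ℝ} {t : ℝ} (ht : 0 ≤ t)
    (hg : IntervalIntegrable g volume 0 t) (h0 : ∀ᵐ s : ℝ, s ∈ Ioo 0 t → 0 ≤ g s) :
    0 ≤ ∫ s in (0 : ℝ)..t, g s ∧
      ∫⁻ s in Ioc 0 t, ENNReal.ofReal (g s) = ENNReal.ofReal (∫ s in (0 : ℝ)..t, g s) := by
  have h0' : 0 ≤ᵐ[volume.restrict (Ioc 0 t)] g := by
    rw [EventuallyLE, ← restrict_Ioo_eq_restrict_Ioc, ae_restrict_iff' measurableSet_Ioo]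
    exact h0
  rw [intervalIntegral.integral_of_le ht]
  exact ⟨integral_nonneg_of_ae h0', (ofReal_integral_eq_lintegral_ofReal
    ((intervalIntegrable_iff_integrableOn_Ioc_of_le ht).1 hg) h0').symm⟩

/-- Along an energetic solution the force is dissipated almost everywhere. -/
theorem IsEnergeticSolution.ae_dissipation_eq (h : IsQuadraticRIS c a Ψ) (hT : 0 < T)
    (hℓ : ∀ s t, ‖ℓ s - ℓ t‖ ≤ L * |s - t|) (hℓd : ∀ s ∈ Ioo 0 T, HasDerivAt ℓ (ℓ' s) s)
    (hℓ'c : ContinuousOn ℓ' (Icc 0 T))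
    (hE : ∀ t ∈ Icc 0 T, ∀ y, E t y = 1 / 2 * a y y - ℓ t y)
    (hpower : ∀ t ∈ Icc 0 T, ∀ y, power t y = ℓ' t y)
    {y : ℝ → Y} (hy : IsEnergeticSolution T E Ψ power y) :
    ∀ᵐ s : ℝ, s ∈ Ioo 0 T → 0 ≤ (ℓ s - a (y s)) (deriv y s) ∧
      Ψ (deriv y s) = ENNReal.ofReal ((ℓ s - a (y s)) (deriv y s)) := by
  borelize Y
  obtain ⟨hint, hchain⟩ := energy_chain_rule h hT hℓ hℓd hℓ'c hy.ac
  have hT' : T ∈ Icc 0 T := ⟨hT.le, le_rfl⟩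
  have h0' : (0 : ℝ) ∈ Icc 0 T := ⟨le_rfl, hT.le⟩
  have hbal := hy.balance T hT'
  rw [hE T hT', hE 0 h0', ereal_coe_add_eq_iff] at hbal
  have hpow : ∫ s in (0 : ℝ)..T, power s (y s) = ∫ s in (0 : ℝ)..T, ℓ' s (y s) := by
    refine intervalIntegral.integral_congr fun s hs => ?_
    rw [uIcc_of_le hT.le] at hs
    exact hpower s hs _
  have hval : 1 / 2 * a (y 0) (y 0) - ℓ 0 (y 0) - ∫ s in (0 : ℝ)..T, power s (y s) =
      (1 / 2 * a (y T) (y T) - ℓ T (y T)) + ∫ s in (0 : ℝ)..T, (ℓ s - a (y s)) (deriv y s) := by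
    rw [hpow, hchain T hT']
  rw [hval, add_sub_cancel_left] at hbal
  obtain ⟨hnn, hbal⟩ := hbal
  set g : ℝ → ℝ := fun s => (ℓ s - a (y s)) (deriv y s) with hg
  have hmeas : Measurable fun s => Ψ (deriv y s) := h.lsc.measurable.comp (measurable_deriv y)
  have hfin : ∫⁻ s in Ioc 0 T, Ψ (deriv y s) ≠ ∞ := by rw [hbal]; exact ENNReal.ofReal_ne_top
  have haefin := ae_lt_top hmeas hfin
  have hge : ∀ᵐ s ∂volume.restrict (Ioc 0 T), ENNReal.ofReal (g s) ≤ Ψ (deriv y s) := by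
    rw [ae_restrict_iff' measurableSet_Ioc]
    exact Eventually.of_forall fun s hs =>
      (mem_stableSet_iff h (hE s (Ioc_subset_Icc_self hs))).1
        (hy.stable s (Ioc_subset_Icc_self hs)) _
  have hgi : Integrable g (volume.restrict (Ioc 0 T)) :=
    (intervalIntegrable_iff_integrableOn_Ioc_of_le hT.le).1 hint
  have hΨi : Integrable (fun s => (Ψ (deriv y s)).toReal) (volume.restrict (Ioc 0 T)) :=
    integrable_toReal_of_lintegral_ne_top hmeas.aemeasurable hfin
  -- Stability gives force ≤ dissipation at every time, while the energy balance at T and the chain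
  -- rule give equal integrals. The nonnegative difference therefore vanishes almost everywhere.
  have hzero : ∫ s in Ioc 0 T, ((Ψ (deriv y s)).toReal - g s) = 0 := by
    rw [integral_sub hΨi hgi, integral_toReal hmeas.aemeasurable haefin, hbal,
      ENNReal.toReal_ofReal hnn, intervalIntegral.integral_of_le hT.le, sub_self]
  have hnonneg : 0 ≤ᵐ[volume.restrict (Ioc 0 T)] fun s => (Ψ (deriv y s)).toReal - g s := by
    filter_upwards [hge, haefin] with s h1 h2
    have := (ENNReal.ofReal_le_iff_le_toReal h2.ne).1 h1
    simp only [Pi.zero_apply]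
    linarith
  have hae := (integral_eq_zero_iff_of_nonneg_ae hnonneg (hΨi.sub hgi)).1 hzero
  have hall : ∀ᵐ s ∂volume.restrict (Ioc 0 T), 0 ≤ g s ∧ Ψ (deriv y s) = ENNReal.ofReal (g s) := by
    filter_upwards [hae, haefin] with s h1 h2
    have h3 : (Ψ (deriv y s)).toReal = g s := sub_eq_zero.1 h1
    rw [← h3]
    exact ⟨ENNReal.toReal_nonneg, (ENNReal.ofReal_toReal h2.ne).symm⟩
  rw [ae_restrict_iff' measurableSet_Ioc] at hall
  filter_upwards [hall] with s hs hs' using hs (Ioo_subset_Ioc_self hs')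

/-- With w = y - z, the function a(w, w) does not increase: the force of z is admissible and may be
tested with y', the force of y with z', and each solution's own force dissipates exactly. Hence a(w,
y') ≤ 0 ≤ a(w, z') almost everywhere, and a(w, w) starts at zero. -/
theorem IsEnergeticSolution.unique (h : IsQuadraticRIS c a Ψ) (hT : 0 < T)
    (hℓ : ∀ s t, ‖ℓ s - ℓ t‖ ≤ L * |s - t|) (hℓd : ∀ s ∈ Ioo 0 T, HasDerivAt ℓ (ℓ' s) s)
    (hℓ'c : ContinuousOn ℓ' (Icc 0 T))
    (hE : ∀ t ∈ Icc 0 T, ∀ y, E t y = 1 / 2 * a y y - ℓ t y)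
    (hpower : ∀ t ∈ Icc 0 T, ∀ y, power t y = ℓ' t y)
    {y z : ℝ → Y} (hy : IsEnergeticSolution T E Ψ power y) (hz : IsEnergeticSolution T E Ψ power z)
    (h0 : y 0 = z 0) : EqOn y z (Icc 0 T) := by
  let w : ℝ → Y := fun t => y t - z t
  let g : ℝ → ℝ := fun t => a (w t) (w t)
  have hw : AbsolutelyContinuousOnInterval w 0 T := hy.ac.sub hz.ac
  have hg : AbsolutelyContinuousOnInterval g 0 T :=
    AbsolutelyContinuousOnInterval.bilinear a hw hw
  have hder : ∀ᵐ s : ℝ, s ∈ Ioo 0 T → deriv g s ≤ 0 := by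
    filter_upwards [AbsolutelyContinuousOnInterval.ae_differentiableAt_hilbert hT.le hy.ac,
      AbsolutelyContinuousOnInterval.ae_differentiableAt_hilbert hT.le hz.ac,
      hy.ae_dissipation_eq h hT hℓ hℓd hℓ'c hE hpower,
      hz.ae_dissipation_eq h hT hℓ hℓd hℓ'c hE hpower] with s h1 h2 h3 h4 hs
    have hs' := Ioo_subset_Icc_self hs
    have d1 := (h1 hs).hasDerivAt
    have d2 := (h2 hs).hasDerivAt
    have dw : HasDerivAt w (deriv y s - deriv z s) s := d1.sub d2
    have dg : HasDerivAt g (a (deriv y s - deriv z s) (w s) + a (w s) (deriv y s - deriv z s)) s :=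
      (a.hasFDerivAt.comp_hasDerivAt s dw).clm_apply dw
    rw [dg.deriv, h.symm _ (w s)]
    have e1 := (mem_stableSet_iff h (hE s hs')).1 (hz.stable s hs') (deriv y s)
    have e2 := (mem_stableSet_iff h (hE s hs')).1 (hy.stable s hs') (deriv z s)
    rw [(h3 hs).2] at e1
    rw [(h4 hs).2] at e2
    have e1' := (ENNReal.ofReal_le_ofReal_iff (h3 hs).1).1 e1
    have e2' := (ENNReal.ofReal_le_ofReal_iff (h4 hs).1).1 e2
    simp only [w, map_sub, sub_apply] at e1' e2' ⊢
    linarith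
  intro t ht
  have hsub : uIcc 0 t ⊆ uIcc 0 T := by
    rw [uIcc_of_le ht.1, uIcc_of_le hT.le]; exact Icc_subset_Icc_right ht.2
  have hint := (hg.mono hsub).integral_deriv_eq_sub
  have hle : ∫ s in (0 : ℝ)..t, deriv g s ≤ 0 := by
    rw [intervalIntegral.integral_of_le ht.1]
    refine integral_nonpos_of_ae ?_
    rw [EventuallyLE, ← restrict_Ioo_eq_restrict_Ioc, ae_restrict_iff' measurableSet_Ioo]
    filter_upwards [hder] with s hs hs' using hs ⟨hs'.1, hs'.2.trans_le ht.2⟩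
  have hg0 : g 0 = 0 := by simp [g, w, h0]
  have h1 := h.coercive (w t)
  have h2 : g t ≤ 0 := by linarith
  have h3 : ‖w t‖ ^ 2 ≤ 0 := by
    have := h.pos
    by_contra! hlt
    have := mul_pos this hlt
    change c * ‖w t‖ ^ 2 ≤ g t at h1
    linarith
  have h4 : ‖w t‖ = 0 := by
    have := norm_nonneg (w t)
    nlinarith
  exact sub_eq_zero.1 (norm_eq_zero.1 h4)

/-- Existence of the energetic solution as the uniform limit of the dyadic schemes. -/
theorem exists_uniqueEnergeticSolution (h : IsQuadraticRIS c a Ψ) (hT : 0 < T)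
    (hℓ : ∀ s t, ‖ℓ s - ℓ t‖ ≤ L * |s - t|) (hℓd : ∀ s ∈ Ioo 0 T, HasDerivAt ℓ (ℓ' s) s)
    (hℓ'c : ContinuousOn ℓ' (Icc 0 T))
    (hE : ∀ t ∈ Icc 0 T, ∀ y, E t y = 1 / 2 * a y y - ℓ t y)
    (hpower : ∀ t ∈ Icc 0 T, ∀ y, power t y = ℓ' t y)
    {y₀ : Y} (hy₀ : y₀ ∈ stableSet E Ψ 0) :
    ∃ y : ℝ → Y, IsUniqueEnergeticSolution T E Ψ power y₀ y ∧
      ∀ t ∈ Icc 0 T, ∀ j, dist (dyadicApprox h ℓ y₀ T j t) (y t) ≤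
        2 * (L * T / c) * dyadicRate ^ j / (1 - dyadicRate) := by
  have hL := lipschitz_const_nonneg hℓ
  have hc := h.pos
  have h00 : (0 : ℝ) ∈ Icc 0 T := ⟨le_rfl, hT.le⟩
  have h₀ := (mem_stableSet_iff h (hE 0 h00)).1 hy₀
  obtain ⟨y, hy⟩ := exists_dyadicLimit h hT hℓ h₀
  obtain ⟨hinit, hstab, hlip, K, hK⟩ := dyadicLimit_properties h hT hℓ h₀ fun t ht => (hy t ht).1
  have hlip' : LipschitzOnWith ⟨L / c, div_nonneg hL hc.le⟩ y (Icc 0 T) := by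
    refine LipschitzOnWith.of_dist_le_mul fun s hs t ht => ?_
    rw [dist_eq_norm, Real.dist_eq]
    rcases le_total s t with hst | hst
    · rw [norm_sub_rev, abs_sub_comm, abs_of_nonneg (by linarith)]
      exact hlip s hs t ht hst
    · rw [abs_of_nonneg (by linarith)]
      exact hlip t ht s hs hst
  have hac : AbsolutelyContinuousOnInterval y 0 T := by
    refine LipschitzOnWith.absolutelyContinuousOnInterval (K := ⟨L / c, div_nonneg hL hc.le⟩) ?_
    rwa [uIcc_of_le hT.le]
  -- The local dissipation estimate is divided by t - s and t decreases to s. The quadratic error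
  -- disappears, lower semicontinuity bounds Ψ(y') by the force on y', and stability gives the
  -- reverse inequality.
  have hdis : ∀ᵐ s : ℝ, s ∈ Ioo 0 T → 0 ≤ (ℓ s - a (y s)) (deriv y s) ∧
      Ψ (deriv y s) = ENNReal.ofReal ((ℓ s - a (y s)) (deriv y s)) := by
    filter_upwards [AbsolutelyContinuousOnInterval.ae_differentiableAt_hilbert hT.le hac]
      with s hs hs'
    have hsl : Tendsto (slope y s) (𝓝[>] s) (𝓝 (deriv y s)) :=
      (hasDerivAt_iff_tendsto_slope.1 (hs hs').hasDerivAt).mono_left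
        (nhdsWithin_mono _ fun x hx => ne_of_gt hx)
    have hsI := Ioo_subset_Icc_self hs'
    have hr : Tendsto (fun t => (ℓ s - a (y s)) (slope y s t) + K * (t - s)) (𝓝[>] s)
        (𝓝 ((ℓ s - a (y s)) (deriv y s))) := by
      have h1 := ((ℓ s - a (y s)).continuous.tendsto _).comp hsl
      have h2 : Tendsto (fun t : ℝ => K * (t - s)) (𝓝[>] s) (𝓝 (K * (s - s))) :=
        (Continuous.tendsto (by fun_prop) s).mono_left nhdsWithin_le_nhds
      simpa using h1.add h2
    have hev : ∀ᶠ t in 𝓝[>] s, 0 ≤ (ℓ s - a (y s)) (slope y s t) + K * (t - s) ∧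
        Ψ (slope y s t) ≤ ENNReal.ofReal ((ℓ s - a (y s)) (slope y s t) + K * (t - s)) := by
      filter_upwards [self_mem_nhdsWithin, nhdsWithin_le_nhds (Icc_mem_nhds hs'.1 hs'.2)]
        with t ht htI
      have hts : 0 < t - s := sub_pos.2 ht
      obtain ⟨k1, k2⟩ := hK s hsI t htI (le_of_lt ht)
      have e : (ℓ s - a (y s)) (slope y s t) + K * (t - s) =
          (t - s)⁻¹ * ((ℓ s - a (y s)) (y t - y s) + K * (t - s) ^ 2) := by
        rw [slope, vsub_eq_sub, map_smul, smul_eq_mul]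
        field_simp
      have hi : 0 ≤ (t - s)⁻¹ := by positivity
      rw [e]
      refine ⟨mul_nonneg hi k1, ?_⟩
      rw [slope, vsub_eq_sub, h.homog _ _ hi, ENNReal.ofReal_mul hi]
      gcongr
    exact ⟨ge_of_tendsto hr (hev.mono fun t ht => ht.1), le_antisymm
      (le_ofReal_of_tendsto_of_lsc h.lsc hsl hr (hev.mono fun t ht => ht.2)) (hstab s hsI _)⟩
  obtain ⟨hint, hchain⟩ := energy_chain_rule h hT hℓ hℓd hℓ'c hac
  have hsol : IsEnergeticSolution T E Ψ power y := by
    refine ⟨hac, fun t ht => (mem_stableSet_iff h (hE t ht)).2 (hstab t ht), fun t ht => ?_⟩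
    rw [hE t ht, hE 0 h00, ereal_coe_add_eq_iff]
    have hpow : ∫ s in (0 : ℝ)..t, power s (y s) = ∫ s in (0 : ℝ)..t, ℓ' s (y s) := by
      refine intervalIntegral.integral_congr fun s hs => ?_
      rw [uIcc_of_le ht.1] at hs
      exact hpower s ⟨hs.1, hs.2.trans ht.2⟩ _
    have hsub : uIcc 0 t ⊆ uIcc 0 T := by
      rw [uIcc_of_le ht.1, uIcc_of_le hT.le]; exact Icc_subset_Icc_right ht.2
    have hdis' : ∀ᵐ s : ℝ, s ∈ Ioo 0 t → 0 ≤ (ℓ s - a (y s)) (deriv y s) ∧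
        Ψ (deriv y s) = ENNReal.ofReal ((ℓ s - a (y s)) (deriv y s)) := by
      filter_upwards [hdis] with s hs hs' using hs ⟨hs'.1, hs'.2.trans_le ht.2⟩
    obtain ⟨k1, k2⟩ := setLIntegral_ofReal_eq ht.1 (hint.mono_set hsub)
      (by filter_upwards [hdis'] with s hs hs' using (hs hs').1)
    have k3 : ∫⁻ s in Ioc 0 t, Ψ (deriv y s) =
        ∫⁻ s in Ioc 0 t, ENNReal.ofReal ((ℓ s - a (y s)) (deriv y s)) := by
      refine lintegral_congr_ae ?_
      rw [EventuallyEq, ← restrict_Ioo_eq_restrict_Ioc, ae_restrict_iff' measurableSet_Ioo]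
      filter_upwards [hdis'] with s hs hs' using (hs hs').2
    rw [hpow, ← hchain t ht, add_sub_cancel_left, k3]
    exact ⟨k1, k2⟩
  exact ⟨y, ⟨⟨_, hlip'⟩, hinit, hsol, fun y' hy' h0 => IsEnergeticSolution.unique h hT hℓ hℓd hℓ'c
    hE hpower hy' hsol (h0.trans hinit.symm)⟩, fun t ht => (hy t ht).2⟩

end Energetic

end SpringNetwork

namespace SpringNetwork

/-! ### Abstract convergence of rate-independent systems embedded in one Hilbert space. -/

section Mosco


universe v

variable {H : Type*} [NormedAddCommGroup H] [InnerProductSpace ℝ H] [CompleteSpace H]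

/-- Convex, positively one-homogeneous, lower semicontinuous functionals. -/
structure IsDissipationPotential (R : H → ℝ≥0∞) : Prop where
  subadd : ∀ u v, R (u + v) ≤ R u + R v
  homog : ∀ (s : ℝ) (v : H), 0 ≤ s → R (s • v) = ENNReal.ofReal s * R v
  lsc : LowerSemicontinuous R

/-- Dissipation potentials are weakly lower semicontinuous. -/
theorem IsDissipationPotential.eventually_lt {R : H → ℝ≥0∞} (hR : IsDissipationPotential R)
    {ι : Type*} (F : Ultrafilter ι) {f : ι → H} {w : H}
    (hf : ∀ g, Tendsto (fun i => inner ℝ (f i) g) F (𝓝 (inner ℝ w g))) {x : ℝ≥0∞} (hx : x < R w) :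
    ∀ᶠ i in F, x < R (f i) := by
  by_contra hcon
  rw [← Ultrafilter.eventually_not] at hcon
  have hcl : IsClosed {v | R v ≤ x} := hR.lsc.isClosed_preimage x
  have hconv : Convex ℝ {v | R v ≤ x} := by
    intro u hu v hv s t hs ht hst
    refine (hR.subadd _ _).trans ?_
    rw [hR.homog _ _ hs, hR.homog _ _ ht]
    calc ENNReal.ofReal s * R u + ENNReal.ofReal t * R v
        ≤ ENNReal.ofReal s * x + ENNReal.ofReal t * x := by gcongr; exacts [hu, hv]
      _ = x := by rw [← add_mul, ← ENNReal.ofReal_add hs ht, hst, ENNReal.ofReal_one, one_mul]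
  -- The sublevel set is convex and closed, so a continuous functional separates w from it strictly.
  -- Such a functional passes to the weak limit.
  obtain ⟨φ, u, hu1, hu2⟩ := geometric_hahn_banach_point_closed hconv hcl
    (show w ∉ {v | R v ≤ x} from not_le.2 hx)
  have h1 := hf ((InnerProductSpace.toDual ℝ H).symm φ)
  simp only [real_inner_comm ((InnerProductSpace.toDual ℝ H).symm φ),
    InnerProductSpace.toDual_symm_apply] at h1
  have h2 : u ≤ φ w := by
    refine ge_of_tendsto h1 ?_
    filter_upwards [hcon] with i hi using (hu2 _ (not_lt.1 hi)).le
  exact absurd hu1 (not_lt.2 h2)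

variable {Y : ℕ → Type v} [∀ n, NormedAddCommGroup (Y n)] [∀ n, InnerProductSpace ℝ (Y n)]
  [∀ n, CompleteSpace (Y n)]
  {Y₀ : Type*} [NormedAddCommGroup Y₀] [InnerProductSpace ℝ Y₀] [CompleteSpace Y₀]

/-- Convergence of a sequence of quadratic rate-independent systems whose state spaces are embedded
into a common Hilbert space. -/
structure IsMoscoLimit (c M : ℝ) (R : H → ℝ≥0∞) (i : ∀ n, Y n →L[ℝ] H)
    (a : ∀ n, Y n →L[ℝ] Y n →L[ℝ] ℝ) (i₀ : Y₀ →L[ℝ] H) (a₀ : Y₀ →L[ℝ] Y₀ →L[ℝ] ℝ) : Prop where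
  potential : IsDissipationPotential R
  system : ∀ n, IsQuadraticRIS c (a n) fun y => R (i n y)
  system₀ : IsQuadraticRIS c a₀ fun y => R (i₀ y)
  norm_le : ∀ n y, ‖i n y‖ ≤ ‖y‖
  norm_le₀ : ∀ y, ‖i₀ y‖ ≤ ‖y‖
  bound : ∀ n u v, |a n u v| ≤ M * ‖i n u‖ * ‖i n v‖
  recovery : ∀ v, R (i₀ v) ≠ ∞ → ∃ r : ∀ n, Y n, Tendsto (fun n => i n (r n)) atTop (𝓝 (i₀ v)) ∧
    ∀ n, R (i n (r n)) ≤ R (i₀ v)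
  weak_closed : ∀ (F : Ultrafilter ℕ), (F : Filter ℕ) ≤ atTop → ∀ (v : ∀ n, Y n) (w : H),
    (∃ C, ∀ᶠ n in F, ‖v n‖ ≤ C) →
    (∀ g, Tendsto (fun n => inner ℝ (i n (v n)) g) F (𝓝 (inner ℝ w g))) → ∃ v₀, i₀ v₀ = w
  form_tendsto : ∀ (F : Ultrafilter ℕ), (F : Filter ℕ) ≤ atTop → ∀ (x v : ∀ n, Y n) (x₀ v₀ : Y₀),
    Tendsto (fun n => i n (x n)) F (𝓝 (i₀ x₀)) → (∃ C, ∀ᶠ n in F, ‖v n‖ ≤ C) →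
    (∀ g, Tendsto (fun n => inner ℝ (i n (v n)) g) F (𝓝 (inner ℝ (i₀ v₀) g))) →
    Tendsto (fun n => a n (x n) (v n)) F (𝓝 (a₀ x₀ v₀))

variable {c M : ℝ} {R : H → ℝ≥0∞} {i : ∀ n, Y n →L[ℝ] H} {a : ∀ n, Y n →L[ℝ] Y n →L[ℝ] ℝ}
  {i₀ : Y₀ →L[ℝ] H} {a₀ : Y₀ →L[ℝ] Y₀ →L[ℝ] ℝ}

/-- Convergence of the solutions of the incremental problems. -/
theorem IsMoscoLimit.tendsto_increment (h : IsMoscoLimit c M R i a i₀ a₀) (Λ : H →L[ℝ] ℝ)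
    {y δ : ∀ n, Y n} {y₀ δ₀ : Y₀} (hy : Tendsto (fun n => i n (y n)) atTop (𝓝 (i₀ y₀)))
    (hδ : ∀ n, IsIncrement (a n) (fun y => R (i n y)) (Λ.comp (i n) - a n (y n)) (δ n))
    (hδ₀ : IsIncrement a₀ (fun y => R (i₀ y)) (Λ.comp i₀ - a₀ y₀) δ₀) :
    Tendsto (fun n => i n (δ n)) atTop (𝓝 (i₀ δ₀)) := by
  have hc := h.system₀.pos
  rw [tendsto_iff_ultrafilter]
  intro F hF
  -- boundedness of the increments
  have hbd : ∃ C, ∀ᶠ n in F, ‖δ n‖ ≤ C := by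
    refine ⟨(‖Λ‖ + |M| * (‖i₀ y₀‖ + 1)) / c, ?_⟩
    filter_upwards [(tendsto_order.1 (hy.mono_left hF).norm).2 (‖i₀ y₀‖ + 1) (by linarith)] with n hn
    have h1 := (hδ n).nonneg
    have h2 := (h.system n).coercive (δ n)
    simp only [sub_apply, ContinuousLinearMap.comp_apply] at h1
    have hni := h.norm_le n (δ n)
    have h3 : Λ (i n (δ n)) ≤ ‖Λ‖ * ‖δ n‖ := ((le_abs_self _).trans (Λ.le_opNorm _)).trans
      (mul_le_mul_of_nonneg_left hni (norm_nonneg _))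
    have h4 : -(a n (y n) (δ n)) ≤ |M| * (‖i₀ y₀‖ + 1) * ‖δ n‖ := by
      refine ((neg_le_abs _).trans (h.bound n _ _)).trans ?_
      have := le_abs_self M
      gcongr
    rw [le_div_iff₀ hc]
    rcases eq_or_lt_of_le (norm_nonneg (δ n)) with h0 | h0
    · rw [← h0, zero_mul]; positivity
    · refine le_of_mul_le_mul_left ?_ h0
      nlinarith
  obtain ⟨C, hC⟩ := hbd
  obtain ⟨w, hw⟩ := exists_weak_limit F (fun n => i n (δ n)) C
    (hC.mono fun n hn => (h.norm_le n _).trans hn)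
  obtain ⟨w₀, rfl⟩ := h.weak_closed F hF δ w ⟨C, hC⟩ hw
  have hδfin : R (i₀ δ₀) ≠ ∞ := by rw [hδ₀.eq]; exact ENNReal.ofReal_ne_top
  obtain ⟨r, hr, hrR⟩ := h.recovery δ₀ hδfin
  have hrF := hr.mono_left hF
  have hnorm : ∀ n (v : Y n), c * ‖v‖ ^ 2 ≤ M * ‖i n v‖ ^ 2 := fun n v => by
    have h1 := (h.system n).coercive v
    have h2 := (le_abs_self _).trans (h.bound n v v)
    nlinarith
  -- A negative M would make every Y n trivial, by coercivity. The structure thus needs no sign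
  -- condition on M.
  have hM : 0 ≤ M ∨ ∀ n (v : Y n), v = 0 := by
    by_cases hM : 0 ≤ M
    · exact Or.inl hM
    · refine Or.inr fun n v => ?_
      have h1 := hnorm n v
      have h2 : M * ‖i n v‖ ^ 2 ≤ 0 := mul_nonpos_of_nonpos_of_nonneg (not_le.1 hM).le (by positivity)
      have h3 : ‖v‖ ^ 2 ≤ 0 := by
        by_contra! hlt
        have := mul_pos hc hlt
        linarith
      have := norm_nonneg v
      exact norm_eq_zero.1 (by nlinarith)
  -- Coercivity and the bound on the form control the norm in Y n by the norm of the image in H, so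
  -- strong convergence of the images bounds the recovery sequence.
  have hrb : ∃ C, ∀ᶠ n in F, ‖r n‖ ≤ C := by
    rcases hM with hM | hM
    · refine ⟨Real.sqrt (M / c) * (‖i₀ δ₀‖ + 1), ?_⟩
      filter_upwards [(tendsto_order.1 hrF.norm).2 (‖i₀ δ₀‖ + 1) (by linarith)] with n hn
      have h1 := hnorm n (r n)
      have h2 : ‖r n‖ ^ 2 ≤ (Real.sqrt (M / c) * (‖i₀ δ₀‖ + 1)) ^ 2 := by
        rw [mul_pow, Real.sq_sqrt (by positivity), div_mul_eq_mul_div, le_div_iff₀ hc, mul_comm]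
        refine h1.trans ?_
        gcongr
      exact (sq_le_sq₀ (norm_nonneg _) (by positivity)).1 h2
    · exact ⟨0, Eventually.of_forall fun n => by rw [hM n (r n), norm_zero]⟩
  obtain ⟨C', hC'⟩ := hrb
  have hwd : ∀ g, Tendsto (fun n => inner ℝ (i n (δ n - r n)) g) F
      (𝓝 (inner ℝ (i₀ (w₀ - δ₀)) g)) := fun g => by
    simp only [map_sub, inner_sub_left]
    exact (hw g).sub (hrF.inner tendsto_const_nhds)
  have hdb : ∃ C, ∀ᶠ n in F, ‖δ n - r n‖ ≤ C := ⟨C + C', by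
    filter_upwards [hC, hC'] with n h1 h2
    exact (norm_sub_le _ _).trans (add_le_add h1 h2)⟩
  -- The increments are compared with a recovery sequence r n of δ₀. The combination is arranged so
  -- that y n + r n converges strongly while δ n - r n converges only weakly, the one situation in
  -- which the form passes to the limit.
  have hform := h.form_tendsto F hF (fun n => y n + r n) (fun n => δ n - r n) (y₀ + δ₀) (w₀ - δ₀)
    (by simpa only [map_add] using (hy.mono_left hF).add hrF) hdb hwd
  have hload : Tendsto (fun n => Λ (i n (δ n - r n))) F (𝓝 (Λ (i₀ (w₀ - δ₀)))) := by
    have h1 := hwd ((InnerProductSpace.toDual ℝ H).symm Λ)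
    simpa only [real_inner_comm ((InnerProductSpace.toDual ℝ H).symm Λ),
      InnerProductSpace.toDual_symm_apply] using h1
  set g₀ := Λ.comp i₀ - a₀ y₀ - a₀ δ₀ with hg₀
  have key : ∀ η : ℝ, 0 < η → ∀ᶠ n in F, c * ‖δ n - r n‖ ^ 2 < 2 * η := by
    intro η hη
    -- Weak lower semicontinuity: the dissipation of δ n is eventually almost R(i₀ w₀), which is at
    -- least g₀ w₀ by admissibility of the limit force. A nonpositive bound holds at once because
    -- the dissipated force is nonnegative.
    have hlow : ∀ᶠ n in F, g₀ w₀ - η ≤ (Λ.comp (i n) - a n (y n) - a n (δ n)) (δ n) := by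
      rcases le_or_gt (g₀ w₀ - η) 0 with h0 | h0
      · exact Eventually.of_forall fun n => h0.trans (hδ n).nonneg
      · have hlt : ENNReal.ofReal (g₀ w₀ - η) < R (i₀ w₀) :=
          ((ENNReal.ofReal_lt_ofReal_iff (by linarith)).2 (by linarith)).trans_le
            (hδ₀.admissible w₀)
        filter_upwards [h.potential.eventually_lt F hw hlt] with n hn
        have hn' := hn.le
        rw [(hδ n).eq] at hn'
        exact (ENNReal.ofReal_le_ofReal_iff (hδ n).nonneg).1 hn'
    have hlim : Tendsto (fun n => Λ (i n (δ n - r n)) - a n (y n + r n) (δ n - r n) +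
        g₀ δ₀ - g₀ w₀ + η) F (𝓝 η) := by
      have h1 := (((hload.sub hform).add_const (g₀ δ₀)).sub_const (g₀ w₀)).add_const η
      have h2 : Λ (i₀ (w₀ - δ₀)) - a₀ (y₀ + δ₀) (w₀ - δ₀) + g₀ δ₀ - g₀ w₀ + η = η := by
        simp only [hg₀, map_add, map_sub, add_apply, sub_apply, ContinuousLinearMap.comp_apply]
        ring
      rwa [h2] at h1
    filter_upwards [hlow, (tendsto_order.1 hlim).2 (2 * η) (by linarith)] with n h1 h2
    -- The force at step n is admissible on r n, whose dissipation does not exceed that of δ₀.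
    -- Subtracting this from `hlow` bounds a(δ n - r n, δ n - r n) by the sequence in `hlim`.
    have h3 : (Λ.comp (i n) - a n (y n) - a n (δ n)) (r n) ≤ g₀ δ₀ := by
      have h4 := ((hδ n).admissible (r n)).trans (hrR n)
      rw [hδ₀.eq] at h4
      exact (ENNReal.ofReal_le_ofReal_iff hδ₀.nonneg).1 h4
    refine ((h.system n).coercive (δ n - r n)).trans_lt (lt_of_le_of_lt ?_ h2)
    have h5 := (h.system n).symm (δ n) (r n)
    simp only [map_add, map_sub, add_apply, sub_apply, ContinuousLinearMap.comp_apply] at h1 h3 ⊢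
    linarith
  have hsub : Tendsto (fun n => i n (δ n) - i n (r n)) F (𝓝 0) := by
    rw [Metric.tendsto_nhds]
    intro e he
    filter_upwards [key (c * e ^ 2 / 2) (by positivity)] with n hn
    rw [dist_zero_right, ← map_sub]
    refine (h.norm_le n _).trans_lt ?_
    have : ‖δ n - r n‖ ^ 2 < e ^ 2 := by
      refine lt_of_mul_lt_mul_left ?_ hc.le
      linarith
    exact lt_of_pow_lt_pow_left₀ 2 he.le this
  have := hsub.add hrF
  simpa using this

theorem IsMoscoLimit.tendsto_scheme (h : IsMoscoLimit c M R i a i₀ a₀) (Λ : ℕ → H →L[ℝ] ℝ)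
    {y : ∀ n, Y n} {y₀ : Y₀} (hy : Tendsto (fun n => i n (y n)) atTop (𝓝 (i₀ y₀))) (k : ℕ) :
    Tendsto (fun n => i n (scheme (h.system n) (fun k => (Λ k).comp (i n)) (y n) k)) atTop
      (𝓝 (i₀ (scheme h.system₀ (fun k => (Λ k).comp i₀) y₀ k))) := by
  induction k with
  | zero => exact hy
  | succ k ih =>
    have h1 := h.tendsto_increment (Λ (k + 1)) ih
      (fun n => scheme_isIncrement (h.system n) (ℓ := fun k => (Λ k).comp (i n)) (y₀ := y n) k)
      (scheme_isIncrement h.system₀ (ℓ := fun k => (Λ k).comp i₀) (y₀ := y₀) k)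
    have h2 := ih.add h1
    simpa only [← map_add, add_sub_cancel] using h2

/-- The limit of stable states is stable. -/
theorem IsMoscoLimit.admissible_of_tendsto (h : IsMoscoLimit c M R i a i₀ a₀) (Λ : H →L[ℝ] ℝ)
    {y : ∀ n, Y n} {y₀ : Y₀} (hy : Tendsto (fun n => i n (y n)) atTop (𝓝 (i₀ y₀)))
    (hst : ∀ n, IsAdmissibleForce (fun y => R (i n y)) (Λ.comp (i n) - a n (y n))) :
    IsAdmissibleForce (fun y => R (i₀ y)) (Λ.comp i₀ - a₀ y₀) := by
  intro v
  rcases eq_or_ne (R (i₀ v)) ∞ with hv | hv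
  · simp [hv]
  obtain ⟨r, hr, hrR⟩ := h.recovery v hv
  obtain ⟨F, hF⟩ := Ultrafilter.exists_le (atTop : Filter ℕ)
  have hc := h.system₀.pos
  have hrF := hr.mono_left hF
  have hrb : ∃ C, ∀ᶠ n in F, ‖r n‖ ≤ C := by
    refine ⟨Real.sqrt (|M| / c) * (‖i₀ v‖ + 1), ?_⟩
    filter_upwards [(tendsto_order.1 hrF.norm).2 (‖i₀ v‖ + 1) (by linarith)] with n hn
    have h1 := (h.system n).coercive (r n)
    have h2 := (le_abs_self _).trans (h.bound n (r n) (r n))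
    have h3 : M * ‖i n (r n)‖ * ‖i n (r n)‖ ≤ |M| * (‖i₀ v‖ + 1) ^ 2 := by
      rw [mul_assoc, ← sq]
      have := le_abs_self M
      gcongr
    refine (sq_le_sq₀ (norm_nonneg _) (by positivity)).1 ?_
    rw [mul_pow, Real.sq_sqrt (by positivity), div_mul_eq_mul_div, le_div_iff₀ hc, mul_comm]
    linarith
  have hform := h.form_tendsto F hF y r y₀ v (hy.mono_left hF) hrb
    fun g => hrF.inner tendsto_const_nhds
  have hlim : Tendsto (fun n => (Λ.comp (i n) - a n (y n)) (r n)) F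
      (𝓝 ((Λ.comp i₀ - a₀ y₀) v)) := ((Λ.continuous.tendsto _).comp hrF).sub hform
  exact le_of_tendsto' ((ENNReal.continuous_ofReal.tendsto _).comp hlim)
    fun n => (hst n (r n)).trans (hrR n)

theorem norm_comp_sub_le {Z : Type*} [NormedAddCommGroup Z] [NormedSpace ℝ Z] {L : ℝ}
    {Λ : ℝ → H →L[ℝ] ℝ} (hΛ : ∀ s t, ‖Λ s - Λ t‖ ≤ L * |s - t|) (j : Z →L[ℝ] H)
    (hj : ∀ z, ‖j z‖ ≤ ‖z‖) (s t : ℝ) : ‖(Λ s).comp j - (Λ t).comp j‖ ≤ L * |s - t| := by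
  rw [← ContinuousLinearMap.sub_comp]
  refine (ContinuousLinearMap.opNorm_comp_le _ _).trans (le_trans ?_ (hΛ s t))
  exact mul_le_of_le_one_right (norm_nonneg _)
    (j.opNorm_le_bound zero_le_one fun z => by rw [one_mul]; exact hj z)

theorem hasDerivAt_comp {Z : Type*} [NormedAddCommGroup Z] [NormedSpace ℝ Z]
    {Λ : ℝ → H →L[ℝ] ℝ} {Λ' : H →L[ℝ] ℝ} {s : ℝ} (hΛ : HasDerivAt Λ Λ' s) (j : Z →L[ℝ] H) :
    HasDerivAt (fun t => (Λ t).comp j) (Λ'.comp j) s :=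
  ((ContinuousLinearMap.compL ℝ Z H ℝ).flip j).hasFDerivAt.comp_hasDerivAt s hΛ

theorem continuousOn_comp {Z : Type*} [NormedAddCommGroup Z] [NormedSpace ℝ Z]
    {Λ : ℝ → H →L[ℝ] ℝ} {S : Set ℝ} (hΛ : ContinuousOn Λ S) (j : Z →L[ℝ] H) :
    ContinuousOn (fun t => (Λ t).comp j) S :=
  ((ContinuousLinearMap.compL ℝ Z H ℝ).flip j).continuous.comp_continuousOn hΛ

/-- Convergence of the energetic solutions. -/
theorem IsMoscoLimit.tendsto_energeticSolution (h : IsMoscoLimit c M R i a i₀ a₀) {T L : ℝ}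
    (hT : 0 < T) {Λ Λ' : ℝ → H →L[ℝ] ℝ} (hΛ : ∀ s t, ‖Λ s - Λ t‖ ≤ L * |s - t|)
    (hΛd : ∀ s ∈ Ioo 0 T, HasDerivAt Λ (Λ' s) s) (hΛ'c : ContinuousOn Λ' (Icc 0 T))
    {E power : ∀ n, ℝ → Y n → ℝ} {E₀ power₀ : ℝ → Y₀ → ℝ}
    (hE : ∀ n, ∀ t ∈ Icc 0 T, ∀ y, E n t y = 1 / 2 * a n y y - Λ t (i n y))
    (hE₀ : ∀ t ∈ Icc 0 T, ∀ y, E₀ t y = 1 / 2 * a₀ y y - Λ t (i₀ y))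
    (hpower : ∀ n, ∀ t ∈ Icc 0 T, ∀ y, power n t y = Λ' t (i n y))
    (hpower₀ : ∀ t ∈ Icc 0 T, ∀ y, power₀ t y = Λ' t (i₀ y))
    {y : ∀ n, Y n} {y₀ : Y₀} (hst : ∀ n, y n ∈ stableSet (E n) (fun y => R (i n y)) 0)
    (hy : Tendsto (fun n => i n (y n)) atTop (𝓝 (i₀ y₀))) :
    y₀ ∈ stableSet E₀ (fun y => R (i₀ y)) 0 ∧
    ∃ (ys : ∀ n, ℝ → Y n) (y' : ℝ → Y₀),
      (∀ n, IsUniqueEnergeticSolution T (E n) (fun y => R (i n y)) (power n) (y n) (ys n)) ∧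
      IsUniqueEnergeticSolution T E₀ (fun y => R (i₀ y)) power₀ y₀ y' ∧
      ∀ t ∈ Icc 0 T, Tendsto (fun n => i n (ys n t)) atTop (𝓝 (i₀ (y' t))) := by
  have h00 : (0 : ℝ) ∈ Icc 0 T := ⟨le_rfl, hT.le⟩
  have hL := lipschitz_const_nonneg (ℓ := fun t => Λ t) hΛ
  have hst' : ∀ n, IsAdmissibleForce (fun y => R (i n y)) ((Λ 0).comp (i n) - a n (y n)) :=
    fun n => (mem_stableSet_iff (h.system n) (hE n 0 h00)).1 (hst n)
  have hst₀ : y₀ ∈ stableSet E₀ (fun y => R (i₀ y)) 0 :=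
    (mem_stableSet_iff h.system₀ (f := (Λ 0).comp i₀) (hE₀ 0 h00)).2
      (h.admissible_of_tendsto (Λ 0) hy hst')
  have hlip := fun n => norm_comp_sub_le hΛ (i n) (h.norm_le n)
  have hlip₀ := norm_comp_sub_le hΛ i₀ h.norm_le₀
  choose ys hys hrate using fun n => exists_uniqueEnergeticSolution (h.system n) hT (hlip n)
    (fun s hs => hasDerivAt_comp (hΛd s hs) (i n)) (continuousOn_comp hΛ'c (i n)) (hE n)
    (hpower n) (hst n)
  obtain ⟨y', hy', hrate₀⟩ := exists_uniqueEnergeticSolution h.system₀ hT hlip₀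
    (fun s hs => hasDerivAt_comp (hΛd s hs) i₀) (continuousOn_comp hΛ'c i₀) hE₀ hpower₀ hst₀
  refine ⟨hst₀, ys, y', hys, hy', fun t ht => ?_⟩
  set K : ℝ := 2 * (L * T / c) / (1 - dyadicRate) with hK
  have hKj : ∀ j, 2 * (L * T / c) * dyadicRate ^ j / (1 - dyadicRate) = K * dyadicRate ^ j :=
    fun j => by rw [hK]; ring
  have hK0 : Tendsto (fun j => K * dyadicRate ^ j) atTop (𝓝 0) := by
    simpa using (tendsto_pow_atTop_nhds_zero_of_lt_one dyadicRate_nonneg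
      dyadicRate_lt_one).const_mul K
  rw [Metric.tendsto_atTop]
  intro e he
  -- The level j is chosen before n. This is possible because the error bound of the scheme involves
  -- only L, T and c, the same for every n and for the limit system.
  obtain ⟨j, hj⟩ := ((tendsto_order.1 hK0).2 (e / 3) (by positivity)).exists
  have hsch := h.tendsto_scheme (fun k => dyadicLoad Λ T j k) hy (dyadicIndex T j t)
  obtain ⟨N, hN⟩ := Metric.tendsto_atTop.1 hsch (e / 3) (by positivity)
  refine ⟨N, fun n hn => ?_⟩
  have e1 := hrate n t ht j
  have e2 := hrate₀ t ht j
  rw [hKj, dist_eq_norm] at e1 e2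
  have e3 := hN n hn
  have e1' := (h.norm_le n _).trans e1
  have e2' := (h.norm_le₀ _).trans e2
  rw [map_sub, ← dist_eq_norm] at e1' e2'
  have t1 := dist_triangle4_right (i n (ys n t)) (i₀ (y' t))
    (i n (dyadicApprox (h.system n) (fun t => (Λ t).comp (i n)) (y n) T j t))
    (i₀ (dyadicApprox h.system₀ (fun t => (Λ t).comp i₀) y₀ T j t))
  have e3' : dist (i n (dyadicApprox (h.system n) (fun t => (Λ t).comp (i n)) (y n) T j t))
    (i₀ (dyadicApprox h.system₀ (fun t => (Λ t).comp i₀) y₀ T j t)) < e / 3 := e3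
  rw [dist_comm] at e1' e2'
  linarith

end Mosco

end SpringNetwork

namespace SpringNetwork

/-! ### Square integrable functions, tensor products and limits of ranges. -/

section LTwo

variable {α β γ : Type*} [MeasurableSpace α] [MeasurableSpace β] [MeasurableSpace γ]
  {μ : Measure α} {ν : Measure β} {κ : Measure γ}

/-- Composition with a measure preserving map on `L²`. -/
noncomputable def pull (f : α → β) (hf : MeasurePreserving f μ ν) : Lp ℝ 2 ν →ₗᵢ[ℝ] Lp ℝ 2 μ :=
  Lp.compMeasurePreservingₗᵢ ℝ f hf

theorem coeFn_pull {f : α → β} (hf : MeasurePreserving f μ ν) (g : Lp ℝ 2 ν) :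
    pull f hf g =ᵐ[μ] g ∘ f :=
  Lp.coeFn_compMeasurePreserving g hf

theorem pull_pull {f : α → β} (hf : MeasurePreserving f μ ν) {g : β → γ}
    (hg : MeasurePreserving g ν κ) (u : Lp ℝ 2 κ) :
    pull f hf (pull g hg u) = pull (g ∘ f) (hg.comp hf) u :=
  (Lp.compMeasurePreserving_comp_apply u hg hf).symm

theorem pull_congr {f g : α → β} (hf : MeasurePreserving f μ ν) (hg : MeasurePreserving g μ ν)
    (h : f = g) (u : Lp ℝ 2 ν) : pull f hf u = pull g hg u := by
  subst h; rfl

theorem inner_eq_integral (f g : Lp ℝ 2 μ) : inner ℝ f g = ∫ x, f x * g x ∂μ := by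
  rw [L2.inner_def]
  exact integral_congr_ae (Eventually.of_forall fun x => by simp [mul_comm])

theorem integrable_mul (f g : Lp ℝ 2 μ) : Integrable (fun x => f x * g x) μ :=
  (Lp.memLp f).integrable_mul (Lp.memLp g)

theorem norm_sq_eq_integral (f : Lp ℝ 2 μ) : ‖f‖ ^ 2 = ∫ x, f x ^ 2 ∂μ := by
  rw [← real_inner_self_eq_norm_sq, inner_eq_integral]
  simp only [sq]

/-- Dominated convergence in `L²`. -/
theorem tendsto_of_dominated {f : ℕ → Lp ℝ 2 μ} {g : Lp ℝ 2 μ} {b : α → ℝ} (hb : MemLp b 2 μ)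
    (hle : ∀ n, ∀ᵐ x ∂μ, |f n x| ≤ b x)
    (hlim : ∀ᵐ x ∂μ, Tendsto (fun n => f n x) atTop (𝓝 (g x))) :
    Tendsto f atTop (𝓝 g) := by
  rw [tendsto_iff_norm_sub_tendsto_zero]
  suffices h : Tendsto (fun n => ‖f n - g‖ ^ 2) atTop (𝓝 0) by simpa using h.sqrt
  have hg : ∀ᵐ x ∂μ, |g x| ≤ b x := by
    filter_upwards [hlim, ae_all_iff.2 hle] with x h1 h2 using le_of_tendsto' h1.abs h2
  have e : ∀ n, ‖f n - g‖ ^ 2 = ∫ x, (f n x - g x) ^ 2 ∂μ := fun n => by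
    rw [norm_sq_eq_integral]
    refine integral_congr_ae ?_
    filter_upwards [Lp.coeFn_sub (f n) g] with x hx
    rw [hx, Pi.sub_apply]
  simp only [e]
  have h0 : (0 : ℝ) = ∫ _x : α, (0 : ℝ) ∂μ := by simp
  rw [h0]
  -- The majorant 4b² comes from |f n - g| ≤ 2b, as the pointwise limit g inherits the bound b.
  refine tendsto_integral_of_dominated_convergence (fun x => 4 * b x ^ 2)
    (fun n => ((Lp.aestronglyMeasurable (f n)).sub (Lp.aestronglyMeasurable g)).pow 2)
    (hb.integrable_sq.const_mul 4) (fun n => ?_) ?_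
  · filter_upwards [hle n, hg] with x h1 h2
    rw [Real.norm_eq_abs, abs_of_nonneg (sq_nonneg _)]
    have h3 : |f n x - g x| ≤ 2 * b x := by
      have := abs_sub (f n x) (g x)
      linarith
    calc (f n x - g x) ^ 2 = |f n x - g x| ^ 2 := (sq_abs _).symm
      _ ≤ (2 * b x) ^ 2 := by gcongr
      _ = 4 * b x ^ 2 := by ring
  · filter_upwards [hlim] with x hx
    have := (hx.sub_const (g x)).pow 2
    simpa using this

/-! ### Tensor products -/

variable [SFinite μ] [SFinite ν]

theorem memLp_tens (ψ : Lp ℝ 2 μ) (η : Lp ℝ 2 ν) :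
    MemLp (fun p : α × β => ψ p.1 * η p.2) 2 (μ.prod ν) := by
  have hm : AEStronglyMeasurable (fun p : α × β => ψ p.1 * η p.2) (μ.prod ν) :=
    (Lp.aestronglyMeasurable ψ).comp_fst.mul (Lp.aestronglyMeasurable η).comp_snd
  rw [memLp_two_iff_integrable_sq hm]
  have := (Lp.memLp ψ).integrable_sq.mul_prod (Lp.memLp η).integrable_sq
  refine this.congr (Eventually.of_forall fun p => ?_)
  simp [mul_pow]

/-- The tensor product `ψ ⊗ η` as an element of `L²` of the product measure. -/
noncomputable def tensFun (ψ : Lp ℝ 2 μ) (η : Lp ℝ 2 ν) : Lp ℝ 2 (μ.prod ν) := (memLp_tens ψ η).toLp _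

theorem coeFn_tensFun (ψ : Lp ℝ 2 μ) (η : Lp ℝ 2 ν) :
    tensFun ψ η =ᵐ[μ.prod ν] fun p => ψ p.1 * η p.2 := (memLp_tens ψ η).coeFn_toLp

theorem ae_prod_fst {p : α → Prop} (h : ∀ᵐ x ∂μ, p x) : ∀ᵐ z ∂μ.prod ν, p z.1 :=
  Measure.quasiMeasurePreserving_fst.ae h

theorem ae_prod_snd {p : β → Prop} (h : ∀ᵐ x ∂ν, p x) : ∀ᵐ z ∂μ.prod ν, p z.2 :=
  Measure.quasiMeasurePreserving_snd.ae h

theorem norm_tensFun (ψ : Lp ℝ 2 μ) (η : Lp ℝ 2 ν) : ‖tensFun ψ η‖ = ‖ψ‖ * ‖η‖ := by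
  rw [← sq_eq_sq₀ (norm_nonneg _) (by positivity), mul_pow, norm_sq_eq_integral,
    norm_sq_eq_integral, norm_sq_eq_integral, ← integral_prod_mul]
  refine integral_congr_ae ?_
  filter_upwards [coeFn_tensFun ψ η] with p hp
  rw [hp, mul_pow]

/-- The tensor product as a continuous bilinear map. -/
noncomputable def tens : Lp ℝ 2 μ →L[ℝ] Lp ℝ 2 ν →L[ℝ] Lp ℝ 2 (μ.prod ν) :=
  LinearMap.mkContinuous₂ (LinearMap.mk₂ ℝ tensFun
    (fun ψ ψ' η => by
      apply Lp.ext
      filter_upwards [coeFn_tensFun (ψ + ψ') η, coeFn_tensFun ψ η, coeFn_tensFun ψ' η,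
        Lp.coeFn_add (tensFun ψ η) (tensFun ψ' η), ae_prod_fst (ν := ν) (Lp.coeFn_add ψ ψ')]
        with p h1 h2 h3 h4 h5
      rw [h1, h4, Pi.add_apply, h2, h3, h5, Pi.add_apply, add_mul])
    (fun c ψ η => by
      apply Lp.ext
      filter_upwards [coeFn_tensFun (c • ψ) η, coeFn_tensFun ψ η,
        Lp.coeFn_smul c (tensFun ψ η), ae_prod_fst (ν := ν) (Lp.coeFn_smul c ψ)]
        with p h1 h2 h4 h5
      rw [h1, h4, Pi.smul_apply, h2, h5, Pi.smul_apply, smul_eq_mul, smul_eq_mul, mul_assoc])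
    (fun ψ η η' => by
      apply Lp.ext
      filter_upwards [coeFn_tensFun ψ (η + η'), coeFn_tensFun ψ η, coeFn_tensFun ψ η',
        Lp.coeFn_add (tensFun ψ η) (tensFun ψ η'), ae_prod_snd (μ := μ) (Lp.coeFn_add η η')]
        with p h1 h2 h3 h4 h5
      rw [h1, h4, Pi.add_apply, h2, h3, h5, Pi.add_apply, mul_add])
    (fun c ψ η => by
      apply Lp.ext
      filter_upwards [coeFn_tensFun ψ (c • η), coeFn_tensFun ψ η,
        Lp.coeFn_smul c (tensFun ψ η), ae_prod_snd (μ := μ) (Lp.coeFn_smul c η)]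
        with p h1 h2 h4 h5
      rw [h1, h4, Pi.smul_apply, h2, h5, Pi.smul_apply, smul_eq_mul, smul_eq_mul]
      ring)) 1 fun ψ η => by
      rw [LinearMap.mk₂_apply, norm_tensFun, one_mul]

theorem coeFn_tens (ψ : Lp ℝ 2 μ) (η : Lp ℝ 2 ν) :
    tens ψ η =ᵐ[μ.prod ν] fun p => ψ p.1 * η p.2 := coeFn_tensFun ψ η

theorem inner_tens_tens (ψ ψ' : Lp ℝ 2 μ) (η η' : Lp ℝ 2 ν) :
    inner ℝ (tens ψ η) (tens ψ' η') = inner ℝ ψ ψ' * inner ℝ η η' := by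
  rw [inner_eq_integral, inner_eq_integral, inner_eq_integral, ← integral_prod_mul]
  refine integral_congr_ae ?_
  filter_upwards [coeFn_tens ψ η, coeFn_tens ψ' η'] with p h1 h2
  rw [h1, h2]
  ring

/-- Elementary tensors are total in `L²` of a product measure. -/
theorem eq_zero_of_inner_tens [IsFiniteMeasure μ] [SigmaFinite ν] {f : Lp ℝ 2 (μ.prod ν)}
    (h : ∀ ψ η, inner ℝ f (tens ψ η) = 0) : f = 0 := by
  have hrect : ∀ (A : Set α) (B : Set β), MeasurableSet A → MeasurableSet B → ν B ≠ ∞ →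
      ∫ p in A ×ˢ B, f p ∂μ.prod ν = 0 := by
    intro A B hA hB hνB
    rw [← h (indicatorConstLp 2 hA (measure_ne_top μ A) 1) (indicatorConstLp 2 hB hνB 1),
      inner_eq_integral, ← integral_indicator (hA.prod hB)]
    refine integral_congr_ae ?_
    filter_upwards [coeFn_tens (indicatorConstLp 2 hA (measure_ne_top μ A) (1 : ℝ))
      (indicatorConstLp 2 hB hνB (1 : ℝ)),
      ae_prod_fst (ν := ν) (indicatorConstLp_coeFn (p := 2) (hs := hA) (hμs := measure_ne_top μ A)
        (c := (1 : ℝ))),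
      ae_prod_snd (μ := μ) (indicatorConstLp_coeFn (p := 2) (hs := hB) (hμs := hνB)
        (c := (1 : ℝ)))] with p h1 h2 h3
    rw [h1, h2, h3]
    by_cases ha : p.1 ∈ A <;> by_cases hb : p.2 ∈ B <;> simp [indicator, ha, hb]
  -- restrict to sets of finite measure
  have hfin : ∀ B : Set β, MeasurableSet B → ν B ≠ ∞ →
      f =ᵐ[(μ.prod ν).restrict (univ ×ˢ B)] 0 := by
    intro B hB hνB
    set κ := (μ.prod ν).restrict (univ ×ˢ B) with hκ
    have hκfin : IsFiniteMeasure κ := ⟨by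
      rw [hκ, Measure.restrict_apply_univ, Measure.prod_prod]
      exact ENNReal.mul_lt_top (measure_lt_top μ _) hνB.lt_top⟩
    have hfi : Integrable f κ := ((Lp.memLp f).restrict _).integrable (by norm_num)
    -- Vanishing of the integrals spreads from measurable rectangles, an intersection-stable
    -- generator, to all measurable sets.
    have key : ∀ s, MeasurableSet s → ∫ p in s, f p ∂κ = 0 := by
      intro s hs
      induction s, hs using MeasurableSpace.induction_on_inter generateFrom_prod.symm
        isPiSystem_prod with
      | empty => simp
      | basic t ht =>
        obtain ⟨A, hA, D, hD, rfl⟩ := ht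
        rw [hκ, Measure.restrict_restrict (MeasurableSet.prod hA hD), prod_inter_prod, inter_univ]
        exact hrect A (D ∩ B) hA (MeasurableSet.inter hD hB) (measure_ne_top_of_subset inter_subset_right hνB)
      | compl t ht ih =>
        have h1 := integral_add_compl ht hfi
        have h2 : ∫ p, f p ∂κ = 0 := by
          have := hrect univ B MeasurableSet.univ hB hνB
          exact this
        linarith
      | iUnion g hd hg ih =>
        rw [integral_iUnion hg hd hfi.integrableOn]
        simp [ih]
    exact hfi.ae_eq_zero_of_forall_setIntegral_eq_zero fun s hs _ => key s hs
  have hall : ∀ n, ∀ᵐ p ∂μ.prod ν, p.2 ∈ spanningSets ν n → f p = 0 := by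
    intro n
    have h1 := hfin _ (measurableSet_spanningSets ν n) (measure_spanningSets_lt_top ν n).ne
    rw [EventuallyEq, ae_restrict_iff' (MeasurableSet.univ.prod (measurableSet_spanningSets ν n))] at h1
    filter_upwards [h1] with p hp hp2 using hp ⟨mem_univ _, hp2⟩
  apply Lp.ext
  filter_upwards [ae_all_iff.2 hall, Lp.coeFn_zero ℝ 2 (μ.prod ν)] with p hp h0
  rw [h0]
  have := iUnion_spanningSets ν
  obtain ⟨n, hn⟩ := mem_iUnion.1 (this ▸ mem_univ p.2 : p.2 ∈ ⋃ i, spanningSets ν i)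
  exact hp n hn

theorem pull_prodMap_tens {α' β' : Type*} [MeasurableSpace α'] [MeasurableSpace β']
    {μ' : Measure α'} {ν' : Measure β'} [SFinite μ'] [SFinite ν'] {f : α → α'} {g : β → β'}
    (hf : MeasurePreserving f μ μ') (hg : MeasurePreserving g ν ν')
    (hfg : MeasurePreserving (fun p : α × β => (f p.1, g p.2)) (μ.prod ν) (μ'.prod ν'))
    (ψ : Lp ℝ 2 μ') (η : Lp ℝ 2 ν') :
    pull _ hfg (tens ψ η) = tens (pull f hf ψ) (pull g hg η) := by
  apply Lp.ext
  filter_upwards [coeFn_pull hfg (tens ψ η), hfg.quasiMeasurePreserving.ae (coeFn_tens ψ η),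
    coeFn_tens (pull f hf ψ) (pull g hg η), ae_prod_fst (ν := ν) (coeFn_pull hf ψ),
    ae_prod_snd (μ := μ) (coeFn_pull hg η)] with p h1 h2 h3 h4 h5
  rw [h1, Function.comp_apply, h2, h3, h4, h5]
  rfl

end LTwo

/-- The closed submodule of limits of sequences of ranges. -/
theorem exists_tendsto_of_mem_closure {E : ℕ → Type*} {G : Type*} [NormedAddCommGroup G]
    [NormedSpace ℝ G] [∀ n, AddCommGroup (E n)] [∀ n, Module ℝ (E n)] (L : ∀ n, E n →ₗ[ℝ] G)
    {S : Set G} (hS : ∀ w ∈ S, ∃ v : ∀ n, E n, Tendsto (fun n => L n (v n)) atTop (𝓝 w)) {w : G}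
    (hw : w ∈ (Submodule.span ℝ S).topologicalClosure) :
    ∃ v : ∀ n, E n, Tendsto (fun n => L n (v n)) atTop (𝓝 w) := by
  have hspan : ∀ w ∈ Submodule.span ℝ S,
      ∃ v : ∀ n, E n, Tendsto (fun n => L n (v n)) atTop (𝓝 w) := by
    intro w hw
    induction hw using Submodule.span_induction with
    | mem x hx => exact hS x hx
    | zero => exact ⟨fun _ => 0, by simp⟩
    | add x y _ _ hx hy =>
      obtain ⟨v, hv⟩ := hx
      obtain ⟨v', hv'⟩ := hy
      exact ⟨fun n => v n + v' n, by simpa only [map_add] using hv.add hv'⟩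
    | smul c x _ hx =>
      obtain ⟨v, hv⟩ := hx
      exact ⟨fun n => c • v n, by simpa only [map_smul] using hv.const_smul c⟩
  -- The distance from w to the range of L n tends to zero. Choosing at each n an almost nearest
  -- point, with slack 1/(n + 1), replaces a diagonal argument.
  have hdist : ∀ δ : ℝ, 0 < δ → ∀ᶠ n in atTop, Metric.infDist w (range (L n)) < δ := by
    intro δ hδ
    obtain ⟨w', hw', hd⟩ := Metric.mem_closure_iff.1 hw (δ / 2) (by positivity)
    obtain ⟨v, hv⟩ := hspan w' hw'
    filter_upwards [(Metric.tendsto_nhds.1 hv) (δ / 2) (by positivity)] with n hn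
    refine (Metric.infDist_le_dist_of_mem (mem_range_self (v n))).trans_lt ?_
    have := dist_triangle w w' (L n (v n))
    rw [dist_comm] at hn
    linarith
  have hch : ∀ n : ℕ, ∃ v : E n, dist w (L n v) < Metric.infDist w (range (L n)) + 1 / ((n : ℝ) + 1) := by
    intro n
    have : Metric.infDist w (range (L n)) < Metric.infDist w (range (L n)) + 1 / ((n : ℝ) + 1) := by
      have : (0 : ℝ) < 1 / ((n : ℝ) + 1) := by positivity
      linarith
    obtain ⟨_, ⟨v, rfl⟩, hv⟩ := (Metric.infDist_lt_iff (range_nonempty _)).1 this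
    exact ⟨v, hv⟩
  choose v hv using hch
  refine ⟨v, ?_⟩
  rw [Metric.tendsto_nhds]
  intro δ hδ
  filter_upwards [hdist (δ / 2) (by positivity), (tendsto_order.1
    (tendsto_one_div_add_atTop_nhds_zero_nat (𝕜 := ℝ))).2 (δ / 2) (by positivity)] with n h1 h2
  rw [dist_comm]
  have := hv n
  linarith

end SpringNetwork

namespace SpringNetwork

/-! ### Lattice cells, stochastic unfolding and shifts. -/

section Unfolding

variable {d : ℕ}

theorem measurable_nearestNode (ε : ℝ) : Measurable (nearestNode ε : Space d → IntLattice d) := by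
  refine measurable_pi_lambda _ fun i => ?_
  have : Measurable fun x : Space d => x i := by fun_prop
  exact Int.measurable_floor.comp ((this.div_const ε).add_const _)

theorem nearestNode_eq_iff {ε : ℝ} (hε : 0 < ε) (x : Space d) (n : IntLattice d) :
    nearestNode ε x = n ↔ x ∈ cell ε (node ε n) := by
  simp only [funext_iff, nearestNode, Int.floor_eq_iff, cell, mem_ofPred_eq, mem_Ico, node]
  refine forall_congr' fun i => ?_
  rw [← sub_le_iff_le_add, le_div_iff₀ hε, ← lt_sub_iff_add_lt, div_lt_iff₀ hε]
  constructor <;> rintro ⟨h1, h2⟩ <;> constructor <;> nlinarith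

theorem preimage_nearestNode {ε : ℝ} (hε : 0 < ε) (n : IntLattice d) :
    nearestNode ε ⁻¹' {n} = cell ε (node ε n) := by
  ext x
  simp [nearestNode_eq_iff hε]

theorem volume_cell {ε : ℝ} (x : Space d) :
    volume (cell ε x) = ENNReal.ofReal ε ^ d := by
  have h : cell ε x = WithLp.ofLp ⁻¹' (univ.pi fun i => Ico (x i - ε / 2) (x i + ε / 2)) := by
    ext y
    simp only [cell, mem_ofPred_eq, mem_preimage, Set.mem_pi, mem_univ, true_implies, mem_Ico]
    refine forall_congr' fun i => ?_
    constructor <;> rintro ⟨h1, h2⟩ <;> constructor <;> linarith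
  rw [h, (PiLp.volume_preserving_ofLp (Fin d)).measure_preimage
    (MeasurableSet.univ_pi fun i => measurableSet_Ico).nullMeasurableSet, Real.volume_pi_Ico]
  have : ∀ i, x i + ε / 2 - (x i - ε / 2) = ε := fun i => by ring
  simp [this]

theorem measurableSet_cell (ε : ℝ) (x : Space d) : MeasurableSet (cell ε x) := by
  have : cell ε x = ⋂ i, {y : Space d | y i - x i ∈ Ico (-(ε / 2)) (ε / 2)} := by
    ext y; simp [cell]
  rw [this]
  refine MeasurableSet.iInter fun i => ?_
  have h : Measurable fun y : Space d => y i - x i := by fun_prop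
  exact h measurableSet_Ico

instance (ε : ℝ) : SigmaFinite (latticeMeasure d ε) := by
  refine Measure.sigmaFinite_of_countable (S := range fun n : IntLattice d => ({n} : Set _))
    (countable_range _) ?_ ?_
  · rintro _ ⟨n, rfl⟩
    simp [latticeMeasure]
  · ext n
    simp

theorem latticeMeasure_singleton (ε : ℝ) (n : IntLattice d) :
    latticeMeasure d ε {n} = ENNReal.ofReal (ε ^ d) := by
  simp [latticeMeasure]

/-- Each cell has volume ε^d, the mass of its node, and a measure on the countable lattice is
determined by its singletons. -/
theorem measurePreserving_nearestNode {ε : ℝ} (hε : 0 < ε) :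
    MeasurePreserving (nearestNode ε : Space d → IntLattice d) volume (latticeMeasure d ε) := by
  refine ⟨measurable_nearestNode ε, Measure.ext_of_singleton fun n => ?_⟩
  rw [Measure.map_apply (measurable_nearestNode ε) (measurableSet_singleton n),
    preimage_nearestNode hε, volume_cell, latticeMeasure_singleton, ENNReal.ofReal_pow hε.le]

theorem node_add {ε : ℝ} (m n : IntLattice d) : node ε (m + n) = node ε m + node ε n := by
  ext i; simp [node, mul_add]

theorem node_eq_smul (ε : ℝ) (n : IntLattice d) : node ε n = ε • node 1 n := by
  ext i; simp [node]

theorem nearestNode_add_node {ε : ℝ} (hε : 0 < ε) (x : Space d) (n : IntLattice d) :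
    nearestNode ε (x + node ε n) = nearestNode ε x + n := by
  ext i
  simp only [nearestNode, node, Pi.add_apply, PiLp.add_apply]
  rw [← Int.floor_add_intCast]
  congr 1
  field_simp
  ring

theorem norm_node_nearestNode_sub_le {ε : ℝ} (hε : 0 < ε) (x : Space d) :
    ‖node ε (nearestNode ε x) - x‖ ≤ ε * d := by
  have hx := (nearestNode_eq_iff hε x _).1 rfl
  have h1 : ∀ i, ‖(node ε (nearestNode ε x) - x) i‖ ≤ ε := fun i => by
    have := hx i
    rw [mem_Ico] at this
    rw [Real.norm_eq_abs, abs_le]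
    simp only [PiLp.sub_apply]
    constructor <;> linarith
  rw [EuclideanSpace.norm_eq]
  refine Real.sqrt_le_iff.2 ⟨by positivity, ?_⟩
  calc ∑ i, ‖(node ε (nearestNode ε x) - x) i‖ ^ 2 ≤ ∑ i : Fin d, ε ^ 2 :=
        Finset.sum_le_sum fun i _ => pow_le_pow_left₀ (norm_nonneg _) (h1 i) 2
    _ = d * ε ^ 2 := by simp
    _ ≤ (ε * d) ^ 2 := by
      have : (d : ℝ) ≤ d ^ 2 := by
        have : d ≤ d ^ 2 := Nat.le_self_pow two_ne_zero d
        exact_mod_cast this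
      nlinarith [sq_nonneg ε]

theorem tendsto_node_nearestNode {ε : ℕ → ℝ} (hε : ∀ n, 0 < ε n) (hεlim : Tendsto ε atTop (𝓝 0))
    (x : Space d) : Tendsto (fun n => node (ε n) (nearestNode (ε n) x)) atTop (𝓝 x) := by
  rw [tendsto_iff_norm_sub_tendsto_zero]
  refine squeeze_zero (fun _ => norm_nonneg _) (fun n => norm_node_nearestNode_sub_le (hε n) x) ?_
  simpa using hεlim.mul_const (d : ℝ)

variable {Ω : Type*} [MeasurableSpace Ω] {P : Measure Ω} [IsProbabilityMeasure P]
  {τ : IntLattice d → Ω → Ω}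

theorem IsDynamicalSystem.add_apply (hτ : IsDynamicalSystem P τ) (x y : IntLattice d) (ω : Ω) :
    τ (x + y) ω = τ x (τ y ω) := by rw [hτ.add]; rfl

theorem IsDynamicalSystem.neg_apply_apply (hτ : IsDynamicalSystem P τ) (x : IntLattice d) (ω : Ω) :
    τ (-x) (τ x ω) = ω := by rw [← hτ.add_apply, neg_add_cancel, hτ.zero]; rfl

theorem IsDynamicalSystem.apply_neg_apply (hτ : IsDynamicalSystem P τ) (x : IntLattice d) (ω : Ω) :
    τ x (τ (-x) ω) = ω := by rw [← hτ.add_apply, add_neg_cancel, hτ.zero]; rfl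

theorem IsDynamicalSystem.measurable_uncurry (hτ : IsDynamicalSystem P τ) :
    Measurable fun p : IntLattice d × Ω => τ p.1 p.2 :=
  measurable_from_prod_countable_right fun x => (hτ.measurePreserving x).measurable

/-- A map of the form `(ω, x) ↦ (τ_{g x} ω, f x)` preserves the product measure. -/
theorem IsDynamicalSystem.measurePreserving_skew (hτ : IsDynamicalSystem P τ) {α β : Type*}
    [MeasurableSpace α] [MeasurableSpace β] {μ : Measure α} {ν : Measure β} [SFinite μ] [SFinite ν]
    {f : α → β} (hf : MeasurePreserving f μ ν) {g : α → IntLattice d} (hg : Measurable g) :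
    MeasurePreserving (fun p : Ω × α => (τ (g p.2) p.1, f p.2)) (P.prod μ) (P.prod ν) := by
  have h1 : MeasurePreserving (fun p : α × Ω => (f p.1, τ (g p.1) p.2)) (μ.prod P) (ν.prod P) :=
    hf.skew_product (g := fun x ω => τ (g x) ω)
      (hτ.measurable_uncurry.comp ((hg.comp measurable_fst).prodMk measurable_snd))
      (Eventually.of_forall fun x => (hτ.measurePreserving (g x)).map_eq)
  exact (Measure.measurePreserving_swap.comp h1).comp Measure.measurePreserving_swap

variable {ε : ℝ}

/-- The random shift by -n preserves P for every n, so unfolding is isometric. Along the unfolding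
map a coefficient A(τ_n ω) becomes A(ω), independent of x and ε. -/
theorem IsDynamicalSystem.measurePreserving_unfold (hτ : IsDynamicalSystem P τ) (hε : 0 < ε) :
    MeasurePreserving (fun p : Ω × Space d => (τ (-nearestNode ε p.2) p.1, nearestNode ε p.2))
      (P.prod volume) (P.prod (latticeMeasure d ε)) :=
  hτ.measurePreserving_skew (measurePreserving_nearestNode hε) (measurable_nearestNode ε).neg

theorem IsDynamicalSystem.measurePreserving_twist (hτ : IsDynamicalSystem P τ) :
    MeasurePreserving (fun p : Ω × IntLattice d => (τ p.2 p.1, p.2))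
      (P.prod (latticeMeasure d ε)) (P.prod (latticeMeasure d ε)) :=
  hτ.measurePreserving_skew (g := id) (MeasurePreserving.id _) measurable_id

theorem IsDynamicalSystem.measurePreserving_shift (hτ : IsDynamicalSystem P τ) (y : IntLattice d)
    (h : Space d) :
    MeasurePreserving (fun p : Ω × Space d => (τ y p.1, p.2 + h)) (P.prod volume) (P.prod volume) :=
  hτ.measurePreserving_skew (g := fun _ => y) (measurePreserving_add_right volume h) measurable_const

/-- The space `L²(Ω × ℝ^d)`. -/
abbrev FullL2 (P : Measure Ω) (d : ℕ) : Type _ := Lp ℝ 2 (P.prod (volume : Measure (Space d)))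

/-- Stochastic unfolding as an isometry of `L²(Ω × ε ℤ^d)` into `L²(Ω × ℝ^d)`. -/
noncomputable def unfolding (hτ : IsDynamicalSystem P τ) (hε : 0 < ε) : DiscreteL2 P d ε →ₗᵢ[ℝ] FullL2 P d :=
  pull _ (hτ.measurePreserving_unfold hε)

theorem coeFn_unfolding (hτ : IsDynamicalSystem P τ) (hε : 0 < ε) (u : DiscreteL2 P d ε) :
    unfolding hτ hε u =ᵐ[P.prod volume] unfold τ u :=
  coeFn_pull (hτ.measurePreserving_unfold hε) u

/-- The simultaneous shift `F ↦ F(τ_y ω, x + h)`. -/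
noncomputable def shift (hτ : IsDynamicalSystem P τ) (y : IntLattice d) (h : Space d) :
    FullL2 P d →ₗᵢ[ℝ] FullL2 P d :=
  pull _ (hτ.measurePreserving_shift y h)

theorem coeFn_shift (hτ : IsDynamicalSystem P τ) (y : IntLattice d) (h : Space d) (F : FullL2 P d) :
    shift hτ y h F =ᵐ[P.prod volume] fun p => F (τ y p.1, p.2 + h) :=
  coeFn_pull (hτ.measurePreserving_shift y h) F

theorem shift_shift (hτ : IsDynamicalSystem P τ) (y y' : IntLattice d) (h h' : Space d)
    (F : FullL2 P d) : shift hτ y h (shift hτ y' h' F) = shift hτ (y + y') (h + h') F := by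
  unfold shift
  rw [pull_pull]
  apply pull_congr
  ext p
  · simp only [Function.comp_apply]
    rw [add_comm y, hτ.add_apply]
  · simp [add_assoc]

theorem shift_zero (hτ : IsDynamicalSystem P τ) (F : FullL2 P d) : shift hτ 0 0 F = F := by
  apply Lp.ext
  filter_upwards [coeFn_shift hτ 0 0 F] with p hp
  rw [hp, hτ.zero, add_zero, id]

theorem inner_shift_left (hτ : IsDynamicalSystem P τ) (y : IntLattice d) (h : Space d)
    (F G : FullL2 P d) : inner ℝ (shift hτ y h F) G = inner ℝ F (shift hτ (-y) (-h) G) := by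
  rw [← (shift hτ (-y) (-h)).inner_map_map (shift hτ y h F) G, shift_shift, neg_add_cancel,
    neg_add_cancel, shift_zero]

/-- Moving to a neighbouring node changes both the physical point and the compensating random shift.
The random shift survives as ε tends to zero and is the origin of the corrector. -/
theorem unfolding_translate (hτ : IsDynamicalSystem P τ) (hε : 0 < ε) (b : IntLattice d)
    (u : DiscreteL2 P d ε) :
    unfolding hτ hε (translate P ε b u) = shift hτ b (node ε b) (unfolding hτ hε u) := by
  have h1 : unfolding hτ hε (translate P ε b u) =
      pull _ (hτ.measurePreserving_unfold hε) (pull _ (measurePreserving_translate P ε b) u) := rfl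
  rw [h1, pull_pull, shift, unfolding, pull_pull]
  apply pull_congr
  ext p
  · simp only [Function.comp_apply]
    rw [nearestNode_add_node hε, ← hτ.add_apply]
    congr 1
    abel
  · simp [nearestNode_add_node hε]

theorem unfolding_discreteGrad (hτ : IsDynamicalSystem P τ) (hε : 0 < ε) (j : Fin d)
    (u : DiscreteL2 P d ε) :
    unfolding hτ hε (discreteGrad P ε j u) = ε⁻¹ •
      (shift hτ (unitVec j) (node ε (unitVec j)) (unfolding hτ hε u) - unfolding hτ hε u) := by
  rw [← unfolding_translate, ← map_sub, ← map_smul]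
  rfl

/-- The random lattice field `(ω, n) ↦ ψ(τ_n ω) h(n)`. -/
noncomputable def twistTens (hτ : IsDynamicalSystem P τ) (ε : ℝ) (ψ : Lp ℝ 2 P)
    (h : Lp ℝ 2 (latticeMeasure d ε)) : DiscreteL2 P d ε :=
  pull _ (hτ.measurePreserving_twist) (tens ψ h)

theorem coeFn_twistTens (hτ : IsDynamicalSystem P τ) (ψ : Lp ℝ 2 P)
    (h : Lp ℝ 2 (latticeMeasure d ε)) :
    twistTens hτ ε ψ h =ᵐ[P.prod (latticeMeasure d ε)] fun p => ψ (τ p.2 p.1) * h p.2 := by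
  have := hτ.measurePreserving_twist (ε := ε)
  filter_upwards [coeFn_pull this (tens ψ h), this.quasiMeasurePreserving.ae (coeFn_tens ψ h)]
    with p h1 h2
  rw [twistTens, h1, Function.comp_apply, h2]

/-- The shift built into the twisted field cancels the one in the unfolding, so a genuine product
remains. -/
theorem unfolding_twistTens (hτ : IsDynamicalSystem P τ) (hε : 0 < ε) (ψ : Lp ℝ 2 P)
    (h : Lp ℝ 2 (latticeMeasure d ε)) :
    unfolding hτ hε (twistTens hτ ε ψ h) =
      tens ψ (pull _ (measurePreserving_nearestNode hε) h) := by
  have e : MeasurePreserving (fun p : Ω × Space d => (id p.1, nearestNode ε p.2)) (P.prod volume)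
      (P.prod (latticeMeasure d ε)) :=
    (MeasurePreserving.id P).prod (measurePreserving_nearestNode hε)
  rw [unfolding, twistTens, pull_pull, pull_congr _ e, pull_prodMap_tens (MeasurePreserving.id P)
    (measurePreserving_nearestNode hε)]
  · congr 2
    apply Lp.ext
    filter_upwards [coeFn_pull (MeasurePreserving.id P) ψ] with ω hω
    rw [hω]; rfl
  · ext p
    · simp [hτ.apply_neg_apply]
    · simp

theorem shift_tens (hτ : IsDynamicalSystem P τ) (y : IntLattice d) (h : Space d) (ψ : Lp ℝ 2 P)
    (η : Lp ℝ 2 (volume : Measure (Space d))) :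
    shift hτ y h (tens ψ η) =
      tens (pull _ (hτ.measurePreserving y) ψ) (pull _ (measurePreserving_add_right volume h) η) :=
  pull_prodMap_tens (hτ.measurePreserving y) (measurePreserving_add_right volume h) _ ψ η

theorem pull_add_zero (η : Lp ℝ 2 (volume : Measure (Space d))) :
    pull _ (measurePreserving_add_right (volume : Measure (Space d)) 0) η = η := by
  apply Lp.ext
  filter_upwards [coeFn_pull (measurePreserving_add_right (volume : Measure (Space d)) 0) η]
    with x hx
  rw [hx, Function.comp_apply, add_zero]

theorem tendsto_pull_add (η : Lp ℝ 2 (volume : Measure (Space d))) {ι : Type*} {F : Filter ι}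
    {h : ι → Space d} (hh : Tendsto h F (𝓝 0)) :
    Tendsto (fun i => pull _ (measurePreserving_add_right volume (h i)) η) F (𝓝 η) := by
  have hc : Continuous fun v : Space d =>
      pull _ (measurePreserving_add_right (volume : Measure (Space d)) v) η := by
    let g : Space d → C(Space d, Space d) :=
      ContinuousMap.curry ⟨fun p : Space d × Space d => p.2 + p.1, by fun_prop⟩
    have hg : Continuous g := ContinuousMap.continuous _
    exact Continuous.compMeasurePreservingLp (f := fun _ => η) continuous_const hg
      (fun v => measurePreserving_add_right (volume : Measure (Space d)) v) (by simp)
  have := (hc.tendsto 0).comp hh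
  rwa [pull_add_zero] at this

theorem topologicalClosure_span_tens {α β : Type*} [MeasurableSpace α] [MeasurableSpace β]
    (μ : Measure α) (ν : Measure β) [IsFiniteMeasure μ] [SigmaFinite ν] :
    (Submodule.span ℝ {f : Lp ℝ 2 (μ.prod ν) | ∃ ψ η, tens ψ η = f}).topologicalClosure = ⊤ := by
  rw [Submodule.topologicalClosure_eq_top_iff, Submodule.eq_bot_iff]
  intro f hf
  refine eq_zero_of_inner_tens fun ψ η => ?_
  rw [real_inner_comm]
  exact hf _ (Submodule.subset_span ⟨ψ, η, rfl⟩)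

/-- Uniformly bounded operators that converge on a total set converge pointwise. -/
theorem tendsto_of_tendsto_on_total {ι E G : Type*} [NormedAddCommGroup E] [NormedSpace ℝ E]
    [NormedAddCommGroup G] [NormedSpace ℝ G] {F : Filter ι} {L : ι → E →ₗ[ℝ] G} {L₀ : E →ₗ[ℝ] G}
    (hL : ∀ i v, ‖L i v‖ ≤ ‖v‖) (hL₀ : ∀ v, ‖L₀ v‖ ≤ ‖v‖) {S : Set E}
    (hS : (Submodule.span ℝ S).topologicalClosure = ⊤)
    (h : ∀ v ∈ S, Tendsto (fun i => L i v) F (𝓝 (L₀ v))) (v : E) :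
    Tendsto (fun i => L i v) F (𝓝 (L₀ v)) := by
  have hspan : ∀ v ∈ Submodule.span ℝ S, Tendsto (fun i => L i v) F (𝓝 (L₀ v)) := by
    intro v hv
    induction hv using Submodule.span_induction with
    | mem x hx => exact h x hx
    | zero => simpa using tendsto_const_nhds
    | add x y _ _ hx hy => simpa only [map_add] using hx.add hy
    | smul c x _ hx => simpa only [map_smul] using hx.const_smul c
  rw [Metric.tendsto_nhds]
  intro δ hδ
  have hv : v ∈ (Submodule.span ℝ S).topologicalClosure := hS ▸ Submodule.mem_top
  obtain ⟨w, hw, hd⟩ := Metric.mem_closure_iff.1 hv (δ / 3) (by positivity)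
  filter_upwards [(Metric.tendsto_nhds.1 (hspan w hw)) (δ / 3) (by positivity)] with i hi
  have h1 : dist (L i v) (L i w) ≤ dist v w := by
    rw [dist_eq_norm, dist_eq_norm, ← map_sub]; exact hL i _
  have h2 : dist (L₀ w) (L₀ v) ≤ dist v w := by
    rw [dist_comm v w, dist_eq_norm, dist_eq_norm, ← map_sub]; exact hL₀ _
  have := dist_triangle4 (L i v) (L i w) (L₀ w) (L₀ v)
  linarith

/-- The random shift is fixed and only the spatial translation tends to zero. On elementary tensors
this is strong continuity of translations in L², and isometries extend it to all fields. -/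
theorem tendsto_shift (hτ : IsDynamicalSystem P τ) (y : IntLattice d) {ι : Type*} {F : Filter ι}
    {h : ι → Space d} (hh : Tendsto h F (𝓝 0)) (G : FullL2 P d) :
    Tendsto (fun i => shift hτ y (h i) G) F (𝓝 (shift hτ y 0 G)) := by
  refine tendsto_of_tendsto_on_total (L := fun i => (shift hτ y (h i)).toLinearMap)
    (L₀ := (shift hτ y 0).toLinearMap) (fun i v => (LinearIsometry.norm_map _ v).le)
    (fun v => (LinearIsometry.norm_map _ v).le) (topologicalClosure_span_tens P volume) ?_ G
  rintro _ ⟨ψ, η, rfl⟩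
  simp only [LinearIsometry.coe_toLinearMap, shift_tens]
  rw [pull_add_zero]
  exact ((tens _).continuous.tendsto η).comp (tendsto_pull_add η hh)

end Unfolding

end SpringNetwork

namespace SpringNetwork

/-! ### Cell averages as the adjoint of unfolding. -/

section CellAverage

variable {d : ℕ} {Ω : Type*} [MeasurableSpace Ω] {P : Measure Ω} [IsProbabilityMeasure P]
  {τ : IntLattice d → Ω → Ω} {ε : ℝ}

theorem ae_prod_lattice_of_forall {q : Ω × IntLattice d → Prop}
    (h : ∀ n, ∀ᵐ ω ∂P, q (ω, n)) : ∀ᵐ p ∂P.prod (latticeMeasure d ε), q p := by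
  rw [ae_iff]
  refine measure_mono_null (t := ⋃ n, {ω | ¬q (ω, n)} ×ˢ ({n} : Set (IntLattice d))) ?_
    (measure_iUnion_null fun n => ?_)
  · rintro ⟨ω, n⟩ hp
    exact mem_iUnion.2 ⟨n, hp, rfl⟩
  · rw [Measure.prod_prod, ae_iff.1 (h n), zero_mul]

theorem forall_of_ae_prod_lattice (hε : 0 < ε) {q : Ω × IntLattice d → Prop}
    (h : ∀ᵐ p ∂P.prod (latticeMeasure d ε), q p) (n : IntLattice d) : ∀ᵐ ω ∂P, q (ω, n) := by
  have h1 : (P.prod (latticeMeasure d ε)) ({ω | ¬q (ω, n)} ×ˢ ({n} : Set (IntLattice d))) = 0 := by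
    refine measure_mono_null ?_ (ae_iff.1 h)
    rintro ⟨ω, m⟩ ⟨h1, rfl : m = n⟩
    exact h1
  rw [Measure.prod_prod, latticeMeasure_singleton, mul_eq_zero] at h1
  have h2 : ENNReal.ofReal (ε ^ d) ≠ 0 := by simp [pow_pos hε d]
  exact h1.resolve_right h2

theorem ae_lattice_of_ae (hε : 0 < ε) {q : IntLattice d → Prop}
    (h : ∀ᵐ n ∂latticeMeasure d ε, q n) (n : IntLattice d) : q n := by
  by_contra hn
  have h1 : latticeMeasure d ε {n} = 0 :=
    measure_mono_null (by rintro m rfl; exact hn) (ae_iff.1 h)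
  rw [latticeMeasure_singleton] at h1
  have := pow_pos hε d
  simp only [ENNReal.ofReal_eq_zero] at h1
  linarith

theorem latticeMeasure_real_singleton (hε : 0 < ε) (n : IntLattice d) :
    (latticeMeasure d ε).real {n} = ε ^ d := by
  rw [Measure.real, latticeMeasure_singleton, ENNReal.toReal_ofReal (by positivity)]

/-- The cell average, the adjoint of the stochastic unfolding. -/
noncomputable def cellAverage (hτ : IsDynamicalSystem P τ) (hε : 0 < ε) :
    FullL2 P d →L[ℝ] DiscreteL2 P d ε :=
  (unfolding hτ hε).toContinuousLinearMap.adjoint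

theorem inner_cellAverage (hτ : IsDynamicalSystem P τ) (hε : 0 < ε) (F : FullL2 P d)
    (u : DiscreteL2 P d ε) :
    inner ℝ (cellAverage hτ hε F) u = inner ℝ F (unfolding hτ hε u) :=
  ContinuousLinearMap.adjoint_inner_left _ _ _

theorem norm_cellAverage_le (hτ : IsDynamicalSystem P τ) (hε : 0 < ε) (F : FullL2 P d) :
    ‖cellAverage hτ hε F‖ ≤ ‖F‖ := by
  have h : ‖cellAverage hτ hε F‖ ^ 2 ≤ ‖F‖ * ‖cellAverage hτ hε F‖ := by
    rw [← real_inner_self_eq_norm_sq, inner_cellAverage]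
    refine (real_inner_le_norm _ _).trans ?_
    rw [LinearIsometry.norm_map]
  by_contra! hlt
  nlinarith [norm_nonneg F]

/-- Unfolding after its adjoint is the orthogonal projection onto the range of the isometry, hence
gives the best approximation. -/
theorem norm_sub_unfolding_cellAverage_le (hτ : IsDynamicalSystem P τ) (hε : 0 < ε)
    (F : FullL2 P d) (u : DiscreteL2 P d ε) :
    ‖F - unfolding hτ hε (cellAverage hτ hε F)‖ ≤ ‖F - unfolding hτ hε u‖ := by
  set T := unfolding hτ hε
  set G := cellAverage hτ hε F
  have h0 : inner ℝ (F - T G) (T (G - u)) = 0 := by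
    rw [inner_sub_left, T.inner_map_map, inner_cellAverage, sub_self]
  have h1 : F - T u = (F - T G) + T (G - u) := by rw [map_sub]; abel
  have h2 : ‖F - T u‖ ^ 2 = ‖F - T G‖ ^ 2 + ‖T (G - u)‖ ^ 2 := by
    rw [h1, norm_add_sq_real, h0]; ring
  exact le_of_sq_le_sq (by nlinarith [sq_nonneg ‖T (G - u)‖]) (norm_nonneg _)

theorem integrable_section_cell (F : FullL2 P d) (n : IntLattice d) :
    Integrable (fun p => F p * (cell ε (node ε n)).indicator (fun _ => (1 : ℝ)) p.2)
      (P.prod volume) := by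
  have hc : volume (cell ε (node ε n)) ≠ ∞ := by
    rw [volume_cell]; exact ENNReal.pow_ne_top ENNReal.ofReal_ne_top
  have := integrable_mul F (tens (indicatorConstLp 2 MeasurableSet.univ (measure_ne_top P _) (1 : ℝ))
    (indicatorConstLp 2 (measurableSet_cell ε (node ε n)) hc (1 : ℝ)))
  refine this.congr ?_
  filter_upwards [coeFn_tens (indicatorConstLp 2 MeasurableSet.univ (measure_ne_top P _) (1 : ℝ))
    (indicatorConstLp 2 (measurableSet_cell ε (node ε n)) hc (1 : ℝ)),
    ae_prod_fst (ν := (volume : Measure (Space d)))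
      (indicatorConstLp_coeFn (p := 2) (hs := MeasurableSet.univ) (hμs := measure_ne_top P _)
        (c := (1 : ℝ))),
    ae_prod_snd (μ := P) (indicatorConstLp_coeFn (p := 2)
      (hs := measurableSet_cell ε (node ε n)) (hμs := hc) (c := (1 : ℝ)))] with p h1 h2 h3
  rw [h1, h2, h3]
  simp

theorem ae_integrableOn_cell (F : FullL2 P d) :
    ∀ᵐ ω ∂P, ∀ n, IntegrableOn (fun x => F (ω, x)) (cell ε (node ε n)) := by
  rw [ae_all_iff]
  intro n
  filter_upwards [(integrable_section_cell (ε := ε) F n).prod_right_ae] with ω hω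
  rw [← integrable_indicator_iff (measurableSet_cell _ _)]
  refine hω.congr (Eventually.of_forall fun x => ?_)
  by_cases hx : x ∈ cell ε (node ε n) <;> simp [hx]

theorem setAverage_cell (hε : 0 < ε) (n : IntLattice d) (f : Space d → ℝ) :
    ⨍ x in cell ε (node ε n), f x = (ε ^ d)⁻¹ * ∫ x in cell ε (node ε n), f x := by
  rw [setAverage_eq, Measure.real, volume_cell, ← ENNReal.ofReal_pow hε.le,
    ENNReal.toReal_ofReal (by positivity), smul_eq_mul]

/-- Makes the abstract adjoint explicit, as needed for Jensen's inequality and for the discretized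
load. Testing with fields concentrated at one node identifies the integrals over every event, hence
the functions. -/
theorem coeFn_cellAverage (hτ : IsDynamicalSystem P τ) (hε : 0 < ε) (F : FullL2 P d) :
    ∀ᵐ p ∂P.prod (latticeMeasure d ε),
      cellAverage hτ hε F p = ⨍ x in cell ε (node ε p.2), F (τ p.2 p.1, x) := by
  refine ae_prod_lattice_of_forall fun n => ?_
  set G := cellAverage hτ hε F
  have hlm : latticeMeasure d ε {n} ≠ ∞ := by
    rw [latticeMeasure_singleton]; exact ENNReal.ofReal_ne_top
  let h : Lp ℝ 2 (latticeMeasure d ε) := indicatorConstLp 2 (measurableSet_singleton n) hlm 1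
  have hh : ∀ m, h m = ({n} : Set (IntLattice d)).indicator (fun _ => (1 : ℝ)) m :=
    ae_lattice_of_ae hε (indicatorConstLp_coeFn (p := 2) (hs := measurableSet_singleton n)
      (hμs := hlm) (c := (1 : ℝ)))
  have hcell : ∀ x, nearestNode ε x = n ↔ x ∈ cell ε (node ε n) := fun x => nearestNode_eq_iff hε x n
  -- testing against `1_A ⊗ 1_n`
  have key : ∀ s : Set Ω, MeasurableSet s → Integrable (fun ω => G (τ (-n) ω, n)) P ∧
      ε ^ d * ∫ ω in s, G (τ (-n) ω, n) ∂P = ∫ ω in s, (∫ x in cell ε (node ε n), F (ω, x)) ∂P := by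
    intro s hs
    let ψ : Lp ℝ 2 P := indicatorConstLp 2 hs (measure_ne_top P _) 1
    have hψ : ψ =ᵐ[P] s.indicator fun _ => (1 : ℝ) := indicatorConstLp_coeFn
    have hψ' : ∀ᵐ p ∂P.prod (latticeMeasure d ε), ψ (τ p.2 p.1) =
        s.indicator (fun _ => (1 : ℝ)) (τ p.2 p.1) :=
      (hτ.measurePreserving_twist (ε := ε)).quasiMeasurePreserving.ae (ae_prod_fst hψ)
    let g : Ω × IntLattice d → ℝ := fun p => G p * (s.indicator (fun _ => (1 : ℝ)) (τ p.2 p.1) *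
      ({n} : Set (IntLattice d)).indicator (fun _ => (1 : ℝ)) p.2)
    have hg : (fun p => G p * twistTens hτ ε ψ h p) =ᵐ[P.prod (latticeMeasure d ε)] g := by
      filter_upwards [coeFn_twistTens hτ ψ h, hψ'] with p h1 h2
      simp only [g, h1, h2, hh]
    have hgi : Integrable g (P.prod (latticeMeasure d ε)) := (integrable_mul _ _).congr hg
    have hsec : Integrable (fun ω => g (ω, n)) P := ae_lattice_of_ae hε hgi.prod_left_ae n
    have hshift := (hτ.measurePreserving (-n))
    have hg2 : (fun ω => g (τ (-n) ω, n)) = s.indicator fun ω => G (τ (-n) ω, n) := by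
      ext ω
      by_cases hω : ω ∈ s <;> simp [g, hτ.apply_neg_apply, hω]
    have e1 : inner ℝ G (twistTens hτ ε ψ h) = ε ^ d * ∫ ω in s, G (τ (-n) ω, n) ∂P := by
      rw [inner_eq_integral, integral_congr_ae hg, integral_prod_symm _ hgi,
        ← setIntegral_eq_integral_of_forall_compl_eq_zero (s := {n}), integral_singleton,
        latticeMeasure_real_singleton hε, smul_eq_mul, ← integral_indicator hs, ← hg2]
      · congr 1
        conv_lhs => rw [← hshift.map_eq]
        rw [integral_map hshift.measurable.aemeasurable]
        rw [hshift.map_eq]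
        exact hsec.aestronglyMeasurable
      · intro m hm
        have : m ≠ n := hm
        simp [g, this]
    have e2 : inner ℝ F (unfolding hτ hε (twistTens hτ ε ψ h)) =
        ∫ ω in s, (∫ x in cell ε (node ε n), F (ω, x)) ∂P := by
      have hfi := integrable_mul F (unfolding hτ hε (twistTens hτ ε ψ h))
      have hf : (fun p => F p * unfolding hτ hε (twistTens hτ ε ψ h) p) =ᵐ[P.prod volume]
          fun p => F p * (s.indicator (fun _ => (1 : ℝ)) p.1 *
            (cell ε (node ε n)).indicator (fun _ => (1 : ℝ)) p.2) := by
        rw [unfolding_twistTens]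
        filter_upwards [coeFn_tens ψ (pull _ (measurePreserving_nearestNode hε) h),
          ae_prod_fst hψ, ae_prod_snd (coeFn_pull (measurePreserving_nearestNode hε) h)]
          with p h1 h2 h3
        rw [h1, h2, h3, Function.comp_apply, hh]
        congr 2
        by_cases hx : p.2 ∈ cell ε (node ε n)
        · simp [hx, (hcell p.2).2 hx]
        · simp [hx, mt (hcell p.2).1 hx]
      rw [inner_eq_integral, integral_congr_ae hf, integral_prod _ (hfi.congr hf),
        ← integral_indicator hs]
      refine integral_congr_ae (Eventually.of_forall fun ω => ?_)
      by_cases hω : ω ∈ s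
      · simp only [hω, indicator_of_mem, one_mul]
        rw [← integral_indicator (measurableSet_cell _ _)]
        refine integral_congr_ae (Eventually.of_forall fun x => ?_)
        by_cases hx : x ∈ cell ε (node ε n) <;> simp [hx]
      · simp [hω]
    refine ⟨?_, by rw [← e1, ← e2, inner_cellAverage]⟩
    -- integrability, from the test function `1`
    let ψ1 : Lp ℝ 2 P := indicatorConstLp 2 MeasurableSet.univ (measure_ne_top P _) 1
    have hi := integrable_mul G (tens ψ1 h)
    have hi2 : Integrable (fun p : Ω × IntLattice d => G p *
        ({n} : Set (IntLattice d)).indicator (fun _ => (1 : ℝ)) p.2)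
        (P.prod (latticeMeasure d ε)) := by
      refine hi.congr ?_
      filter_upwards [coeFn_tens ψ1 h, ae_prod_fst (ν := latticeMeasure d ε)
        (indicatorConstLp_coeFn (p := 2) (hs := MeasurableSet.univ) (hμs := measure_ne_top P _)
          (c := (1 : ℝ)))] with p h1 h2
      rw [h1, h2, hh]
      simp
    have hi3 : Integrable (fun ω => G (ω, n)) P := by
      have := ae_lattice_of_ae hε hi2.prod_left_ae n
      simpa using this
    exact hshift.integrable_comp_of_integrable hi3
  have hrhs : Integrable (fun ω => ∫ x in cell ε (node ε n), F (ω, x)) P := by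
    refine (integrable_section_cell (ε := ε) F n).integral_prod_left.congr
      (Eventually.of_forall fun ω => ?_)
    simp only
    rw [← integral_indicator (measurableSet_cell _ _)]
    refine integral_congr_ae (Eventually.of_forall fun x => ?_)
    by_cases hx : x ∈ cell ε (node ε n) <;> simp [hx]
  have hae : (fun ω => ε ^ d * G (τ (-n) ω, n)) =ᵐ[P]
      fun ω => ∫ x in cell ε (node ε n), F (ω, x) := by
    refine Integrable.ae_eq_of_forall_setIntegral_eq _ _ ((key univ MeasurableSet.univ).1.const_mul _)
      hrhs fun s hs _ => ?_
    rw [integral_const_mul]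
    exact (key s hs).2
  filter_upwards [(hτ.measurePreserving n).quasiMeasurePreserving.ae hae] with ω hω
  rw [hτ.neg_apply_apply] at hω
  rw [setAverage_cell hε, ← hω, ← mul_assoc, inv_mul_cancel₀ (by positivity), one_mul]

theorem coeFn_unfolding_cellAverage (hτ : IsDynamicalSystem P τ) (hε : 0 < ε) (F : FullL2 P d) :
    ∀ᵐ p ∂P.prod volume, unfolding hτ hε (cellAverage hτ hε F) p =
      ⨍ x in cell ε (node ε (nearestNode ε p.2)), F (p.1, x) := by
  filter_upwards [coeFn_pull (hτ.measurePreserving_unfold hε) (cellAverage hτ hε F),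
    (hτ.measurePreserving_unfold hε).quasiMeasurePreserving.ae (coeFn_cellAverage hτ hε F)]
    with p h1 h2
  rw [unfolding, h1, Function.comp_apply, h2, hτ.apply_neg_apply]

end CellAverage

/-! ### Jensen's inequality on lattice cells. -/

section Jensen

variable {d k : ℕ} {ε : ℝ}

theorem lintegral_latticeMeasure (f : IntLattice d → ℝ≥0∞) :
    ∫⁻ n, f n ∂latticeMeasure d ε = ∑' n, ENNReal.ofReal (ε ^ d) * f n := by
  rw [latticeMeasure, lintegral_smul_measure, lintegral_count, smul_eq_mul, ENNReal.tsum_mul_left]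

theorem lintegral_eq_tsum_cell (hε : 0 < ε) (f : Space d → ℝ≥0∞) :
    ∫⁻ x, f x = ∑' n, ∫⁻ x in cell ε (node ε n), f x := by
  have h : (⋃ n, cell ε (node ε n)) = (univ : Set (Space d)) :=
    eq_univ_of_forall fun x => mem_iUnion.2 ⟨nearestNode ε x, (nearestNode_eq_iff hε x _).1 rfl⟩
  rw [← setLIntegral_univ f, ← h, lintegral_iUnion (fun n => measurableSet_cell _ _)]
  intro m n hmn
  refine disjoint_left.2 fun x hm hn => hmn ?_
  rw [← (nearestNode_eq_iff hε x m).2 hm, (nearestNode_eq_iff hε x n).2 hn]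

/-- Jensen's inequality on the cells. -/
theorem lintegral_cellAverage_le (hε : 0 < ε) {r : (Fin k → ℝ) → ℝ} (h0 : ∀ F, 0 ≤ r F)
    (hr : ConvexOn ℝ univ r) {f : Fin k → Space d → ℝ}
    (hf : ∀ i n, IntegrableOn (f i) (cell ε (node ε n))) :
    ∫⁻ x, ENNReal.ofReal (r fun i => ⨍ x' in cell ε (node ε (nearestNode ε x)), f i x') ≤
      ∫⁻ x, ENNReal.ofReal (r fun i => f i x) := by
  have hrc : Continuous r := by
    rw [← continuousOn_univ]; exact hr.continuousOn isOpen_univ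
  have e := (measurePreserving_nearestNode (d := d) hε).lintegral_comp
    (f := fun n => ENNReal.ofReal (r fun i => ⨍ x' in cell ε (node ε n), f i x'))
    (measurable_of_countable _)
  rw [e, lintegral_latticeMeasure, lintegral_eq_tsum_cell hε]
  refine ENNReal.tsum_le_tsum fun n => ?_
  set c := cell ε (node ε n)
  have hc : volume c = ENNReal.ofReal (ε ^ d) := by rw [volume_cell, ENNReal.ofReal_pow hε.le]
  have hc' : volume.real c = ε ^ d := by
    rw [Measure.real, hc, ENNReal.toReal_ofReal (by positivity)]
  have hfi : IntegrableOn (fun x i => f i x) c := Integrable.of_eval fun i => hf i n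
  have hmeas : AEStronglyMeasurable (fun x => r fun i => f i x) (volume.restrict c) :=
    hrc.comp_aestronglyMeasurable hfi.aestronglyMeasurable
  -- Jensen's inequality requires integrability of the composition. When it fails, the right-hand
  -- side is infinite because r is nonnegative.
  by_cases hint : IntegrableOn (fun x => r fun i => f i x) c
  · rw [← ofReal_integral_eq_lintegral_ofReal hint (Eventually.of_forall fun x => h0 _),
      ← ENNReal.ofReal_mul (by positivity)]
    refine ENNReal.ofReal_le_ofReal ?_
    have h1 := hr.map_set_average_le hrc.continuousOn isClosed_univ (μ := volume) (t := c)
      (f := fun x i => f i x) (by rw [hc]; simp [pow_pos hε d]) (by rw [hc]; simp)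
      (Eventually.of_forall fun _ => mem_univ _) hfi hint
    have h2 : (⨍ x in c, (fun i => f i x)) = fun i => ⨍ x in c, f i x := by
      ext i
      rw [setAverage_eq, setAverage_eq, Pi.smul_apply, eval_integral fun i => hf i n]
    rw [h2] at h1
    refine (mul_le_mul_of_nonneg_left h1 (by positivity)).trans ?_
    rw [setAverage_eq, hc', smul_eq_mul, ← mul_assoc, mul_inv_cancel₀ (by positivity), one_mul]
  · have : ∫⁻ x in c, ENNReal.ofReal (r fun i => f i x) = ∞ := by
      by_contra hne
      refine hint ⟨hmeas, ?_⟩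
      rw [hasFiniteIntegral_iff_ofReal (Eventually.of_forall fun x => h0 _)]
      exact lt_top_iff_ne_top.2 hne
    rw [this]
    exact le_top

end Jensen

end SpringNetwork

namespace SpringNetwork

/-! ### Test functions and their density. -/

section TestFunctions

variable {d : ℕ}

/-- Test functions, the elements of `C_c^∞(O)`. -/
structure IsTest (O : Set (Space d)) (φ : Space d → ℝ) : Prop where
  smooth : ContDiff ℝ (⊤ : ℕ∞) φ
  compact : HasCompactSupport φ
  supp : tsupport φ ⊆ O

variable {O : Set (Space d)} {φ : Space d → ℝ}

theorem IsTest.mono {O' : Set (Space d)} (h : IsTest O φ) (hO : O ⊆ O') : IsTest O' φ :=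
  ⟨h.smooth, h.compact, h.supp.trans hO⟩

theorem IsTest.eq_zero (h : IsTest O φ) {x : Space d} (hx : x ∉ O) : φ x = 0 :=
  image_eq_zero_of_notMem_tsupport fun h' => hx (h.supp h')

theorem IsTest.continuous (h : IsTest O φ) : Continuous φ := h.smooth.continuous

theorem IsTest.memLp (h : IsTest O φ) (p : ℝ≥0∞) (μ : Measure (Space d))
    [IsFiniteMeasureOnCompacts μ] : MemLp φ p μ :=
  h.continuous.memLp_of_hasCompactSupport h.compact

/-- The partial derivative along the `j`-th coordinate. -/
noncomputable def partialDeriv (φ : Space d → ℝ) (j : Fin d) (x : Space d) : ℝ :=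
  fderiv ℝ φ x (EuclideanSpace.single j 1)

theorem IsTest.isTest_partialDeriv (h : IsTest O φ) (j : Fin d) : IsTest O (partialDeriv φ j) := by
  refine ⟨?_, ?_, ?_⟩
  · exact (h.smooth.fderiv_right (m := (⊤ : ℕ∞)) (by simp)).clm_apply contDiff_const
  · exact h.compact.fderiv_apply (𝕜 := ℝ) _
  · exact (tsupport_fderiv_apply_subset ℝ _).trans h.supp

/-- The orthogonal complement is trivial by the fundamental lemma of the calculus of variations. The
measure enters through an equation so that the whole space with plain Lebesgue measure is covered as
well. -/
theorem isTest_total (hO : IsOpen O) {μ : Measure (Space d)} (hμ : μ = volume.restrict O) :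
    (Submodule.span ℝ {η : Lp ℝ 2 μ | ∃ φ, IsTest O φ ∧ η =ᵐ[μ] φ}).topologicalClosure = ⊤ := by
  subst hμ
  rw [Submodule.topologicalClosure_eq_top_iff, Submodule.eq_bot_iff]
  intro f hf
  have hf' : ∀ φ, IsTest O φ → ∫ x in O, φ x * f x = 0 := by
    intro φ hφ
    have := hf ((hφ.memLp 2 _).toLp φ) (Submodule.subset_span ⟨φ, hφ, MemLp.coeFn_toLp _⟩)
    rw [inner_eq_integral] at this
    rw [← this]
    refine integral_congr_ae ?_
    filter_upwards [(hφ.memLp 2 (volume.restrict O)).coeFn_toLp] with x hx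
    rw [hx]
  have hloc : LocallyIntegrableOn f O volume := by
    have h1 : LocallyIntegrable f (volume.restrict O) := (Lp.memLp f).locallyIntegrable (by norm_num)
    exact locallyIntegrableOn_of_locallyIntegrable_restrict h1
  have h0 := hO.ae_eq_zero_of_integral_contDiff_smul_eq_zero hloc fun g hg hgc hgs => by
    have := hf' g ⟨hg, hgc, hgs⟩
    rw [← this, setIntegral_eq_integral_of_forall_compl_eq_zero]
    · simp
    · intro x hx
      rw [image_eq_zero_of_notMem_tsupport fun h => hx (hgs h), zero_mul]
  apply Lp.ext
  filter_upwards [(ae_restrict_iff' hO.measurableSet).2 h0, Lp.coeFn_zero ℝ 2 (volume.restrict O)]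
    with x h1 h2
  rw [h1, h2]; rfl

end TestFunctions

/-! ### Sampling test functions on the lattice. -/

section Sampling

variable {d : ℕ}

theorem finite_node_mem {ε : ℝ} (hε : 0 < ε) {K : Set (Space d)} (hK : Bornology.IsBounded K) :
    {n : IntLattice d | node ε n ∈ K}.Finite := by
  obtain ⟨R, hR⟩ := hK.subset_closedBall 0
  refine (Set.finite_Icc (fun _ => -⌈R / ε⌉ : IntLattice d) (fun _ => ⌈R / ε⌉)).subset ?_
  intro n hn
  have h1 : ‖node ε n‖ ≤ R := by simpa using hR hn
  have h2 : ∀ i, |(n i : ℝ)| ≤ R / ε := fun i => by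
    have := (PiLp.norm_apply_le (node ε n) i).trans h1
    rw [node, Real.norm_eq_abs, abs_mul, abs_of_pos hε] at this
    rw [le_div_iff₀ hε]; linarith
  constructor <;> intro i
  · have := (abs_le.1 (h2 i)).1
    have h3 := Int.le_ceil (R / ε)
    have : (-⌈R / ε⌉ : ℝ) ≤ n i := by linarith
    exact_mod_cast this
  · have := (abs_le.1 (h2 i)).2
    have h3 := Int.le_ceil (R / ε)
    have : (n i : ℝ) ≤ ⌈R / ε⌉ := by linarith
    exact_mod_cast this

theorem memLp_of_finite_support {ε : ℝ} {f : IntLattice d → ℝ} (hf : (Function.support f).Finite) :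
    MemLp f 2 (latticeMeasure d ε) := by
  have h : f = fun n => ∑ m ∈ hf.toFinset, ({m} : Set (IntLattice d)).indicator (fun _ => f m) n := by
    ext n
    by_cases hn : f n = 0
    · rw [hn, Finset.sum_eq_zero]
      intro m hm
      rw [indicator_of_notMem]
      rintro rfl
      simp [hn] at hm
    · rw [Finset.sum_eq_single n]
      · simp
      · intro m _ hmn
        simp [hmn.symm]
      · intro h; simp [hn] at h
  rw [h]
  refine memLp_finsetSum _ fun m _ => memLp_indicator_const 2 (measurableSet_singleton m) _ (Or.inr ?_)
  rw [latticeMeasure_singleton]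
  exact ENNReal.ofReal_ne_top

/-- A finitely supported lattice function as an element of `L²(ε ℤ^d)`. -/
noncomputable def latticeLp (ε : ℝ) (f : IntLattice d → ℝ) (hf : (Function.support f).Finite) :
    Lp ℝ 2 (latticeMeasure d ε) := (memLp_of_finite_support hf).toLp f

theorem coeFn_latticeLp {ε : ℝ} (hε : 0 < ε) {f : IntLattice d → ℝ}
    (hf : (Function.support f).Finite) (n : IntLattice d) : latticeLp ε f hf n = f n :=
  ae_lattice_of_ae hε (memLp_of_finite_support hf).coeFn_toLp n

variable {O : Set (Space d)} {φ : Space d → ℝ}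

theorem IsTest.finite_support (h : IsTest O φ) {ε : ℝ} (hε : 0 < ε) :
    (Function.support fun n => φ (node ε n)).Finite :=
  (finite_node_mem hε h.compact.isCompact.isBounded).subset fun _ hn => subset_tsupport φ hn

theorem exists_bound_of_tendsto_zero {ε : ℕ → ℝ} (hεlim : Tendsto ε atTop (𝓝 0)) :
    ∃ C, 0 < C ∧ ∀ n, ε n ≤ C := by
  obtain ⟨C, hC⟩ := hεlim.bddAbove_range
  exact ⟨max C 1, by positivity, fun n => (hC (mem_range_self n)).trans (le_max_left _ _)⟩

/-- Convergence in `L²` of piecewise constant interpolations. -/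
theorem tendsto_of_nearestNode {ε : ℕ → ℝ} (hε : ∀ n, 0 < ε n) (hεlim : Tendsto ε atTop (𝓝 0))
    {F : ℕ → Lp ℝ 2 (volume : Measure (Space d))} {F₀ : Lp ℝ 2 (volume : Measure (Space d))}
    {f : ℕ → IntLattice d → ℝ} (hF : ∀ n, F n =ᵐ[volume] fun x => f n (nearestNode (ε n) x))
    {M R : ℝ} (hM : ∀ n m, |f n m| ≤ M) (hR : ∀ n m, f n m ≠ 0 → ‖node (ε n) m‖ ≤ R)
    (hlim : ∀ᵐ x, Tendsto (fun n => f n (nearestNode (ε n) x)) atTop (𝓝 (F₀ x))) :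
    Tendsto F atTop (𝓝 F₀) := by
  obtain ⟨C, hC, hεC⟩ := exists_bound_of_tendsto_zero hεlim
  -- Rounding moves a point by at most ε d ≤ C d, so all interpolations live on one ball and are
  -- bounded by M there.
  refine tendsto_of_dominated
    (b := (Metric.closedBall (0 : Space d) (R + C * d)).indicator fun _ => M) ?_ (fun n => ?_) ?_
  · exact memLp_indicator_const 2 Metric.isClosed_closedBall.measurableSet _
      (Or.inr (measure_closedBall_lt_top).ne)
  · filter_upwards [hF n] with x hx
    rw [hx]
    by_cases h0 : f n (nearestNode (ε n) x) = 0
    · rw [h0, abs_zero]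
      exact indicator_nonneg (fun _ _ => (abs_nonneg _).trans (hM n 0)) x
    · rw [indicator_of_mem]
      · exact hM n _
      · have h1 := hR n _ h0
        have h2 := norm_node_nearestNode_sub_le (hε n) x
        have h3 : ε n * d ≤ C * d := by gcongr; exact hεC n
        have h4 := norm_sub_norm_le x (node (ε n) (nearestNode (ε n) x))
        rw [norm_sub_rev] at h4
        rw [Metric.mem_closedBall, dist_zero_right]
        linarith
  · filter_upwards [hlim, ae_all_iff.2 hF] with x h1 h2
    simpa only [h2] using h1

theorem IsTest.exists_bound (h : IsTest O φ) : ∃ M, ∀ x, |φ x| ≤ M := by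
  obtain ⟨M, hM⟩ := h.compact.exists_bound_of_continuous h.continuous
  exact ⟨M, hM⟩

theorem IsTest.exists_support_bound (h : IsTest O φ) : ∃ R, ∀ x, φ x ≠ 0 → ‖x‖ ≤ R := by
  obtain ⟨R, hR⟩ := h.compact.isCompact.isBounded.subset_closedBall 0
  exact ⟨R, fun x hx => by simpa using hR (subset_tsupport φ hx)⟩

theorem IsTest.tendsto_sample (h : IsTest O φ) {ε : ℕ → ℝ} (hε : ∀ n, 0 < ε n)
    (hεlim : Tendsto ε atTop (𝓝 0)) {F₀ : Lp ℝ 2 (volume : Measure (Space d))}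
    (hF₀ : F₀ =ᵐ[volume] φ) :
    Tendsto (fun n => pull _ (measurePreserving_nearestNode (hε n))
      (latticeLp (ε n) (fun m => φ (node (ε n) m)) (h.finite_support (hε n)))) atTop (𝓝 F₀) := by
  obtain ⟨M, hM⟩ := h.exists_bound
  obtain ⟨R, hR⟩ := h.exists_support_bound
  refine tendsto_of_nearestNode hε hεlim (f := fun n m => φ (node (ε n) m)) (M := M) (R := R)
    (fun n => ?_) (fun n m => hM _) (fun n m => hR _) ?_
  · filter_upwards [coeFn_pull (measurePreserving_nearestNode (hε n))
      (latticeLp (ε n) (fun m => φ (node (ε n) m)) (h.finite_support (hε n)))] with x hx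
    rw [hx, Function.comp_apply, coeFn_latticeLp (hε n)]
  · filter_upwards [hF₀] with x hx
    rw [hx]
    exact (h.continuous.tendsto x).comp (tendsto_node_nearestNode hε hεlim x)

theorem IsTest.lipschitz (h : IsTest O φ) : ∃ K, LipschitzWith K φ :=
  h.smooth.lipschitzWith_of_hasCompactSupport h.compact (by simp)

theorem node_unitVec (ε : ℝ) (j : Fin d) : node ε (unitVec j) = ε • EuclideanSpace.single j 1 := by
  ext i
  by_cases hij : i = j
  · subst hij; simp [node, unitVec]
  · simp [node, unitVec, hij]

/-- Convergence of the difference quotients of a sampled test function. -/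
theorem IsTest.tendsto_sample_grad (h : IsTest O φ) {ε : ℕ → ℝ} (hε : ∀ n, 0 < ε n)
    (hεlim : Tendsto ε atTop (𝓝 0)) (j : Fin d) {F₀ : Lp ℝ 2 (volume : Measure (Space d))}
    (hF₀ : F₀ =ᵐ[volume] partialDeriv φ j) :
    Tendsto (fun n => (ε n)⁻¹ •
      (pull _ (measurePreserving_add_right volume (node (ε n) (unitVec j)))
        (pull _ (measurePreserving_nearestNode (hε n))
          (latticeLp (ε n) (fun m => φ (node (ε n) m)) (h.finite_support (hε n)))) -
        pull _ (measurePreserving_nearestNode (hε n))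
          (latticeLp (ε n) (fun m => φ (node (ε n) m)) (h.finite_support (hε n)))))
      atTop (𝓝 F₀) := by
  obtain ⟨K, hK⟩ := h.lipschitz
  obtain ⟨R, hR⟩ := h.exists_support_bound
  obtain ⟨C, hC, hεC⟩ := exists_bound_of_tendsto_zero hεlim
  have hnorm : ∀ n, ‖node (ε n) (unitVec j : IntLattice d)‖ = ε n := fun n => by
    rw [node_unitVec, norm_smul, PiLp.norm_single]
    simp [abs_of_pos (hε n)]
  refine tendsto_of_nearestNode hε hεlim
    (f := fun n m => (ε n)⁻¹ * (φ (node (ε n) m + node (ε n) (unitVec j)) - φ (node (ε n) m)))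
    (M := K) (R := R + C) (fun n => ?_) (fun n m => ?_) (fun n m hm => ?_) ?_
  · set g := latticeLp (ε n) (fun m => φ (node (ε n) m)) (h.finite_support (hε n))
    set G := pull _ (measurePreserving_nearestNode (hε n)) g
    have hG := coeFn_pull (measurePreserving_nearestNode (hε n)) g
    have hs := measurePreserving_add_right (volume : Measure (Space d)) (node (ε n) (unitVec j))
    filter_upwards [hG, hs.quasiMeasurePreserving.ae hG, coeFn_pull hs G,
      Lp.coeFn_smul (ε n)⁻¹ (pull _ hs G - G), Lp.coeFn_sub (pull _ hs G) G] with x h1 h2 h3 h4 h5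
    rw [h4, Pi.smul_apply, h5, Pi.sub_apply, h3, Function.comp_apply, h2, h1, Function.comp_apply,
      Function.comp_apply, coeFn_latticeLp (hε n), coeFn_latticeLp (hε n),
      nearestNode_add_node (hε n), node_add, smul_eq_mul]
  · rw [abs_mul, abs_inv, abs_of_pos (hε n), inv_mul_le_iff₀ (hε n)]
    have := hK.dist_le_mul (node (ε n) m + node (ε n) (unitVec j)) (node (ε n) m)
    rw [Real.dist_eq, dist_eq_norm, add_sub_cancel_left, hnorm] at this
    linarith
  · by_contra! hlt
    refine hm ?_
    have h1 : φ (node (ε n) m) = 0 := by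
      by_contra hne
      have := hR _ hne
      linarith
    have h2 : φ (node (ε n) m + node (ε n) (unitVec j)) = 0 := by
      by_contra hne
      have h3 := hR _ hne
      have h4 := norm_sub_le (node (ε n) m + node (ε n) (unitVec j)) (node (ε n) (unitVec j))
      rw [add_sub_cancel_right, hnorm] at h4
      linarith [hεC n]
    rw [h1, h2]; simp
  · filter_upwards [hF₀] with x hx
    rw [hx]
    -- Strict differentiability is needed because both endpoints of the difference quotient move
    -- with n: the base point is the node nearest to x, not x itself.
    have hd : HasStrictFDerivAt φ (fderiv ℝ φ x) x :=
      h.smooth.contDiffAt.hasStrictFDerivAt (by simp)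
    have ht : Tendsto (fun n => (node (ε n) (nearestNode (ε n) x) + node (ε n) (unitVec j),
        node (ε n) (nearestNode (ε n) x))) atTop (𝓝 (x, x)) := by
      have h1 := tendsto_node_nearestNode hε hεlim x
      have h2 : Tendsto (fun n => node (ε n) (unitVec j : IntLattice d)) atTop (𝓝 0) := by
        rw [tendsto_zero_iff_norm_tendsto_zero]; simpa only [hnorm] using hεlim
      simpa using (h1.add h2).prodMk_nhds h1
    have ho := (hd.isLittleO.comp_tendsto ht)
    simp only [Function.comp_def, add_sub_cancel_left] at ho
    have ho' : (fun n => (ε n)⁻¹ * (φ (node (ε n) (nearestNode (ε n) x) +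
        node (ε n) (unitVec j)) - φ (node (ε n) (nearestNode (ε n) x))) - partialDeriv φ j x)
        =o[atTop] fun _ => (1 : ℝ) := by
      have h1 := (Asymptotics.isBigO_refl (fun n => (ε n)⁻¹) atTop).mul_isLittleO ho.norm_right
      refine (h1.congr (fun n => ?_) fun n => ?_)
      · rw [node_unitVec, map_smul, smul_eq_mul, mul_sub, inv_mul_cancel_left₀ (hε n).ne']
        rfl
      · rw [hnorm, inv_mul_cancel₀ (hε n).ne']
    have := (Asymptotics.isLittleO_one_iff ℝ).1 ho'
    simpa using this.add_const (partialDeriv φ j x)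

end Sampling

/-! ### Density of lattice fields. -/

section Projection

variable {d : ℕ} {Ω : Type*} [MeasurableSpace Ω] {P : Measure Ω} [IsProbabilityMeasure P]
  {τ : IntLattice d → Ω → Ω}

theorem isTest_univ_total :
    (Submodule.span ℝ {η : Lp ℝ 2 (volume : Measure (Space d)) |
      ∃ φ, IsTest univ φ ∧ η =ᵐ[volume] φ}).topologicalClosure = ⊤ :=
  isTest_total isOpen_univ Measure.restrict_univ.symm

theorem tens_test_total :
    (Submodule.span ℝ {F : FullL2 P d | ∃ (ψ : Lp ℝ 2 P) (η : Lp ℝ 2 (volume : Measure (Space d)))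
      (φ : Space d → ℝ), IsTest univ φ ∧ η =ᵐ[volume] φ ∧ tens ψ η = F}).topologicalClosure = ⊤ := by
  set W := (Submodule.span ℝ {F : FullL2 P d | ∃ (ψ : Lp ℝ 2 P)
    (η : Lp ℝ 2 (volume : Measure (Space d)))
      (φ : Space d → ℝ), IsTest univ φ ∧ η =ᵐ[volume] φ ∧ tens ψ η = F}) with hW
  rw [eq_top_iff, ← topologicalClosure_span_tens P (volume : Measure (Space d))]
  refine Submodule.topologicalClosure_minimal _ ?_ W.isClosed_topologicalClosure
  rw [Submodule.span_le]
  rintro _ ⟨ψ, η, rfl⟩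
  have h1 : (⊤ : Submodule ℝ (Lp ℝ 2 (volume : Measure (Space d)))) ≤
      W.topologicalClosure.comap (tens ψ : Lp ℝ 2 (volume : Measure (Space d)) →L[ℝ] FullL2 P d).toLinearMap := by
    rw [← isTest_univ_total]
    refine Submodule.topologicalClosure_minimal _ ?_
      (W.isClosed_topologicalClosure.preimage (tens ψ).continuous)
    rw [Submodule.span_le]
    rintro η ⟨φ, hφ, hη⟩
    exact W.le_topologicalClosure (Submodule.subset_span ⟨ψ, η, φ, hφ, hη, rfl⟩)
  exact h1 Submodule.mem_top

/-- By the best approximation property it suffices that some lattice field approximates ψ ⊗ φ, and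
the samples of φ do. These tensors are total and the operators are contractions. -/
theorem tendsto_unfolding_cellAverage (hτ : IsDynamicalSystem P τ) {ε : ℕ → ℝ} (hε : ∀ n, 0 < ε n)
    (hεlim : Tendsto ε atTop (𝓝 0)) (F : FullL2 P d) :
    Tendsto (fun n => unfolding hτ (hε n) (cellAverage hτ (hε n) F)) atTop (𝓝 F) := by
  refine tendsto_of_tendsto_on_total (L := fun n => (unfolding hτ (hε n)).toLinearMap ∘ₗ
    (cellAverage hτ (hε n)).toLinearMap) (L₀ := LinearMap.id) (fun n v => ?_) (fun v => le_rfl)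
    tens_test_total ?_ F
  · simpa using norm_cellAverage_le hτ (hε n) v
  · rintro _ ⟨ψ, η, φ, hφ, hη, rfl⟩
    have h1 : Tendsto (fun n => unfolding hτ (hε n) (twistTens hτ (ε n) ψ
        (latticeLp (ε n) (fun m => φ (node (ε n) m)) (hφ.finite_support (hε n))))) atTop
        (𝓝 (tens ψ η)) := by
      simp only [unfolding_twistTens]
      exact ((tens ψ).continuous.tendsto η).comp (hφ.tendsto_sample hε hεlim hη)
    rw [tendsto_iff_norm_sub_tendsto_zero] at h1 ⊢
    refine squeeze_zero (fun _ => norm_nonneg _) (fun n => ?_) h1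
    rw [norm_sub_rev, norm_sub_rev _ (tens ψ η)]
    exact norm_sub_unfolding_cellAverage_le hτ (hε n) _ _

end Projection

/-! ### Shift invariant fields are deterministic. -/

section Ergodicity

variable {d : ℕ} {Ω : Type*} [MeasurableSpace Ω] {P : Measure Ω} [IsProbabilityMeasure P]
  {τ : IntLattice d → Ω → Ω}

/-- Almost everywhere invariant functions are constant. -/
theorem IsErgodicSystem.exists_ae_eq_const (hτ : IsDynamicalSystem P τ) (he : IsErgodicSystem P τ)
    {f : Ω → ℝ} (hf : AEStronglyMeasurable f P) (hinv : ∀ x, f ∘ τ x =ᵐ[P] f) :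
    ∃ c, f =ᵐ[P] fun _ => c := by
  obtain ⟨g, hg, hfg⟩ := hf
  have hginv : ∀ x, g ∘ τ x =ᵐ[P] g := fun x => by
    filter_upwards [hinv x, hfg, (hτ.measurePreserving x).quasiMeasurePreserving.ae hfg]
      with ω h1 h2 h3
    rw [Function.comp_apply, ← h3, ← h2, ← h1, Function.comp_apply]
  have hconst : ∃ c, g =ᵐ[P] Function.const Ω c := by
    refine Filter.exists_eventuallyEq_const_of_forall_separating MeasurableSet fun U hU => ?_
    -- Ergodicity speaks of strictly invariant sets, whereas g is invariant only almost everywhere.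
    -- Intersecting over the countable group gives a strictly invariant set that differs from the
    -- preimage of U by a null set.
    set S := ⋂ x, τ x ⁻¹' (g ⁻¹' U) with hS
    have hSm : MeasurableSet S := MeasurableSet.iInter fun x =>
      (hτ.measurePreserving x).measurable (hg.measurable hU)
    have hSinv : ∀ x, τ x '' S = S := by
      intro x
      have h1 : ∀ x, ∀ ω ∈ S, τ x ω ∈ S := by
        intro x ω hω
        rw [hS, mem_iInter] at hω ⊢
        intro y
        have := hω (y + x)
        rwa [mem_preimage, hτ.add_apply] at this
      refine Subset.antisymm (image_subset_iff.2 (h1 x)) fun ω hω => ?_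
      exact ⟨τ (-x) ω, h1 (-x) ω hω, hτ.apply_neg_apply x ω⟩
    have hae : ∀ᵐ ω ∂P, ω ∈ S ↔ g ω ∈ U := by
      filter_upwards [ae_all_iff.2 hginv] with ω hω
      simp only [Function.comp_apply] at hω
      simp [hS, hω]
    rcases he S hSm hSinv with h | h
    · right
      have : ∀ᵐ ω ∂P, ω ∉ S := measure_eq_zero_iff_ae_notMem.1 h
      filter_upwards [this, hae] with ω h1 h2 using fun h3 => h1 (h2.2 h3)
    · left
      have : ∀ᵐ ω ∂P, ω ∈ S := by
        rw [ae_iff]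
        exact (prob_compl_eq_zero_iff hSm).2 h
      filter_upwards [this, hae] with ω h1 h2 using h2.1 h1
  obtain ⟨c, hc⟩ := hconst
  exact ⟨c, hfg.trans hc⟩

/-- The constant function `1` on the probability space. -/
noncomputable def oneLp (P : Measure Ω) [IsProbabilityMeasure P] : Lp ℝ 2 P :=
  indicatorConstLp 2 MeasurableSet.univ (measure_ne_top P _) 1

theorem coeFn_oneLp : oneLp P =ᵐ[P] fun _ => (1 : ℝ) := by
  filter_upwards [indicatorConstLp_coeFn (p := 2) (hs := MeasurableSet.univ)
    (hμs := measure_ne_top P _) (c := (1 : ℝ))] with ω hω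
  rw [oneLp, hω]; simp

theorem inner_oneLp_oneLp : inner ℝ (oneLp P) (oneLp P) = (1 : ℝ) := by
  rw [inner_eq_integral]
  have : (fun ω => oneLp P ω * oneLp P ω) =ᵐ[P] fun _ => (1 : ℝ) := by
    filter_upwards [coeFn_oneLp (P := P)] with ω h
    rw [h, mul_one]
  rw [integral_congr_ae this]
  simp

theorem pull_oneLp (hτ : IsDynamicalSystem P τ) (y : IntLattice d) :
    pull _ (hτ.measurePreserving y) (oneLp P) = oneLp P := by
  apply Lp.ext
  filter_upwards [coeFn_pull (hτ.measurePreserving y) (oneLp P), coeFn_oneLp (P := P),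
    (hτ.measurePreserving y).quasiMeasurePreserving.ae (coeFn_oneLp (P := P))] with ω h1 h2 h3
  rw [h1, Function.comp_apply, h3, h2]

theorem IsErgodicSystem.eq_smul_oneLp (hτ : IsDynamicalSystem P τ) (he : IsErgodicSystem P τ)
    {f : Lp ℝ 2 P} (hf : ∀ y, pull _ (hτ.measurePreserving y) f = f) :
    f = (inner ℝ f (oneLp P) : ℝ) • oneLp P := by
  obtain ⟨c, hc⟩ := he.exists_ae_eq_const hτ (Lp.aestronglyMeasurable f) fun y =>
    (coeFn_pull (hτ.measurePreserving y) f).symm.trans (by rw [hf y])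
  have h : f = c • oneLp P := by
    apply Lp.ext
    filter_upwards [hc, Lp.coeFn_smul c (oneLp P), coeFn_oneLp (P := P)] with ω h1 h2 h3
    rw [h1, h2, Pi.smul_apply, h3, smul_eq_mul, mul_one]
  rw [h, inner_smul_left, inner_oneLp_oneLp]
  simp

/-- A field on `Ω × ℝ^d` that is invariant under all shifts of `Ω` is deterministic. -/
theorem IsErgodicSystem.inner_tens_of_shift_eq (hτ : IsDynamicalSystem P τ)
    (he : IsErgodicSystem P τ) {U : FullL2 P d} (hU : ∀ y, shift hτ y 0 U = U) (ψ : Lp ℝ 2 P)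
    (η : Lp ℝ 2 (volume : Measure (Space d))) :
    inner ℝ U (tens ψ η) = inner ℝ ψ (oneLp P) * inner ℝ U (tens (oneLp P) η) := by
  let L : Lp ℝ 2 P →L[ℝ] FullL2 P d := tens.flip η
  have hL : ∀ φ, L φ = tens φ η := fun φ => rfl
  -- f is the partial integral of U against η in x. It inherits the shift invariance of U and is
  -- therefore constant.
  let f := L.adjoint U
  have hf : ∀ φ, inner ℝ f φ = inner ℝ U (tens φ η) := fun φ => by
    rw [ContinuousLinearMap.adjoint_inner_left, hL]
  have hinv : ∀ y, pull _ (hτ.measurePreserving y) f = f := by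
    intro y
    refine ext_inner_right ℝ fun φ => ?_
    have h1 : φ = pull _ (hτ.measurePreserving y) (pull _ (hτ.measurePreserving (-y)) φ) := by
      rw [pull_pull, pull_congr _ (MeasurePreserving.id P)]
      · apply Lp.ext
        filter_upwards [coeFn_pull (MeasurePreserving.id P) φ] with ω hω
        rw [hω]; rfl
      · ext ω; exact hτ.neg_apply_apply y ω
    rw [hf φ]
    conv_lhs => rw [h1]
    rw [LinearIsometry.inner_map_map, hf]
    have h2 : tens (pull _ (hτ.measurePreserving (-y)) φ) η = shift hτ (-y) 0 (tens φ η) := by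
      rw [shift_tens, pull_add_zero]
    have h3 := inner_shift_left hτ y 0 U (tens φ η)
    rw [h2, ← neg_zero, ← h3, hU]
  have := he.eq_smul_oneLp hτ hinv
  rw [← hf, this, inner_smul_left, hf, real_inner_comm ψ]
  simp [mul_comm]

end Ergodicity

end SpringNetwork

namespace SpringNetwork

/-! ### Extension by zero and orthogonality of correctors to deterministic fields. -/

section Extension

variable {d : ℕ} {Ω : Type*} [MeasurableSpace Ω] {P : Measure Ω} [IsProbabilityMeasure P]
  {O : Set (Space d)}

theorem exists_subseq_tendsto_ae {α : Type*} [MeasurableSpace α] {μ : Measure α}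
    {f : ℕ → Lp ℝ 2 μ} {g : Lp ℝ 2 μ} (h : Tendsto f atTop (𝓝 g)) :
    ∃ ns : ℕ → ℕ, StrictMono ns ∧ ∀ᵐ x ∂μ, Tendsto (fun k => f (ns k) x) atTop (𝓝 (g x)) :=
  (tendstoInMeasure_of_tendsto_Lp h).exists_seq_tendsto_ae

theorem prod_restrict_snd (P : Measure Ω) [IsProbabilityMeasure P] (O : Set (Space d)) :
    P.prod (volume.restrict O) = (P.prod volume).restrict (Prod.snd ⁻¹' O) := by
  conv_lhs => rw [← Measure.restrict_univ (μ := P)]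
  rw [Measure.prod_restrict, univ_prod]

theorem ae_of_ae_prod_restrict (hO : MeasurableSet O) {q : Ω × Space d → Prop}
    (h : ∀ᵐ p ∂P.prod (volume.restrict O), q p) : ∀ᵐ p ∂P.prod volume, p.2 ∈ O → q p := by
  rw [prod_restrict_snd] at h
  exact (ae_restrict_iff' (measurable_snd hO)).1 h

theorem memLp_zeroExt (hO : MeasurableSet O) (f : TwoScaleL2 P O) :
    MemLp (zeroExt O f) 2 (P.prod volume) := by
  rw [zeroExt, memLp_indicator_iff_restrict (measurable_snd hO), ← prod_restrict_snd]
  exact Lp.memLp f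

/-- Extension by zero from `Ω × O` to `Ω × ℝ^d`. -/
noncomputable def extendZero (P : Measure Ω) [IsProbabilityMeasure P] (hO : MeasurableSet O) :
    TwoScaleL2 P O →ₗᵢ[ℝ] FullL2 P d where
  toFun f := (memLp_zeroExt hO f).toLp _
  map_add' f g := by
    rw [← MemLp.toLp_add, MemLp.toLp_eq_toLp_iff]
    filter_upwards [ae_of_ae_prod_restrict hO (Lp.coeFn_add f g)] with p hp
    by_cases hx : p.2 ∈ O
    · simpa [zeroExt, indicator, hx] using hp hx
    · simp [zeroExt, hx]
  map_smul' c f := by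
    rw [RingHom.id_apply, ← MemLp.toLp_const_smul, MemLp.toLp_eq_toLp_iff]
    filter_upwards [ae_of_ae_prod_restrict hO (Lp.coeFn_smul c f)] with p hp
    by_cases hx : p.2 ∈ O
    · simpa [zeroExt, indicator, hx] using hp hx
    · simp [zeroExt, hx]
  norm_map' f := by
    change ‖(memLp_zeroExt hO f).toLp _‖ = ‖f‖
    rw [Lp.norm_toLp, zeroExt, eLpNorm_indicator_eq_eLpNorm_restrict (measurable_snd hO),
      ← prod_restrict_snd, Lp.norm_def]

theorem coeFn_extendZero (hO : MeasurableSet O) (f : TwoScaleL2 P O) :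
    extendZero P hO f =ᵐ[P.prod volume] zeroExt O f :=
  (memLp_zeroExt hO f).coeFn_toLp

/-- A field on `Ω × ℝ^d` that vanishes outside `O` is the extension of a field on `Ω × O`. -/
theorem exists_extendZero_eq (hO : MeasurableSet O) {F : FullL2 P d}
    (hF : ∀ᵐ p ∂P.prod volume, p.2 ∉ O → F p = 0) : ∃ f, extendZero P hO f = F := by
  have hm : MemLp F 2 (P.prod (volume.restrict O)) := by
    rw [prod_restrict_snd]; exact (Lp.memLp F).restrict _
  refine ⟨hm.toLp F, Lp.ext ?_⟩
  filter_upwards [coeFn_extendZero hO (hm.toLp F), ae_of_ae_prod_restrict hO hm.coeFn_toLp, hF]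
    with p h1 h2 h3
  rw [h1, zeroExt]
  by_cases hx : p.2 ∈ O
  · rw [indicator_of_mem (by exact hx), h2 hx]
  · rw [indicator_of_notMem (by exact hx), h3 hx]

theorem norm_oneLp : ‖oneLp P‖ = 1 := by
  have := inner_oneLp_oneLp (P := P)
  rw [real_inner_self_eq_norm_sq] at this
  exact (pow_eq_one_iff_of_nonneg (norm_nonneg _) two_ne_zero).1 this

theorem norm_tens {α β : Type*} [MeasurableSpace α] [MeasurableSpace β] {μ : Measure α}
    {ν : Measure β} [SFinite μ] [SFinite ν] (ψ : Lp ℝ 2 μ) (η : Lp ℝ 2 ν) :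
    ‖tens ψ η‖ = ‖ψ‖ * ‖η‖ := norm_tensFun ψ η

theorem coeFn_tens_oneLp {ν : Measure (Space d)} [SFinite ν] (g : Lp ℝ 2 ν) :
    tens (oneLp P) g =ᵐ[P.prod ν] fun p => g p.2 := by
  filter_upwards [coeFn_tens (oneLp P) g, ae_prod_fst (coeFn_oneLp (P := P))] with p h1 h2
  rw [h1, h2, one_mul]

/-- The mean of φ ∘ τ - φ vanishes because τ preserves P, and having mean zero is a closed
condition. -/
theorem inner_oneLp_of_mem_L2Pot {τ : IntLattice d → Ω → Ω} (hτ : IsDynamicalSystem P τ)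
    {ψ : PiLp 2 (fun _ : Fin d => Lp ℝ 2 P)} (hψ : ψ ∈ L2Pot P τ) (j : Fin d) :
    inner ℝ (oneLp P) (ψ j) = (0 : ℝ) := by
  let K : Submodule ℝ (PiLp 2 (fun _ : Fin d => Lp ℝ 2 P)) :=
    LinearMap.ker ((innerSL ℝ (oneLp P)).comp (PiLp.proj 2 (fun _ : Fin d => Lp ℝ 2 P) j)).toLinearMap
  suffices h : L2Pot P τ ≤ K by exact h hψ
  refine Submodule.topologicalClosure_minimal _ ?_ (ContinuousLinearMap.isClosed_ker _)
  rw [Submodule.span_le]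
  rintro ψ ⟨φ, hφ⟩
  change inner ℝ (oneLp P) (ψ j) = (0 : ℝ)
  have h : ψ j = pull _ (hτ.measurePreserving (unitVec j)) φ - φ := by
    apply Lp.ext
    filter_upwards [hφ j, Lp.coeFn_sub (pull _ (hτ.measurePreserving (unitVec j)) φ) φ,
      coeFn_pull (hτ.measurePreserving (unitVec j)) φ] with ω h1 h2 h3
    rw [h1, h2, Pi.sub_apply, h3, Function.comp_apply]
  rw [h, inner_sub_right]
  conv_lhs => enter [1]; rw [← pull_oneLp hτ (unitVec j)]
  rw [LinearIsometry.inner_map_map, sub_self]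

/-- Correctors have mean zero, hence are orthogonal to every deterministic field. The sum ∇U + χ
therefore determines both summands and their norms. -/
theorem inner_tens_oneLp_of_mem {τ : IntLattice d → Ω → Ω} (hτ : IsDynamicalSystem P τ)
    {χ : PiLp 2 (fun _ : Fin d => TwoScaleL2 P O)} (hχ : χ ∈ L2PotTensor P τ O) (g : DomainL2 O)
    (j : Fin d) : inner ℝ (tens (oneLp P) g) (χ j) = (0 : ℝ) := by
  let K : Submodule ℝ (PiLp 2 (fun _ : Fin d => TwoScaleL2 P O)) :=
    LinearMap.ker ((innerSL ℝ (tens (oneLp P) g)).comp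
      (PiLp.proj 2 (fun _ : Fin d => TwoScaleL2 P O) j)).toLinearMap
  suffices h : L2PotTensor P τ O ≤ K by exact h hχ
  refine Submodule.topologicalClosure_minimal _ ?_ (ContinuousLinearMap.isClosed_ker _)
  rw [Submodule.span_le]
  rintro f ⟨ψ, hψ, η, hf⟩
  change inner ℝ (tens (oneLp P) g) (f j) = (0 : ℝ)
  have h : f j = tens (ψ j) η := Lp.ext ((hf j).trans (coeFn_tens (ψ j) η).symm)
  rw [h, inner_tens_tens, inner_oneLp_of_mem_L2Pot hτ hψ, zero_mul]

end Extension

/-! ### Completeness of the component spaces. -/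

section Completeness

variable {d k : ℕ} {Ω : Type*} [MeasurableSpace Ω] {P : Measure Ω} [IsProbabilityMeasure P]

theorem isClosed_supportedOn (ε : ℝ) (S : Set (Space d)) :
    IsClosed (supportedOn P ε S : Set (DiscreteL2 P d ε)) := by
  refine IsSeqClosed.isClosed fun f g hf hg => ?_
  obtain ⟨ns, _, hns⟩ := exists_subseq_tendsto_ae hg
  have hf' : ∀ k, ∀ᵐ p ∂P.prod (latticeMeasure d ε), node ε p.2 ∉ S → f k p = 0 := hf
  change ∀ᵐ p ∂P.prod (latticeMeasure d ε), node ε p.2 ∉ S → g p = 0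
  filter_upwards [hns, ae_all_iff.2 hf'] with p h1 h2 hp
  refine tendsto_nhds_unique h1 ?_
  simp only [h2 _ hp]
  exact tendsto_const_nhds

instance (ε : ℝ) (S : Set (Space d)) : CompleteSpace (supportedOn P ε S) :=
  (isClosed_supportedOn ε S).completeSpace_coe

theorem continuous_discreteGrad (ε : ℝ) (j : Fin d) : Continuous (discreteGrad P ε j) := by
  have : Continuous fun u : DiscreteL2 P d ε => ε⁻¹ • (translate P ε (unitVec j) u - u) := by
    fun_prop
  exact this

instance (ε : ℝ) (O : Set (Space d)) : CompleteSpace (DiscreteH10 P ε O) := by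
  have e : (DiscreteH10 P ε O : Set (WithLp 2 (DiscreteL2 P d ε × PiLp 2 fun _ : Fin d => DiscreteL2 P d ε))) =
      {v | v.fst ∈ supportedOn P ε O} ∩ ⋂ j, {v | v.snd j = discreteGrad P ε j v.fst} := by
    ext v
    simp [DiscreteH10]
  have h1 : Continuous fun v : WithLp 2 (DiscreteL2 P d ε × PiLp 2 fun _ : Fin d => DiscreteL2 P d ε) =>
      v.fst := by fun_prop
  have h2 : ∀ j, Continuous fun v : WithLp 2 (DiscreteL2 P d ε × PiLp 2 fun _ : Fin d => DiscreteL2 P d ε) =>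
      v.snd j := fun j => by fun_prop
  have h3 := ((isClosed_supportedOn (P := P) ε O).preimage h1).inter
    (isClosed_iInter fun j => isClosed_eq (h2 j) ((continuous_discreteGrad ε j).comp h1))
  exact IsClosed.completeSpace_coe (s := (DiscreteH10 P ε O : Set
    (WithLp 2 (DiscreteL2 P d ε × PiLp 2 fun _ : Fin d => DiscreteL2 P d ε)))) (hs := e ▸ h3)

instance (O : Set (Space d)) : CompleteSpace (H10 O) :=
  (Submodule.isClosed_topologicalClosure _).completeSpace_coe

instance (τ : IntLattice d → Ω → Ω) (O : Set (Space d)) : CompleteSpace (L2PotTensor P τ O) :=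
  (Submodule.isClosed_topologicalClosure _).completeSpace_coe

end Completeness

/-! ### Isometric embeddings into the common Hilbert space. -/

section Embedding

variable {d k : ℕ} {Ω : Type*} [MeasurableSpace Ω] {P : Measure Ω} [IsProbabilityMeasure P]
  {τ : IntLattice d → Ω → Ω} {b : Fin k → IntLattice d} {O : Set (Space d)} {ε : ℝ}

/-- The components `u_l`, `∂_j u_l`, `z_i` of a state. -/
abbrev CrossIndex (d k : ℕ) : Type := Fin d ⊕ (Fin d × Fin d) ⊕ Fin k

/-- The common space for unfolded discrete states and for continuum states. -/
abbrev CrossL2 (P : Measure Ω) (d k : ℕ) : Type _ := PiLp 2 (fun _ : CrossIndex d k => FullL2 P d)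

theorem tendsto_crossL2 {ι : Type*} {F : Filter ι} {f : ι → CrossL2 P d k} {v : CrossL2 P d k} :
    Tendsto f F (𝓝 v) ↔ ∀ c, Tendsto (fun i => f i c) F (𝓝 (v c)) := by
  constructor
  · intro h c
    exact (((PiLp.proj 2 (fun _ : CrossIndex d k => FullL2 P d) c).continuous (R₁ := ℝ)).tendsto v).comp h
  · intro h
    have h1 : Tendsto (fun i => WithLp.ofLp (f i)) F (𝓝 (WithLp.ofLp v)) := tendsto_pi_nhds.2 h
    exact ((PiLp.continuous_toLp 2 (fun _ : CrossIndex d k => FullL2 P d)).tendsto _).comp h1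

/-- The unfolded discrete state. -/
noncomputable def discreteEmbedding (hτ : IsDynamicalSystem P τ) (b : Fin k → IntLattice d)
    (O : Set (Space d)) (hε : 0 < ε) : DiscreteState P b O ε →ₗᵢ[ℝ] CrossL2 P d k where
  toFun y := WithLp.toLp 2 (Sum.elim (fun l => unfolding hτ hε (y.u l))
    (Sum.elim (fun lj => unfolding hτ hε (y.gradU lj.1 lj.2)) fun i => unfolding hτ hε (y.z i)))
  map_add' y y' := by
    ext1 c
    rcases c with l | lj | i
    · exact map_add (unfolding hτ hε) _ _
    · exact map_add (unfolding hτ hε) _ _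
    · exact map_add (unfolding hτ hε) _ _
  map_smul' r y := by
    ext1 c
    rcases c with l | lj | i
    · exact map_smul (unfolding hτ hε) _ _
    · exact map_smul (unfolding hτ hε) _ _
    · exact map_smul (unfolding hτ hε) _ _
  norm_map' y := by
    rw [← sq_eq_sq₀ (norm_nonneg _) (norm_nonneg _)]
    simp only [LinearMap.coe_mk, AddHom.coe_mk]
    rw [PiLp.norm_sq_eq_of_L2, WithLp.prod_norm_sq_eq_of_L2, PiLp.norm_sq_eq_of_L2,
      PiLp.norm_sq_eq_of_L2]
    simp only [Fintype.sum_sum_type, Sum.elim_inl, Sum.elim_inr, LinearIsometry.norm_map,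
      Submodule.coe_norm, WithLp.prod_norm_sq_eq_of_L2, PiLp.norm_sq_eq_of_L2, Fintype.sum_prod_type,
      Finset.sum_add_distrib, add_assoc]
    rfl

theorem discreteEmbedding_u (hτ : IsDynamicalSystem P τ) (hε : 0 < ε) (y : DiscreteState P b O ε)
    (l : Fin d) : discreteEmbedding hτ b O hε y (.inl l) = unfolding hτ hε (y.u l) := rfl

theorem discreteEmbedding_gradU (hτ : IsDynamicalSystem P τ) (hε : 0 < ε)
    (y : DiscreteState P b O ε) (l j : Fin d) :
    discreteEmbedding hτ b O hε y (.inr (.inl (l, j))) = unfolding hτ hε (y.gradU l j) := rfl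

theorem discreteEmbedding_z (hτ : IsDynamicalSystem P τ) (hε : 0 < ε) (y : DiscreteState P b O ε)
    (i : Fin k) : discreteEmbedding hτ b O hε y (.inr (.inr i)) = unfolding hτ hε (y.z i) := rfl

/-- The continuum state, extended by zero. -/
noncomputable def contEmbedding (k : ℕ) (hτ : IsDynamicalSystem P τ) (hO : MeasurableSet O) :
    ContState k P τ O →ₗᵢ[ℝ] CrossL2 P d k where
  toFun y := WithLp.toLp 2 (Sum.elim (fun l => extendZero P hO (tens (oneLp P) (y.U l)))
    (Sum.elim (fun lj => extendZero P hO (tens (oneLp P) (y.gradU lj.1 lj.2) + y.χ lj.1 lj.2))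
      fun i => extendZero P hO (y.Z i)))
  map_add' y y' := by
    ext1 c
    rcases c with l | lj | i
    · exact map_add ((extendZero P hO).toLinearMap ∘ₗ (tens (oneLp P)).toLinearMap) _ _
    · have h1 : (y + y').gradU lj.1 lj.2 = y.gradU lj.1 lj.2 + y'.gradU lj.1 lj.2 := rfl
      have h2 : (y + y').χ lj.1 lj.2 = y.χ lj.1 lj.2 + y'.χ lj.1 lj.2 := rfl
      simp only [Sum.elim_inr, Sum.elim_inl, PiLp.add_apply, h1, h2, map_add]
      abel
    · exact map_add (extendZero P hO) _ _
  map_smul' r y := by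
    ext1 c
    rcases c with l | lj | i
    · exact map_smul ((extendZero P hO).toLinearMap ∘ₗ (tens (oneLp P)).toLinearMap) _ _
    · have h1 : (r • y).gradU lj.1 lj.2 = r • y.gradU lj.1 lj.2 := rfl
      have h2 : (r • y).χ lj.1 lj.2 = r • y.χ lj.1 lj.2 := rfl
      simp only [Sum.elim_inr, Sum.elim_inl, PiLp.smul_apply, h1, h2, map_add, map_smul, smul_add,
        RingHom.id_apply]
    · exact map_smul (extendZero P hO) _ _
  norm_map' y := by
    rw [← sq_eq_sq₀ (norm_nonneg _) (norm_nonneg _)]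
    simp only [LinearMap.coe_mk, AddHom.coe_mk]
    -- Pythagoras: this orthogonality is what makes the continuum embedding isometric although ∇U
    -- and χ enter only through their sum.
    have h : ∀ l j, ‖tens (oneLp P) (y.gradU l j) + y.χ l j‖ ^ 2 =
        ‖y.gradU l j‖ ^ 2 + ‖y.χ l j‖ ^ 2 := fun l j => by
      rw [norm_add_sq_real, ContState.χ, inner_tens_oneLp_of_mem hτ (y.snd.snd l).2, norm_tens,
        norm_oneLp]
      ring
    rw [PiLp.norm_sq_eq_of_L2, WithLp.prod_norm_sq_eq_of_L2, WithLp.prod_norm_sq_eq_of_L2,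
      PiLp.norm_sq_eq_of_L2, PiLp.norm_sq_eq_of_L2, PiLp.norm_sq_eq_of_L2]
    simp only [Fintype.sum_sum_type, Sum.elim_inl, Sum.elim_inr, LinearIsometry.norm_map,
      Submodule.coe_norm, WithLp.prod_norm_sq_eq_of_L2, PiLp.norm_sq_eq_of_L2, Fintype.sum_prod_type,
      Finset.sum_add_distrib, norm_tens, norm_oneLp, one_mul, h]
    simp only [ContState.U, ContState.gradU, ContState.χ, ContState.Z]
    abel

theorem contEmbedding_U (hτ : IsDynamicalSystem P τ) (hO : MeasurableSet O) (y : ContState k P τ O)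
    (l : Fin d) : contEmbedding k hτ hO y (.inl l) = extendZero P hO (tens (oneLp P) (y.U l)) := rfl

theorem contEmbedding_gradU (hτ : IsDynamicalSystem P τ) (hO : MeasurableSet O)
    (y : ContState k P τ O) (l j : Fin d) : contEmbedding k hτ hO y (.inr (.inl (l, j))) =
      extendZero P hO (tens (oneLp P) (y.gradU l j) + y.χ l j) := rfl

theorem contEmbedding_Z (hτ : IsDynamicalSystem P τ) (hO : MeasurableSet O) (y : ContState k P τ O)
    (i : Fin k) : contEmbedding k hτ hO y (.inr (.inr i)) = extendZero P hO (y.Z i) := rfl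

theorem strongTwoScale_iff (hτ : IsDynamicalSystem P τ) {ε : ℕ → ℝ} (hε : ∀ n, 0 < ε n)
    (u : ∀ n, DiscreteL2 P d (ε n)) {U : Ω × Space d → ℝ} {V : FullL2 P d}
    (hV : V =ᵐ[P.prod volume] U) :
    StrongTwoScale τ ε u U ↔ Tendsto (fun n => unfolding hτ (hε n) (u n)) atTop (𝓝 V) := by
  rw [StrongTwoScale, Lp.tendsto_Lp_iff_tendsto_eLpNorm']
  refine tendsto_congr fun n => eLpNorm_congr_ae ?_
  filter_upwards [coeFn_unfolding hτ (hε n) (u n), hV] with p h1 h2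
  rw [Pi.sub_apply, h1, h2]

/-- Turns the two-scale notion of the theorem into norm convergence, the language of the abstract
convergence result. -/
theorem strongCross_iff (hτ : IsDynamicalSystem P τ) (hO : MeasurableSet O) {ε : ℕ → ℝ}
    (hε : ∀ n, 0 < ε n) (yseq : ∀ n, DiscreteState P b O (ε n)) (y : ContState k P τ O) :
    StrongCross ε yseq y ↔ Tendsto (fun n => discreteEmbedding hτ b O (hε n) (yseq n)) atTop
      (𝓝 (contEmbedding k hτ hO y)) := by
  have hU : ∀ l, contEmbedding k hτ hO y (.inl l) =ᵐ[P.prod volume]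
      zeroExt O fun p => y.U l p.2 := fun l => by
    rw [contEmbedding_U]
    filter_upwards [coeFn_extendZero hO (tens (oneLp P) (y.U l)),
      ae_of_ae_prod_restrict hO (coeFn_tens_oneLp (P := P) (y.U l))] with p h1 h2
    rw [h1]
    by_cases hx : p.2 ∈ O
    · simp [zeroExt, indicator, hx, h2 hx]
    · simp [zeroExt, indicator, hx]
  have hG : ∀ l j, contEmbedding k hτ hO y (.inr (.inl (l, j))) =ᵐ[P.prod volume]
      zeroExt O fun p => y.gradU l j p.2 + y.χ l j p := fun l j => by
    rw [contEmbedding_gradU]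
    filter_upwards [coeFn_extendZero hO (tens (oneLp P) (y.gradU l j) + y.χ l j),
      ae_of_ae_prod_restrict hO (coeFn_tens_oneLp (P := P) (y.gradU l j)),
      ae_of_ae_prod_restrict hO (Lp.coeFn_add (tens (oneLp P) (y.gradU l j)) (y.χ l j))]
      with p h1 h2 h3
    rw [h1]
    by_cases hx : p.2 ∈ O
    · rw [zeroExt, zeroExt, indicator_of_mem (by exact hx), indicator_of_mem (by exact hx), h3 hx,
        Pi.add_apply, h2 hx]
    · simp [zeroExt, indicator, hx]
  have hZ : ∀ i, contEmbedding k hτ hO y (.inr (.inr i)) =ᵐ[P.prod volume]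
      zeroExt O fun p => y.Z i p := fun i => by
    rw [contEmbedding_Z]
    exact coeFn_extendZero hO (y.Z i)
  rw [tendsto_crossL2, StrongCross]
  simp only [strongTwoScale_iff hτ hε _ (hU _), strongTwoScale_iff hτ hε _ (hG _ _),
    strongTwoScale_iff hτ hε _ (hZ _)]
  constructor
  · rintro ⟨h1, h2, h3⟩ (l | ⟨l, j⟩ | i)
    · exact h1 l
    · exact h2 l j
    · exact h3 i
  · intro h
    exact ⟨fun l => h (.inl l), fun l j => h (.inr (.inl (l, j))), fun i => h (.inr (.inr i))⟩

end Embedding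

end SpringNetwork

namespace SpringNetwork

/-! ### Edge kernels. -/

section Kernels

variable {d : ℕ} {b : IntLattice d} {B : IntLattice d →₀ (Fin d → ℝ)}

/-- The defining identity of an edge kernel, for functions with values in any vector space. -/
theorem IsEdgeKernel.smul_sub_eq (hB : IsEdgeKernel b B) {M : Type*} [AddCommGroup M] [Module ℝ M]
    (f : IntLattice d → M) :
    (len b)⁻¹ • (f b - f 0) =
      ∑ y ∈ B.support, ∑ j, B y j • (f (-y + unitVec j) - f (-y)) := by
  -- The scalar identity, applied to coordinate indicators, becomes an identity of finite formal
  -- combinations of lattice points. Evaluating it along f transfers it to any vector space.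
  have key : (len b)⁻¹ • (Finsupp.single b (1 : ℝ) - Finsupp.single 0 1) =
      ∑ y ∈ B.support, ∑ j, B y j •
        (Finsupp.single (-y + unitVec j) (1 : ℝ) - Finsupp.single (-y) 1) := by
    ext m
    have := hB (fun n => Finsupp.single n (1 : ℝ) m) 0
    simp only [zero_add, zero_sub, Finsupp.sum] at this
    simp only [Finsupp.smul_apply, Finsupp.sub_apply, smul_eq_mul, Finsupp.finsetSum_apply]
    rw [inv_mul_eq_div, this]
    exact Finset.sum_congr rfl fun y _ => Finset.sum_congr rfl fun j _ => mul_comm _ _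
  have := congrArg (Finsupp.linearCombination ℝ f) key
  simpa only [map_smul, map_sub, map_sum, Finsupp.linearCombination_single, one_smul] using this

/-- The coordinate function n ↦ n_j has constant discrete gradient, so the kernel identity for it
reads off the total mass. Deterministic gradients therefore pass through the kernel as ∇U b / |b|.
-/
theorem IsEdgeKernel.sum_apply (hB : IsEdgeKernel b B) (j : Fin d) :
    ∑ y ∈ B.support, B y j = (b j : ℝ) / len b := by
  have := hB.smul_sub_eq fun n => (n j : ℝ)
  simp only [Pi.zero_apply, Int.cast_zero, sub_zero, Pi.add_apply, Pi.neg_apply, Int.cast_add,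
    add_sub_cancel_left, smul_eq_mul, unitVec, Pi.single_apply] at this
  rw [div_eq_inv_mul, this]
  refine Finset.sum_congr rfl fun y _ => ?_
  rw [Finset.sum_eq_single j] <;> simp +contextual [eq_comm]

end Kernels

section Weak

variable {H K : Type*} [NormedAddCommGroup H] [InnerProductSpace ℝ H]

theorem tendsto_inner_of_weak {ι : Type*} {F : Filter ι} {w g : ι → H} {w₀ g₀ : H} {C : ℝ}
    (hC : ∀ᶠ i in F, ‖w i‖ ≤ C) (hw : ∀ v, Tendsto (fun i => inner ℝ (w i) v) F (𝓝 (inner ℝ w₀ v)))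
    (hg : Tendsto g F (𝓝 g₀)) :
    Tendsto (fun i => (inner ℝ (w i) (g i) : ℝ)) F (𝓝 (inner ℝ w₀ g₀)) := by
  have h1 : Tendsto (fun i => (inner ℝ (w i) (g i - g₀) : ℝ)) F (𝓝 0) := by
    refine squeeze_zero_norm' (a := fun i => C * ‖g i - g₀‖) ?_ ?_
    · filter_upwards [hC] with i hi
      exact (norm_inner_le_norm _ _).trans (by gcongr)
    · have := (tendsto_iff_norm_sub_tendsto_zero.1 hg).const_mul C
      simpa using this
  have := h1.add (hw g₀)
  simpa only [← inner_add_right, sub_add_cancel, zero_add] using this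

end Weak

/-! ### The strain operator and the energy form on the common space. -/

section Form

variable {d k : ℕ} {Ω : Type*} [MeasurableSpace Ω] {P : Measure Ω} [IsProbabilityMeasure P]
  {τ : IntLattice d → Ω → Ω}

theorem memLp_top_comp_fst {f : Ω → ℝ} (hf : MemLp f ∞ P) :
    MemLp (f ∘ Prod.fst) ∞ (P.prod (volume : Measure (Space d))) := by
  have h : ∀ᵐ ω ∂P, ‖f ω‖ ≤ (eLpNormEssSup f P).toReal := by
    filter_upwards [ae_le_eLpNormEssSup (f := f) (μ := P)] with ω hω
    have hne : eLpNormEssSup f P ≠ ∞ := by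
      rw [← eLpNorm_exponent_top]; exact hf.2.ne
    rw [← toReal_enorm]
    exact ENNReal.toReal_mono hne hω
  exact memLp_top_of_bound hf.1.comp_fst _ (ae_prod_fst h)

/-- Multiplication by an essentially bounded function of `ω`. -/
noncomputable def mulFst (d : ℕ) {f : Ω → ℝ} (hf : MemLp f ∞ P) : FullL2 P d →L[ℝ] FullL2 P d :=
  (ContinuousLinearMap.mul ℝ ℝ).holderL (P.prod volume) ∞ 2 2
    ((memLp_top_comp_fst hf).toLp (f ∘ Prod.fst))

theorem coeFn_mulFst {f : Ω → ℝ} (hf : MemLp f ∞ P) (F : FullL2 P d) :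
    mulFst d hf F =ᵐ[P.prod volume] fun p => f p.1 * F p := by
  have h := memLp_top_comp_fst (d := d) hf
  filter_upwards [(ContinuousLinearMap.mul ℝ ℝ).coeFn_holder (r := 2) (h.toLp (f ∘ Prod.fst)) F,
    h.coeFn_toLp] with p h1 h2
  rw [mulFst, ContinuousLinearMap.holderL_apply_apply, h1, h2]
  rfl

variable (hτ : IsDynamicalSystem P τ) (b : Fin k → IntLattice d)
  (B : Fin k → IntLattice d →₀ (Fin d → ℝ)) (ε : ℝ)

/-- The projection to a component. -/
noncomputable abbrev crossProj (P : Measure Ω) [IsProbabilityMeasure P] {d k : ℕ} (c : CrossIndex d k) :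
    CrossL2 P d k →L[ℝ] FullL2 P d := PiLp.proj 2 (fun _ : CrossIndex d k => FullL2 P d) c

/-- The symmetrized gradient, computed from the full gradient through the edge kernels at scale `ε`,
together with the internal variable. -/
noncomputable def strain (a : Fin k ⊕ Fin k) : CrossL2 P d k →L[ℝ] FullL2 P d :=
  Sum.elim
    (fun i => ∑ l, ((b i l : ℝ) / len (b i)) • ∑ n ∈ (B i).support, ∑ j, B i n j •
      ((shift hτ (-n) (node ε (-n))).toContinuousLinearMap ∘L crossProj P (.inr (.inl (l, j)))))
    (fun i => crossProj P (.inr (.inr i))) a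

theorem strain_inl (i : Fin k) (v : CrossL2 P d k) :
    strain hτ b B ε (.inl i) v = ∑ l, ((b i l : ℝ) / len (b i)) • ∑ n ∈ (B i).support, ∑ j,
      B i n j • shift hτ (-n) (node ε (-n)) (v (.inr (.inl (l, j)))) := by
  simp [strain]

theorem strain_inr (i : Fin k) (v : CrossL2 P d k) :
    strain hτ b B ε (.inr i) v = v (.inr (.inr i)) := rfl

theorem exists_norm_strain_le : ∃ K, 0 ≤ K ∧ ∀ ε a (v : CrossL2 P d k),
    ‖strain hτ b B ε a v‖ ≤ K * ‖v‖ := by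
  have hc : ∀ (v : CrossL2 P d k) c, ‖v c‖ ≤ ‖v‖ := fun v c => PiLp.norm_apply_le v c
  have h : ∀ a, ∃ K, 0 ≤ K ∧ ∀ ε (v : CrossL2 P d k), ‖strain hτ b B ε a v‖ ≤ K * ‖v‖ := by
    rintro (i | i)
    · refine ⟨∑ l, ‖(b i l : ℝ) / len (b i)‖ * ∑ n ∈ (B i).support, ∑ j, ‖B i n j‖,
        Finset.sum_nonneg fun l _ => mul_nonneg (norm_nonneg _) (Finset.sum_nonneg fun n _ =>
          Finset.sum_nonneg fun j _ => norm_nonneg _), fun ε v => ?_⟩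
      rw [strain_inl, Finset.sum_mul]
      refine (norm_sum_le _ _).trans (Finset.sum_le_sum fun l _ => ?_)
      rw [norm_smul, mul_assoc, Finset.sum_mul]
      refine mul_le_mul_of_nonneg_left ?_ (norm_nonneg _)
      refine (norm_sum_le _ _).trans (Finset.sum_le_sum fun n _ => ?_)
      rw [Finset.sum_mul]
      refine (norm_sum_le _ _).trans (Finset.sum_le_sum fun j _ => ?_)
      rw [norm_smul, LinearIsometry.norm_map]
      exact mul_le_mul_of_nonneg_left (hc _ _) (norm_nonneg _)
    · exact ⟨1, zero_le_one, fun ε v => by rw [strain_inr, one_mul]; exact hc _ _⟩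
  choose K hK0 hK using h
  refine ⟨∑ a, K a, Finset.sum_nonneg fun a _ => hK0 a, fun ε a v => (hK a ε v).trans ?_⟩
  exact mul_le_mul_of_nonneg_right (Finset.single_le_sum (fun a _ => hK0 a) (Finset.mem_univ a))
    (norm_nonneg _)

theorem tendsto_node_zero {ι : Type*} {F : Filter ι} {ε : ι → ℝ} (hε : Tendsto ε F (𝓝 0))
    (n : IntLattice d) : Tendsto (fun i => node (ε i) n) F (𝓝 0) := by
  have : Tendsto (fun i => ε i • node 1 n) F (𝓝 ((0 : ℝ) • node 1 n)) := hε.smul_const _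
  simpa only [zero_smul, ← node_eq_smul] using this

theorem node_zero_left (n : IntLattice d) : node 0 n = 0 := by
  rw [node_eq_smul, zero_smul]

theorem tendsto_shift_of_tendsto (y : IntLattice d) {ι : Type*} {F : Filter ι} {h : ι → Space d}
    (hh : Tendsto h F (𝓝 0)) {G : ι → FullL2 P d} {G₀ : FullL2 P d} (hG : Tendsto G F (𝓝 G₀)) :
    Tendsto (fun i => shift hτ y (h i) (G i)) F (𝓝 (shift hτ y 0 G₀)) := by
  have h1 : Tendsto (fun i => shift hτ y (h i) (G i - G₀)) F (𝓝 0) := by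
    rw [tendsto_zero_iff_norm_tendsto_zero]
    simpa only [LinearIsometry.norm_map] using tendsto_iff_norm_sub_tendsto_zero.1 hG
  have := h1.add (tendsto_shift hτ y hh G₀)
  simpa only [← map_add, sub_add_cancel, zero_add] using this

/-- In each term of the kernel the spatial translation disappears with ε while the random shift
stays, which leaves the strain at ε = 0. -/
theorem tendsto_strain {ι : Type*} {F : Filter ι} {ε : ι → ℝ} (hε : Tendsto ε F (𝓝 0))
    (a : Fin k ⊕ Fin k) {v : ι → CrossL2 P d k} {v₀ : CrossL2 P d k} (hv : Tendsto v F (𝓝 v₀)) :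
    Tendsto (fun i => strain hτ b B (ε i) a (v i)) F (𝓝 (strain hτ b B 0 a v₀)) := by
  rw [tendsto_crossL2] at hv
  rcases a with i | i
  · simp only [strain_inl, node_zero_left]
    refine tendsto_finsetSum _ fun l _ => Tendsto.const_smul ?_ _
    refine tendsto_finsetSum _ fun n _ => tendsto_finsetSum _ fun j _ => Tendsto.const_smul ?_ _
    exact tendsto_shift_of_tendsto hτ (-n) (tendsto_node_zero hε (-n)) (hv _)
  · exact hv _

theorem crossProj_weak {ι : Type*} {F : Filter ι} {w : ι → CrossL2 P d k} {w₀ : CrossL2 P d k}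
    (hw : ∀ v, Tendsto (fun i => (inner ℝ (w i) v : ℝ)) F (𝓝 (inner ℝ w₀ v))) (c : CrossIndex d k)
    (G : FullL2 P d) : Tendsto (fun i => (inner ℝ (w i c) G : ℝ)) F (𝓝 (inner ℝ (w₀ c) G)) := by
  have := hw ((crossProj P c).adjoint G)
  simp only [ContinuousLinearMap.adjoint_inner_right] at this
  exact this

/-- The shift is moved to the fixed test field, where it converges strongly, so the weakly
convergent factor stands alone. -/
theorem tendsto_inner_strain {ι : Type*} {F : Filter ι} {ε : ι → ℝ} (hε : Tendsto ε F (𝓝 0))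
    (a : Fin k ⊕ Fin k) {w : ι → CrossL2 P d k} {w₀ : CrossL2 P d k} {C : ℝ}
    (hC : ∀ᶠ i in F, ‖w i‖ ≤ C)
    (hw : ∀ v, Tendsto (fun i => (inner ℝ (w i) v : ℝ)) F (𝓝 (inner ℝ w₀ v))) (G : FullL2 P d) :
    Tendsto (fun i => (inner ℝ (strain hτ b B (ε i) a (w i)) G : ℝ)) F
      (𝓝 (inner ℝ (strain hτ b B 0 a w₀) G)) := by
  rcases a with i | i
  · simp only [strain_inl, node_zero_left, sum_inner, inner_smul_left, RCLike.conj_to_real]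
    refine tendsto_finsetSum _ fun l _ => Tendsto.const_mul _ ?_
    refine tendsto_finsetSum _ fun n _ => tendsto_finsetSum _ fun j _ => Tendsto.const_mul _ ?_
    simp only [inner_shift_left]
    refine tendsto_inner_of_weak (C := C) ?_ (crossProj_weak hw _) ?_
    · filter_upwards [hC] with m hm using (PiLp.norm_apply_le _ _).trans hm
    · have h := (tendsto_node_zero hε (-n)).neg
      rw [neg_zero] at h
      simpa using tendsto_shift hτ (- -n) h G
  · exact crossProj_weak hw _ G

variable {A : Ω → Matrix (Fin k ⊕ Fin k) (Fin k ⊕ Fin k) ℝ} (hA : IsAdmissibleCoefficient P A)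

/-- The energy form on the common space. -/
noncomputable def energyForm : CrossL2 P d k →L[ℝ] CrossL2 P d k →L[ℝ] ℝ :=
  ∑ a, ∑ c, (innerSL ℝ).bilinearComp (mulFst d (hA.essBounded a c) ∘L strain hτ b B ε c)
    (strain hτ b B ε a)

theorem energyForm_apply (v w : CrossL2 P d k) : energyForm hτ b B ε hA v w =
    ∑ a, ∑ c, inner ℝ (mulFst d (hA.essBounded a c) (strain hτ b B ε c v))
      (strain hτ b B ε a w) := by
  simp [energyForm]

theorem integrable_mulFst_mul {f : Ω → ℝ} (hf : MemLp f ∞ P) (F G : FullL2 P d) :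
    Integrable (fun p => f p.1 * F p * G p) (P.prod volume) := by
  refine (integrable_mul (mulFst d hf F) G).congr ?_
  filter_upwards [coeFn_mulFst hf F] with p hp
  rw [hp]

theorem inner_mulFst {f : Ω → ℝ} (hf : MemLp f ∞ P) (F G : FullL2 P d) :
    inner ℝ (mulFst d hf F) G = ∫ p, f p.1 * F p * G p ∂P.prod volume := by
  rw [inner_eq_integral]
  refine integral_congr_ae ?_
  filter_upwards [coeFn_mulFst hf F] with p hp
  rw [hp]

include hA in
theorem integrable_pairing (F G : Fin k ⊕ Fin k → FullL2 P d) :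
    Integrable (fun p => pairing (A p.1) (fun c => F c p) fun a => G a p) (P.prod volume) :=
  integrable_finsetSum _ fun a _ => integrable_finsetSum _ fun c _ =>
    integrable_mulFst_mul (hA.essBounded a c) (F c) (G a)

theorem energyForm_eq_integral (v w : CrossL2 P d k) : energyForm hτ b B ε hA v w =
    ∫ p, pairing (A p.1) (fun c => strain hτ b B ε c v p) (fun a => strain hτ b B ε a w p)
      ∂P.prod volume := by
  simp only [energyForm_apply, pairing]
  rw [integral_finsetSum _ fun a _ => integrable_finsetSum _ fun c _ =>
    integrable_mulFst_mul (hA.essBounded a c) _ _]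
  refine Finset.sum_congr rfl fun a _ => ?_
  rw [integral_finsetSum _ fun c _ => integrable_mulFst_mul (hA.essBounded a c) _ _]
  exact Finset.sum_congr rfl fun c _ => inner_mulFst _ _ _

theorem energyForm_symm (v w : CrossL2 P d k) :
    energyForm hτ b B ε hA v w = energyForm hτ b B ε hA w v := by
  rw [energyForm_eq_integral, energyForm_eq_integral]
  refine integral_congr_ae ?_
  filter_upwards [ae_prod_fst (ν := (volume : Measure (Space d))) hA.symmetric] with p hp
  simp only [pairing]
  rw [Finset.sum_comm]
  refine Finset.sum_congr rfl fun a _ => Finset.sum_congr rfl fun c _ => ?_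
  rw [← hp.apply a c]
  ring

/-- The form controls only the strain. The passage to the full gradient requires the Korn inequality
and is made on discrete states. -/
theorem exists_energyForm_coercive : ∃ c, 0 < c ∧ ∀ ε (v : CrossL2 P d k),
    c * ∑ a, ‖strain hτ b B ε a v‖ ^ 2 ≤ energyForm hτ b B ε hA v v := by
  obtain ⟨C, hC, h⟩ := hA.coercive
  refine ⟨C, hC, fun ε v => ?_⟩
  rw [energyForm_eq_integral]
  simp only [norm_sq_eq_integral]
  rw [← integral_finsetSum _ fun a _ => (Lp.memLp _).integrable_sq, ← integral_const_mul]
  refine integral_mono_ae ((integrable_finsetSum _ fun a _ =>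
    (Lp.memLp _).integrable_sq).const_mul C) (integrable_pairing hA _ _) ?_
  filter_upwards [ae_prod_fst (ν := (volume : Measure (Space d))) h] with p hp
  exact hp _

theorem exists_energyForm_bound : ∃ M, ∀ ε (v w : CrossL2 P d k),
    |energyForm hτ b B ε hA v w| ≤ M * ‖v‖ * ‖w‖ := by
  obtain ⟨K, hK0, hK⟩ := exists_norm_strain_le hτ b B
  refine ⟨∑ a, ∑ c, ‖mulFst d (hA.essBounded a c)‖ * K * K, fun ε v w => ?_⟩
  rw [energyForm_apply, Finset.sum_mul, Finset.sum_mul]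
  refine (Finset.abs_sum_le_sum_abs _ _).trans (Finset.sum_le_sum fun a _ => ?_)
  rw [Finset.sum_mul, Finset.sum_mul]
  refine (Finset.abs_sum_le_sum_abs _ _).trans (Finset.sum_le_sum fun c _ => ?_)
  refine (abs_real_inner_le_norm _ _).trans ?_
  calc ‖mulFst d (hA.essBounded a c) (strain hτ b B ε c v)‖ * ‖strain hτ b B ε a w‖
      ≤ (‖mulFst d (hA.essBounded a c)‖ * (K * ‖v‖)) * (K * ‖w‖) := by
        gcongr
        · exact (ContinuousLinearMap.le_opNorm _ _).trans (by gcongr; exact hK _ _ _)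
        · exact hK _ _ _
    _ = ‖mulFst d (hA.essBounded a c)‖ * K * K * ‖v‖ * ‖w‖ := by ring

/-- The coefficients depend on ω alone and act as one bounded operator for every ε. The strain of v
converges strongly and that of w weakly, so their product converges. -/
theorem tendsto_energyForm {ι : Type*} {F : Filter ι} {ε : ι → ℝ} (hε : Tendsto ε F (𝓝 0))
    {v w : ι → CrossL2 P d k} {v₀ w₀ : CrossL2 P d k} (hv : Tendsto v F (𝓝 v₀)) {C : ℝ}
    (hC : ∀ᶠ i in F, ‖w i‖ ≤ C)
    (hw : ∀ g, Tendsto (fun i => (inner ℝ (w i) g : ℝ)) F (𝓝 (inner ℝ w₀ g))) :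
    Tendsto (fun i => energyForm hτ b B (ε i) hA (v i) (w i)) F
      (𝓝 (energyForm hτ b B 0 hA v₀ w₀)) := by
  obtain ⟨K, hK0, hK⟩ := exists_norm_strain_le hτ b B
  simp only [energyForm_apply]
  refine tendsto_finsetSum _ fun a _ => tendsto_finsetSum _ fun c _ => ?_
  have h1 : ∀ i, inner ℝ (mulFst d (hA.essBounded a c) (strain hτ b B (ε i) c (v i)))
      (strain hτ b B (ε i) a (w i)) = inner ℝ (strain hτ b B (ε i) a (w i))
      (mulFst d (hA.essBounded a c) (strain hτ b B (ε i) c (v i))) := fun i => real_inner_comm _ _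
  have h2 : inner ℝ (mulFst d (hA.essBounded a c) (strain hτ b B 0 c v₀))
      (strain hτ b B 0 a w₀) = inner ℝ (strain hτ b B 0 a w₀)
      (mulFst d (hA.essBounded a c) (strain hτ b B 0 c v₀)) := real_inner_comm _ _
  simp only [h1, h2]
  refine tendsto_inner_of_weak (C := K * C) ?_
    (tendsto_inner_strain hτ b B hε a hC hw) ?_
  · filter_upwards [hC] with i hi
    exact (hK _ _ _).trans (by gcongr)
  · exact ((mulFst d (hA.essBounded a c)).continuous.tendsto _).comp (tendsto_strain hτ b B hε c hv)

end Form

end SpringNetwork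

namespace SpringNetwork

section Restriction

variable {d : ℕ} {Ω : Type*} [MeasurableSpace Ω] {P : Measure Ω} [IsProbabilityMeasure P]
  {O : Set (Space d)}

theorem integral_prod_restrict (hO : MeasurableSet O) (f : Ω × Space d → ℝ) :
    ∫ p, f p ∂P.prod (volume.restrict O) =
      ∫ p, (Prod.snd ⁻¹' O).indicator f p ∂P.prod volume := by
  rw [prod_restrict_snd, ← integral_indicator (measurable_snd hO)]

theorem lintegral_prod_restrict (hO : MeasurableSet O) (f : Ω × Space d → ℝ≥0∞) :
    ∫⁻ p, f p ∂P.prod (volume.restrict O) =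
      ∫⁻ p, (Prod.snd ⁻¹' O).indicator f p ∂P.prod volume := by
  rw [prod_restrict_snd, ← lintegral_indicator (measurable_snd hO)]

end Restriction

/-! ### Discrete and continuum energies and loads as restrictions from the common space. -/

section Identification

variable {d k : ℕ} {Ω : Type*} [MeasurableSpace Ω] {P : Measure Ω} [IsProbabilityMeasure P]
  {τ : IntLattice d → Ω → Ω} (hτ : IsDynamicalSystem P τ) {b : Fin k → IntLattice d}
  {B : Fin k → IntLattice d →₀ (Fin d → ℝ)} {O : Set (Space d)} {ε : ℝ}

theorem DiscreteState.gradU_eq (y : DiscreteState P b O ε) (l j : Fin d) :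
    y.gradU l j = discreteGrad P ε j (y.u l) := (y.fst l).2.2 j

theorem DiscreteState.u_mem (y : DiscreteState P b O ε) (l : Fin d) :
    y.u l ∈ supportedOn P ε O := (y.fst l).2.1

theorem DiscreteState.z_mem (y : DiscreteState P b O ε) (i : Fin k) :
    y.z i ∈ supportedOn P ε (enlarged b ε O) := (y.snd i).2

/-- The kernel identity is applied to the orbit c ↦ shift by (c, εc) of the unfolded field. It
expresses edge differences through the full gradient, the quantity whose two-scale limit is known.
-/
theorem unfolding_edgeDiff (hε : 0 < ε) {b : IntLattice d} {B : IntLattice d →₀ (Fin d → ℝ)}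
    (hB : IsEdgeKernel b B) (u : DiscreteL2 P d ε) :
    unfolding hτ hε (edgeDiff P ε b u) = ∑ n ∈ B.support, ∑ j, B n j •
      shift hτ (-n) (node ε (-n)) (unfolding hτ hε (discreteGrad P ε j u)) := by
  have h1 : edgeDiff P ε b u = ε⁻¹ • (len b)⁻¹ • (translate P ε b u - u) := by
    rw [smul_smul, ← mul_inv]; rfl
  have h2 := hB.smul_sub_eq fun c => shift hτ c (node ε c) (unfolding hτ hε u)
  have h3 : node ε (0 : IntLattice d) = 0 := by ext i; simp [node]
  rw [h3, shift_zero] at h2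
  rw [h1, map_smul, map_smul, map_sub, unfolding_translate, h2, Finset.smul_sum]
  refine Finset.sum_congr rfl fun n _ => ?_
  rw [Finset.smul_sum]
  refine Finset.sum_congr rfl fun j _ => ?_
  rw [unfolding_discreteGrad, map_smul, map_sub, shift_shift, ← node_add, smul_comm]

theorem strain_discreteEmbedding_inl (hε : 0 < ε) (hB : ∀ i, IsEdgeKernel (b i) (B i))
    (y : DiscreteState P b O ε) (i : Fin k) :
    strain hτ b B ε (.inl i) (discreteEmbedding hτ b O hε y) =
      unfolding hτ hε (discreteSymGrad P ε b y.u i) := by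
  rw [strain_inl, discreteSymGrad, map_sum]
  refine Finset.sum_congr rfl fun l _ => ?_
  rw [map_smul, unfolding_edgeDiff hτ hε (hB i)]
  simp only [discreteEmbedding_gradU, DiscreteState.gradU_eq]

/-- The discrete strain and internal variables as a family of fields. -/
noncomputable def discreteStrain (y : DiscreteState P b O ε) : Fin k ⊕ Fin k → DiscreteL2 P d ε :=
  Sum.elim (discreteSymGrad P ε b y.u) y.z

theorem strain_discreteEmbedding (hε : 0 < ε) (hB : ∀ i, IsEdgeKernel (b i) (B i))
    (y : DiscreteState P b O ε) (a : Fin k ⊕ Fin k) :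
    strain hτ b B ε a (discreteEmbedding hτ b O hε y) = unfolding hτ hε (discreteStrain y a) := by
  rcases a with i | i
  · exact strain_discreteEmbedding_inl hτ hε hB y i
  · rfl

theorem coeFn_translate (b : IntLattice d) (u : DiscreteL2 P d ε) :
    translate P ε b u =ᵐ[P.prod (latticeMeasure d ε)] fun p => u (p.1, p.2 + b) :=
  Lp.coeFn_compMeasurePreserving u (measurePreserving_translate P ε b)

/-- If the far end of the edge lay in O, then by openness so would points of the open segment close
to it, and the near end would belong to the enlarged set. -/
theorem notMem_of_notMem_enlarged (hO : IsOpen O) {n : IntLattice d} (i : Fin k)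
    (h : node ε n ∉ enlarged b ε O) : node ε n ∉ O ∧ node ε (n + b i) ∉ O := by
  refine ⟨fun h' => h (Or.inl h'), fun h' => h (Or.inr ⟨i, ?_⟩)⟩
  rw [node_add] at h'
  set x := node ε n
  set y := x + node ε (b i)
  have hc : Tendsto (fun t : ℝ => (1 - t) • x + t • y) (𝓝[<] 1) (𝓝 y) := by
    have h1 : Continuous fun t : ℝ => (1 - t) • x + t • y := by fun_prop
    have h2 := (h1.tendsto 1).mono_left (nhdsWithin_le_nhds (s := Iio 1))
    simpa using h2
  have h1 := hc.eventually (hO.mem_nhds h')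
  have h2 : ∀ᶠ t : ℝ in 𝓝[<] 1, 0 < t ∧ t < 1 := by
    filter_upwards [self_mem_nhdsWithin, nhdsWithin_le_nhds (lt_mem_nhds (zero_lt_one))] with t h3 h4
    exact ⟨h4, h3⟩
  obtain ⟨t, h3, h4, h5⟩ := (h1.and h2).exists
  exact ⟨_, ⟨1 - t, t, by linarith, h4, by ring, rfl⟩, h3⟩

theorem discreteSymGrad_mem (hO : IsOpen O) (y : DiscreteState P b O ε) (i : Fin k) :
    discreteSymGrad P ε b y.u i ∈ supportedOn P ε (enlarged b ε O) := by
  refine Submodule.sum_mem _ fun l _ => Submodule.smul_mem _ _ ?_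
  refine Submodule.smul_mem _ _ ?_
  have h1 : ∀ᵐ p ∂P.prod (latticeMeasure d ε), node ε p.2 ∉ O → y.u l p = 0 := y.u_mem l
  change ∀ᵐ p ∂P.prod (latticeMeasure d ε), node ε p.2 ∉ enlarged b ε O →
    (translate P ε (b i) (y.u l) - y.u l : DiscreteL2 P d ε) p = 0
  filter_upwards [h1, (measurePreserving_translate P ε (b i)).quasiMeasurePreserving.ae h1,
    coeFn_translate (b i) (y.u l), Lp.coeFn_sub (translate P ε (b i) (y.u l)) (y.u l)]
    with p h2 h3 h4 h5 hp
  obtain ⟨h6, h7⟩ := notMem_of_notMem_enlarged hO i hp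
  rw [h5, Pi.sub_apply, h4, h2 h6, h3 h7, sub_zero]

theorem discreteStrain_mem (hO : IsOpen O) (y : DiscreteState P b O ε) (a : Fin k ⊕ Fin k) :
    discreteStrain y a ∈ supportedOn P ε (enlarged b ε O) := by
  rcases a with i | i
  · exact discreteSymGrad_mem hO y i
  · exact y.z_mem i

theorem measurableSet_node_mem (ε : ℝ) (S : Set (Space d)) :
    MeasurableSet {p : Ω × IntLattice d | node ε p.2 ∈ S} :=
  measurable_snd (MeasurableSet.of_discrete (s := {n : IntLattice d | node ε n ∈ S}))

theorem coeFn_unfolding' (hε : 0 < ε) (u : DiscreteL2 P d ε) : unfolding hτ hε u =ᵐ[P.prod volume]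
    fun p => u (τ (-nearestNode ε p.2) p.1, nearestNode ε p.2) := coeFn_unfolding hτ hε u

variable {A : Ω → Matrix (Fin k ⊕ Fin k) (Fin k ⊕ Fin k) ℝ}

/-- Strain and internal variable vanish at nodes outside the enlarged set, so the integral extends
over the whole lattice. The measure preserving unfolding map then turns A(τ_n ω) into A(ω). -/
theorem discreteQuad_eq (hA : IsAdmissibleCoefficient P A) (hε : 0 < ε) (hO : IsOpen O)
    (hB : ∀ i, IsEdgeKernel (b i) (B i)) (y : DiscreteState P b O ε) :
    discreteQuad P τ b O ε A y = energyForm hτ b B ε hA (discreteEmbedding hτ b O hε y)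
      (discreteEmbedding hτ b O hε y) := by
  set m := fun p : Ω × Space d => (τ (-nearestNode ε p.2) p.1, nearestNode ε p.2) with hm
  have hmp : MeasurePreserving m (P.prod volume) (P.prod (latticeMeasure d ε)) :=
    hτ.measurePreserving_unfold hε
  let g : Ω × IntLattice d → ℝ := fun p => pairing (A (τ p.2 p.1))
    (fun a => discreteStrain y a p) (fun a => discreteStrain y a p)
  have e0 : discreteQuad P τ b O ε A y = ∫ p in {p : Ω × IntLattice d | node ε p.2 ∈ enlarged b ε O},
      g p ∂P.prod (latticeMeasure d ε) := by
    have hs : ∀ p, (fun a => discreteStrain y a p) = Sum.elim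
        (fun i => discreteSymGrad P ε b y.u i p) (fun i => y.z i p) := fun p => by
      ext (i | i) <;> rfl
    simp only [discreteQuad, g, hs]
  have e1 : ∫ p in {p : Ω × IntLattice d | node ε p.2 ∈ enlarged b ε O},
      g p ∂P.prod (latticeMeasure d ε) = ∫ p, g p ∂P.prod (latticeMeasure d ε) := by
    refine setIntegral_eq_integral_of_ae_compl_eq_zero ?_
    have h1 : ∀ a, ∀ᵐ p ∂P.prod (latticeMeasure d ε), node ε p.2 ∉ enlarged b ε O →
        discreteStrain y a p = 0 := fun a => discreteStrain_mem hO y a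
    filter_upwards [ae_all_iff.2 h1] with p hp hp2
    simp [g, pairing, hp _ hp2]
  have hgm : AEStronglyMeasurable g (P.prod (latticeMeasure d ε)) := by
    refine Finset.aestronglyMeasurable_fun_sum _ fun a _ =>
      Finset.aestronglyMeasurable_fun_sum _ fun c _ => ?_
    refine AEStronglyMeasurable.mul (AEStronglyMeasurable.mul ?_ (Lp.aestronglyMeasurable _))
      (Lp.aestronglyMeasurable _)
    have := ((hA.essBounded a c).1.comp_fst (ν := latticeMeasure d ε)).comp_measurePreserving
      (hτ.measurePreserving_twist (ε := ε))
    exact this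
  have e2 : ∫ p, g p ∂P.prod (latticeMeasure d ε) = ∫ p, g (m p) ∂P.prod volume := by
    have := integral_map hmp.measurable.aemeasurable (f := g) (by rwa [hmp.map_eq])
    rwa [hmp.map_eq] at this
  rw [e0, e1, e2, energyForm_eq_integral]
  refine integral_congr_ae ?_
  filter_upwards [ae_all_iff.2 fun a => coeFn_unfolding' hτ hε (discreteStrain y a)] with p hp
  simp only [strain_discreteEmbedding hτ hε hB, hp, g, hm, hτ.apply_neg_apply]

/-- Random shifts do not act on the deterministic gradient, so there the kernel contributes only its
total mass b / |b| and yields ∇_s U. The corrector is shifted and yields χ_s. -/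
theorem strain_contEmbedding (hO : MeasurableSet O) (hB : ∀ i, IsEdgeKernel (b i) (B i))
    (y : ContState k P τ O) (a : Fin k ⊕ Fin k) :
    strain hτ b B 0 a (contEmbedding k hτ hO y) =ᵐ[P.prod volume] zeroExt O (fun p => Sum.elim
      (fun i => y.symGradU b i p.2 + y.symχ b B i p) (fun i => y.Z i p) a) := by
  rcases a with i | i
  · have hG : ∀ l j, ∀ᵐ p ∂P.prod volume, contEmbedding k hτ hO y (.inr (.inl (l, j))) p =
        zeroExt O (fun p => y.gradU l j p.2 + y.χ l j p) p := fun l j => by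
      rw [contEmbedding_gradU]
      filter_upwards [coeFn_extendZero hO (tens (oneLp P) (y.gradU l j) + y.χ l j),
        ae_of_ae_prod_restrict hO (coeFn_tens_oneLp (P := P) (y.gradU l j)),
        ae_of_ae_prod_restrict hO (Lp.coeFn_add (tens (oneLp P) (y.gradU l j)) (y.χ l j))]
        with p h1 h2 h3
      rw [h1]
      by_cases hx : p.2 ∈ O
      · rw [zeroExt, zeroExt, indicator_of_mem (by exact hx), indicator_of_mem (by exact hx), h3 hx,
          Pi.add_apply, h2 hx]
      · simp [zeroExt, indicator, hx]
    have hS : ∀ l j n, ∀ᵐ p ∂P.prod volume,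
        shift hτ (-n) 0 (contEmbedding k hτ hO y (.inr (.inl (l, j)))) p =
        zeroExt O (fun p => y.gradU l j p.2 + y.χ l j (τ (-n) p.1, p.2)) p := fun l j n => by
      filter_upwards [coeFn_shift hτ (-n) 0 (contEmbedding k hτ hO y (.inr (.inl (l, j)))),
        (hτ.measurePreserving_shift (-n) 0).quasiMeasurePreserving.ae (hG l j)] with p h1 h2
      rw [h1, h2]
      by_cases hx : p.2 ∈ O <;> simp [zeroExt, indicator, hx]
    have hsum : strain hτ b B 0 (.inl i) (contEmbedding k hτ hO y) =ᵐ[P.prod volume]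
        fun p => ∑ l, ((b i l : ℝ) / len (b i)) * ∑ n ∈ (B i).support, ∑ j,
          B i n j * shift hτ (-n) 0 (contEmbedding k hτ hO y (.inr (.inl (l, j)))) p := by
      rw [strain_inl]
      simp only [node_zero_left]
      refine (Lp.coeFn_finsetSum _ _).trans ?_
      filter_upwards [ae_all_iff.2 fun l => Lp.coeFn_smul ((b i l : ℝ) / len (b i))
          (∑ n ∈ (B i).support, ∑ j, B i n j •
            shift hτ (-n) 0 (contEmbedding k hτ hO y (.inr (.inl (l, j))))),
        ae_all_iff.2 fun l => Lp.coeFn_finsetSum (B i).support fun n => ∑ j, B i n j •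
            shift hτ (-n) 0 (contEmbedding k hτ hO y (.inr (.inl (l, j)))),
        ae_all_iff.2 fun l => ae_all_iff.2 fun n => Lp.coeFn_finsetSum Finset.univ fun j => B i n j •
            shift hτ (-n) 0 (contEmbedding k hτ hO y (.inr (.inl (l, j)))),
        ae_all_iff.2 fun l => ae_all_iff.2 fun n => ae_all_iff.2 fun j => Lp.coeFn_smul (B i n j)
            (shift hτ (-n) 0 (contEmbedding k hτ hO y (.inr (.inl (l, j)))))] with p h1 h2 h3 h4
      simp only [Finset.sum_apply, h1, h2, h3, h4, Pi.smul_apply, smul_eq_mul]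
    filter_upwards [hsum, ae_all_iff.2 fun l => ae_all_iff.2 fun j => ae_all_iff.2 fun n => hS l j n]
      with p h1 h2
    rw [h1]
    simp only [h2]
    by_cases hx : p.2 ∈ O
    · simp only [zeroExt, indicator, mem_preimage, hx, if_true, Sum.elim_inl, ContState.symGradU,
        ContState.symχ, ← Finset.sum_add_distrib]
      refine Finset.sum_congr rfl fun l _ => ?_
      rw [Finsupp.sum]
      have h3 : ∑ n ∈ (B i).support, ∑ j, B i n j * y.gradU l j p.2 =
          ∑ j, y.gradU l j p.2 * ((b i j : ℝ) / len (b i)) := by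
        rw [Finset.sum_comm]
        refine Finset.sum_congr rfl fun j _ => ?_
        rw [← Finset.sum_mul, (hB i).sum_apply j, mul_comm]
      simp only [mul_assoc, ← Finset.mul_sum]
      rw [← h3, ← mul_add, ← Finset.sum_add_distrib]
      congr 1
      refine Finset.sum_congr rfl fun n _ => ?_
      rw [← Finset.sum_add_distrib]
      exact Finset.sum_congr rfl fun j _ => by ring
    · simp [zeroExt, hx]
  · exact coeFn_extendZero hO (y.Z i)

theorem contQuad_eq (hA : IsAdmissibleCoefficient P A) (hO : MeasurableSet O)
    (hB : ∀ i, IsEdgeKernel (b i) (B i)) (y : ContState k P τ O) :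
    contQuad P τ b B O A y = energyForm hτ b B 0 hA (contEmbedding k hτ hO y)
      (contEmbedding k hτ hO y) := by
  rw [contQuad, energyForm_eq_integral, integral_prod_restrict hO]
  refine integral_congr_ae ?_
  filter_upwards [ae_all_iff.2 fun a => strain_contEmbedding hτ hO hB y a] with p hp
  simp only [hp]
  by_cases hx : p.2 ∈ O
  · simp [indicator, hx, zeroExt]
  · simp [indicator, hx, zeroExt, pairing]

/-- The loading as a functional on the common space. -/
noncomputable def loadForm (P : Measure Ω) [IsProbabilityMeasure P] (k : ℕ) (hO : MeasurableSet O) :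
    Load O →L[ℝ] CrossL2 P d k →L[ℝ] ℝ :=
  ∑ l, (innerSL ℝ).bilinearComp ((extendZero P hO).toContinuousLinearMap ∘L tens (oneLp P) ∘L
    PiLp.proj 2 (fun _ : Fin d => DomainL2 O) l) (crossProj P (.inl l))

theorem loadForm_apply (hO : MeasurableSet O) (f : Load O) (v : CrossL2 P d k) :
    loadForm P k hO f v = ∑ l, inner ℝ (extendZero P hO (tens (oneLp P) (f l))) (v (.inl l)) := by
  simp [loadForm]

theorem coeFn_extendZero_tens (hO : MeasurableSet O) (f : DomainL2 O) :
    extendZero P hO (tens (oneLp P) f) =ᵐ[P.prod volume] fun p => O.indicator f p.2 := by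
  filter_upwards [coeFn_extendZero hO (tens (oneLp P) f),
    ae_of_ae_prod_restrict hO (coeFn_tens_oneLp (P := P) f)] with p h1 h2
  rw [h1]
  by_cases hx : p.2 ∈ O
  · simp [zeroExt, indicator, hx, h2 hx]
  · simp [zeroExt, indicator, hx]

/-- A deterministic field ignores the random shift, so its cell average is the discretization π_ε f.
The discrete load is thereby the restriction of an ε-independent functional. -/
theorem coeFn_cellAverage_extendZero (hO : MeasurableSet O) (hε : 0 < ε) (f : DomainL2 O) :
    ∀ᵐ p ∂P.prod (latticeMeasure d ε),
      cellAverage hτ hε (extendZero P hO (tens (oneLp P) f)) p = discretize ε f p.2 := by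
  have h1 : ∀ᵐ p ∂P.prod (latticeMeasure d ε), ∀ᵐ x,
      extendZero P hO (tens (oneLp P) f) (τ p.2 p.1, x) = O.indicator f x :=
    (hτ.measurePreserving_twist (ε := ε)).quasiMeasurePreserving.ae (ae_prod_fst
      (Measure.ae_ae_of_ae_prod (coeFn_extendZero_tens (P := P) hO f)))
  filter_upwards [coeFn_cellAverage hτ hε (extendZero P hO (tens (oneLp P) f)), h1] with p h2 h3
  rw [h2, discretize]
  exact average_congr (ae_restrict_of_ae h3)

theorem discreteLoad_eq (hO : MeasurableSet O) (hε : 0 < ε) (f : Load O)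
    (y : DiscreteState P b O ε) :
    discreteLoad P b O ε f y = loadForm P k hO f (discreteEmbedding hτ b O hε y) := by
  have h1 : ∀ l, ∀ᵐ p ∂P.prod (latticeMeasure d ε), node ε p.2 ∉ O → y.u l p = 0 := y.u_mem
  rw [discreteLoad, setIntegral_eq_integral_of_ae_compl_eq_zero, loadForm_apply]
  · simp only [discreteEmbedding_u, ← inner_cellAverage]
    simp only [inner_eq_integral]
    rw [← integral_finsetSum _ fun l _ => integrable_mul _ _]
    refine integral_congr_ae ?_
    filter_upwards [ae_all_iff.2 fun l => coeFn_cellAverage_extendZero hτ hO hε (f l)] with p hp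
    simp only [hp]
  · filter_upwards [ae_all_iff.2 h1] with p hp hp2
    exact Finset.sum_eq_zero fun l _ => by rw [hp l hp2, mul_zero]

theorem contLoad_eq (hO : MeasurableSet O) (f : Load O) (y : ContState k P τ O) :
    contLoad P τ O f y = loadForm P k hO f (contEmbedding k hτ hO y) := by
  simp only [contLoad, loadForm_apply, contEmbedding_U, LinearIsometry.inner_map_map,
    inner_tens_tens, inner_oneLp_oneLp, one_mul]
  simp only [inner_eq_integral]
  exact integral_finsetSum _ fun l _ => integrable_mul (f l) (y.U l)

end Identification

/-! ### The dissipation functional on the common space. -/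

section Dissipation

variable {d k : ℕ} {Ω : Type*} [MeasurableSpace Ω] {P : Measure Ω} [IsProbabilityMeasure P]
  {τ : IntLattice d → Ω → Ω} {b : Fin k → IntLattice d} {O : Set (Space d)} {ε : ℝ}
  {ρ : Ω → (Fin k → ℝ) → ℝ}

/-- The dissipation potential on the common space. -/
noncomputable def dissipation (P : Measure Ω) (d : ℕ) (ρ : Ω → (Fin k → ℝ) → ℝ)
    (Z : Fin k → FullL2 P d) : ℝ≥0∞ :=
  ∫⁻ p, ENNReal.ofReal (ρ p.1 fun i => Z i p) ∂P.prod volume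

theorem IsAdmissibleDissipation.apply_zero (hρ : IsAdmissibleDissipation P ρ) :
    ∀ᵐ ω ∂P, ρ ω 0 = 0 := by
  filter_upwards [hρ.homogeneous] with ω h
  have := h 0 0 le_rfl
  simpa using this

/-- Convexity at the midpoint, with the factor ½ removed by homogeneity. -/
theorem IsAdmissibleDissipation.add_le (hρ : IsAdmissibleDissipation P ρ) :
    ∀ᵐ ω ∂P, ∀ F G, ρ ω (F + G) ≤ ρ ω F + ρ ω G := by
  filter_upwards [hρ.homogeneous, hρ.convex] with ω h hc F G
  have h1 := hc.2 (mem_univ F) (mem_univ G) (by norm_num : (0 : ℝ) ≤ 1 / 2)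
    (by norm_num : (0 : ℝ) ≤ 1 / 2) (by norm_num)
  rw [← smul_add, h _ _ (by norm_num), smul_eq_mul, smul_eq_mul] at h1
  linarith

theorem IsAdmissibleDissipation.continuous (hρ : IsAdmissibleDissipation P ρ) :
    ∀ᵐ ω ∂P, Continuous (ρ ω) := by
  filter_upwards [hρ.convex] with ω h
  rw [← continuousOn_univ]
  exact h.continuousOn isOpen_univ

theorem IsAdmissibleDissipation.aemeasurable (hρ : IsAdmissibleDissipation P ρ) {α : Type*}
    [MeasurableSpace α] {μ : Measure α} {f : α → Ω} (hf : Measurable f) (Z : Fin k → Lp ℝ 2 μ) :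
    AEMeasurable (fun p => ENNReal.ofReal (ρ (f p) fun i => Z i p)) μ := by
  refine ENNReal.measurable_ofReal.comp_aemeasurable ?_
  have h : AEMeasurable (fun p => (f p, fun i => Z i p)) μ :=
    hf.aemeasurable.prodMk (aemeasurable_pi_lambda _ fun i =>
      (Lp.aestronglyMeasurable (Z i)).aemeasurable)
  exact hρ.measurable.comp_aemeasurable h

theorem exists_subseq_tendsto_ae_pi {α : Type*} [MeasurableSpace α] {μ : Measure α}
    {f : ℕ → Fin k → Lp ℝ 2 μ} {g : Fin k → Lp ℝ 2 μ} (h : ∀ i, Tendsto (fun n => f n i) atTop (𝓝 (g i))) :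
    ∃ ns : ℕ → ℕ, StrictMono ns ∧
      ∀ᵐ x ∂μ, ∀ i, Tendsto (fun m => f (ns m) i x) atTop (𝓝 (g i x)) := by
  suffices H : ∀ s : Finset (Fin k), ∃ ns : ℕ → ℕ, StrictMono ns ∧
      ∀ᵐ x ∂μ, ∀ i ∈ s, Tendsto (fun m => f (ns m) i x) atTop (𝓝 (g i x)) by
    simpa using H Finset.univ
  intro s
  induction s using Finset.induction_on with
  | empty => exact ⟨id, strictMono_id, by simp⟩
  | insert i s _ ih =>
    obtain ⟨ns, hns, hs⟩ := ih
    obtain ⟨ms, hms, hi⟩ := exists_subseq_tendsto_ae ((h i).comp hns.tendsto_atTop)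
    refine ⟨ns ∘ ms, hns.comp hms, ?_⟩
    filter_upwards [hs, hi] with x h1 h2 j hj
    rcases Finset.mem_insert.1 hj with rfl | hj
    · exact h2
    · exact (h1 j hj).comp hms.tendsto_atTop

/-- Fatou's lemma along a subsequence that converges almost everywhere. A finite convex function on
ℝ^k is continuous, so the integrands converge pointwise. -/
theorem dissipation_le_of_tendsto (hρ : IsAdmissibleDissipation P ρ) {Z : ℕ → Fin k → FullL2 P d}
    {Z₀ : Fin k → FullL2 P d} (hZ : ∀ i, Tendsto (fun n => Z n i) atTop (𝓝 (Z₀ i))) {C : ℝ≥0∞}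
    (hC : ∀ n, dissipation P d ρ (Z n) ≤ C) : dissipation P d ρ Z₀ ≤ C := by
  obtain ⟨ns, -, hns⟩ := exists_subseq_tendsto_ae_pi hZ
  have h1 : dissipation P d ρ Z₀ ≤ ∫⁻ p, liminf (fun m => ENNReal.ofReal
      (ρ p.1 fun i => Z (ns m) i p)) atTop ∂P.prod volume := by
    refine lintegral_mono_ae ?_
    filter_upwards [hns, ae_prod_fst (ν := (volume : Measure (Space d))) hρ.continuous] with p h2 h3
    refine (Tendsto.liminf_eq ?_).ge
    exact (ENNReal.continuous_ofReal.tendsto _).comp ((h3.tendsto _).comp (tendsto_pi_nhds.2 h2))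
  refine h1.trans ((lintegral_liminf_le' fun m => hρ.aemeasurable measurable_fst _).trans ?_)
  exact liminf_le_of_le (by isBoundedDefault) fun x hx => by
    obtain ⟨m, hm⟩ := hx.exists
    exact hm.trans (hC _)

theorem dissipation_add_le (hρ : IsAdmissibleDissipation P ρ) (Z Z' : Fin k → FullL2 P d) :
    dissipation P d ρ (Z + Z') ≤ dissipation P d ρ Z + dissipation P d ρ Z' := by
  rw [dissipation, dissipation, dissipation, ← lintegral_add_left' (hρ.aemeasurable measurable_fst _)]
  refine lintegral_mono_ae ?_
  filter_upwards [ae_prod_fst (ν := (volume : Measure (Space d))) hρ.add_le,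
    ae_all_iff.2 fun i => Lp.coeFn_add (Z i) (Z' i)] with p h1 h2
  rw [← ENNReal.ofReal_add (hρ.nonneg _ _) (hρ.nonneg _ _)]
  refine ENNReal.ofReal_le_ofReal ?_
  have : (fun i => (Z + Z') i p) = (fun i => Z i p) + fun i => Z' i p := funext h2
  rw [this]
  exact h1 _ _

theorem dissipation_smul (hρ : IsAdmissibleDissipation P ρ) {s : ℝ} (hs : 0 ≤ s)
    (Z : Fin k → FullL2 P d) :
    dissipation P d ρ (s • Z) = ENNReal.ofReal s * dissipation P d ρ Z := by
  rw [dissipation, dissipation, ← lintegral_const_mul'' _ (hρ.aemeasurable measurable_fst _)]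
  refine lintegral_congr_ae ?_
  filter_upwards [ae_prod_fst (ν := (volume : Measure (Space d))) hρ.homogeneous,
    ae_all_iff.2 fun i => Lp.coeFn_smul s (Z i)] with p h1 h2
  have : (fun i => (s • Z) i p) = s • fun i => Z i p := funext h2
  rw [this, h1 _ _ hs, ENNReal.ofReal_mul hs]

theorem isDissipationPotential_dissipation (hρ : IsAdmissibleDissipation P ρ) :
    IsDissipationPotential fun v : CrossL2 P d k => dissipation P d ρ fun i => v (.inr (.inr i)) where
  subadd v w := dissipation_add_le hρ _ _
  homog s v hs := dissipation_smul hρ hs _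
  lsc := by
    rw [lowerSemicontinuous_iff_isClosed_preimage]
    intro C
    refine IsSeqClosed.isClosed fun v v₀ hv hlim => ?_
    rw [tendsto_crossL2] at hlim
    exact dissipation_le_of_tendsto hρ (fun i => hlim (.inr (.inr i))) hv

theorem dissipation_unfolding (hτ : IsDynamicalSystem P τ) (hε : 0 < ε)
    (hρ : IsAdmissibleDissipation P ρ) (z : Fin k → DiscreteL2 P d ε) :
    dissipation P d ρ (fun i => unfolding hτ hε (z i)) =
      ∫⁻ p, ENNReal.ofReal (ρ (τ p.2 p.1) fun i => z i p) ∂P.prod (latticeMeasure d ε) := by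
  have hmp := hτ.measurePreserving_unfold hε
  have h := lintegral_map' (μ := P.prod (volume : Measure (Space d))) (g := fun p => (τ (-nearestNode ε p.2) p.1, nearestNode ε p.2))
    (f := fun p => ENNReal.ofReal (ρ (τ p.2 p.1) fun i => z i p))
    (by rw [hmp.map_eq]
        exact hρ.aemeasurable (measurable_fst.comp
          (hτ.measurePreserving_twist (ε := ε)).measurable) z) hmp.measurable.aemeasurable
  rw [hmp.map_eq] at h
  rw [h, dissipation]
  refine lintegral_congr_ae ?_
  filter_upwards [ae_all_iff.2 fun i => coeFn_unfolding' hτ hε (z i)] with p hp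
  simp only [hp, hτ.apply_neg_apply]

theorem setLIntegral_node_eq (hτ : IsDynamicalSystem P τ)
    (hρ : IsAdmissibleDissipation P ρ) {S : Set (Space d)} {z : Fin k → DiscreteL2 P d ε}
    (hz : ∀ i, z i ∈ supportedOn P ε S) :
    ∫⁻ p in {p : Ω × IntLattice d | node ε p.2 ∈ S}, ENNReal.ofReal (ρ (τ p.2 p.1) fun i => z i p)
      ∂P.prod (latticeMeasure d ε) =
    ∫⁻ p, ENNReal.ofReal (ρ (τ p.2 p.1) fun i => z i p) ∂P.prod (latticeMeasure d ε) := by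
  rw [← lintegral_indicator (measurableSet_node_mem ε S)]
  refine lintegral_congr_ae ?_
  have h1 : ∀ i, ∀ᵐ p ∂P.prod (latticeMeasure d ε), node ε p.2 ∉ S → z i p = 0 := hz
  filter_upwards [ae_all_iff.2 h1, (hτ.measurePreserving_twist (ε := ε)).quasiMeasurePreserving.ae
    (ae_prod_fst hρ.apply_zero)] with p h2 h3
  by_cases hp : node ε p.2 ∈ S
  · rw [indicator_of_mem (by exact hp)]
  · rw [indicator_of_notMem (by exact hp)]
    have : (fun i => z i p) = 0 := funext fun i => h2 i hp
    rw [this, h3, ENNReal.ofReal_zero]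

theorem discreteDissipation_eq (hτ : IsDynamicalSystem P τ) (hε : 0 < ε)
    (hρ : IsAdmissibleDissipation P ρ) (y : DiscreteState P b O ε) :
    discreteDissipation P τ b O ε ρ y =
      dissipation P d ρ fun i => discreteEmbedding hτ b O hε y (.inr (.inr i)) := by
  simp only [discreteEmbedding_z]
  rw [dissipation_unfolding hτ hε hρ, discreteDissipation, setLIntegral_node_eq hτ hρ y.z_mem]

theorem contDissipation_eq (hτ : IsDynamicalSystem P τ) (hO : MeasurableSet O)
    (hρ : IsAdmissibleDissipation P ρ) (y : ContState k P τ O) :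
    contDissipation P τ O ρ y =
      dissipation P d ρ fun i => contEmbedding k hτ hO y (.inr (.inr i)) := by
  simp only [contEmbedding_Z]
  rw [contDissipation, lintegral_prod_restrict hO, dissipation]
  refine lintegral_congr_ae ?_
  filter_upwards [ae_all_iff.2 fun i => coeFn_extendZero hO (y.Z i),
    ae_prod_fst (ν := (volume : Measure (Space d))) hρ.apply_zero] with p h1 h2
  simp only [h1]
  by_cases hx : p.2 ∈ O
  · simp [indicator, hx, zeroExt]
  · have : (fun i => zeroExt O (y.Z i) p) = 0 := funext fun i => by simp [zeroExt, hx]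
    rw [this, h2]
    simp [hx]

/-- Averaging over cells and cutting off does not increase the dissipation. -/
theorem dissipation_cellAverage_le (hτ : IsDynamicalSystem P τ) (hε : 0 < ε)
    (hρ : IsAdmissibleDissipation P ρ) (Z : Fin k → FullL2 P d) {z : Fin k → DiscreteL2 P d ε}
    {S : Set (Space d)}
    (hz : ∀ i, ∀ᵐ p ∂P.prod (latticeMeasure d ε), z i p =
      ({p : Ω × IntLattice d | node ε p.2 ∈ S}).indicator (cellAverage hτ hε (Z i)) p) :
    dissipation P d ρ (fun i => unfolding hτ hε (z i)) ≤ dissipation P d ρ Z := by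
  -- Outside S the cut-off field is zero, where ρ vanishes, and ρ is nonnegative elsewhere.
  have h1 : dissipation P d ρ (fun i => unfolding hτ hε (z i)) ≤
      dissipation P d ρ (fun i => unfolding hτ hε (cellAverage hτ hε (Z i))) := by
    rw [dissipation_unfolding hτ hε hρ, dissipation_unfolding hτ hε hρ]
    refine lintegral_mono_ae ?_
    filter_upwards [ae_all_iff.2 hz, (hτ.measurePreserving_twist (ε := ε)).quasiMeasurePreserving.ae
      (ae_prod_fst hρ.apply_zero)] with p h2 h3
    by_cases hp : node ε p.2 ∈ S
    · simp [h2, indicator, hp]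
    · have : (fun i => z i p) = 0 := funext fun i => by simp [h2, hp]
      rw [this, h3, ENNReal.ofReal_zero]
      exact zero_le
  refine h1.trans ?_
  -- After unfolding, ρ(ω, ·) does not depend on x. With ω frozen, Jensen's inequality applies on
  -- each cell.
  have e1 : dissipation P d ρ (fun i => unfolding hτ hε (cellAverage hτ hε (Z i))) =
      ∫⁻ ω, (∫⁻ x, ENNReal.ofReal (ρ ω fun i =>
        unfolding hτ hε (cellAverage hτ hε (Z i)) (ω, x))) ∂P :=
    lintegral_prod _ (hρ.aemeasurable measurable_fst _)
  have e2 : dissipation P d ρ Z =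
      ∫⁻ ω, (∫⁻ x, ENNReal.ofReal (ρ ω fun i => Z i (ω, x))) ∂P :=
    lintegral_prod _ (hρ.aemeasurable measurable_fst _)
  rw [e1, e2]
  refine lintegral_mono_ae ?_
  filter_upwards [hρ.convex, ae_all_iff.2 fun i => ae_integrableOn_cell (ε := ε) (Z i),
    ae_all_iff.2 fun i => Measure.ae_ae_of_ae_prod (coeFn_unfolding_cellAverage hτ hε (Z i))]
    with ω h2 h3 h4
  refine le_trans (le_of_eq ?_) (lintegral_cellAverage_le hε (hρ.nonneg ω) h2 (f := fun i x => Z i (ω, x)) h3)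
  refine lintegral_congr_ae ?_
  filter_upwards [ae_all_iff.2 h4] with x hx
  simp only [hx]

end Dissipation

end SpringNetwork

namespace SpringNetwork

/-! ### Uniform coercivity: Korn and Poincaré inequalities for random lattice fields. -/

section Coercivity

variable {d k : ℕ} {Ω : Type*} [MeasurableSpace Ω] {P : Measure Ω} [IsProbabilityMeasure P]
  {τ : IntLattice d → Ω → Ω} {b : Fin k → IntLattice d}
  {B : Fin k → IntLattice d →₀ (Fin d → ℝ)} {O : Set (Space d)} {ε : ℝ}

theorem ofReal_sum_norm_sq {ι : Type*} [Fintype ι] (F : ι → DiscreteL2 P d ε) :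
    ENNReal.ofReal (∑ a, ‖F a‖ ^ 2) =
      ∫⁻ ω, (∑' n, ENNReal.ofReal (ε ^ d) * ENNReal.ofReal (∑ a, F a (ω, n) ^ 2)) ∂P := by
  have hi : ∀ a ∈ (Finset.univ : Finset ι),
      Integrable (fun p => F a p ^ 2) (P.prod (latticeMeasure d ε)) :=
    fun a _ => (Lp.memLp (F a)).integrable_sq
  simp only [norm_sq_eq_integral]
  rw [← integral_finsetSum _ hi, ofReal_integral_eq_lintegral_ofReal (integrable_finsetSum _ hi)
    (Eventually.of_forall fun p => Finset.sum_nonneg fun a _ => sq_nonneg _),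
    lintegral_prod _ (integrable_finsetSum _ hi).aestronglyMeasurable.aemeasurable.ennreal_ofReal]
  simp only [lintegral_latticeMeasure]

theorem coeFn_discreteGrad (j : Fin d) (u : DiscreteL2 P d ε) :
    discreteGrad P ε j u =ᵐ[P.prod (latticeMeasure d ε)]
      fun p => ε⁻¹ * (u (p.1, p.2 + unitVec j) - u p) := by
  change (ε⁻¹ • (translate P ε (unitVec j) u - u) : DiscreteL2 P d ε) =ᵐ[_] _
  filter_upwards [Lp.coeFn_smul ε⁻¹ (translate P ε (unitVec j) u - u),
    Lp.coeFn_sub (translate P ε (unitVec j) u) u, coeFn_translate (unitVec j) u] with p h1 h2 h3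
  rw [h1, Pi.smul_apply, h2, Pi.sub_apply, h3, smul_eq_mul]

theorem coeFn_discreteSymGrad (u : Fin d → DiscreteL2 P d ε) (i : Fin k) :
    discreteSymGrad P ε b u i =ᵐ[P.prod (latticeMeasure d ε)]
      fun p => ε⁻¹ * ∑ l, (b i l : ℝ) / len (b i) *
        ((u l (p.1, p.2 + b i) - u l p) / len (b i)) := by
  refine (Lp.coeFn_finsetSum _ _).trans ?_
  have h : ∀ l, edgeDiff P ε (b i) (u l) =ᵐ[P.prod (latticeMeasure d ε)]
      fun p => (ε * len (b i))⁻¹ * (u l (p.1, p.2 + b i) - u l p) := fun l => by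
    change ((ε * len (b i))⁻¹ • (translate P ε (b i) (u l) - u l) : DiscreteL2 P d ε) =ᵐ[_] _
    filter_upwards [Lp.coeFn_smul (ε * len (b i))⁻¹ (translate P ε (b i) (u l) - u l),
      Lp.coeFn_sub (translate P ε (b i) (u l)) (u l), coeFn_translate (b i) (u l)] with p h1 h2 h3
    rw [h1, Pi.smul_apply, h2, Pi.sub_apply, h3, smul_eq_mul]
  filter_upwards [ae_all_iff.2 h, ae_all_iff.2 fun l => Lp.coeFn_smul ((b i l : ℝ) / len (b i))
    (edgeDiff P ε (b i) (u l))] with p h1 h2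
  rw [Finset.sum_apply, Finset.mul_sum]
  refine Finset.sum_congr rfl fun l _ => ?_
  rw [h2, Pi.smul_apply, h1, smul_eq_mul, mul_inv, div_eq_mul_inv _ (len (b i)),
    div_eq_mul_inv _ (len (b i))]
  ring

/-- The discrete Korn inequality for random fields. -/
theorem exists_korn (hKorn : DiscreteKorn b) (hO : Bornology.IsBounded O) :
    ∃ C : ℝ, 0 < C ∧ ∀ (ε : ℝ), 0 < ε → ∀ u : Fin d → DiscreteL2 P d ε,
      (∀ l, u l ∈ supportedOn P ε O) →
      ∑ l, ∑ j, ‖discreteGrad P ε j (u l)‖ ^ 2 ≤ C * ∑ i, ‖discreteSymGrad P ε b u i‖ ^ 2 := by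
  obtain ⟨C, hC, hK⟩ := hKorn
  refine ⟨C, hC, fun ε hε u hu => ?_⟩
  rw [← Fintype.sum_prod_type' (f := fun l j => ‖discreteGrad P ε j (u l)‖ ^ 2)]
  have hnn : 0 ≤ ∑ i, ‖discreteSymGrad P ε b u i‖ ^ 2 := Finset.sum_nonneg fun i _ => sq_nonneg _
  rw [← ENNReal.ofReal_le_ofReal_iff (by positivity), ENNReal.ofReal_mul hC.le,
    ofReal_sum_norm_sq (fun lj : Fin d × Fin d => discreteGrad P ε lj.2 (u lj.1)),
    ofReal_sum_norm_sq (discreteSymGrad P ε b u), ← lintegral_const_mul' _ _ ENNReal.ofReal_ne_top]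
  refine lintegral_mono_ae ?_
  have hg := fun (lj : Fin d × Fin d) n => forall_of_ae_prod_lattice hε
    (coeFn_discreteGrad lj.2 (u lj.1)) n
  have hs := fun i n => forall_of_ae_prod_lattice hε (coeFn_discreteSymGrad (b := b) u i) n
  have hz := fun l n => forall_of_ae_prod_lattice hε (hu l) n
  filter_upwards [ae_all_iff.2 fun lj => ae_all_iff.2 (hg lj), ae_all_iff.2 fun i => ae_all_iff.2 (hs i),
    ae_all_iff.2 fun l => ae_all_iff.2 (hz l)] with ω h1 h2 h3
  -- For almost every ω the realization is finitely supported because O is bounded, and the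
  -- deterministic inequality applies to it. Both sides carry the factor ε⁻², so the constant does
  -- not depend on ε.
  let v : IntLattice d → Fin d → ℝ := fun n l => u l (ω, n)
  have hv : (Function.support v).Finite := by
    refine (finite_node_mem hε hO).subset fun n hn => ?_
    by_contra hno
    exact hn (funext fun l => h3 l n hno)
  have hfin : ∀ c : IntLattice d, {n | v (n + c) ≠ 0 ∨ v n ≠ 0}.Finite := fun c => by
    refine Set.Finite.union (hv.preimage (add_left_injective c).injOn) hv
  have hsum1 : Summable fun n => ∑ l, ∑ j, (v (n + unitVec j) l - v n l) ^ 2 := by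
    refine summable_of_hasFiniteSupport ((Set.finite_iUnion fun j => hfin (unitVec j)).subset ?_)
    intro n hn
    by_contra hno
    simp only [mem_iUnion, mem_ofPred_eq, not_exists, not_or, not_not] at hno
    refine hn (Finset.sum_eq_zero fun l _ => Finset.sum_eq_zero fun j _ => ?_)
    rw [(hno j).1, (hno j).2]
    simp
  have hsum2 : Summable fun n => ∑ i, (∑ l, (b i l : ℝ) / len (b i) *
      ((v (n + b i) l - v n l) / len (b i))) ^ 2 := by
    refine summable_of_hasFiniteSupport ((Set.finite_iUnion fun i => hfin (b i)).subset ?_)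
    intro n hn
    by_contra hno
    simp only [mem_iUnion, mem_ofPred_eq, not_exists, not_or, not_not] at hno
    refine hn (Finset.sum_eq_zero fun i _ => ?_)
    rw [(hno i).1, (hno i).2]
    simp
  have hkorn := hK v hv
  have e1 : ∀ n, ∑ lj : Fin d × Fin d, discreteGrad P ε lj.2 (u lj.1) (ω, n) ^ 2 =
      (ε⁻¹) ^ 2 * ∑ l, ∑ j, (v (n + unitVec j) l - v n l) ^ 2 := fun n => by
    simp only [h1, mul_pow, Fintype.sum_prod_type, ← Finset.mul_sum, v]
  have e2 : ∀ n, ∑ i, discreteSymGrad P ε b u i (ω, n) ^ 2 =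
      (ε⁻¹) ^ 2 * ∑ i, (∑ l, (b i l : ℝ) / len (b i) *
        ((v (n + b i) l - v n l) / len (b i))) ^ 2 := fun n => by
    simp only [h2, mul_pow, ← Finset.mul_sum, v]
  simp only [e1, e2, ENNReal.tsum_mul_left]
  rw [mul_left_comm]
  refine mul_le_mul_right ?_ _
  rw [← ENNReal.ofReal_tsum_of_nonneg (fun n => mul_nonneg (sq_nonneg _) (Finset.sum_nonneg fun l _ =>
      Finset.sum_nonneg fun j _ => sq_nonneg _)) (hsum1.mul_left _),
    ← ENNReal.ofReal_tsum_of_nonneg (fun n => mul_nonneg (sq_nonneg _) (Finset.sum_nonneg fun i _ =>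
      sq_nonneg _)) (hsum2.mul_left _), ← ENNReal.ofReal_mul hC.le, tsum_mul_left, tsum_mul_left]
  refine ENNReal.ofReal_le_ofReal ?_
  rw [mul_left_comm]
  exact mul_le_mul_of_nonneg_left hkorn (sq_nonneg _)

theorem translate_translate (b c : IntLattice d) (u : DiscreteL2 P d ε) :
    translate P ε b (translate P ε c u) = translate P ε (b + c) u := by
  have h : ∀ (b : IntLattice d) (u : DiscreteL2 P d ε),
      translate P ε b u = pull _ (measurePreserving_translate P ε b) u := fun _ _ => rfl
  rw [h, h, h, pull_pull]
  apply pull_congr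
  ext p
  · rfl
  · simp [add_assoc]

theorem norm_translate_nsmul_sub_le (e : IntLattice d) (u : DiscreteL2 P d ε) (m : ℕ) :
    ‖translate P ε (m • e) u - u‖ ≤ m * ‖translate P ε e u - u‖ := by
  induction m with
  | zero =>
    have h : translate P ε ((0 : ℕ) • e) u = u := by
      apply Lp.ext
      filter_upwards [coeFn_translate ((0 : ℕ) • e) u] with p hp
      rw [hp, zero_smul, add_zero]
    rw [h]; simp
  | succ m ih =>
    have h : translate P ε ((m + 1) • e) u - u =
        translate P ε e (translate P ε (m • e) u - u) + (translate P ε e u - u) := by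
      rw [map_sub, translate_translate, succ_nsmul']
      abel
    rw [h]
    refine (norm_add_le _ _).trans ?_
    rw [LinearIsometry.norm_map]
    push_cast
    linarith

/-- A translation that moves O off itself separates the support of u from that of its translate. -/
theorem inner_translate_eq_zero {e : IntLattice d} {u : DiscreteL2 P d ε}
    (hu : u ∈ supportedOn P ε O) (he : ∀ n, node ε n ∈ O → node ε (n + e) ∉ O) :
    inner ℝ (translate P ε e u) u = (0 : ℝ) := by
  have h1 : ∀ᵐ p ∂P.prod (latticeMeasure d ε), node ε p.2 ∉ O → u p = 0 := hu
  rw [inner_eq_integral]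
  refine integral_eq_zero_of_ae ?_
  filter_upwards [h1, coeFn_translate e u,
    (measurePreserving_translate P ε e).quasiMeasurePreserving.ae h1] with p h2 h3 h4
  rw [h3]
  by_cases hp : node ε p.2 ∈ O
  · rw [h4 (he _ hp)]; simp
  · rw [h2 hp]; simp

/-- The discrete Poincaré inequality. -/
theorem exists_poincare (hd : 0 < d) (hO : Bornology.IsBounded O) (E : ℝ) :
    ∃ C : ℝ, 0 < C ∧ ∀ (ε : ℝ), 0 < ε → ε ≤ E → ∀ u ∈ supportedOn P ε O,
      ‖u‖ ^ 2 ≤ C * ∑ j, ‖discreteGrad P ε j u‖ ^ 2 := by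
  obtain ⟨R, hR0, hR⟩ := hO.subset_ball_lt 0 0
  refine ⟨(2 * R + 2 * |E|) ^ 2, by positivity, fun ε hε hεE u hu => ?_⟩
  let j : Fin d := ⟨0, hd⟩
  -- After m steps of length ε the domain, contained in a ball of radius R, has left itself; the
  -- added one makes ε m > 2R strict. Then u is orthogonal to its translate, so ‖u‖ is at most the
  -- norm of the difference, which telescopes over m steps. Uniformity in ε comes from ε m ≤ 2R +
  -- 2|E|.
  set m := ⌈2 * R / ε⌉₊ + 1 with hm
  have hm1 : 2 * R < ε * m := by
    have := Nat.le_ceil (2 * R / ε)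
    rw [div_le_iff₀ hε] at this
    rw [hm]; push_cast
    nlinarith
  have hm2 : ε * m ≤ 2 * R + 2 * |E| := by
    have := Nat.ceil_lt_add_one (a := 2 * R / ε) (by positivity)
    have h2 : (m : ℝ) ≤ 2 * R / ε + 2 := by rw [hm]; push_cast; linarith
    have h3 : ε * m ≤ ε * (2 * R / ε + 2) := by gcongr
    have h4 : ε * (2 * R / ε + 2) = 2 * R + 2 * ε := by field_simp
    have := le_abs_self E
    linarith
  have horth : inner ℝ (translate P ε (m • unitVec j) u) u = (0 : ℝ) := by
    refine inner_translate_eq_zero hu fun n hn hn' => ?_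
    have h1 := hR hn
    have h2 := hR hn'
    rw [mem_ball_zero_iff] at h1 h2
    have h3 : ‖node ε (m • unitVec j : IntLattice d)‖ = ε * m := by
      have : node ε (m • unitVec j : IntLattice d) = (m : ℝ) • node ε (unitVec j) := by
        ext i; simp [node]; ring
      rw [this, node_unitVec, norm_smul, norm_smul, PiLp.norm_single]
      simp [abs_of_pos hε, mul_comm]
    have h4 : node ε (m • unitVec j : IntLattice d) = node ε (n + m • unitVec j) - node ε n := by
      rw [node_add]; abel
    rw [h4] at h3
    have := norm_sub_le (node ε (n + m • unitVec j)) (node ε n)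
    linarith
  have h1 : ‖u‖ ^ 2 ≤ ‖translate P ε (m • unitVec j) u - u‖ ^ 2 := by
    rw [norm_sub_sq_real, horth, LinearIsometry.norm_map]
    nlinarith [sq_nonneg ‖u‖]
  have h2 : ‖u‖ ≤ ‖translate P ε (m • unitVec j) u - u‖ :=
    le_of_sq_le_sq h1 (norm_nonneg _)
  have h3 : ‖translate P ε (unitVec j) u - u‖ = ε * ‖discreteGrad P ε j u‖ := by
    have : discreteGrad P ε j u = ε⁻¹ • (translate P ε (unitVec j) u - u) := rfl
    rw [this, norm_smul, Real.norm_eq_abs, abs_inv, abs_of_pos hε, mul_inv_cancel_left₀ hε.ne']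
  have h4 : ‖u‖ ≤ (2 * R + 2 * |E|) * ‖discreteGrad P ε j u‖ := by
    refine h2.trans ((norm_translate_nsmul_sub_le _ _ _).trans ?_)
    rw [h3, ← mul_assoc, mul_comm (m : ℝ) ε]
    gcongr
  calc ‖u‖ ^ 2 ≤ ((2 * R + 2 * |E|) * ‖discreteGrad P ε j u‖) ^ 2 := by gcongr
    _ = (2 * R + 2 * |E|) ^ 2 * ‖discreteGrad P ε j u‖ ^ 2 := by ring
    _ ≤ _ := by
      gcongr
      exact Finset.single_le_sum (f := fun j => ‖discreteGrad P ε j u‖ ^ 2)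
        (fun j _ => sq_nonneg _) (Finset.mem_univ j)

/-- Korn bounds the full gradient by the strain, Poincaré bounds the displacement by the gradient,
and the form bounds the strain. All three constants are uniform for ε ≤ E. -/
theorem exists_discrete_coercive (hd : 0 < d) (hτ : IsDynamicalSystem P τ)
    {A : Ω → Matrix (Fin k ⊕ Fin k) (Fin k ⊕ Fin k) ℝ} (hA : IsAdmissibleCoefficient P A)
    (hB : ∀ i, IsEdgeKernel (b i) (B i)) (hKorn : DiscreteKorn b) (hO : Bornology.IsBounded O)
    (E : ℝ) : ∃ c : ℝ, 0 < c ∧ ∀ (ε : ℝ) (hε : 0 < ε), ε ≤ E → ∀ y : DiscreteState P b O ε,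
      c * ‖y‖ ^ 2 ≤ energyForm hτ b B ε hA (discreteEmbedding hτ b O hε y)
        (discreteEmbedding hτ b O hε y) := by
  obtain ⟨cA, hcA, hcoer⟩ := exists_energyForm_coercive hτ b B hA
  obtain ⟨CK, hCK, hkorn⟩ := exists_korn (P := P) hKorn hO
  obtain ⟨CP, hCP, hpoinc⟩ := exists_poincare (P := P) hd hO E
  refine ⟨cA / ((CP + 1) * CK + 1), by positivity, fun ε hε hεE y => ?_⟩
  refine le_trans ?_ (hcoer ε _)
  rw [div_mul_eq_mul_div, mul_div_assoc]
  refine mul_le_mul_of_nonneg_left ?_ hcA.le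
  rw [div_le_iff₀ (by positivity)]
  have hnorm : ‖y‖ ^ 2 = ∑ l, ‖y.u l‖ ^ 2 + (∑ l, ∑ j, ‖discreteGrad P ε j (y.u l)‖ ^ 2 +
      ∑ i, ‖y.z i‖ ^ 2) := by
    rw [← (discreteEmbedding hτ b O hε).norm_map y, PiLp.norm_sq_eq_of_L2]
    simp only [Fintype.sum_sum_type, discreteEmbedding_u, discreteEmbedding_z,
      LinearIsometry.norm_map, Fintype.sum_prod_type, discreteEmbedding_gradU,
      DiscreteState.gradU_eq]
  have hstrain : ∑ a, ‖strain hτ b B ε a (discreteEmbedding hτ b O hε y)‖ ^ 2 =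
      ∑ i, ‖discreteSymGrad P ε b y.u i‖ ^ 2 + ∑ i, ‖y.z i‖ ^ 2 := by
    simp only [strain_discreteEmbedding hτ hε hB, LinearIsometry.norm_map, Fintype.sum_sum_type]
    rfl
  rw [hnorm, hstrain]
  have h1 := hkorn ε hε y.u y.u_mem
  have h2 : ∑ l, ‖y.u l‖ ^ 2 ≤ CP * ∑ l, ∑ j, ‖discreteGrad P ε j (y.u l)‖ ^ 2 := by
    rw [Finset.mul_sum]
    exact Finset.sum_le_sum fun l _ => hpoinc ε hε hεE _ (y.u_mem l)
  set S := ∑ i, ‖discreteSymGrad P ε b y.u i‖ ^ 2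
  set G := ∑ l, ∑ j, ‖discreteGrad P ε j (y.u l)‖ ^ 2
  have hS : 0 ≤ S := Finset.sum_nonneg fun i _ => sq_nonneg _
  have hZ : 0 ≤ ∑ i, ‖y.z i‖ ^ 2 := Finset.sum_nonneg fun i _ => sq_nonneg _
  have h3 : (CP + 1) * G ≤ (CP + 1) * (CK * S) := by gcongr
  have h4 : 0 ≤ (CP + 1) * CK * ∑ i, ‖y.z i‖ ^ 2 := by positivity
  nlinarith

end Coercivity

end SpringNetwork

namespace SpringNetwork

/-! ### Closed subspaces of limits of ranges. -/

section LimitRange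

variable {E : ℕ → Type*} {G : Type*} [NormedAddCommGroup G] [NormedSpace ℝ G]
  [∀ n, AddCommGroup (E n)] [∀ n, Module ℝ (E n)]

/-- The limits of sequences of elements of the ranges of `L n`. -/
def limitRange (L : ∀ n, E n →ₗ[ℝ] G) : Submodule ℝ G where
  carrier := {w | ∃ v : ∀ n, E n, Tendsto (fun n => L n (v n)) atTop (𝓝 w)}
  zero_mem' := ⟨fun _ => 0, by simp⟩
  add_mem' := by
    rintro x y ⟨v, hv⟩ ⟨v', hv'⟩
    exact ⟨fun n => v n + v' n, by simpa only [map_add] using hv.add hv'⟩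
  smul_mem' := by
    rintro c x ⟨v, hv⟩
    exact ⟨fun n => c • v n, by simpa only [map_smul] using hv.const_smul c⟩

theorem isClosed_limitRange (L : ∀ n, E n →ₗ[ℝ] G) : IsClosed (limitRange L : Set G) := by
  refine isClosed_of_closure_subset fun w hw => ?_
  refine exists_tendsto_of_mem_closure L (S := (limitRange L : Set G)) (fun w hw => hw) ?_
  rwa [Submodule.span_eq]

/-- A continuous linear map sends the closed span of `S` to limits of the ranges of `L n`, if it
does so for the elements of `S`. -/
theorem mem_limitRange_of_mem_closure (L : ∀ n, E n →ₗ[ℝ] G) {K : Type*} [NormedAddCommGroup K]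
    [NormedSpace ℝ K] (J : K →L[ℝ] G) {S : Set K} (hS : ∀ x ∈ S, J x ∈ limitRange L) {x : K}
    (hx : x ∈ (Submodule.span ℝ S).topologicalClosure) : J x ∈ limitRange L := by
  have h : (Submodule.span ℝ S).topologicalClosure ≤ (limitRange L).comap J.toLinearMap :=
    Submodule.topologicalClosure_minimal _ (Submodule.span_le.2 hS)
      ((isClosed_limitRange L).preimage J.continuous)
  exact h hx

end LimitRange

section Tens

variable {α β : Type*} [MeasurableSpace α] [MeasurableSpace β] {μ : Measure α} {ν : Measure β}
  [SFinite μ] [SFinite ν]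

theorem tens_sub_left (ψ ψ' : Lp ℝ 2 μ) (η : Lp ℝ 2 ν) :
    tens (ψ - ψ') η = tens ψ η - tens ψ' η := by
  rw [(tens : Lp ℝ 2 μ →L[ℝ] Lp ℝ 2 ν →L[ℝ] Lp ℝ 2 (μ.prod ν)).map_sub]
  rfl

theorem tens_smul_sub_right (c : ℝ) (ψ : Lp ℝ 2 μ) (η η' : Lp ℝ 2 ν) :
    tens ψ (c • (η - η')) = c • (tens ψ η - tens ψ η') := by
  rw [(tens ψ).map_smul, (tens ψ).map_sub]

end Tens

theorem inv_smul_map_smul_sub {E : Type*} [NormedAddCommGroup E] [NormedSpace ℝ E] (S : E →ₗᵢ[ℝ] E)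
    {c : ℝ} (hc : c ≠ 0) {x y : E} (h : y = c • x) : c⁻¹ • (S y - y) = S x - x := by
  rw [h, map_smul, ← smul_sub, smul_smul, inv_mul_cancel₀ hc, one_smul]

/-! ### Recovery sequences. -/

section Recovery

variable {d k : ℕ} {Ω : Type*} [MeasurableSpace Ω] {P : Measure Ω} [IsProbabilityMeasure P]
  {τ : IntLattice d → Ω → Ω} (hτ : IsDynamicalSystem P τ) {b : Fin k → IntLattice d}
  {O : Set (Space d)}

/-- A random lattice field together with its discrete gradient. -/
noncomputable def mkDiscreteH10 {ε : ℝ} (u : DiscreteL2 P d ε) (hu : u ∈ supportedOn P ε O) :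
    DiscreteH10 P ε O :=
  ⟨WithLp.toLp 2 (u, WithLp.toLp 2 fun j => discreteGrad P ε j u), hu, fun _ => rfl⟩

/-- The unfolding of a displacement component and its gradient. -/
noncomputable def displacementMap {ε : ℝ} (hε : 0 < ε) (O : Set (Space d)) :
    DiscreteH10 P ε O →ₗ[ℝ] FullL2 P d × (Fin d → FullL2 P d) where
  toFun v := (unfolding hτ hε v.1.fst, fun j => unfolding hτ hε (v.1.snd j))
  map_add' v w := by
    ext1
    · exact map_add (unfolding hτ hε) _ _
    · exact funext fun j => map_add (unfolding hτ hε) _ _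
  map_smul' c v := by
    ext1
    · exact map_smul (unfolding hτ hε) _ _
    · exact funext fun j => map_smul (unfolding hτ hε) _ _

theorem displacementMap_mk {ε : ℝ} (hε : 0 < ε) (u : DiscreteL2 P d ε)
    (hu : u ∈ supportedOn P ε O) : displacementMap hτ hε O (mkDiscreteH10 u hu) =
      (unfolding hτ hε u, fun j => ε⁻¹ • (shift hτ (unitVec j) (node ε (unitVec j))
        (unfolding hτ hε u) - unfolding hτ hε u)) := by
  ext1
  · rfl
  · exact funext fun j => unfolding_discreteGrad hτ hε j u

variable {φ : Space d → ℝ}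

/-- The lattice samples of a test function. -/
noncomputable def IsTest.sample (h : IsTest O φ) {ε : ℝ} (hε : 0 < ε) : Lp ℝ 2 (latticeMeasure d ε) :=
  latticeLp ε (fun m => φ (node ε m)) (h.finite_support hε)

theorem IsTest.twistTens_sample_mem (h : IsTest O φ) {ε : ℝ} (hε : 0 < ε) (ψ : Lp ℝ 2 P) :
    twistTens hτ ε ψ (h.sample hε) ∈ supportedOn P ε O := by
  change ∀ᵐ p ∂P.prod (latticeMeasure d ε), node ε p.2 ∉ O → twistTens hτ ε ψ (h.sample hε) p = 0
  filter_upwards [coeFn_twistTens hτ ψ (h.sample hε)] with p hp hn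
  rw [hp, IsTest.sample, coeFn_latticeLp hε, h.eq_zero hn, mul_zero]

theorem IsTest.extendZero_tens (h : IsTest O φ) (hO : MeasurableSet O) (ψ : Lp ℝ 2 P)
    {η : DomainL2 O} (hη : η =ᵐ[volume.restrict O] φ) {H : Lp ℝ 2 (volume : Measure (Space d))}
    (hH : H =ᵐ[volume] φ) : extendZero P hO (tens ψ η) = tens ψ H := by
  apply Lp.ext
  filter_upwards [coeFn_extendZero hO (tens ψ η), coeFn_tens ψ H, ae_prod_snd (μ := P) hH,
    ae_of_ae_prod_restrict hO (coeFn_tens ψ η),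
    ae_of_ae_prod_restrict hO (ae_prod_snd (μ := P) hη)] with p h1 h2 h3 h4 h5
  rw [h1, h2, h3, zeroExt]
  by_cases hx : p.2 ∈ O
  · rw [indicator_of_mem (by exact hx), h4 hx, h5 hx]
  · rw [indicator_of_notMem (by exact hx), h.eq_zero hx, mul_zero]

variable {ε : ℕ → ℝ} (hε : ∀ n, 0 < ε n) (hεlim : Tendsto ε atTop (𝓝 0))

theorem shift_tens_oneLp (y : IntLattice d) (h : Space d) (η : Lp ℝ 2 (volume : Measure (Space d))) :
    shift hτ y h (tens (oneLp P) η) =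
      tens (oneLp P) (pull _ (measurePreserving_add_right volume h) η) :=
  (shift_tens hτ y h (oneLp P) η).trans
    (congrArg (fun ψ => tens ψ (pull _ (measurePreserving_add_right volume h) η)) (pull_oneLp hτ y))

theorem tendsto_prod_pi {ι : Type*} {F : Filter ι} {X : Type*} [TopologicalSpace X]
    {f : ι → X × (Fin d → X)} {w : X × (Fin d → X)} :
    Tendsto f F (𝓝 w) ↔ Tendsto (fun i => (f i).1) F (𝓝 w.1) ∧
      ∀ j, Tendsto (fun i => (f i).2 j) F (𝓝 (w.2 j)) := by
  rw [nhds_prod_eq, tendsto_prod_iff', tendsto_pi_nhds]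

include hεlim in
-- Lattice samples of a deterministic test function form the recovery sequence; no corrector appears
-- because the constant random factor is invariant.
theorem IsTest.mem_limitRange (h : IsTest O φ) {H : Lp ℝ 2 (volume : Measure (Space d))}
    (hH : H =ᵐ[volume] φ) {H' : Fin d → Lp ℝ 2 (volume : Measure (Space d))}
    (hH' : ∀ j, H' j =ᵐ[volume] partialDeriv φ j) :
    (tens (oneLp P) H, fun j => tens (oneLp P) (H' j)) ∈
      limitRange fun n => displacementMap hτ (hε n) O := by
  refine ⟨fun n => mkDiscreteH10 _ (h.twistTens_sample_mem hτ (hε n) (oneLp P)), ?_⟩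
  simp only [displacementMap_mk, unfolding_twistTens]
  rw [tendsto_prod_pi]
  refine ⟨((tens (oneLp P)).continuous.tendsto H).comp (h.tendsto_sample hε hεlim hH), fun j => ?_⟩
  refine (((tens (oneLp P)).continuous.tendsto (H' j)).comp
    (h.tendsto_sample_grad hε hεlim j (hH' j))).congr fun n => ?_
  rw [Function.comp_apply, tens_smul_sub_right]
  exact congrArg (fun X => (ε n)⁻¹ • (X - tens (oneLp P)
    (pull _ (measurePreserving_nearestNode (hε n)) (h.sample (hε n))))) (shift_tens_oneLp hτ _ _ _).symm

include hεlim in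
-- The field ε ψ(τ_n ω) φ(εn) vanishes in the limit, but the factor ε cancels in its difference
-- quotient. What remains is the shift minus the identity applied to ψ ⊗ φ; the spatial translation
-- disappears and leaves the random difference Dψ ⊗ φ.
theorem IsTest.mem_limitRange_corrector (h : IsTest O φ)
    {H : Lp ℝ 2 (volume : Measure (Space d))} (hH : H =ᵐ[volume] φ) (ψ : Lp ℝ 2 P) :
    ((0 : FullL2 P d), fun j => tens (pull _ (hτ.measurePreserving (unitVec j)) ψ - ψ) H) ∈
      limitRange fun n => displacementMap hτ (hε n) O := by
  have h1 : Tendsto (fun n => tens ψ (pull _ (measurePreserving_nearestNode (hε n)) (h.sample (hε n))))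
      atTop (𝓝 (tens ψ H)) :=
    ((tens ψ).continuous.tendsto H).comp (h.tendsto_sample hε hεlim hH)
  have e1 : ∀ n, unfolding hτ (hε n) (ε n • twistTens hτ (ε n) ψ (h.sample (hε n))) =
      ε n • tens ψ (pull _ (measurePreserving_nearestNode (hε n)) (h.sample (hε n))) := fun n => by
    rw [map_smul, unfolding_twistTens]
  refine ⟨fun n => mkDiscreteH10 (ε n • twistTens hτ (ε n) ψ (h.sample (hε n)))
    (Submodule.smul_mem _ (ε n) (h.twistTens_sample_mem hτ (hε n) ψ)), ?_⟩
  rw [tendsto_prod_pi]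
  refine ⟨?_, fun j => ?_⟩
  · have h2 := hεlim.smul h1
    rw [zero_smul] at h2
    refine h2.congr fun n => ?_
    rw [displacementMap_mk, e1]
  · have h2 := (tendsto_shift_of_tendsto hτ (unitVec j) (tendsto_node_zero hεlim (unitVec j)) h1).sub h1
    have e2 : shift hτ (unitVec j) 0 (tens ψ H) - tens ψ H =
        tens (pull _ (hτ.measurePreserving (unitVec j)) ψ - ψ) H := by
      rw [shift_tens, pull_add_zero]
      exact (tens_sub_left (pull _ (hτ.measurePreserving (unitVec j)) ψ) ψ H).symm
    refine Tendsto.congr (fun n => ?_) (le_trans h2 (le_of_eq (congrArg 𝓝 e2)))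
    have e3 := congrArg (fun w : FullL2 P d × (Fin d → FullL2 P d) => w.2 j) (displacementMap_mk hτ (hε n)
      (ε n • twistTens hτ (ε n) ψ (h.sample (hε n)))
      (Submodule.smul_mem _ (ε n) (h.twistTens_sample_mem hτ (hε n) ψ)))
    refine Eq.trans ?_ e3.symm
    exact (inv_smul_map_smul_sub _ (hε n).ne' (e1 n)).symm

theorem IsTest.exists_toLp (h : IsTest O φ) (μ : Measure (Space d)) [IsFiniteMeasureOnCompacts μ] :
    ∃ H : Lp ℝ 2 μ, H =ᵐ[μ] φ := ⟨(h.memLp 2 μ).toLp φ, MemLp.coeFn_toLp _⟩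

include hεlim in
theorem limitRange_of_mem_H10 (hO : IsOpen O)
    {v : WithLp 2 (DomainL2 O × PiLp 2 (fun _ : Fin d => DomainL2 O))} (hv : v ∈ H10 O) :
    (extendZero P hO.measurableSet (tens (oneLp P) v.fst),
      fun j => extendZero P hO.measurableSet (tens (oneLp P) (v.snd j))) ∈
      limitRange fun n => displacementMap hτ (hε n) O := by
  let e := (WithLp.prodContinuousLinearEquiv 2 ℝ (DomainL2 O)
    (PiLp 2 (fun _ : Fin d => DomainL2 O))).toContinuousLinearMap
  let X : DomainL2 O →L[ℝ] FullL2 P d :=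
    (extendZero P hO.measurableSet).toContinuousLinearMap ∘L tens (oneLp P)
  let J : WithLp 2 (DomainL2 O × PiLp 2 (fun _ : Fin d => DomainL2 O)) →L[ℝ]
      FullL2 P d × (Fin d → FullL2 P d) :=
    (X ∘L ContinuousLinearMap.fst ℝ _ _ ∘L e).prod (ContinuousLinearMap.pi fun j =>
      X ∘L PiLp.proj 2 (fun _ : Fin d => DomainL2 O) j ∘L ContinuousLinearMap.snd ℝ _ _ ∘L e)
  refine mem_limitRange_of_mem_closure _ J ?_ hv
  rintro w ⟨φ, hφ, hc, hs, h1, h2⟩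
  have h : IsTest O φ := ⟨hφ, hc, hs⟩
  obtain ⟨H, hH⟩ := h.exists_toLp volume
  choose H' hH' using fun j => (h.isTest_partialDeriv j).exists_toLp volume
  have := h.mem_limitRange hτ hε hεlim hH hH'
  convert this using 1
  ext1
  · exact h.extendZero_tens hO.measurableSet _ h1 hH
  · exact funext fun j => (h.isTest_partialDeriv j).extendZero_tens hO.measurableSet _ (h2 j) (hH' j)

include hεlim in
-- Limits of ranges form a closed subspace, so three closures suffice: from generators Dφ to
-- potentials with a fixed test function, from test functions to all of L²(O), and from products to
-- their closed span.
theorem limitRange_of_mem_L2PotTensor (hO : IsOpen O)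
    {f : PiLp 2 (fun _ : Fin d => TwoScaleL2 P O)} (hf : f ∈ L2PotTensor P τ O) :
    ((0 : FullL2 P d), fun j => extendZero P hO.measurableSet (f j)) ∈
      limitRange fun n => displacementMap hτ (hε n) O := by
  let X := (extendZero P hO.measurableSet).toContinuousLinearMap
  -- elementary tensors of generators
  have h1 : ∀ (η : DomainL2 O), (∃ φ, IsTest O φ ∧ η =ᵐ[volume.restrict O] φ) → ∀ ψ ∈ L2Pot P τ,
      ((0 : FullL2 P d), fun j => X (tens (ψ j) η)) ∈
        limitRange fun n => displacementMap hτ (hε n) O := by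
    rintro η ⟨φ, h, hη⟩ ψ hψ
    let J : PiLp 2 (fun _ : Fin d => Lp ℝ 2 P) →L[ℝ] FullL2 P d × (Fin d → FullL2 P d) :=
      (0 : PiLp 2 (fun _ : Fin d => Lp ℝ 2 P) →L[ℝ] FullL2 P d).prod (ContinuousLinearMap.pi fun j =>
        X ∘L tens.flip η ∘L PiLp.proj 2 (fun _ : Fin d => Lp ℝ 2 P) j)
    refine mem_limitRange_of_mem_closure _ J ?_ hψ
    rintro w ⟨ϕ, hϕ⟩
    obtain ⟨H, hH⟩ := h.exists_toLp volume
    convert h.mem_limitRange_corrector hτ hε hεlim hH ϕ using 1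
    ext1
    · rfl
    · refine funext fun j => ?_
      have hw : w j = pull _ (hτ.measurePreserving (unitVec j)) ϕ - ϕ := by
        apply Lp.ext
        filter_upwards [hϕ j, Lp.coeFn_sub (pull _ (hτ.measurePreserving (unitVec j)) ϕ) ϕ,
          coeFn_pull (hτ.measurePreserving (unitVec j)) ϕ] with ω h1 h2 h3
        rw [h1, h2, Pi.sub_apply, h3, Function.comp_apply]
      change X (tens (w j) η) = tens (pull _ (hτ.measurePreserving (unitVec j)) ϕ - ϕ) H
      rw [← hw]
      exact h.extendZero_tens hO.measurableSet (w j) hη hH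
  have h2 : ∀ ψ ∈ L2Pot P τ, ∀ η : DomainL2 O, ((0 : FullL2 P d), fun j => X (tens (ψ j) η)) ∈
      limitRange fun n => displacementMap hτ (hε n) O := by
    intro ψ hψ η
    let J : DomainL2 O →L[ℝ] FullL2 P d × (Fin d → FullL2 P d) :=
      (0 : DomainL2 O →L[ℝ] FullL2 P d).prod (ContinuousLinearMap.pi fun j => X ∘L tens (ψ j))
    refine mem_limitRange_of_mem_closure _ J (S := {η | ∃ φ, IsTest O φ ∧ η =ᵐ[volume.restrict O] φ})
      (fun η hη => h1 η hη ψ hψ) ?_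
    rw [isTest_total hO rfl]
    exact Submodule.mem_top
  let J : PiLp 2 (fun _ : Fin d => TwoScaleL2 P O) →L[ℝ] FullL2 P d × (Fin d → FullL2 P d) :=
    (0 : PiLp 2 (fun _ : Fin d => TwoScaleL2 P O) →L[ℝ] FullL2 P d).prod
      (ContinuousLinearMap.pi fun j => X ∘L PiLp.proj 2 (fun _ : Fin d => TwoScaleL2 P O) j)
  refine mem_limitRange_of_mem_closure _ J ?_ hf
  rintro w ⟨ψ, hψ, η, hw⟩
  convert h2 ψ hψ η using 1
  ext1
  · rfl
  · exact funext fun j => congrArg X (Lp.ext ((hw j).trans (coeFn_tens (ψ j) η).symm))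

/-- Multiplication of a lattice field by the indicator function of `S`. -/
noncomputable def cutoff {ε : ℝ} (S : Set (Space d)) (u : DiscreteL2 P d ε) : DiscreteL2 P d ε :=
  ((Lp.memLp u).indicator (measurableSet_node_mem ε S)).toLp _

theorem coeFn_cutoff {ε : ℝ} (S : Set (Space d)) (u : DiscreteL2 P d ε) :
    cutoff S u =ᵐ[P.prod (latticeMeasure d ε)]
      ({p : Ω × IntLattice d | node ε p.2 ∈ S}).indicator u :=
  MemLp.coeFn_toLp _

theorem cutoff_mem {ε : ℝ} {S S' : Set (Space d)} (h : S ⊆ S') (u : DiscreteL2 P d ε) :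
    cutoff S u ∈ supportedOn P ε S' := by
  change ∀ᵐ p ∂P.prod (latticeMeasure d ε), node ε p.2 ∉ S' → cutoff S u p = 0
  filter_upwards [coeFn_cutoff S u] with p hp hn
  rw [hp, indicator_of_notMem]
  exact fun h' => hn (h h')

include hεlim in
-- The cut-off acts through the nearest node. Inside the open set O that node is eventually in O,
-- and outside O the field is zero, so cutting off alone converges. The remaining error is dominated
-- by that of the plain cell average.
theorem tendsto_unfolding_cutoff (hO : IsOpen O) (Z : TwoScaleL2 P O) :
    Tendsto (fun n => unfolding hτ (hε n)
      (cutoff O (cellAverage hτ (hε n) (extendZero P hO.measurableSet Z)))) atTop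
      (𝓝 (extendZero P hO.measurableSet Z)) := by
  set F := extendZero P hO.measurableSet Z with hF
  let S : ℕ → Set (Ω × Space d) := fun n => {p | node (ε n) (nearestNode (ε n) p.2) ∈ O}
  have hS : ∀ n, MeasurableSet (S n) := fun n =>
    (measurable_nearestNode (ε n)).comp measurable_snd
      (MeasurableSet.of_discrete (s := {m : IntLattice d | node (ε n) m ∈ O}))
  let w : ℕ → FullL2 P d := fun n => ((Lp.memLp F).indicator (hS n)).toLp _
  have hw : ∀ n, w n =ᵐ[P.prod volume] (S n).indicator F := fun n => MemLp.coeFn_toLp _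
  have h1 : Tendsto w atTop (𝓝 F) := by
    refine tendsto_of_dominated (b := fun p => |F p|) (Lp.memLp F).abs (fun n => ?_) ?_
    · filter_upwards [hw n] with p hp
      rw [hp, ← Real.norm_eq_abs, ← Real.norm_eq_abs]
      exact norm_indicator_le_norm_self _ _
    · filter_upwards [ae_all_iff.2 hw, coeFn_extendZero hO.measurableSet Z] with p h2 h3
      by_cases hx : p.2 ∈ O
      · have h4 := (tendsto_node_nearestNode hε hεlim p.2).eventually (hO.mem_nhds hx)
        refine tendsto_const_nhds.congr' ?_
        filter_upwards [h4] with n hn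
        rw [h2, indicator_of_mem (by exact hn)]
      · have h5 : F p = 0 := by rw [h3, zeroExt, indicator_of_notMem (by exact hx)]
        refine tendsto_const_nhds.congr fun n => ?_
        rw [h2, h5]
        by_cases hp : p ∈ S n
        · rw [indicator_of_mem hp, h5]
        · rw [indicator_of_notMem hp]
  have h2 : Tendsto (fun n => unfolding hτ (hε n) (cutoff O (cellAverage hτ (hε n) F)) - w n) atTop
      (𝓝 0) := by
    rw [tendsto_zero_iff_norm_tendsto_zero]
    refine squeeze_zero (fun _ => norm_nonneg _) (fun n => ?_)
      (tendsto_iff_norm_sub_tendsto_zero.1 (tendsto_unfolding_cellAverage hτ hε hεlim F))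
    refine Lp.norm_le_norm_of_ae_le ?_
    filter_upwards [hw n, coeFn_unfolding' hτ (hε n) (cutoff O (cellAverage hτ (hε n) F)),
      coeFn_unfolding' hτ (hε n) (cellAverage hτ (hε n) F),
      (hτ.measurePreserving_unfold (hε n)).quasiMeasurePreserving.ae
        (coeFn_cutoff O (cellAverage hτ (hε n) F)),
      Lp.coeFn_sub (unfolding hτ (hε n) (cutoff O (cellAverage hτ (hε n) F))) (w n),
      Lp.coeFn_sub (unfolding hτ (hε n) (cellAverage hτ (hε n) F)) F] with p e1 e2 e3 e4 e5 e6
    rw [e5, e6, Pi.sub_apply, Pi.sub_apply, e1, e2, e3, e4]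
    by_cases hp : node (ε n) (nearestNode (ε n) p.2) ∈ O
    · rw [indicator_of_mem (by exact hp), indicator_of_mem (by exact hp)]
    · rw [indicator_of_notMem (by exact hp), indicator_of_notMem (by exact hp)]
      simp
  simpa using h2.add h1

include hεlim in
/-- Existence of recovery sequences along which the dissipation does not increase. -/
theorem exists_recovery {ρ : Ω → (Fin k → ℝ) → ℝ} (hρ : IsAdmissibleDissipation P ρ)
    (hO : IsOpen O) (v : ContState k P τ O) :
    ∃ r : ∀ n, DiscreteState P b O (ε n),
      Tendsto (fun n => discreteEmbedding hτ b O (hε n) (r n)) atTop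
        (𝓝 (contEmbedding k hτ hO.measurableSet v)) ∧
      ∀ n, dissipation P d ρ (fun i => discreteEmbedding hτ b O (hε n) (r n) (.inr (.inr i))) ≤
        dissipation P d ρ (fun i => contEmbedding k hτ hO.measurableSet v (.inr (.inr i))) := by
  have h1 : ∀ l, ∃ u : ∀ n, DiscreteH10 P (ε n) O,
      Tendsto (fun n => displacementMap hτ (hε n) O (u n)) atTop
        (𝓝 (extendZero P hO.measurableSet (tens (oneLp P) (v.U l)), fun j =>
          extendZero P hO.measurableSet (tens (oneLp P) (v.gradU l j) + v.χ l j))) := by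
    intro l
    -- The deterministic and the corrector sequences are added: the latter contributes nothing to
    -- the displacement and exactly χ to the gradient.
    have := Submodule.add_mem _ (limitRange_of_mem_H10 (P := P) hτ hε hεlim hO (v.fst l).2)
      (limitRange_of_mem_L2PotTensor hτ hε hεlim hO (v.snd.snd l).2)
    obtain ⟨u, hu⟩ := this
    refine ⟨u, ?_⟩
    have e : (extendZero P hO.measurableSet (tens (oneLp P) (v.U l)), fun j =>
          extendZero P hO.measurableSet (tens (oneLp P) (v.gradU l j) + v.χ l j)) =
        (extendZero P hO.measurableSet (tens (oneLp P) (v.fst l).1.fst),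
          fun j => extendZero P hO.measurableSet (tens (oneLp P) ((v.fst l).1.snd j))) +
        ((0 : FullL2 P d), fun j => extendZero P hO.measurableSet ((v.snd.snd l).1 j)) := by
      refine Prod.ext ?_ (funext fun j => ?_)
      · exact (add_zero _).symm
      · exact (extendZero P hO.measurableSet).map_add _ _
    rw [e]
    exact hu
  choose u hu using h1
  let z : ∀ n, Fin k → DiscreteL2 P d (ε n) := fun n i =>
    cutoff O (cellAverage hτ (hε n) (extendZero P hO.measurableSet (v.Z i)))
  refine ⟨fun n => WithLp.toLp 2 (WithLp.toLp 2 fun l => u l n,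
    WithLp.toLp 2 fun i => ⟨z n i, cutoff_mem subset_union_left _⟩), ?_, fun n => ?_⟩
  · rw [tendsto_crossL2]
    rintro (l | ⟨l, j⟩ | i)
    · exact (tendsto_prod_pi.1 (hu l)).1
    · exact (tendsto_prod_pi.1 (hu l)).2 j
    · exact tendsto_unfolding_cutoff hτ hε hεlim hO (v.Z i)
  · exact dissipation_cellAverage_le hτ (hε n) hρ (fun i => extendZero P hO.measurableSet (v.Z i))
      (z := z n) (S := O) fun i => coeFn_cutoff O _


include hεlim in
/-- Coercivity of the homogenized quadratic form. -/
theorem contEmbedding_coercive {A : Ω → Matrix (Fin k ⊕ Fin k) (Fin k ⊕ Fin k) ℝ}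
    (hA : IsAdmissibleCoefficient P A) {B : Fin k → IntLattice d →₀ (Fin d → ℝ)} (hO : IsOpen O)
    {c : ℝ} (hc : ∀ n, ∀ y : DiscreteState P b O (ε n), c * ‖y‖ ^ 2 ≤
      energyForm hτ b B (ε n) hA (discreteEmbedding hτ b O (hε n) y)
        (discreteEmbedding hτ b O (hε n) y)) (v : ContState k P τ O) :
    c * ‖v‖ ^ 2 ≤ energyForm hτ b B 0 hA (contEmbedding k hτ hO.measurableSet v)
      (contEmbedding k hτ hO.measurableSet v) := by
  -- The zero dissipation is admissible, so recovery sequences are available without reference to ρ.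
  -- Coercivity passes to the limit along them because the embeddings are isometric and the form
  -- converges.
  have hρ : IsAdmissibleDissipation P (fun _ _ => 0 : Ω → (Fin k → ℝ) → ℝ) :=
    ⟨fun _ _ => le_rfl, measurable_const, .of_forall fun _ => convexOn_const 0 convex_univ,
      .of_forall fun _ _ _ _ => (mul_zero _).symm⟩
  obtain ⟨r, hr, -⟩ := exists_recovery (b := b) hτ hε hεlim hρ hO v
  have h1 := (hr.norm.pow 2).const_mul c
  rw [LinearIsometry.norm_map] at h1
  refine le_of_tendsto_of_tendsto' h1 (tendsto_energyForm hτ b B hA hεlim hr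
    (hr.norm.eventually_le_const (lt_add_one _))
    fun g => hr.inner tendsto_const_nhds) fun n => ?_
  rw [LinearIsometry.norm_map]
  exact hc n (r n)

end Recovery

end SpringNetwork

namespace SpringNetwork

/-! ### Solenoidal random fields and discrete integration by parts. -/

section Solenoidal

variable {d : ℕ} {Ω : Type*} [MeasurableSpace Ω] {P : Measure Ω} [IsProbabilityMeasure P]
  {τ : IntLattice d → Ω → Ω} (hτ : IsDynamicalSystem P τ)

/-- The action of the lattice on `L²(Ω)`. -/
noncomputable def act (y : IntLattice d) : Lp ℝ 2 P →ₗᵢ[ℝ] Lp ℝ 2 P := pull _ (hτ.measurePreserving y)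

/-- The action of translations on `L²(ℝ^d)`. -/
noncomputable def transl (h : Space d) :
    Lp ℝ 2 (volume : Measure (Space d)) →ₗᵢ[ℝ] Lp ℝ 2 (volume : Measure (Space d)) :=
  pull _ (measurePreserving_add_right volume h)

theorem shift_tens_eq (y : IntLattice d) (h : Space d) (ψ : Lp ℝ 2 P)
    (η : Lp ℝ 2 (volume : Measure (Space d))) :
    shift hτ y h (tens ψ η) = tens (act hτ y ψ) (transl h η) := shift_tens hτ y h ψ η

theorem act_act (y y' : IntLattice d) (ψ : Lp ℝ 2 P) : act hτ y (act hτ y' ψ) = act hτ (y + y') ψ := by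
  unfold act
  rw [pull_pull]
  refine pull_congr _ _ ?_ ψ
  rw [add_comm, hτ.add]

theorem act_zero (ψ : Lp ℝ 2 P) : act hτ 0 ψ = ψ := by
  apply Lp.ext
  filter_upwards [coeFn_pull (hτ.measurePreserving 0) ψ] with ω h
  rw [act, h, Function.comp_apply, hτ.zero, id]

theorem inner_act_right (y : IntLattice d) (ψ ϕ : Lp ℝ 2 P) :
    inner ℝ ψ (act hτ y ϕ) = (inner ℝ (act hτ (-y) ψ) ϕ : ℝ) := by
  rw [← (act hτ (-y)).inner_map_map, act_act, neg_add_cancel, act_zero]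

theorem transl_transl (h h' : Space d) (η : Lp ℝ 2 (volume : Measure (Space d))) :
    transl h (transl h' η) = transl (h + h') η := by
  unfold transl
  rw [pull_pull]
  refine pull_congr _ _ ?_ η
  ext1 x
  simp only [Function.comp_apply, add_assoc]

theorem transl_zero (η : Lp ℝ 2 (volume : Measure (Space d))) : transl 0 η = η := pull_add_zero η

theorem tendsto_transl_of_tendsto {ι : Type*} {F : Filter ι} {h : ι → Space d}
    (hh : Tendsto h F (𝓝 0)) {G : ι → Lp ℝ 2 (volume : Measure (Space d))}
    {G₀ : Lp ℝ 2 (volume : Measure (Space d))} (hG : Tendsto G F (𝓝 G₀)) :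
    Tendsto (fun i => transl (h i) (G i)) F (𝓝 G₀) := by
  have h1 : Tendsto (fun i => transl (h i) (G i - G₀)) F (𝓝 0) := by
    rw [tendsto_zero_iff_norm_tendsto_zero]
    simpa only [LinearIsometry.norm_map] using tendsto_iff_norm_sub_tendsto_zero.1 hG
  have h2 : Tendsto (fun i => transl (h i) G₀) F (𝓝 G₀) := tendsto_pull_add G₀ hh
  have := h1.add h2
  simpa only [← map_add, sub_add_cancel, zero_add] using this

/-- The solenoidal fields in `L²(Ω)^d`. -/
def IsSolenoidal (ψ : Fin d → Lp ℝ 2 P) : Prop := ∑ j, (act hτ (-unitVec j) (ψ j) - ψ j) = 0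

/-- The adjoint of D_j is the shift by -e_j minus the identity, so orthogonality to all gradients Dφ
says that the discrete divergence vanishes. -/
theorem isSolenoidal_of_mem {ψ : PiLp 2 (fun _ : Fin d => Lp ℝ 2 P)} (hψ : ψ ∈ (L2Pot P τ)ᗮ) :
    IsSolenoidal hτ fun j => ψ j := by
  refine ext_inner_right ℝ fun ϕ => ?_
  let D : PiLp 2 (fun _ : Fin d => Lp ℝ 2 P) := WithLp.toLp 2 fun j => act hτ (unitVec j) ϕ - ϕ
  have hD : D ∈ L2Pot P τ := Submodule.le_topologicalClosure _ (Submodule.subset_span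
    ⟨ϕ, fun j => by
      filter_upwards [Lp.coeFn_sub (act hτ (unitVec j) ϕ) ϕ,
        coeFn_pull (hτ.measurePreserving (unitVec j)) ϕ] with ω h1 h2
      change (act hτ (unitVec j) ϕ - ϕ : Lp ℝ 2 P) ω = _
      rw [h1, Pi.sub_apply, act, h2, Function.comp_apply]⟩)
  have h := (Submodule.mem_orthogonal' _ _).1 hψ D hD
  rw [PiLp.inner_apply] at h
  rw [inner_zero_left, sum_inner, ← h]
  refine Finset.sum_congr rfl fun j _ => ?_
  change _ = inner ℝ (ψ j) (act hτ (unitVec j) ϕ - ϕ)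
  rw [inner_sub_left, inner_sub_right, inner_act_right]

theorem act_oneLp (y : IntLattice d) : act hτ y (oneLp P) = oneLp P := pull_oneLp hτ y

theorem inner_act_oneLp (y : IntLattice d) (ψ : Lp ℝ 2 P) :
    inner ℝ (act hτ y ψ) (oneLp P) = (inner ℝ ψ (oneLp P) : ℝ) := by
  rw [← (act hτ y).inner_map_map ψ, act_oneLp]

/-- A discrete product rule: the shift, moved to the test field, splits into a spatial difference of
η and a random difference of ψ. The two scale differently in ε. -/
theorem inner_shift_sub (y : IntLattice d) (h : Space d) (u : FullL2 P d) (ψ : Lp ℝ 2 P)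
    (η : Lp ℝ 2 (volume : Measure (Space d))) :
    inner ℝ (shift hτ y h u - u) (tens ψ η) =
      inner ℝ u (tens (act hτ (-y) ψ) (transl (-h) η - η)) +
        (inner ℝ u (tens (act hτ (-y) ψ - ψ) η) : ℝ) := by
  rw [inner_sub_left, inner_shift_left, shift_tens_eq, tens_sub_left,
    (tens (act hτ (-y) ψ)).map_sub, inner_sub_right, inner_sub_right]
  ring

theorem inner_smul_shift_sub (y : IntLattice d) (h : Space d) (u : FullL2 P d) (ψ : Lp ℝ 2 P)
    (η : Lp ℝ 2 (volume : Measure (Space d))) (c : ℝ) :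
    inner ℝ (c • (shift hτ y h u - u)) (tens ψ η) =
      inner ℝ u (tens (act hτ (-y) ψ) (c • (transl (-h) η - η))) +
        c * (inner ℝ u (tens (act hτ (-y) ψ - ψ) η) : ℝ) := by
  rw [real_inner_smul_left, inner_shift_sub, (tens (act hτ (-y) ψ)).map_smul, real_inner_smul_right,
    mul_add]

/-- This is the sum of the random differences from the product rule. Its vanishing removes the term
with the singular factor ε⁻¹. -/
theorem sum_inner_tens_of_isSolenoidal {ψ : Fin d → Lp ℝ 2 P} (hψ : IsSolenoidal hτ ψ)
    (u : FullL2 P d) (η : Lp ℝ 2 (volume : Measure (Space d))) :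
    ∑ j, (inner ℝ u (tens (act hτ (-unitVec j) (ψ j) - ψ j) η) : ℝ) = 0 := by
  let L := (innerSL ℝ u).comp ((tens : Lp ℝ 2 P →L[ℝ] _).flip η)
  change ∑ j, L (act hτ (-unitVec j) (ψ j) - ψ j) = 0
  rw [← map_sum, hψ, map_zero]

end Solenoidal

/-! ### Two-scale limits of displacements and gradients. -/

section Compactness

variable {d k : ℕ} {Ω : Type*} [MeasurableSpace Ω] {P : Measure Ω} [IsProbabilityMeasure P]
  {τ : IntLattice d → Ω → Ω} (hτ : IsDynamicalSystem P τ) (he : IsErgodicSystem P τ)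
  {ε : ℕ → ℝ} (hε : ∀ n, 0 < ε n) (hεlim : Tendsto ε atTop (𝓝 0)) {F : Filter ℕ} [NeBot F]
  (hF : F ≤ atTop)

/-- A bounded sequence of unfolded displacements whose gradients converge weakly. -/
structure IsWeakDisplacement (ε : ℕ → ℝ) (F : Filter ℕ) (u : ℕ → FullL2 P d)
    (g : ℕ → Fin d → FullL2 P d) (U : FullL2 P d) (G : Fin d → FullL2 P d) : Prop where
  grad : ∀ n j, g n j =
    (ε n)⁻¹ • (shift hτ (unitVec j) (node (ε n) (unitVec j)) (u n) - u n)
  bound : ∃ C, ∀ᶠ n in F, ‖u n‖ ≤ C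
  bound_grad : ∀ j, ∃ C, ∀ᶠ n in F, ‖g n j‖ ≤ C
  weak : ∀ v, Tendsto (fun n => (inner ℝ (u n) v : ℝ)) F (𝓝 (inner ℝ U v))
  weak_grad : ∀ j v, Tendsto (fun n => (inner ℝ (g n j) v : ℝ)) F (𝓝 (inner ℝ (G j) v))

variable {hτ} {u : ℕ → FullL2 P d} {g : ℕ → Fin d → FullL2 P d} {U : FullL2 P d}
  {G : Fin d → FullL2 P d} (h : IsWeakDisplacement hτ ε F u g U G)

include hε hεlim hF h

/-- The shift of u n differs from u n by ε g n, which vanishes weakly, while the spatial part of the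
shift disappears on the test side. Only the invariance under the random shift is left. -/
theorem IsWeakDisplacement.shift_unitVec (j : Fin d) : shift hτ (unitVec j) 0 U = U := by
  refine ext_inner_right ℝ fun v => ?_
  have hε0 : Tendsto ε F (𝓝 0) := hεlim.mono_left hF
  obtain ⟨C, hC⟩ := h.bound
  have h1 : Tendsto (fun n => (inner ℝ (u n)
      (shift hτ (-unitVec j) (-node (ε n) (unitVec j)) v) : ℝ)) F
      (𝓝 (inner ℝ U (shift hτ (-unitVec j) 0 v))) := by
    refine tendsto_inner_of_weak hC h.weak (tendsto_shift_of_tendsto hτ _ ?_ tendsto_const_nhds)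
    simpa using (tendsto_node_zero hε0 (unitVec j)).neg
  have h2 : Tendsto (fun n => ε n * (inner ℝ (g n j) v : ℝ) + inner ℝ (u n) v) F
      (𝓝 (inner ℝ U v)) := by
    have := (hε0.mul (h.weak_grad j v)).add (h.weak v)
    rwa [zero_mul, zero_add] at this
  have h3 := tendsto_nhds_unique h1 (h2.congr fun n => by
    rw [h.grad, real_inner_smul_left, ← mul_assoc, mul_inv_cancel₀ (hε n).ne', one_mul,
      inner_sub_left, sub_add_cancel, inner_shift_left])
  rw [inner_shift_left, neg_zero, h3]

theorem IsWeakDisplacement.shift_eq (y : IntLattice d) : shift hτ y 0 U = U := by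
  let S : AddSubgroup (IntLattice d) :=
    { carrier := {y | shift hτ y 0 U = U}
      zero_mem' := shift_zero hτ U
      add_mem' := by
        intro y y' hy hy'
        change shift hτ (y + y') 0 U = U
        have := shift_shift hτ y y' 0 0 U
        rw [add_zero] at this
        rw [← this]
        exact (congrArg (shift hτ y 0) hy').trans hy
      neg_mem' := by
        intro y hy
        change shift hτ (-y) 0 U = U
        have := shift_shift hτ (-y) y 0 0 U
        rw [add_zero, neg_add_cancel, shift_zero] at this
        exact (congrArg (shift hτ (-y) 0) hy).symm.trans this }
  have hy : y = ∑ j, y j • (unitVec j : IntLattice d) := by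
    ext i
    simp [unitVec, Finset.sum_apply, Pi.single_apply]
  rw [hy]
  exact S.sum_mem fun j _ => S.zsmul_mem (h.shift_unitVec hε hεlim hF j) _

include he

theorem IsWeakDisplacement.inner_tens (ψ : Lp ℝ 2 P) (η : Lp ℝ 2 (volume : Measure (Space d))) :
    inner ℝ U (tens ψ η) = inner ℝ ψ (oneLp P) * inner ℝ U (tens (oneLp P) η) :=
  he.inner_tens_of_shift_eq hτ (h.shift_eq hε hεlim hF) ψ η

/-- The two-scale limit of the gradients, tested with solenoidal fields. -/
theorem IsWeakDisplacement.inner_of_isSolenoidal {ψ : Fin d → Lp ℝ 2 P} (hψ : IsSolenoidal hτ ψ)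
    {φ : Space d → ℝ} (hφ : IsTest univ φ) {H : Lp ℝ 2 (volume : Measure (Space d))}
    (hH : H =ᵐ[volume] φ) {H' : Fin d → Lp ℝ 2 (volume : Measure (Space d))}
    (hH' : ∀ j, H' j =ᵐ[volume] partialDeriv φ j) :
    ∑ j, inner ℝ (G j) (tens (ψ j) H) =
      -∑ j, inner ℝ (ψ j) (oneLp P) * (inner ℝ U (tens (oneLp P) (H' j)) : ℝ) := by
  have hε0 : Tendsto ε F (𝓝 0) := hεlim.mono_left hF
  let Hn : ℕ → Lp ℝ 2 (volume : Measure (Space d)) := fun n =>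
    pull _ (measurePreserving_nearestNode (hε n)) (hφ.sample (hε n))
  have hHn : Tendsto Hn F (𝓝 H) := (hφ.tendsto_sample hε hεlim hH).mono_left hF
  let h' : Fin d → ℕ → Space d := fun j n => node (ε n) (unitVec j)
  have hh : ∀ j, Tendsto (fun n => -h' j n) F (𝓝 0) := fun j => by
    simpa using (tendsto_node_zero hε0 (unitVec j)).neg
  have hD : ∀ j, Tendsto (fun n => (ε n)⁻¹ • (transl (h' j n) (Hn n) - Hn n)) F (𝓝 (H' j)) :=
    fun j => (hφ.tendsto_sample_grad hε hεlim j (hH' j)).mono_left hF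
  -- A backward difference quotient is minus a translate of the forward one, so its limit is minus
  -- the derivative, even though the translation varies with n.
  have hD' : ∀ j, Tendsto (fun n => (ε n)⁻¹ • (transl (-h' j n) (Hn n) - Hn n)) F (𝓝 (-H' j)) :=
    fun j => (tendsto_transl_of_tendsto (hh j) (hD j)).neg.congr fun n => by
      rw [map_smul, map_sub, transl_transl, neg_add_cancel, transl_zero, ← smul_neg, neg_sub]
  have h1 : Tendsto (fun n => ∑ j, (inner ℝ (g n j) (tens (ψ j) (Hn n)) : ℝ)) F
      (𝓝 (∑ j, inner ℝ (G j) (tens (ψ j) H))) := by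
    refine tendsto_finsetSum _ fun j _ => ?_
    obtain ⟨C, hC⟩ := h.bound_grad j
    exact tendsto_inner_of_weak hC (h.weak_grad j) (((tens (ψ j)).continuous.tendsto H).comp hHn)
  have h2 : Tendsto (fun n => ∑ j, (inner ℝ (u n) (tens (act hτ (-unitVec j) (ψ j))
      ((ε n)⁻¹ • (transl (-h' j n) (Hn n) - Hn n))) : ℝ)) F
      (𝓝 (∑ j, inner ℝ U (tens (act hτ (-unitVec j) (ψ j)) (-H' j)))) := by
    refine tendsto_finsetSum _ fun j _ => ?_
    obtain ⟨C, hC⟩ := h.bound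
    exact tendsto_inner_of_weak hC h.weak
      (((tens (act hτ (-unitVec j) (ψ j))).continuous.tendsto (-H' j)).comp (hD' j))
  have h3 : ∀ n, ∑ j, (inner ℝ (g n j) (tens (ψ j) (Hn n)) : ℝ) =
      ∑ j, (inner ℝ (u n) (tens (act hτ (-unitVec j) (ψ j))
        ((ε n)⁻¹ • (transl (-h' j n) (Hn n) - Hn n))) : ℝ) := fun n => by
    -- The contributions with factor ε⁻¹ cancel after summation over j, before any limit is taken;
    -- only spatial difference quotients of the test function remain.
    have h4 := sum_inner_tens_of_isSolenoidal hτ hψ (u n) (Hn n)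
    have h6 : ∀ j, (inner ℝ (g n j) (tens (ψ j) (Hn n)) : ℝ) =
        inner ℝ (u n) (tens (act hτ (-unitVec j) (ψ j))
          ((ε n)⁻¹ • (transl (-h' j n) (Hn n) - Hn n))) +
        (ε n)⁻¹ * inner ℝ (u n) (tens (act hτ (-unitVec j) (ψ j) - ψ j) (Hn n)) := fun j =>
      (congrArg (fun f => (inner ℝ f (tens (ψ j) (Hn n)) : ℝ)) (h.grad n j)).trans
        (inner_smul_shift_sub hτ _ _ _ _ _ _)
    rw [Finset.sum_congr rfl fun j _ => h6 j, Finset.sum_add_distrib, ← Finset.mul_sum, h4, mul_zero,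
      add_zero]
  rw [tendsto_nhds_unique h1 (h2.congr fun n => (h3 n).symm), ← Finset.sum_neg_distrib]
  refine Finset.sum_congr rfl fun j _ => ?_
  rw [h.inner_tens he hε hεlim hF, inner_act_oneLp, (tens (oneLp P)).map_neg, inner_neg_right,
    mul_neg]

end Compactness

end SpringNetwork

namespace SpringNetwork

/-! ### Characterization of L²_pot ⊗ L²(O) by orthogonality. -/

section PotentialTensor

variable {d : ℕ} {Ω : Type*} [MeasurableSpace Ω] {P : Measure Ω} [IsProbabilityMeasure P]
  {τ : IntLattice d → Ω → Ω} {O : Set (Space d)}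

/-- The field `ψ(ω) η(x)` for a vector valued `ψ`. -/
noncomputable def vecTens (η : DomainL2 O) :
    PiLp 2 (fun _ : Fin d => Lp ℝ 2 P) →ₗ[ℝ] PiLp 2 (fun _ : Fin d => TwoScaleL2 P O) where
  toFun ψ := WithLp.toLp 2 fun j => tens.flip η (ψ j)
  map_add' ψ ψ' := by
    ext1 j
    exact (tens.flip η).map_add _ _
  map_smul' c ψ := by
    ext1 j
    exact (tens.flip η).map_smul _ _

theorem inner_vecTens (η : DomainL2 O) (ψ : PiLp 2 (fun _ : Fin d => Lp ℝ 2 P))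
    (f : PiLp 2 (fun _ : Fin d => TwoScaleL2 P O)) :
    inner ℝ f (vecTens η ψ) = ∑ j, (inner ℝ (f j) (tens (ψ j) η) : ℝ) := PiLp.inner_apply _ _

theorem vecTens_mem (η : DomainL2 O) {ψ : PiLp 2 (fun _ : Fin d => Lp ℝ 2 P)} (hψ : ψ ∈ L2Pot P τ) :
    vecTens η ψ ∈ L2PotTensor P τ O :=
  Submodule.le_topologicalClosure _ (Submodule.subset_span
    ⟨ψ, hψ, η, fun j => coeFn_tens (ψ j) η⟩)

theorem inner_vecTens_of_mem (η : DomainL2 O) {ψ : PiLp 2 (fun _ : Fin d => Lp ℝ 2 P)}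
    (hψ : ψ ∈ (L2Pot P τ)ᗮ) {f : PiLp 2 (fun _ : Fin d => TwoScaleL2 P O)}
    (hf : f ∈ L2PotTensor P τ O) : inner ℝ (vecTens η ψ) f = (0 : ℝ) := by
  let K : Submodule ℝ (PiLp 2 (fun _ : Fin d => TwoScaleL2 P O)) :=
    LinearMap.ker (innerSL ℝ (vecTens η ψ)).toLinearMap
  suffices h : L2PotTensor P τ O ≤ K by exact h hf
  refine Submodule.topologicalClosure_minimal _ ?_ (ContinuousLinearMap.isClosed_ker _)
  rw [Submodule.span_le]
  rintro w ⟨ψ', hψ', η', hw⟩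
  have h1 : ∀ j, w j = tens (ψ' j) η' := fun j => Lp.ext ((hw j).trans (coeFn_tens _ _).symm)
  have h2 : ∑ j, (inner ℝ (ψ' j) (ψ j) : ℝ) = 0 := by
    rw [← PiLp.inner_apply]
    exact hψ ψ' hψ'
  change inner ℝ (vecTens η ψ) w = (0 : ℝ)
  rw [real_inner_comm, inner_vecTens]
  simp only [h1, inner_tens_tens]
  rw [← Finset.sum_mul, h2, zero_mul]

/-- A field belongs to `L²_pot ⊗ L²(O)` as soon as it is orthogonal to the products of the elements
of the orthogonal complement of `L²_pot` with elements of `L²(O)`. -/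
theorem mem_L2PotTensor {f : PiLp 2 (fun _ : Fin d => TwoScaleL2 P O)}
    (hf : ∀ ψ ∈ (L2Pot P τ)ᗮ, ∀ η : DomainL2 O, ∑ j, (inner ℝ (f j) (tens (ψ j) η) : ℝ) = 0) :
    f ∈ L2PotTensor P τ O := by
  -- The component q orthogonal to the tensor space is shown to be orthogonal to every product: to
  -- those with a potential factor by construction, and to those with a factor in the orthogonal
  -- complement by assumption.
  obtain ⟨p, hp, q, hq, rfl⟩ := Submodule.exists_add_mem_mem_orthogonal (K := L2PotTensor P τ O) f
  have h0 : ∀ ψ η, inner ℝ q (vecTens η ψ) = (0 : ℝ) := by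
    intro ψ η
    have : CompleteSpace (L2Pot P τ) := (Submodule.isClosed_topologicalClosure _).completeSpace_coe
    obtain ⟨ψ₁, h1, ψ₂, h2, rfl⟩ := Submodule.exists_add_mem_mem_orthogonal (K := L2Pot P τ) ψ
    have h3 := hf ψ₂ h2 η
    rw [← inner_vecTens, inner_add_left, real_inner_comm, inner_vecTens_of_mem η h2 hp, zero_add] at h3
    rw [map_add, inner_add_right, h3, add_zero, real_inner_comm]
    exact hq _ (vecTens_mem η h1)
  have hq0 : q = 0 := by
    ext1 j
    refine eq_zero_of_inner_tens fun ψ η => ?_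
    -- A vector field with a single nonzero entry isolates the component q j, which is then
    -- orthogonal to all elementary tensors.
    have := h0 (PiLp.single 2 j ψ) η
    rw [inner_vecTens, Finset.sum_eq_single j] at this
    · simpa using this
    · intro i _ hij
      have h1 : (PiLp.single 2 j ψ : PiLp 2 (fun _ : Fin d => Lp ℝ 2 P)) i = 0 := by
        simp [hij]
      rw [h1]
      have h2 : (tens (0 : Lp ℝ 2 P) η : TwoScaleL2 P O) = 0 := (tens.flip η).map_zero
      rw [h2, inner_zero_right]
    · simp
  rw [hq0, add_zero]
  exact hp

end PotentialTensor

/-! ### Expectation and restriction of random fields. -/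

section Average

variable {d : ℕ} {Ω : Type*} [MeasurableSpace Ω] {P : Measure Ω} [IsProbabilityMeasure P]
  {O : Set (Space d)}

/-- The expectation of a random field. -/
noncomputable def average : FullL2 P d →L[ℝ] Lp ℝ 2 (volume : Measure (Space d)) :=
  (tens (oneLp P)).adjoint

theorem inner_average (W : FullL2 P d) (η : Lp ℝ 2 (volume : Measure (Space d))) :
    inner ℝ (average W) η = (inner ℝ W (tens (oneLp P) η) : ℝ) :=
  ContinuousLinearMap.adjoint_inner_left _ _ _

/-- The restriction to `S` of an `L²` function, extended by zero. -/
theorem exists_indicatorLp {α : Type*} [MeasurableSpace α] {μ : Measure α} {S : Set α}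
    (hS : MeasurableSet S) (f : Lp ℝ 2 μ) : ∃ I : Lp ℝ 2 μ, I =ᵐ[μ] S.indicator f ∧
      inner ℝ f I = ‖I‖ ^ 2 := by
  refine ⟨((Lp.memLp f).indicator hS).toLp _, MemLp.coeFn_toLp _, ?_⟩
  rw [norm_sq_eq_integral, inner_eq_integral]
  refine integral_congr_ae ?_
  filter_upwards [((Lp.memLp f).indicator hS).coeFn_toLp] with x hx
  rw [hx]
  by_cases h : x ∈ S
  · rw [indicator_of_mem h, sq]
  · rw [indicator_of_notMem h, mul_zero, sq, mul_zero]

/-- Testing f against its own restriction to S gives the squared norm of f on S. This is how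
vanishing on a set passes to weak limits. -/
theorem ae_eq_zero_of_inner_eq_zero {α : Type*} [MeasurableSpace α] {μ : Measure α} {S : Set α}
    {f I : Lp ℝ 2 μ} (h1 : I =ᵐ[μ] S.indicator f) (h2 : inner ℝ f I = ‖I‖ ^ 2)
    (h3 : inner ℝ f I = (0 : ℝ)) : ∀ᵐ x ∂μ, x ∈ S → f x = 0 := by
  have h4 : I = 0 := by
    rw [h2] at h3
    exact norm_eq_zero.1 (pow_eq_zero_iff two_ne_zero |>.1 h3)
  rw [h4] at h1
  filter_upwards [h1, Lp.coeFn_zero ℝ 2 μ] with x h5 h6 hx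
  rw [← indicator_of_mem hx f, ← h5, h6, Pi.zero_apply]

theorem average_eq_zero (hO : MeasurableSet O) {W : FullL2 P d}
    (hW : ∀ᵐ p ∂P.prod volume, p.2 ∉ O → W p = 0) : ∀ᵐ x, x ∉ O → average W x = 0 := by
  obtain ⟨I, h1, h2⟩ := exists_indicatorLp hO.compl (average W)
  refine ae_eq_zero_of_inner_eq_zero h1 h2 ?_
  rw [inner_average, inner_eq_integral]
  refine integral_eq_zero_of_ae ?_
  filter_upwards [hW, coeFn_tens (oneLp P) I, ae_prod_snd (μ := P) h1] with p h3 h4 h5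
  rw [h4, h5]
  by_cases hx : p.2 ∈ O
  · rw [indicator_of_notMem (by simpa using hx), mul_zero, mul_zero, Pi.zero_apply]
  · rw [h3 hx, zero_mul, Pi.zero_apply]

/-- The restriction to `O`. -/
noncomputable def restr (O : Set (Space d)) (H : Lp ℝ 2 (volume : Measure (Space d))) : DomainL2 O :=
  ((Lp.memLp H).restrict O).toLp H

theorem coeFn_restr (H : Lp ℝ 2 (volume : Measure (Space d))) : restr O H =ᵐ[volume.restrict O] H :=
  MemLp.coeFn_toLp _

theorem extendZero_tens_restr (hO : MeasurableSet O) {H : Lp ℝ 2 (volume : Measure (Space d))}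
    (hH : ∀ᵐ x, x ∉ O → H x = 0) (ψ : Lp ℝ 2 P) :
    extendZero P hO (tens ψ (restr O H)) = tens ψ H := by
  apply Lp.ext
  filter_upwards [coeFn_extendZero hO (tens ψ (restr O H)), coeFn_tens ψ H,
    ae_of_ae_prod_restrict hO (coeFn_tens ψ (restr O H)),
    ae_of_ae_prod_restrict hO (ae_prod_snd (μ := P) (coeFn_restr (O := O) H)),
    ae_prod_snd (μ := P) hH] with p h1 h2 h3 h4 h5
  rw [h1, h2, zeroExt]
  by_cases hx : p.2 ∈ O
  · rw [indicator_of_mem (by exact hx), h3 hx, h4 hx]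
  · rw [indicator_of_notMem (by exact hx), h5 hx, mul_zero]

end Average

/-! ### Supports of weak limits and the null boundary. -/

section Support

variable {d k : ℕ} {Ω : Type*} [MeasurableSpace Ω] {P : Measure Ω} [IsProbabilityMeasure P]
  {τ : IntLattice d → Ω → Ω} {O : Set (Space d)}

/-- At distance more than 1/(m + 1) from O the fields eventually vanish, hence so does their weak
limit. The union over m is the complement of the closure. -/
theorem ae_eq_zero_of_weak {ε : ℕ → ℝ} {F : Filter ℕ} [NeBot F] (hε : Tendsto ε F (𝓝 0))
    (hne : O.Nonempty) {w : ℕ → FullL2 P d} {W : FullL2 P d} (C : ℝ)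
    (hw : ∀ n, ∀ᵐ p ∂P.prod volume, C * ε n < Metric.infDist p.2 O → w n p = 0)
    (hW : ∀ v, Tendsto (fun n => (inner ℝ (w n) v : ℝ)) F (𝓝 (inner ℝ W v))) :
    ∀ᵐ p ∂P.prod volume, p.2 ∉ closure O → W p = 0 := by
  have h : ∀ m : ℕ, ∀ᵐ p ∂P.prod volume, 1 / ((m : ℝ) + 1) < Metric.infDist p.2 O → W p = 0 := by
    intro m
    have hS : MeasurableSet {p : Ω × Space d | 1 / ((m : ℝ) + 1) < Metric.infDist p.2 O} :=
      measurableSet_lt measurable_const ((Metric.continuous_infDist_pt O).measurable.comp measurable_snd)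
    obtain ⟨I, h1, h2⟩ := exists_indicatorLp hS W
    refine ae_eq_zero_of_inner_eq_zero h1 h2 ?_
    refine tendsto_nhds_unique (hW I) (tendsto_const_nhds.congr' ?_)
    have h3 : Tendsto (fun n => C * ε n) F (𝓝 0) := by simpa using hε.const_mul C
    filter_upwards [h3.eventually_lt_const (Nat.one_div_pos_of_nat (α := ℝ) (n := m))] with n hn
    rw [inner_eq_integral]
    refine (integral_eq_zero_of_ae ?_).symm
    filter_upwards [hw n, h1] with p h4 h5
    rw [h5, Pi.zero_apply]
    by_cases hp : 1 / ((m : ℝ) + 1) < Metric.infDist p.2 O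
    · rw [h4 (hn.trans hp), zero_mul]
    · rw [indicator_of_notMem (by exact hp), mul_zero]
  filter_upwards [ae_all_iff.2 h] with p hp hx
  have h1 : 0 < Metric.infDist p.2 O := lt_of_le_of_ne Metric.infDist_nonneg fun h0 =>
    hx ((Metric.mem_closure_iff_infDist_zero hne).2 h0.symm)
  obtain ⟨m, hm⟩ := exists_nat_one_div_lt h1
  exact hp m hm

/-- Unfolding reads the field at the nearest node, at distance at most d ε; this adds d to the
constant. -/
theorem unfolding_eq_zero (hτ : IsDynamicalSystem P τ) {ε : ℝ} (hε : 0 < ε) {S : Set (Space d)}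
    {C : ℝ} (hS : ∀ x ∈ S, Metric.infDist x O ≤ C * ε) {u : DiscreteL2 P d ε}
    (hu : u ∈ supportedOn P ε S) :
    ∀ᵐ p ∂P.prod volume, (C + d) * ε < Metric.infDist p.2 O → unfolding hτ hε u p = 0 := by
  filter_upwards [coeFn_unfolding' hτ hε u,
    (hτ.measurePreserving_unfold hε).quasiMeasurePreserving.ae hu] with p h1 h2 hp
  rw [h1]
  refine h2 fun h3 => ?_
  have h4 := hS _ h3
  have h5 := Metric.infDist_le_infDist_add_dist (s := O) (x := p.2)
    (y := node ε (nearestNode ε p.2))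
  have h6 := norm_node_nearestNode_sub_le hε p.2
  rw [dist_comm, dist_eq_norm] at h5
  linarith

theorem infDist_le_of_mem_enlarged {b : Fin k → IntLattice d} {ε : ℝ} (hε : 0 < ε) {x : Space d}
    (hx : x ∈ enlarged b ε O) : Metric.infDist x O ≤ (∑ i, len (b i)) * ε := by
  have h0 : ∀ i, 0 ≤ len (b i) := fun i => norm_nonneg _
  rcases hx with hx | ⟨i, z, hz, hzO⟩
  · rw [Metric.infDist_zero_of_mem hx]
    exact mul_nonneg (Finset.sum_nonneg fun i _ => h0 i) hε.le
  · refine (Metric.infDist_le_dist_of_mem hzO).trans ?_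
    have h1 : dist x z ≤ dist x (x + node ε (b i)) := by
      rw [dist_comm x z, dist_comm x]
      have := (segment_subset_closedBall_left x (x + node ε (b i))) (openSegment_subset_segment ℝ _ _ hz)
      rw [dist_comm _ x]
      simpa [Metric.mem_closedBall, dist_comm] using this
    have h2 : dist x (x + node ε (b i)) = len (b i) * ε := by
      rw [dist_self_add_right, node_eq_smul, norm_smul, Real.norm_of_nonneg hε.le, mul_comm, len]
    rw [h2] at h1
    exact h1.trans (mul_le_mul_of_nonneg_right
      (Finset.single_le_sum (f := fun i => len (b i)) (fun i _ => h0 i) (Finset.mem_univ i)) hε.le)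

theorem discreteGrad_mem {ε : ℝ} {S : Set (Space d)} {j : Fin d}
    (hS : ∀ n, node ε n ∉ S → node ε n ∉ O ∧ node ε (n + unitVec j) ∉ O) {u : DiscreteL2 P d ε}
    (hu : u ∈ supportedOn P ε O) : discreteGrad P ε j u ∈ supportedOn P ε S := by
  have h1 : ∀ᵐ p ∂P.prod (latticeMeasure d ε), node ε p.2 ∉ O → u p = 0 := hu
  change ∀ᵐ p ∂P.prod (latticeMeasure d ε), node ε p.2 ∉ S → discreteGrad P ε j u p = 0
  filter_upwards [h1, (measurePreserving_translate P ε (unitVec j)).quasiMeasurePreserving.ae h1,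
    coeFn_discreteGrad j u] with p h2 h3 h4 hp
  obtain ⟨h5, h6⟩ := hS p.2 hp
  rw [h4, h2 h5, h3 h6, sub_zero, mul_zero]

theorem infDist_node_le {ε : ℝ} (hε : 0 < ε) {j : Fin d} {n : IntLattice d}
    (h : node ε n ∈ O ∨ node ε (n + unitVec j) ∈ O) : Metric.infDist (node ε n) O ≤ 1 * ε := by
  rcases h with h | h
  · rw [Metric.infDist_zero_of_mem h, one_mul]
    exact hε.le
  · refine (Metric.infDist_le_dist_of_mem h).trans ?_
    rw [node_add, dist_self_add_right, node_unitVec, norm_smul, PiLp.norm_single,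
      Real.norm_of_nonneg hε.le, norm_one, mul_comm]

/-- Near each of its points the boundary lies in a Lipschitz graph over the hyperplane orthogonal to
ν. Translates of the graph by distinct multiples of ν are disjoint, and infinitely many disjoint
translates by a bounded family of vectors force measure zero. -/
theorem volume_frontier_eq_zero (hO : IsOpen O) (hlip : HasLipschitzBoundary O) :
    volume (frontier O) = 0 := by
  refine measure_null_of_locally_null _ fun x₀ hx₀ => ?_
  obtain ⟨r, hr, ν, hν, L, γ, hγ, h⟩ := hlip x₀ hx₀
  have hγc : Continuous fun x : Space d => γ (x - inner ℝ x ν • ν) :=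
    hγ.continuous.comp (by fun_prop)
  have hic : Continuous fun x : Space d => (inner ℝ x ν : ℝ) := by fun_prop
  let S : Set (Space d) := {x | γ (x - inner ℝ x ν • ν) = inner ℝ x ν}
  refine ⟨S, ?_, ?_⟩
  · rw [mem_nhdsWithin]
    refine ⟨Metric.ball x₀ r, Metric.isOpen_ball, Metric.mem_ball_self hr, ?_⟩
    rintro x ⟨hx, hxf⟩
    rw [hO.frontier_eq] at hxf
    refine le_antisymm ?_ (not_lt.1 fun hlt => hxf.2 ((h x hx).2 hlt))
    have h1 : x ∈ closure (O ∩ Metric.ball x₀ r) := by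
      rw [inter_comm]
      exact Metric.isOpen_ball.inter_closure ⟨hx, hxf.1⟩
    exact closure_minimal (s := O ∩ Metric.ball x₀ r) (t := {x | γ (x - inner ℝ x ν • ν) ≤ inner ℝ x ν})
      (fun y hy => ((h y hy.2).1 hy.1).le) (isClosed_le hγc hic) h1
  · refine Measure.addHaar_eq_zero_of_disjoint_translates volume
      (fun n : ℕ => (1 / ((n : ℝ) + 1)) • ν) ?_ ?_ (isClosed_eq hγc hic).measurableSet
    · have : Tendsto (fun n : ℕ => (1 / ((n : ℝ) + 1)) • ν) atTop (𝓝 ((0 : ℝ) • ν)) :=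
        tendsto_one_div_add_atTop_nhds_zero_nat.smul_const ν
      exact Metric.isBounded_range_of_tendsto _ this
    · intro m n hmn
      rw [Function.onFun, Set.disjoint_left]
      rintro x ⟨_, rfl, y, hy, rfl⟩ ⟨_, rfl, z, hz, hyz⟩
      have key : ∀ (t : ℝ) (y : Space d), inner ℝ (t • ν + y) ν = t + (inner ℝ y ν : ℝ) := fun t y => by
        rw [inner_add_left, real_inner_smul_left, real_inner_self_eq_norm_sq, hν]
        ring
      have key2 : ∀ (t : ℝ) (y : Space d), (t • ν + y) - (inner ℝ (t • ν + y) ν : ℝ) • ν =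
          y - (inner ℝ y ν : ℝ) • ν := fun t y => by
        rw [key, add_smul]
        abel
      have e1 := key2 (1 / ((m : ℝ) + 1)) y
      have e2 := key2 (1 / ((n : ℝ) + 1)) z
      have e3 := key (1 / ((m : ℝ) + 1)) y
      have e4 := key (1 / ((n : ℝ) + 1)) z
      dsimp only at hyz
      rw [hyz] at e2 e4
      have e5 : (inner ℝ y ν : ℝ) = inner ℝ z ν := by
        rw [← show γ (y - (inner ℝ y ν : ℝ) • ν) = inner ℝ y ν from hy,
          ← show γ (z - (inner ℝ z ν : ℝ) • ν) = inner ℝ z ν from hz, ← e1, ← e2]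
      have e6 : 1 / ((m : ℝ) + 1) = 1 / ((n : ℝ) + 1) := by linarith
      rw [one_div, one_div, inv_inj, add_left_inj, Nat.cast_inj] at e6
      exact hmn e6

end Support

end SpringNetwork

namespace SpringNetwork

/-! ### Mollification of functionals and membership in H¹_0, locally. -/

section Kernel

variable {d : ℕ} {O : Set (Space d)} {κ : Space d → ℝ}

/-- The space `L²(ℝ^d)`. -/
abbrev SpaceL2 (d : ℕ) : Type := Lp ℝ 2 (volume : Measure (Space d))

theorem isTest_of_eq_zero {φ : Space d → ℝ} (hφ : ContDiff ℝ (⊤ : ℕ∞) φ) {K : Set (Space d)}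
    (hK : IsCompact K) (h : ∀ x ∉ K, φ x = 0) (hKO : K ⊆ O) : IsTest O φ :=
  ⟨hφ, HasCompactSupport.intro hK h, (closure_minimal (fun x hx => by
    by_contra hn
    exact hx (h x hn)) hK.isClosed).trans hKO⟩

/-- The integrand is dominated by (a² + c²)|κ|, and each part is integrable as a convolution
integrand of two integrable functions. -/
theorem integrable_kernel (hκ : IsTest univ κ) (a c : SpaceL2 d) :
    Integrable (fun p : Space d × Space d => a p.2 * (κ (p.1 - p.2) * c p.1))
      (volume.prod volume) := by
  have hi : Integrable (fun x => |κ x|) (volume : Measure (Space d)) :=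
    (memLp_one_iff_integrable.1 (hκ.memLp 1 volume)).abs
  have h1 : Integrable (fun p : Space d × Space d => a p.2 ^ 2 * |κ (p.1 - p.2)|)
      (volume.prod volume) :=
    (Lp.memLp a).integrable_sq.convolution_integrand (ContinuousLinearMap.mul ℝ ℝ) hi
  have h2 : Integrable (fun p : Space d × Space d => c p.1 ^ 2 * |κ (p.1 - p.2)|)
      (volume.prod volume) := by
    have := ((Lp.memLp c).integrable_sq.convolution_integrand (ContinuousLinearMap.mul ℝ ℝ)
      hi.comp_neg).swap
    refine this.congr (.of_forall fun p => ?_)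
    simp
  refine (h1.add h2).mono' ?_ (.of_forall fun p => ?_)
  · exact (Lp.aestronglyMeasurable a).comp_snd.mul
      (((hκ.continuous.comp (continuous_fst.sub continuous_snd)).aestronglyMeasurable).mul
        (Lp.aestronglyMeasurable c).comp_fst)
  · rw [Pi.add_apply, Real.norm_eq_abs, abs_mul, abs_mul, ← sq_abs (a p.2), ← sq_abs (c p.1)]
    nlinarith [mul_nonneg (abs_nonneg (κ (p.1 - p.2))) (sq_nonneg (|a p.2| - |c p.1|)),
      mul_nonneg (abs_nonneg (κ (p.1 - p.2))) (sq_nonneg (|a p.2| + |c p.1|))]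

/-- The bilinear form on `L²(ℝ^d)` with convolution kernel `κ`. -/
noncomputable def kernelForm (κ : Space d → ℝ) (a c : SpaceL2 d) : ℝ :=
  ∫ p : Space d × Space d, a p.2 * (κ (p.1 - p.2) * c p.1) ∂volume.prod volume

theorem kernelForm_eq_left (hκ : IsTest univ κ) (a c : SpaceL2 d) :
    kernelForm κ a c = ∫ y, a y * ∫ x, κ (x - y) * c x := by
  rw [kernelForm, integral_prod_symm _ (integrable_kernel hκ a c)]
  simp only [integral_const_mul]

theorem kernelForm_eq_right (hκ : IsTest univ κ) (a c : SpaceL2 d) :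
    kernelForm κ a c = ∫ x, (∫ y, a y * κ (x - y)) * c x := by
  rw [kernelForm, integral_prod _ (integrable_kernel hκ a c)]
  simp only [← mul_assoc, integral_mul_const]

/-- The substitution x = y + h exhibits the form as an average, with weight κ, of scalar products
with translates. When κ concentrates at the origin it approaches the plain scalar product. -/
theorem kernelForm_eq_shift (hκ : IsTest univ κ) (a c : SpaceL2 d) :
    kernelForm κ a c = ∫ h, κ h * (inner ℝ (transl h c) a : ℝ) := by
  have hm : MeasurePreserving (fun z : Space d × Space d => (z.1 + z.2, z.1))
      (volume.prod volume) (volume.prod volume) :=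
    Measure.measurePreserving_swap.comp
      (measurePreserving_prod_add (volume : Measure (Space d)) (volume : Measure (Space d)))
  have hi : Integrable (Function.uncurry fun y h : Space d => a y * (κ h * c (y + h)))
      (volume.prod volume) := by
    refine (hm.integrable_comp_of_integrable (integrable_kernel hκ a c)).congr
      (.of_forall fun z => ?_)
    simp [Function.uncurry]
  have h1 : ∀ y : Space d, ∫ x, κ (x - y) * c x = ∫ h, κ h * c (y + h) := fun y => by
    rw [← integral_add_left_eq_self (fun x => κ (x - y) * c x) y]
    simp
  rw [kernelForm_eq_left hκ]
  simp only [h1, ← integral_const_mul]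
  rw [integral_integral_swap hi]
  refine integral_congr_ae (.of_forall fun h => ?_)
  simp only
  rw [inner_eq_integral, ← integral_const_mul]
  refine integral_congr_ae ?_
  filter_upwards [coeFn_pull (measurePreserving_add_right (volume : Measure (Space d)) h) c]
    with y hy
  rw [transl, hy, Function.comp_apply]
  ring

theorem partialDeriv_comp_sub_right (hκ : IsTest univ κ) (j : Fin d) (x y : Space d) :
    partialDeriv (fun x => κ (x - y)) j x = partialDeriv κ j (x - y) := by
  have h1 : HasFDerivAt κ (fderiv ℝ κ (x - y)) (x - y) :=
    (hκ.smooth.differentiable (by simp) _).hasFDerivAt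
  have h2 : HasFDerivAt (fun x => κ (x - y)) _ x := h1.comp x ((hasFDerivAt_id x).sub_const y)
  rw [partialDeriv, h2.fderiv]
  rfl

theorem partialDeriv_comp_sub_left (hκ : IsTest univ κ) (j : Fin d) (x y : Space d) :
    partialDeriv (fun y => κ (x - y)) j y = -partialDeriv κ j (x - y) := by
  have h1 : HasFDerivAt κ (fderiv ℝ κ (x - y)) (x - y) :=
    (hκ.smooth.differentiable (by simp) _).hasFDerivAt
  have h2 : HasFDerivAt (fun y => κ (x - y)) _ y := h1.comp y ((hasFDerivAt_id y).const_sub x)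
  rw [partialDeriv, h2.fderiv]
  simp [partialDeriv]

/-- `G` is the weak gradient of `U` on `ℝ^d`. -/
def IsWeakGradient (U : SpaceL2 d) (G : Fin d → SpaceL2 d) : Prop :=
  ∀ φ, IsTest univ φ → ∀ j, ∫ x, G j x * φ x = -∫ x, U x * partialDeriv φ j x

/-- The functional `(U, G) ↦ ∫ f₀ U + ∑ j, ∫ f_j G_j` vanishes on `C_c^∞(O)`. -/
def Annihilates (O : Set (Space d)) (f₀ : SpaceL2 d) (f : Fin d → SpaceL2 d) : Prop :=
  ∀ φ, IsTest O φ → (∫ x, φ x * f₀ x) + ∑ j, (∫ x, partialDeriv φ j x * f j x) = 0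

theorem IsTest.comp_sub_left (hκ : IsTest univ κ) (x : Space d) : IsTest univ fun y => κ (x - y) := by
  refine isTest_of_eq_zero (hκ.smooth.comp (contDiff_const.sub contDiff_id))
    (K := (fun z => x - z) '' tsupport κ) (hκ.compact.isCompact.image (by fun_prop)) (fun y hy => ?_)
    (subset_univ _)
  by_contra h
  exact hy ⟨x - y, subset_tsupport _ h, by simp⟩

/-- Integration by parts in y moves the derivative from G to U, and the sign of ∂_y κ(x - y) turns
it into a derivative in x. The sum becomes the integral over y of U(y) times the functional applied
to κ(· - y), a test function on O for every y that matters. -/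
theorem kernelForm_annihilates (hκ : IsTest univ κ) {U : SpaceL2 d} {G : Fin d → SpaceL2 d}
    (hUG : IsWeakGradient U G) {S : Set (Space d)} (hU : ∀ᵐ y, y ∉ S → U y = 0)
    (hS : ∀ y ∈ S, IsTest O fun x => κ (x - y)) {f₀ : SpaceL2 d} {f : Fin d → SpaceL2 d}
    (hf : Annihilates O f₀ f) : kernelForm κ U f₀ + ∑ j, kernelForm κ (G j) (f j) = 0 := by
  have hκ' : ∀ j, IsTest univ (partialDeriv κ j) := fun j => hκ.isTest_partialDeriv j
  have h1 : ∀ j, kernelForm κ (G j) (f j) = kernelForm (partialDeriv κ j) U (f j) := fun j => by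
    rw [kernelForm_eq_right hκ, kernelForm_eq_right (hκ' j)]
    refine integral_congr_ae (.of_forall fun x => ?_)
    simp only
    rw [hUG _ (hκ.comp_sub_left x) j]
    simp only [partialDeriv_comp_sub_left hκ, mul_neg, integral_neg, neg_neg]
  have hi : ∀ {κ' : Space d → ℝ}, IsTest univ κ' → ∀ c : SpaceL2 d,
      Integrable fun y => U y * ∫ x, κ' (x - y) * c x := fun h' c => by
    simpa only [integral_const_mul] using (integrable_kernel h' U c).integral_prod_right
  simp only [h1, kernelForm_eq_left hκ, kernelForm_eq_left (hκ' _)]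
  rw [← integral_finsetSum _ fun j _ => hi (hκ' j) (f j),
    ← integral_add (hi hκ f₀) (integrable_finsetSum _ fun j _ => hi (hκ' j) (f j))]
  refine integral_eq_zero_of_ae ?_
  filter_upwards [hU] with y hy
  by_cases hyS : y ∈ S
  · have := hf _ (hS y hyS)
    simp only [partialDeriv_comp_sub_right hκ] at this
    rw [← Finset.mul_sum, ← mul_add, this, mul_zero, Pi.zero_apply]
  · simp [hy hyS]

theorem tendsto_inner_transl (a c : SpaceL2 d) :
    Tendsto (fun h => (inner ℝ (transl h c) a : ℝ)) (𝓝 0) (𝓝 (inner ℝ c a)) :=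
  (show Tendsto (fun h : Space d => transl h c) (𝓝 0) (𝓝 c) from tendsto_pull_add c tendsto_id).inner
    tendsto_const_nhds

theorem continuous_inner_transl (a c : SpaceL2 d) :
    Continuous fun h : Space d => (inner ℝ (transl h c) a : ℝ) := by
  refine continuous_iff_continuousAt.2 fun h₀ => ?_
  have h1 : Tendsto (fun h => h - h₀) (𝓝 h₀) (𝓝 0) := by
    rw [← sub_self h₀]
    exact tendsto_id.sub_const h₀
  have h2 := (tendsto_inner_transl (transl (-h₀) a) c).comp h1
  have h3 : ∀ h, (inner ℝ (transl (h - h₀) c) (transl (-h₀) a) : ℝ) = inner ℝ (transl h c) a :=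
    fun h => by
      rw [← (transl (-h₀)).inner_map_map (transl h c), transl_transl, neg_add_eq_sub]
  have h4 : (inner ℝ c (transl (-h₀) a) : ℝ) = inner ℝ (transl h₀ c) a := by
    rw [← (transl (-h₀)).inner_map_map (transl h₀ c), transl_transl, neg_add_cancel, transl_zero]
  rw [h4] at h2
  exact h2.congr fun h => h3 h

/-- If the support of `U` can be moved into `O` by small translations, then every functional that
annihilates `C_c^∞(O)` annihilates `(U, G)`. -/
theorem inner_add_sum_eq_zero_of_local {U : SpaceL2 d} {G : Fin d → SpaceL2 d}
    (hUG : IsWeakGradient U G) {S : Set (Space d)} (hU : ∀ᵐ y, y ∉ S → U y = 0) {ν : Space d}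
    {η s₀ : ℝ} (hη : 0 < η) (hs₀ : 0 < s₀)
    (hS : ∀ y ∈ S, ∀ s, 0 < s → s < s₀ → Metric.closedBall (y + s • ν) (s * η) ⊆ O)
    {f₀ : SpaceL2 d} {f : Fin d → SpaceL2 d} (hf : Annihilates O f₀ f) :
    inner ℝ f₀ U + ∑ j, (inner ℝ (f j) (G j) : ℝ) = 0 := by
  let θ : Space d → ℝ := fun h => inner ℝ (transl h f₀) U + ∑ j, inner ℝ (transl h (f j)) (G j)
  have hθc : Continuous θ := (continuous_inner_transl U f₀).add
    (continuous_finsetSum _ fun j _ => continuous_inner_transl (G j) (f j))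
  have hθ0 : θ 0 = inner ℝ f₀ U + ∑ j, (inner ℝ (f j) (G j) : ℝ) := by
    simp only [θ, transl_zero]
  rw [← hθ0]
  refine abs_nonpos_iff.1 (le_of_forall_pos_le_add fun δ hδ => ?_)
  rw [zero_add]
  obtain ⟨R, hR, hRθ⟩ := Metric.continuousAt_iff.1 hθc.continuousAt δ hδ
  set s : ℝ := min (s₀ / 2) (R / (‖ν‖ + η + 1)) with hs
  have hpos : 0 < ‖ν‖ + η + 1 := by positivity
  have hs1 : 0 < s := lt_min (by positivity) (by positivity)
  have hs2 : s < s₀ := (min_le_left _ _).trans_lt (by linarith)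
  have hs3 : s * ‖ν‖ + s * η < R := by
    have : s * (‖ν‖ + η + 1) ≤ R := (le_div_iff₀ hpos).1 (min_le_right _ _)
    linarith
  let β : ContDiffBump (s • ν) := ⟨s * η / 2, s * η, by positivity, by
    have : 0 < s * η := by positivity
    linarith⟩
  set κ : Space d → ℝ := β.normed volume with hκdef
  have hball : tsupport κ = Metric.closedBall (s • ν) (s * η) := β.tsupport_normed_eq
  have hκ0 : ∀ x ∉ Metric.closedBall (s • ν) (s * η), κ x = 0 := fun x hx =>
    image_eq_zero_of_notMem_tsupport (by rwa [hball])
  have hκ : IsTest univ κ := ⟨β.contDiff_normed, β.hasCompactSupport_normed, subset_univ _⟩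
  have h1 := kernelForm_annihilates hκ hUG hU (fun y hy => ?_) hf
  · simp only [kernelForm_eq_shift hκ] at h1
    have hi : ∀ a c : SpaceL2 d, Integrable fun h => κ h * (inner ℝ (transl h c) a : ℝ) :=
      fun a c => (hκ.continuous.mul (continuous_inner_transl a c)).integrable_of_hasCompactSupport
        hκ.compact.mul_right
    rw [← integral_finsetSum _ fun j _ => hi _ _,
      ← integral_add (hi _ _) (integrable_finsetSum _ fun j _ => hi _ _)] at h1
    have hκi : Integrable κ := hκ.continuous.integrable_of_hasCompactSupport hκ.compact
    -- κ has integral one and the integral of κ θ vanishes by the preceding lemma.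
    have h2 : θ 0 = ∫ h, κ h * (θ 0 - θ h) := by
      have h3 : ∀ h, κ h * (θ 0 - θ h) = κ h * θ 0 - (κ h * inner ℝ (transl h f₀) U +
          ∑ j, κ h * inner ℝ (transl h (f j)) (G j)) := fun h => by
        simp only [θ, mul_sub, mul_add, Finset.mul_sum]
      have h4 : Integrable fun h => κ h * inner ℝ (transl h f₀) U +
          ∑ j, κ h * inner ℝ (transl h (f j)) (G j) :=
        (hi _ _).add (integrable_finsetSum _ fun j _ => hi _ _)
      simp only [h3]
      rw [integral_sub (hκi.mul_const _) h4, h1, integral_mul_const, β.integral_normed, one_mul,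
        sub_zero]
    rw [h2, ← Real.norm_eq_abs]
    refine (norm_integral_le_of_norm_le (hκi.mul_const δ) (.of_forall fun h => ?_)).trans_eq ?_
    · rw [norm_mul, show ‖κ h‖ = κ h from Real.norm_of_nonneg (β.nonneg_normed h)]
      by_cases hh : h ∈ Metric.closedBall (s • ν) (s * η)
      · refine mul_le_mul_of_nonneg_left ?_ (β.nonneg_normed h)
        rw [← dist_eq_norm, dist_comm]
        refine (hRθ ?_).le
        rw [dist_zero_right]
        have h4 : ‖h - s • ν‖ ≤ s * η := by rwa [← dist_eq_norm]
        calc ‖h‖ ≤ ‖s • ν‖ + ‖h - s • ν‖ := by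
              simpa using norm_add_le (s • ν) (h - s • ν)
          _ < R := by
              rw [norm_smul, Real.norm_of_nonneg hs1.le]
              linarith
      · rw [hκ0 h hh, zero_mul, zero_mul]
    · rw [integral_mul_const, β.integral_normed, one_mul]
  · refine isTest_of_eq_zero (hκ.smooth.comp (contDiff_id.sub contDiff_const))
      (isCompact_closedBall (y + s • ν) (s * η)) (fun x hx => hκ0 _ fun h => hx ?_)
      (hS y hy s hs1 hs2)
    rw [Metric.mem_closedBall, dist_eq_norm] at h ⊢
    rwa [show x - (y + s • ν) = id x - y - s • ν by simp [sub_sub]]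

end Kernel

end SpringNetwork

namespace SpringNetwork

/-! ### Localization and global membership in H¹_0. -/

section Localization

variable {d : ℕ} {O : Set (Space d)} {φ β : Space d → ℝ}

theorem IsTest.integrable_mul (hφ : IsTest univ φ) (a : SpaceL2 d) :
    Integrable fun x => a x * φ x := (Lp.memLp a).integrable_mul (hφ.memLp 2 volume)

theorem IsTest.mul (hβ : IsTest univ β) (hφ : IsTest univ φ) : IsTest univ fun x => β x * φ x :=
  ⟨hβ.smooth.mul hφ.smooth, hφ.compact.mul_left, subset_univ _⟩

theorem IsTest.partialDeriv_mul (hβ : IsTest univ β) (hφ : IsTest univ φ) (j : Fin d) (x : Space d) :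
    partialDeriv (fun x => β x * φ x) j x = β x * partialDeriv φ j x + partialDeriv β j x * φ x := by
  rw [partialDeriv, fderiv_fun_mul (hβ.smooth.differentiable (by simp) x)
    (hφ.smooth.differentiable (by simp) x)]
  simp [partialDeriv, mul_comm]

theorem IsWeakGradient.sub {U V : SpaceL2 d} {G H : Fin d → SpaceL2 d} (h : IsWeakGradient U G)
    (h' : IsWeakGradient V H) : IsWeakGradient (U - V) fun j => G j - H j := by
  intro φ hφ j
  have key : ∀ (a c : SpaceL2 d) {ψ : Space d → ℝ}, IsTest univ ψ →
      ∫ x, (a - c : SpaceL2 d) x * ψ x = (∫ x, a x * ψ x) - ∫ x, c x * ψ x := fun a c ψ hψ => by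
    rw [← integral_sub (hψ.integrable_mul a) (hψ.integrable_mul c)]
    refine integral_congr_ae ?_
    filter_upwards [Lp.coeFn_sub a c] with x hx
    rw [hx, Pi.sub_apply, sub_mul]
  rw [key _ _ hφ, key _ _ (hφ.isTest_partialDeriv j), h φ hφ, h' φ hφ]
  ring

theorem IsTest.exists_bounded_mul (hβ : IsTest univ β) (U : SpaceL2 d) :
    ∃ V : SpaceL2 d, V =ᵐ[volume] fun x => β x * U x :=
  ⟨((Lp.memLp U).mul (r := 2) (hβ.memLp ∞ volume)).toLp _, MemLp.coeFn_toLp _⟩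

theorem IsWeakGradient.exists_mul {U : SpaceL2 d} {G : Fin d → SpaceL2 d} (h : IsWeakGradient U G)
    (hβ : IsTest univ β) : ∃ (V : SpaceL2 d) (H : Fin d → SpaceL2 d), IsWeakGradient V H ∧
      (V =ᵐ[volume] fun x => β x * U x) ∧
      ∀ j, H j =ᵐ[volume] fun x => β x * G j x + partialDeriv β j x * U x := by
  obtain ⟨V, hV⟩ := hβ.exists_bounded_mul U
  choose H₁ hH₁ using fun j => hβ.exists_bounded_mul (G j)
  choose H₂ hH₂ using fun j => (hβ.isTest_partialDeriv j).exists_bounded_mul U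
  have hH : ∀ j, (H₁ j + H₂ j : SpaceL2 d) =ᵐ[volume]
      fun x => β x * G j x + partialDeriv β j x * U x := fun j => by
    filter_upwards [Lp.coeFn_add (H₁ j) (H₂ j), hH₁ j, hH₂ j] with x h1 h2 h3
    rw [h1, Pi.add_apply, h2, h3]
  refine ⟨V, fun j => H₁ j + H₂ j, fun φ hφ j => ?_, hV, hH⟩
  have hφ' := hφ.isTest_partialDeriv j
  have hβ' := hβ.isTest_partialDeriv j
  have h1 := h _ (hβ.mul hφ) j
  simp only [hβ.partialDeriv_mul hφ, mul_add] at h1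
  rw [integral_add ((hβ.mul hφ').integrable_mul U) ((hβ'.mul hφ).integrable_mul U)] at h1
  have h2 : ∫ x, (H₁ j + H₂ j : SpaceL2 d) x * φ x =
      (∫ x, G j x * (β x * φ x)) + ∫ x, U x * (partialDeriv β j x * φ x) := by
    rw [← integral_add ((hβ.mul hφ).integrable_mul (G j)) ((hβ'.mul hφ).integrable_mul U)]
    refine integral_congr_ae ?_
    filter_upwards [hH j] with x hx
    rw [hx]
    ring
  have h3 : ∫ x, V x * partialDeriv φ j x = ∫ x, U x * (β x * partialDeriv φ j x) := by
    refine integral_congr_ae ?_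
    filter_upwards [hV] with x hx
    rw [hx]
    ring
  rw [h2, h3, h1]
  ring

/-- Near every point of its closure, a Lipschitz domain contains the small translates of its points
along a cone of directions. -/
theorem HasLipschitzBoundary.exists_cone (hO : IsOpen O) (h : HasLipschitzBoundary O) {x₀ : Space d}
    (hx₀ : x₀ ∈ closure O) : ∃ (r : ℝ) (ν : Space d) (η s₀ : ℝ), 0 < r ∧ 0 < η ∧ 0 < s₀ ∧
      ∀ y ∈ O ∩ Metric.ball x₀ r, ∀ s, 0 < s → s < s₀ →
        Metric.closedBall (y + s • ν) (s * η) ⊆ O := by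
  by_cases hx : x₀ ∈ O
  · obtain ⟨R, hR, hRO⟩ := Metric.isOpen_iff.1 hO x₀ hx
    refine ⟨R / 2, 0, 1, R / 2, by positivity, one_pos, by positivity, ?_⟩
    rintro y ⟨-, hy⟩ s - hs z hz
    refine hRO ?_
    rw [Metric.mem_closedBall, smul_zero, add_zero, mul_one] at hz
    rw [Metric.mem_ball] at hy ⊢
    linarith [dist_triangle z y x₀]
  · obtain ⟨r, hr, ν, hν, L, γ, hγ, hγO⟩ := h x₀ (by rw [hO.frontier_eq]; exact ⟨hx₀, hx⟩)
    -- A perturbation e of y + s • ν lowers the height by at most ‖e‖ and moves the base point by at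
    -- most 2‖e‖. The point stays above the graph once (2L + 1)‖e‖ ≤ s, which fixes the aperture
    -- 1/(2L + 1).
    have hL : (0 : ℝ) < 2 * L + 1 := by positivity
    have hη1 : 1 / (2 * (L : ℝ) + 1) ≤ 1 := by
      rw [div_le_one hL]
      linarith [L.coe_nonneg]
    refine ⟨r / 2, ν, 1 / (2 * L + 1), r / 4, by positivity, by positivity, by positivity, ?_⟩
    rintro y ⟨hyO, hy⟩ s hs hs' z hz
    set e := z - (y + s • ν) with he
    have hz' : z = y + s • ν + e := by rw [he]; abel
    have he1 : ‖e‖ ≤ s * (1 / (2 * L + 1)) := by rwa [Metric.mem_closedBall, dist_eq_norm] at hz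
    have he2 : ‖e‖ ≤ s := he1.trans (by nlinarith)
    rw [Metric.mem_ball, dist_eq_norm] at hy
    have hyr : y ∈ Metric.ball x₀ r := by
      rw [Metric.mem_ball, dist_eq_norm]
      linarith
    have hzr : z ∈ Metric.ball x₀ r := by
      rw [Metric.mem_ball, dist_eq_norm]
      calc ‖z - x₀‖ = ‖(y - x₀) + s • ν + e‖ := by rw [hz']; congr 1; abel
        _ ≤ ‖y - x₀‖ + ‖s • ν‖ + ‖e‖ := norm_add₃_le
        _ < r := by
          rw [norm_smul, hν, Real.norm_of_nonneg hs.le]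
          linarith
    rw [hγO z hzr]
    have h1 := (hγO y hyr).1 hyO
    have hνν : (inner ℝ ν ν : ℝ) = 1 := by rw [real_inner_self_eq_norm_sq, hν, one_pow]
    have h2 : (inner ℝ z ν : ℝ) = inner ℝ y ν + s + inner ℝ e ν := by
      rw [hz', inner_add_left, inner_add_left, real_inner_smul_left, hνν, mul_one]
    have h3 : |(inner ℝ e ν : ℝ)| ≤ ‖e‖ := by
      simpa [hν] using abs_real_inner_le_norm e ν
    have h4 : z - (inner ℝ z ν : ℝ) • ν - (y - (inner ℝ y ν : ℝ) • ν) =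
        e - (inner ℝ e ν : ℝ) • ν := by
      rw [h2, hz', add_smul, add_smul]
      abel
    have h5 := hγ.dist_le_mul (z - (inner ℝ z ν : ℝ) • ν) (y - (inner ℝ y ν : ℝ) • ν)
    rw [dist_eq_norm (z - _), h4, Real.dist_eq] at h5
    have h6 : ‖e - (inner ℝ e ν : ℝ) • ν‖ ≤ 2 * ‖e‖ := by
      refine (norm_sub_le _ _).trans ?_
      rw [norm_smul, hν, mul_one, Real.norm_eq_abs]
      linarith
    have h7 : (L : ℝ) * ‖e - (inner ℝ e ν : ℝ) • ν‖ ≤ L * (2 * ‖e‖) :=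
      mul_le_mul_of_nonneg_left h6 L.coe_nonneg
    have h8 : ‖e‖ * (2 * L + 1) ≤ s := by
      rw [← div_eq_mul_one_div] at he1
      exact (le_div_iff₀ hL).1 he1
    have h9 := (abs_le.1 h5).2
    have h10 := (abs_le.1 h3).1
    linarith

/-- The closure is covered by finitely many balls on whose doubles the cone condition holds.
Multiplication by a bump function equal to one on a ball splits off a part handled by the local
result, and the remainder vanishes off the other balls. Induction over the cover finishes. -/
theorem inner_add_sum_eq_zero (hO : IsOpen O) (hbdd : Bornology.IsBounded O)
    (hlip : HasLipschitzBoundary O) {U : SpaceL2 d} {G : Fin d → SpaceL2 d}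
    (hUG : IsWeakGradient U G) (hU : ∀ᵐ y, y ∉ O → U y = 0) (hG : ∀ j, ∀ᵐ y, y ∉ O → G j y = 0)
    {f₀ : SpaceL2 d} {f : Fin d → SpaceL2 d} (hf : Annihilates O f₀ f) :
    inner ℝ f₀ U + ∑ j, (inner ℝ (f j) (G j) : ℝ) = 0 := by
  choose! r ν η s₀ hr hη hs₀ hcone using fun x (hx : x ∈ closure O) => hlip.exists_cone hO hx
  have main : ∀ t : Finset (Space d), (∀ x ∈ t, x ∈ closure O) →
      ∀ (U : SpaceL2 d) (G : Fin d → SpaceL2 d), IsWeakGradient U G → (∀ᵐ y, y ∉ O → U y = 0) →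
      (∀ᵐ y, y ∉ (⋃ x ∈ t, Metric.ball x (r x / 2)) → U y = 0 ∧ ∀ j, G j y = 0) →
      inner ℝ f₀ U + ∑ j, (inner ℝ (f j) (G j) : ℝ) = 0 := by
    intro t
    induction t using Finset.induction_on with
    | empty =>
      intro _ U G _ _ h0
      have hU0 : U = 0 := by
        apply Lp.ext
        filter_upwards [h0, Lp.coeFn_zero ℝ 2 (volume : Measure (Space d))] with y h1 h2
        rw [h2, (h1 (by simp)).1, Pi.zero_apply]
      have hG0 : ∀ j, G j = 0 := fun j => by
        apply Lp.ext
        filter_upwards [h0, Lp.coeFn_zero ℝ 2 (volume : Measure (Space d))] with y h1 h2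
        rw [h2, (h1 (by simp)).2, Pi.zero_apply]
      simp [hU0, hG0]
    | insert x t _ ih =>
      intro ht U G hUG hU h0
      have hx : x ∈ closure O := ht x (Finset.mem_insert_self x t)
      have hrx := hr x hx
      let β : ContDiffBump x := ⟨r x / 2, r x, by positivity, by linarith⟩
      have hβ : IsTest univ β := ⟨β.contDiff, β.hasCompactSupport, subset_univ _⟩
      obtain ⟨V, H, hVH, hV, hH⟩ := hUG.exists_mul hβ
      have h1 := inner_add_sum_eq_zero_of_local hVH (S := O ∩ Metric.ball x (r x)) (by
        filter_upwards [hV, hU] with y h2 h3 hy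
        rw [h2]
        by_cases hyO : y ∈ O
        · have h4 : y ∉ Function.support β := by
            rw [β.support_eq]
            exact fun h => hy ⟨hyO, h⟩
          rw [Function.notMem_support.1 h4, zero_mul]
        · rw [h3 hyO, mul_zero]) (hη x hx) (hs₀ x hx) (hcone x hx) hf
      have h2 := ih (fun z hz => ht z (Finset.mem_insert_of_mem hz)) _ _ (hUG.sub hVH) (by
        filter_upwards [hU, hV, Lp.coeFn_sub U V] with y h2 h3 h4 hy
        rw [h4, Pi.sub_apply, h3, h2 hy, mul_zero, sub_zero]) (by
        filter_upwards [h0, hV, Lp.coeFn_sub U V, ae_all_iff.2 hH,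
          ae_all_iff.2 fun j => Lp.coeFn_sub (G j) (H j)] with y h2 h3 h4 h5 h6 hy
        simp only [h4, h6, Pi.sub_apply, h3, h5]
        by_cases hyx : y ∈ Metric.ball x (r x / 2)
        · have h7 : β =ᶠ[𝓝 y] fun _ => (1 : ℝ) := β.eventuallyEq_one_of_mem_ball hyx
          have h8 : ∀ j, partialDeriv β j y = 0 := fun j => by
            rw [partialDeriv, h7.fderiv_eq, fderiv_const_apply]
            rfl
          have h9 : β y = 1 := h7.self_of_nhds
          simp [h8, h9]
        · obtain ⟨h7, h8⟩ := h2 (by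
            rw [Finset.set_biUnion_insert]
            exact fun h => h.elim hyx hy)
          simp [h7, h8])
      simp only [inner_sub_right, Finset.sum_sub_distrib] at h2
      linarith
  obtain ⟨t, ht, hcover⟩ := hbdd.isCompact_closure.elim_nhds_subcover
    (fun x => Metric.ball x (r x / 2)) fun x hx => Metric.ball_mem_nhds x (half_pos (hr x hx))
  refine main t ht U G hUG hU ?_
  filter_upwards [hU, ae_all_iff.2 hG] with y h1 h2 hy
  have hyO : y ∉ O := fun h => hy (hcover (subset_closure h))
  exact ⟨h1 hyO, fun j => h2 j hyO⟩

theorem exists_extendDomain (hO : MeasurableSet O) (f : DomainL2 O) :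
    ∃ F : SpaceL2 d, F =ᵐ[volume] O.indicator f := by
  have h : MemLp (O.indicator f) 2 (volume : Measure (Space d)) :=
    (memLp_indicator_iff_restrict hO).2 (Lp.memLp f)
  exact ⟨h.toLp _, h.coeFn_toLp⟩

theorem inner_restr (hO : MeasurableSet O) {f : DomainL2 O} {F : SpaceL2 d}
    (hF : F =ᵐ[volume] O.indicator f) (U : SpaceL2 d) :
    inner ℝ f (restr O U) = (inner ℝ F U : ℝ) := by
  rw [inner_eq_integral, inner_eq_integral, ← integral_indicator hO]
  have h1 : ∀ᵐ x, x ∈ O → restr O U x = U x := (ae_restrict_iff' hO).1 (coeFn_restr U)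
  refine integral_congr_ae ?_
  filter_upwards [hF, h1] with x h2 h3
  rw [h2]
  by_cases hx : x ∈ O
  · rw [indicator_of_mem hx, indicator_of_mem hx, h3 hx]
  · rw [indicator_of_notMem hx, indicator_of_notMem hx, zero_mul]

/-- A square integrable function on `ℝ^d` with square integrable weak gradient that vanishes outside
a bounded Lipschitz domain `O` belongs to `H¹_0(O)`. -/
theorem mem_H10_of_isWeakGradient (hO : IsOpen O) (hbdd : Bornology.IsBounded O)
    (hlip : HasLipschitzBoundary O) {U : SpaceL2 d} {G : Fin d → SpaceL2 d}
    (hUG : IsWeakGradient U G) (hU : ∀ᵐ y, y ∉ O → U y = 0) (hG : ∀ j, ∀ᵐ y, y ∉ O → G j y = 0) :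
    (WithLp.toLp 2 (restr O U, WithLp.toLp 2 fun j => restr O (G j)) :
      WithLp 2 (DomainL2 O × PiLp 2 (fun _ : Fin d => DomainL2 O))) ∈ H10 O := by
  -- The closure of the test functions is their double orthogonal complement, so membership means
  -- being annihilated by every f that annihilates test functions.
  rw [H10, ← Submodule.orthogonal_orthogonal_eq_closure, Submodule.mem_orthogonal]
  intro f hf
  obtain ⟨F₀, hF₀⟩ := exists_extendDomain hO.measurableSet f.fst
  choose F hF using fun j => exists_extendDomain hO.measurableSet (f.snd j)
  have hann : Annihilates O F₀ F := by
    intro φ hφ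
    obtain ⟨Φ, hΦ⟩ := (hφ.mono (subset_univ O)).exists_toLp volume
    choose Φ' hΦ' using fun j => ((hφ.mono (subset_univ O)).isTest_partialDeriv j).exists_toLp volume
    have h1 := (Submodule.mem_orthogonal' _ _).1 hf
      (WithLp.toLp 2 (restr O Φ, WithLp.toLp 2 fun j => restr O (Φ' j))) (Submodule.subset_span
        ⟨φ, hφ.smooth, hφ.compact, hφ.supp, (coeFn_restr Φ).trans (ae_restrict_of_ae hΦ), fun j =>
          (coeFn_restr (Φ' j)).trans (ae_restrict_of_ae (hΦ' j))⟩)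
    rw [WithLp.prod_inner_apply, PiLp.inner_apply] at h1
    change inner ℝ f.fst (restr O Φ) + ∑ j, inner ℝ (f.snd j) (restr O (Φ' j)) = (0 : ℝ) at h1
    simp only [inner_restr hO.measurableSet hF₀, inner_restr hO.measurableSet (hF _)] at h1
    have key : ∀ {a c : SpaceL2 d} {ψ : Space d → ℝ}, c =ᵐ[volume] ψ →
        ∫ x, ψ x * a x = inner ℝ a c := fun {a c ψ} h => by
      rw [inner_eq_integral]
      refine integral_congr_ae ?_
      filter_upwards [h] with x hx
      rw [hx, mul_comm]
    rw [key hΦ]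
    simpa only [key (hΦ' _)] using h1
  have h2 := inner_add_sum_eq_zero hO hbdd hlip hUG hU hG hann
  rw [WithLp.prod_inner_apply, PiLp.inner_apply]
  change inner ℝ f.fst (restr O U) + ∑ j, inner ℝ (f.snd j) (restr O (G j)) = (0 : ℝ)
  simpa only [inner_restr hO.measurableSet hF₀, inner_restr hO.measurableSet (hF _)] using h2

end Localization

end SpringNetwork

namespace SpringNetwork

/-! ### Weak limits of discrete states are continuum states. -/

section WeakLimit

variable {d k : ℕ} {Ω : Type*} [MeasurableSpace Ω] {P : Measure Ω} [IsProbabilityMeasure P]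
  {τ : IntLattice d → Ω → Ω} (hτ : IsDynamicalSystem P τ)
  {ε : ℕ → ℝ} (hε : ∀ n, 0 < ε n) (hεlim : Tendsto ε atTop (𝓝 0)) {F : Filter ℕ} [NeBot F]
  (hF : F ≤ atTop) {O : Set (Space d)} {b : Fin k → IntLattice d}

/-- Constant fields are solenoidal. Used as test fields they isolate the expectation of one
component of the gradient. -/
theorem isSolenoidal_single (j : Fin d) :
    IsSolenoidal hτ (Pi.single j (oneLp P) : Fin d → Lp ℝ 2 P) := by
  refine Finset.sum_eq_zero fun i _ => ?_
  by_cases hij : i = j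
  · subst hij
    rw [Pi.single_eq_same, act_oneLp, sub_self]
  · rw [Pi.single_eq_of_ne hij, map_zero, sub_zero]

theorem inner_eq_integral_test {a H : SpaceL2 d} {φ : Space d → ℝ} (hH : H =ᵐ[volume] φ) :
    inner ℝ a H = ∫ x, a x * φ x := by
  rw [inner_eq_integral]
  refine integral_congr_ae ?_
  filter_upwards [hH] with x hx
  rw [hx]

theorem tens_zero_left {α β : Type*} [MeasurableSpace α] [MeasurableSpace β] {μ : Measure α}
    {ν : Measure β} [SFinite μ] [SFinite ν] (η : Lp ℝ 2 ν) : tens (0 : Lp ℝ 2 μ) η = 0 :=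
  (tens.flip η).map_zero

/-- It suffices to test the characterization of `L²_pot ⊗ L²(O)` with test functions on `O`. -/
theorem mem_L2PotTensor_of_isTest (hO : IsOpen O) {f : PiLp 2 (fun _ : Fin d => TwoScaleL2 P O)}
    (hf : ∀ ψ ∈ (L2Pot P τ)ᗮ, ∀ φ, IsTest O φ → ∀ ζ : DomainL2 O, ζ =ᵐ[volume.restrict O] φ →
      ∑ j, (inner ℝ (f j) (tens (ψ j) ζ) : ℝ) = 0) : f ∈ L2PotTensor P τ O := by
  refine mem_L2PotTensor fun ψ hψ η => ?_
  let L : DomainL2 O →L[ℝ] ℝ := ∑ j, (innerSL ℝ (f j)).comp (tens (ψ j))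
  have hL : ∀ ζ, L ζ = ∑ j, (inner ℝ (f j) (tens (ψ j) ζ) : ℝ) := fun ζ => by
    simp only [L, sum_apply]
    rfl
  rw [← hL]
  have h3 : η ∈ (Submodule.span ℝ {η : DomainL2 O |
      ∃ φ, IsTest O φ ∧ η =ᵐ[volume.restrict O] φ}).topologicalClosure := by
    rw [isTest_total hO rfl]
    exact Submodule.mem_top
  refine Submodule.topologicalClosure_minimal (t := LinearMap.ker L.toLinearMap) _ ?_
    (ContinuousLinearMap.isClosed_ker L) h3
  rw [Submodule.span_le]
  rintro ζ ⟨φ, hφ, hζ⟩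
  exact (hL ζ).trans (hf ψ hψ φ hφ ζ hζ)

variable {hτ} {u : ℕ → FullL2 P d} {g : ℕ → Fin d → FullL2 P d} {U : FullL2 P d}
  {G : Fin d → FullL2 P d}

include hε hεlim hF

/-- The two-scale identity is tested with the constant field e_j; the sums reduce to a single term,
the definition of a weak derivative. -/
theorem IsWeakDisplacement.isWeakGradient (h : IsWeakDisplacement hτ ε F u g U G)
    (he : IsErgodicSystem P τ) : IsWeakGradient (average U) fun j => average (G j) := by
  intro φ hφ j
  obtain ⟨H, hH⟩ := hφ.exists_toLp volume
  choose H' hH' using fun j => (hφ.isTest_partialDeriv j).exists_toLp volume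
  have h1 := h.inner_of_isSolenoidal he hε hεlim hF (isSolenoidal_single hτ j) hφ hH hH'
  rw [Finset.sum_eq_single j, Finset.sum_eq_single j, Pi.single_eq_same, inner_oneLp_oneLp,
    one_mul, ← inner_average, ← inner_average, inner_eq_integral_test hH,
    inner_eq_integral_test (hH' j)] at h1
  · exact h1
  · intro i _ hij
    rw [Pi.single_eq_of_ne hij, inner_zero_left, zero_mul]
  · simp
  · intro i _ hij
    rw [Pi.single_eq_of_ne hij, tens_zero_left, inner_zero_right]
  · simp

/-- Ergodicity enters here: the shift invariant limit agrees with its expectation when tested on all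
elementary tensors. -/
theorem IsWeakDisplacement.tens_average (h : IsWeakDisplacement hτ ε F u g U G)
    (he : IsErgodicSystem P τ) : tens (oneLp P) (average U) = U := by
  refine sub_eq_zero.1 (eq_zero_of_inner_tens fun ψ η => ?_)
  rw [inner_sub_left, inner_tens_tens, inner_average, h.inner_tens he hε hεlim hF ψ η,
    real_inner_comm, sub_self]

theorem IsWeakDisplacement.inner_sub_tens_average (h : IsWeakDisplacement hτ ε F u g U G)
    (he : IsErgodicSystem P τ) {φ : Space d → ℝ} (hφ : IsTest univ φ) {H H' : SpaceL2 d}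
    (hH : H =ᵐ[volume] φ) (j : Fin d) (hH' : H' =ᵐ[volume] partialDeriv φ j) (ψ : Lp ℝ 2 P) :
    inner ℝ (G j - tens (oneLp P) (average (G j))) (tens ψ H) = inner ℝ (G j) (tens ψ H) +
      inner ℝ ψ (oneLp P) * (inner ℝ U (tens (oneLp P) H') : ℝ) := by
  have h1 : (inner ℝ (average (G j)) H : ℝ) = -inner ℝ U (tens (oneLp P) H') := by
    rw [inner_eq_integral_test hH, ← inner_average, inner_eq_integral_test hH']
    exact h.isWeakGradient hε hεlim hF he φ hφ j
  rw [inner_sub_left, inner_tens_tens, h1, real_inner_comm ψ]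
  ring

/-- The structure of two-scale limits of bounded sequences of discrete displacements. -/
theorem IsWeakDisplacement.exists_eq (h : IsWeakDisplacement hτ ε F u g U G)
    (he : IsErgodicSystem P τ) (hO : IsOpen O) (hbdd : Bornology.IsBounded O)
    (hlip : HasLipschitzBoundary O) (hU : ∀ᵐ p ∂P.prod volume, p.2 ∉ O → U p = 0)
    (hG : ∀ j, ∀ᵐ p ∂P.prod volume, p.2 ∉ O → G j p = 0) :
    ∃ (V : H10 O) (χ : L2PotTensor P τ O),
      extendZero P hO.measurableSet (tens (oneLp P) V.1.fst) = U ∧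
      ∀ j, extendZero P hO.measurableSet (tens (oneLp P) (V.1.snd j) + χ.1 j) = G j := by
  have hU' := average_eq_zero hO.measurableSet hU
  have hG' := fun j => average_eq_zero hO.measurableSet (hG j)
  -- The corrector is the gradient limit minus its expectation. It vanishes outside O together with
  -- both terms.
  have hχ : ∀ j, ∃ f, extendZero P hO.measurableSet f = G j - tens (oneLp P) (average (G j)) :=
    fun j => exists_extendZero_eq hO.measurableSet (by
      filter_upwards [hG j, ae_prod_snd (μ := P) (hG' j),
        Lp.coeFn_sub (G j) (tens (oneLp P) (average (G j))),
        coeFn_tens (oneLp P) (average (G j))] with p h1 h2 h3 h4 hp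
      rw [h3, Pi.sub_apply, h4, h1 hp, h2 hp, mul_zero, sub_zero])
  choose χ hχ using hχ
  have hmem : (WithLp.toLp 2 χ : PiLp 2 (fun _ : Fin d => TwoScaleL2 P O)) ∈ L2PotTensor P τ O := by
    -- Against solenoidal ψ the two-scale identity produces exactly the contribution of the mean
    -- gradient with opposite sign, so the corrector is orthogonal to ψ ⊗ φ.
    refine mem_L2PotTensor_of_isTest hO fun ψ hψ φ hφ ζ hζ => ?_
    have hφ' := hφ.mono (subset_univ O)
    obtain ⟨H, hH⟩ := hφ'.exists_toLp volume
    choose H' hH' using fun j => (hφ'.isTest_partialDeriv j).exists_toLp volume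
    have h4 := h.inner_of_isSolenoidal he hε hεlim hF (isSolenoidal_of_mem hτ hψ) hφ' hH hH'
    have h5 : ∀ j, (inner ℝ (χ j) (tens (ψ j) ζ) : ℝ) = inner ℝ (G j) (tens (ψ j) H) +
        inner ℝ (ψ j) (oneLp P) * inner ℝ U (tens (oneLp P) (H' j)) := fun j =>
      calc (inner ℝ (χ j) (tens (ψ j) ζ) : ℝ)
          = inner ℝ (extendZero P hO.measurableSet (χ j))
              (extendZero P hO.measurableSet (tens (ψ j) ζ)) :=
            ((extendZero P hO.measurableSet).inner_map_map _ _).symm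
        _ = inner ℝ (G j - tens (oneLp P) (average (G j))) (tens (ψ j) H) :=
            congrArg₂ (inner ℝ) (hχ j) (hφ.extendZero_tens hO.measurableSet (ψ j) hζ hH)
        _ = _ := h.inner_sub_tens_average hε hεlim hF he hφ' hH j (hH' j) (ψ j)
    change ∑ j, (inner ℝ (χ j) (tens (ψ j) ζ) : ℝ) = 0
    rw [Finset.sum_congr rfl fun j _ => h5 j, Finset.sum_add_distrib, h4, neg_add_cancel]
  refine ⟨⟨_, mem_H10_of_isWeakGradient hO hbdd hlip (h.isWeakGradient hε hεlim hF he) hU' hG'⟩,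
    ⟨_, hmem⟩, ?_, fun j => ?_⟩
  · exact (extendZero_tens_restr hO.measurableSet hU' (oneLp P)).trans
      (h.tens_average hε hεlim hF he)
  · refine ((extendZero P hO.measurableSet).map_add _ _).trans ?_
    have h1 := extendZero_tens_restr hO.measurableSet (hG' j) (oneLp P)
    have h2 := hχ j
    exact (congrArg₂ (· + ·) h1 h2).trans (add_sub_cancel _ _)

variable (hτ) in
/-- Weak limits of bounded sequences of unfolded discrete states are continuum states. -/
theorem exists_contEmbedding_eq (he : IsErgodicSystem P τ) (hO : IsOpen O) (hne : O.Nonempty)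
    (hbdd : Bornology.IsBounded O) (hlip : HasLipschitzBoundary O)
    {v : ∀ n, DiscreteState P b O (ε n)} {w : CrossL2 P d k} (hv : ∃ C, ∀ᶠ n in F, ‖v n‖ ≤ C)
    (hw : ∀ G, Tendsto (fun n => (inner ℝ (discreteEmbedding hτ b O (hε n) (v n)) G : ℝ)) F
      (𝓝 (inner ℝ w G))) : ∃ y, contEmbedding k hτ hO.measurableSet y = w := by
  have hε0 : Tendsto ε F (𝓝 0) := hεlim.mono_left hF
  have hweak := fun c G => crossProj_weak hw c G
  have hbound : ∀ c, ∃ C, ∀ᶠ n in F, ‖discreteEmbedding hτ b O (hε n) (v n) c‖ ≤ C := fun c => by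
    obtain ⟨C, hC⟩ := hv
    refine ⟨C, hC.mono fun n hn => (PiLp.norm_apply_le _ c).trans ?_⟩
    rwa [LinearIsometry.norm_map]
  -- The support argument gives vanishing only off the closure of O; the boundary has to be
  -- discarded as a null set.
  have hnull : ∀ᵐ p ∂P.prod (volume : Measure (Space d)), p.2 ∉ frontier O :=
    ae_prod_snd (μ := P) (measure_eq_zero_iff_ae_notMem.1 (volume_frontier_eq_zero hO hlip))
  have hsupp : ∀ c (C : ℝ), (∀ n, ∀ᵐ p ∂P.prod volume, C * ε n < Metric.infDist p.2 O →
      discreteEmbedding hτ b O (hε n) (v n) c p = 0) → ∀ᵐ p ∂P.prod volume, p.2 ∉ O → w c p = 0 := by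
    intro c C h
    filter_upwards [ae_eq_zero_of_weak hε0 hne C h (hweak c), hnull] with p h1 h2 hp
    refine h1 fun h3 => h2 ?_
    rw [hO.frontier_eq]
    exact ⟨h3, hp⟩
  -- In multiples of ε, displacements live at distance 0 from O, gradients at most 1, internal
  -- variables at most one edge length. Rounding to the nearest node adds d in each case.
  have hU : ∀ l, ∀ᵐ p ∂P.prod volume, p.2 ∉ O → w (.inl l) p = 0 := fun l =>
    hsupp _ (0 + d) fun n => unfolding_eq_zero hτ (hε n)
      (fun x hx => by rw [Metric.infDist_zero_of_mem hx, zero_mul]) ((v n).u_mem l)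
  have hG : ∀ l j, ∀ᵐ p ∂P.prod volume, p.2 ∉ O → w (.inr (.inl (l, j))) p = 0 := fun l j =>
    hsupp _ (1 + d) fun n => unfolding_eq_zero hτ (hε n)
      (S := {x | Metric.infDist x O ≤ 1 * ε n}) (fun x hx => hx) (by
        rw [DiscreteState.gradU_eq]
        refine discreteGrad_mem (fun m hm => ?_) ((v n).u_mem l)
        rw [← not_or]
        exact fun h => hm (infDist_node_le (hε n) h))
  have hZ : ∀ i, ∀ᵐ p ∂P.prod volume, p.2 ∉ O → w (.inr (.inr i)) p = 0 := fun i =>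
    hsupp _ (∑ i, len (b i) + d) fun n => unfolding_eq_zero hτ (hε n)
      (fun x hx => infDist_le_of_mem_enlarged (hε n) hx) ((v n).z_mem i)
  have hrow : ∀ l, IsWeakDisplacement hτ ε F
      (fun n => discreteEmbedding hτ b O (hε n) (v n) (.inl l))
      (fun n j => discreteEmbedding hτ b O (hε n) (v n) (.inr (.inl (l, j)))) (w (.inl l))
      (fun j => w (.inr (.inl (l, j)))) := fun l =>
    { grad := fun n j => by
        rw [discreteEmbedding_gradU, discreteEmbedding_u, DiscreteState.gradU_eq,
          unfolding_discreteGrad]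
      bound := hbound _
      bound_grad := fun j => hbound _
      weak := hweak _
      weak_grad := fun j => hweak _ }
  choose V χ hV hχ using fun l => (hrow l).exists_eq hε hεlim hF he hO hbdd hlip (hU l) (hG l)
  choose Z hZ using fun i => exists_extendZero_eq hO.measurableSet (hZ i)
  refine ⟨WithLp.toLp 2 (WithLp.toLp 2 V, WithLp.toLp 2 (WithLp.toLp 2 Z, WithLp.toLp 2 χ)), ?_⟩
  ext1 c
  rcases c with l | ⟨l, j⟩ | i
  · exact hV l
  · exact hχ l j
  · exact hZ i

end WeakLimit

end SpringNetwork

namespace SpringNetwork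

/-! ### Verification of the abstract hypotheses. -/

section Assembly

variable {d k : ℕ} {Ω : Type*} [MeasurableSpace Ω] {P : Measure Ω} [IsProbabilityMeasure P]
  {τ : IntLattice d → Ω → Ω} {b : Fin k → IntLattice d} {B : Fin k → IntLattice d →₀ (Fin d → ℝ)}
  {O : Set (Space d)} {A : Ω → Matrix (Fin k ⊕ Fin k) (Fin k ⊕ Fin k) ℝ}
  {ρ : Ω → (Fin k → ℝ) → ℝ} {ε : ℕ → ℝ}

set_option synthInstance.maxHeartbeats 1000000 in
noncomputable instance (ε : ℝ) : InnerProductSpace ℝ (DiscreteState P b O ε) := inferInstance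

set_option synthInstance.maxHeartbeats 1000000 in
instance (ε : ℝ) : CompleteSpace (DiscreteState P b O ε) := inferInstance

set_option synthInstance.maxHeartbeats 1000000 in
noncomputable instance : InnerProductSpace ℝ (ContState k P τ O) := inferInstance

set_option synthInstance.maxHeartbeats 1000000 in
instance : CompleteSpace (ContState k P τ O) := inferInstance

/-- Symmetry, homogeneity, subadditivity and lower semicontinuity are inherited by composition with
a continuous linear map. Only coercivity depends on the particular state space. -/
theorem isQuadraticRIS_comp {H Y : Type*} [NormedAddCommGroup H] [InnerProductSpace ℝ H]
    [NormedAddCommGroup Y] [InnerProductSpace ℝ Y] {R : H → ℝ≥0∞} (hR : IsDissipationPotential R)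
    {a : H →L[ℝ] H →L[ℝ] ℝ} (ha : ∀ u v, a u v = a v u) {c : ℝ} (hc : 0 < c) (i : Y →L[ℝ] H)
    (hcoer : ∀ v, c * ‖v‖ ^ 2 ≤ a (i v) (i v)) :
    IsQuadraticRIS c (a.bilinearComp i i) fun y => R (i y) where
  pos := hc
  symm u v := ha _ _
  coercive := hcoer
  subadd u v := by
    rw [map_add]
    exact hR.subadd _ _
  homog s v hs := by
    rw [map_smul]
    exact hR.homog s _ hs
  lsc := LowerSemicontinuous.comp hR.lsc i.continuous

set_option maxHeartbeats 4000000 in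
/-- The spring networks converge to the homogenized system. -/
theorem exists_isMoscoLimit (hd : 0 < d) (hτ : IsDynamicalSystem P τ) (he : IsErgodicSystem P τ)
    (hKorn : DiscreteKorn b) (hB : ∀ i, IsEdgeKernel (b i) (B i)) (hO : IsOpen O) (hne : O.Nonempty)
    (hbdd : Bornology.IsBounded O) (hlip : HasLipschitzBoundary O) (hA : IsAdmissibleCoefficient P A)
    (hρ : IsAdmissibleDissipation P ρ) (hε : ∀ n, 0 < ε n) (hεlim : Tendsto ε atTop (𝓝 0)) :
    ∃ c M, IsMoscoLimit c M (fun v : CrossL2 P d k => dissipation P d ρ fun i => v (.inr (.inr i)))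
      (fun n => (discreteEmbedding hτ b O (hε n)).toContinuousLinearMap)
      (fun n => (energyForm hτ b B (ε n) hA).bilinearComp
        (discreteEmbedding hτ b O (hε n)).toContinuousLinearMap
        (discreteEmbedding hτ b O (hε n)).toContinuousLinearMap)
      (contEmbedding k hτ hO.measurableSet).toContinuousLinearMap
      ((energyForm hτ b B 0 hA).bilinearComp
        (contEmbedding k hτ hO.measurableSet).toContinuousLinearMap
        (contEmbedding k hτ hO.measurableSet).toContinuousLinearMap) := by
  -- A convergent sequence of spacings is bounded, and the Poincaré constant depends only on such a
  -- bound.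
  obtain ⟨E, -, hE⟩ := exists_bound_of_tendsto_zero hεlim
  obtain ⟨c, hc, hcoer⟩ := exists_discrete_coercive (P := P) hd hτ hA hB hKorn hbdd E
  obtain ⟨M, hM⟩ := exists_energyForm_bound hτ b B hA
  have hcoer' := fun n => hcoer (ε n) (hε n) (hE n)
  refine ⟨c, M, ?_⟩
  exact
    { potential := isDissipationPotential_dissipation hρ
      system := fun n => isQuadraticRIS_comp (isDissipationPotential_dissipation hρ)
        (energyForm_symm hτ b B _ hA) hc _ (hcoer' n)
      system₀ := isQuadraticRIS_comp (isDissipationPotential_dissipation hρ)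
        (energyForm_symm hτ b B _ hA) hc _
        (contEmbedding_coercive hτ hε hεlim hA hO hcoer')
      norm_le := fun n y => (LinearIsometry.norm_map _ y).le
      norm_le₀ := fun y => (LinearIsometry.norm_map _ y).le
      bound := fun n u v => hM _ _ _
      recovery := fun v _ => exists_recovery hτ hε hεlim hρ hO v
      weak_closed := fun F hF v w hC hw =>
        exists_contEmbedding_eq hτ hε hεlim hF he hO hne hbdd hlip hC hw
      form_tendsto := fun F hF x v x₀ v₀ hx hC hv => by
        obtain ⟨C, hC⟩ := hC
        exact tendsto_energyForm hτ b B hA (hεlim.mono_left hF) hx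
          (hC.mono fun n hn => ((LinearIsometry.norm_map _ _).le).trans hn) hv }

/-- The abstract theory asks for a load that is Lipschitz on the whole line. Clamping time to [0, T]
keeps the Lipschitz constant and changes nothing inside, so the derivative is needed only in the
open interval. -/
theorem exists_clamped_load {T : ℝ} (hT : 0 < T) {l : ℝ → Load O} (hl : ContDiffOn ℝ 1 l (Icc 0 T))
    (hO : MeasurableSet O) : ∃ (Λ Λ' : ℝ → CrossL2 P d k →L[ℝ] ℝ) (L : ℝ),
      (∀ s t, ‖Λ s - Λ t‖ ≤ L * |s - t|) ∧ (∀ s ∈ Ioo 0 T, HasDerivAt Λ (Λ' s) s) ∧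
      ContinuousOn Λ' (Icc 0 T) ∧ (∀ t ∈ Icc 0 T, Λ t = loadForm P k hO (l t)) ∧
      ∀ t, Λ' t = loadForm P k hO (derivWithin l (Icc 0 T) t) := by
  obtain ⟨K, hK⟩ := hl.exists_lipschitzOnWith one_ne_zero (convex_Icc 0 T) isCompact_Icc
  have hproj : ∀ t ∈ Icc 0 T, ((projIcc 0 T hT.le t : Icc 0 T) : ℝ) = t := fun t ht => by
    rw [projIcc_of_mem hT.le ht]
  refine ⟨fun t => loadForm P k hO (l (projIcc 0 T hT.le t)),
    fun t => loadForm P k hO (derivWithin l (Icc 0 T) t), ‖loadForm P k hO‖ * K, fun s t => ?_,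
    fun s hs => ?_, ?_, fun t ht => by simp only [hproj t ht], fun _ => rfl⟩
  · rw [← map_sub, mul_assoc]
    refine ((loadForm P k hO).le_opNorm _).trans (mul_le_mul_of_nonneg_left ?_ (norm_nonneg _))
    rw [← dist_eq_norm]
    refine (hK.dist_le_mul _ (projIcc 0 T hT.le s).2 _ (projIcc 0 T hT.le t).2).trans
      (mul_le_mul_of_nonneg_left ?_ K.coe_nonneg)
    have := (LipschitzWith.projIcc hT.le).dist_le_mul s t
    rwa [NNReal.coe_one, one_mul, Real.dist_eq] at this
  · have h1 : HasDerivAt l (derivWithin l (Icc 0 T) s) s :=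
      ((hl.differentiableOn one_ne_zero s (Ioo_subset_Icc_self hs)).hasDerivWithinAt).hasDerivAt
        (Icc_mem_nhds hs.1 hs.2)
    have h2 : HasDerivAt (fun t => loadForm P k hO (l t))
        (loadForm P k hO (derivWithin l (Icc 0 T) s)) s :=
      (loadForm P k hO).hasFDerivAt.comp_hasDerivAt s h1
    refine h2.congr_of_eventuallyEq ?_
    filter_upwards [Icc_mem_nhds hs.1 hs.2] with t ht
    rw [hproj t ht]
  · exact (loadForm P k hO).continuous.comp_continuousOn
      (hl.continuousOn_derivWithin (uniqueDiffOn_Icc hT) le_rfl)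

end Assembly

end SpringNetwork

namespace SpringNetwork

/-! ### Conclusion for the spring network. -/

section Convergence

variable {d k : ℕ} {Ω : Type*} [MeasurableSpace Ω] {P : Measure Ω} [IsProbabilityMeasure P]
  {τ : IntLattice d → Ω → Ω} {b : Fin k → IntLattice d} {B : Fin k → IntLattice d →₀ (Fin d → ℝ)}
  {O : Set (Space d)} {A : Ω → Matrix (Fin k ⊕ Fin k) (Fin k ⊕ Fin k) ℝ}
  {ρ : Ω → (Fin k → ℝ) → ℝ} {ε : ℕ → ℝ}

theorem discreteEnergy_eq (hτ : IsDynamicalSystem P τ) (hA : IsAdmissibleCoefficient P A) {ε : ℝ}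
    (hε : 0 < ε) (hO : IsOpen O) (hB : ∀ i, IsEdgeKernel (b i) (B i)) (l : ℝ → Load O) (t : ℝ)
    (y : DiscreteState P b O ε) : discreteEnergy P τ b O ε A l t y =
      1 / 2 * (energyForm hτ b B ε hA).bilinearComp
        (discreteEmbedding hτ b O hε).toContinuousLinearMap
        (discreteEmbedding hτ b O hε).toContinuousLinearMap y y -
      loadForm P k hO.measurableSet (l t) ((discreteEmbedding hτ b O hε).toContinuousLinearMap y) := by
  rw [discreteEnergy, discreteQuad_eq hτ hA hε hO hB, discreteLoad_eq hτ hO.measurableSet hε]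
  rfl

theorem contEnergy_eq (hτ : IsDynamicalSystem P τ) (hA : IsAdmissibleCoefficient P A)
    (hO : IsOpen O) (hB : ∀ i, IsEdgeKernel (b i) (B i)) (l : ℝ → Load O) (t : ℝ)
    (y : ContState k P τ O) : contEnergy P τ b B O A l t y =
      1 / 2 * (energyForm hτ b B 0 hA).bilinearComp
        (contEmbedding k hτ hO.measurableSet).toContinuousLinearMap
        (contEmbedding k hτ hO.measurableSet).toContinuousLinearMap y y -
      loadForm P k hO.measurableSet (l t)
        ((contEmbedding k hτ hO.measurableSet).toContinuousLinearMap y) := by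
  rw [contEnergy, contQuad_eq hτ hA hO.measurableSet hB, contLoad_eq hτ hO.measurableSet]
  rfl

set_option maxHeartbeats 4000000 in
/-- Convergence of the energetic solutions of the spring networks. -/
theorem exists_energeticSolution_strongCross (hd : 0 < d) (hτ : IsDynamicalSystem P τ)
    (hergodic : IsErgodicSystem P τ) (hKorn : DiscreteKorn b) (hB : ∀ i, IsEdgeKernel (b i) (B i))
    (hOopen : IsOpen O) (hne : O.Nonempty) (hObdd : Bornology.IsBounded O)
    (hOlip : HasLipschitzBoundary O) (hA : IsAdmissibleCoefficient P A)
    (hρ : IsAdmissibleDissipation P ρ) {T : ℝ} (hT : 0 < T) {l : ℝ → Load O}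
    (hl : ContDiffOn ℝ 1 l (Icc 0 T)) (hε : ∀ n, 0 < ε n) (hεlim : Tendsto ε atTop (𝓝 0))
    {y₀seq : ∀ n, DiscreteState P b O (ε n)}
    (hstable : ∀ n, y₀seq n ∈ stableSet (discreteEnergy P τ b O (ε n) A l)
      (discreteDissipation P τ b O (ε n) ρ) 0)
    {y₀ : ContState k P τ O} (hconv : StrongCross ε y₀seq y₀) :
    y₀ ∈ stableSet (contEnergy P τ b B O A l) (contDissipation P τ O ρ) 0 ∧
    ∃ (yseq : ∀ n, ℝ → DiscreteState P b O (ε n)) (y : ℝ → ContState k P τ O),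
      (∀ n, IsUniqueEnergeticSolution T (discreteEnergy P τ b O (ε n) A l)
        (discreteDissipation P τ b O (ε n) ρ)
        (fun s => discreteLoad P b O (ε n) (derivWithin l (Icc 0 T) s)) (y₀seq n) (yseq n)) ∧
      IsUniqueEnergeticSolution T (contEnergy P τ b B O A l) (contDissipation P τ O ρ)
        (fun s => contLoad P τ O (derivWithin l (Icc 0 T) s)) y₀ y ∧
      ∀ t ∈ Icc 0 T, StrongCross ε (fun n => yseq n t) (y t) := by
  have hOm := hOopen.measurableSet
  obtain ⟨c, M, hM⟩ := exists_isMoscoLimit hd hτ hergodic hKorn hB hOopen hne hObdd hOlip hA hρ hε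
    hεlim
  obtain ⟨Λ, Λ', L, hΛ, hΛd, hΛ'c, hΛl, hΛ'l⟩ := exists_clamped_load (P := P) (k := k) hT hl hOm
  have hD : ∀ n, discreteDissipation P τ b O (ε n) ρ = fun y => dissipation P d ρ fun i =>
      (discreteEmbedding hτ b O (hε n)).toContinuousLinearMap y (.inr (.inr i)) :=
    fun n => funext fun y => discreteDissipation_eq hτ (hε n) hρ y
  have hD₀ : contDissipation P τ O ρ = fun y => dissipation P d ρ fun i =>
      (contEmbedding k hτ hOm).toContinuousLinearMap y (.inr (.inr i)) :=
    funext fun y => contDissipation_eq hτ hOm hρ y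
  simp only [hD] at hstable
  simp only [hD, hD₀]
  obtain ⟨h1, ys, y, h2, h3, h4⟩ := hM.tendsto_energeticSolution hT hΛ hΛd hΛ'c
    (E := fun n => discreteEnergy P τ b O (ε n) A l) (E₀ := contEnergy P τ b B O A l)
    (power := fun n s => discreteLoad P b O (ε n) (derivWithin l (Icc 0 T) s))
    (power₀ := fun s => contLoad P τ O (derivWithin l (Icc 0 T) s))
    (fun n t ht y => by
      rw [hΛl t ht]
      exact discreteEnergy_eq hτ hA (hε n) hOopen hB l t y)
    (fun t ht y => by
      rw [hΛl t ht]
      exact contEnergy_eq hτ hA hOopen hB l t y)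
    (fun n t _ y => by
      rw [hΛ'l]
      exact discreteLoad_eq hτ hOm (hε n) _ y)
    (fun t _ y => by
      rw [hΛ'l]
      exact contLoad_eq hτ hOm _ y)
    hstable ((strongCross_iff hτ hOm hε y₀seq y₀).1 hconv)
  exact ⟨h1, ys, y, h2, h3, fun t ht => (strongCross_iff hτ hOm hε _ _).2 (h4 t ht)⟩

end Convergence

end SpringNetwork

theorem theorem4p4 {d k : ℕ} (hd : 0 < d)
    -- the ergodic random medium
    {Ω : Type*} [MeasurableSpace Ω] (P : Measure Ω) [IsProbabilityMeasure P]
    [MeasureTheory.IsSeparable P] (τ : IntLattice d → Ω → Ω) (hτ : IsDynamicalSystem P τ)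
    (hergodic : IsErgodicSystem P τ)
    -- the lattice graph and a choice of edge kernels
    (b : Fin k → IntLattice d) (hb : ∀ i, b i ≠ 0) (hbunit : ∀ j, ∃ i, b i = unitVec j)
    (hKorn : DiscreteKorn b)
    (B : Fin k → IntLattice d →₀ (Fin d → ℝ)) (hB : ∀ i, IsEdgeKernel (b i) (B i))
    -- the bounded Lipschitz domain
    (O : Set (Space d)) (hOopen : IsOpen O) (hOconn : IsConnected O)
    (hObdd : Bornology.IsBounded O) (hOlip : HasLipschitzBoundary O)
    -- the coefficients and the loading
    (A : Ω → Matrix (Fin k ⊕ Fin k) (Fin k ⊕ Fin k) ℝ) (hA : IsAdmissibleCoefficient P A)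
    (ρ : Ω → (Fin k → ℝ) → ℝ) (hρ : IsAdmissibleDissipation P ρ)
    (T : ℝ) (hT : 0 < T) (l : ℝ → Load O) (hl : ContDiffOn ℝ 1 l (Icc 0 T))
    -- the lattice spacings and the initial data
    (ε : ℕ → ℝ) (hε : ∀ n, 0 < ε n) (hεlim : Tendsto ε atTop (𝓝 0))
    (y₀seq : ∀ n, DiscreteState P b O (ε n))
    (hstable : ∀ n, y₀seq n ∈ stableSet (discreteEnergy P τ b O (ε n) A l)
      (discreteDissipation P τ b O (ε n) ρ) 0)
    (y₀ : ContState k P τ O) (hconv : StrongCross ε y₀seq y₀) :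
    y₀ ∈ stableSet (contEnergy P τ b B O A l) (contDissipation P τ O ρ) 0 ∧
    ∃ (yseq : ∀ n, ℝ → DiscreteState P b O (ε n)) (y : ℝ → ContState k P τ O),
      (∀ n, IsUniqueEnergeticSolution T (discreteEnergy P τ b O (ε n) A l)
        (discreteDissipation P τ b O (ε n) ρ)
        (fun s => discreteLoad P b O (ε n) (derivWithin l (Icc 0 T) s)) (y₀seq n) (yseq n)) ∧
      IsUniqueEnergeticSolution T (contEnergy P τ b B O A l) (contDissipation P τ O ρ)
        (fun s => contLoad P τ O (derivWithin l (Icc 0 T) s)) y₀ y ∧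
      ∀ t ∈ Icc 0 T, StrongCross ε (fun n => yseq n t) (y t) := by
  exact exists_energeticSolution_strongCross hd hτ hergodic hKorn hB hOopen hOconn.nonempty hObdd
    hOlip hA hρ hT hl hε hεlim hstable hconv
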